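/- Let $\pi:E\to M$ be a smooth real vector bundle of rank $m$ over an $n$-dimensional smooth manifold $M$ (Hausdorff, second countable, without boundary), and let $\nu$ be a volume form on $M$; $M$ carries the orientation of $\nu$. Let $J^\infty E$ be the infinite jet bundle, with local coordinates $(x^i,u^a_I)$, total derivatives $D_i=\partial_{x^i}+\sum_{a,J}u^a_{iJ}\,\partial_{u^a_J}$ and $\mathrm{Loc}_E$ the algebra of local functions (pull-backs of smooth functions on finite jet bundles). A horizontal $k$-form is locally $\alpha=\alpha_I\,dx^I$, with smooth coefficients of finite jet order; $d_H\alpha=D_i\alpha_I\,dx^i\wedge dx^I$; and for $k=n$ the Euler–Lagrange operator is, locally, $\mathbf E(L\,d^nx)=\mathbf E_a(L)\,\theta^a\wedge d^nx$, $\mathbf E_a(L)=\sum_I(-D)_I\,\partial L/\partial u^a_I$, $\theta^a=du^a-u^a_i\,dx^i$. Let $\Omega^{k,0}_c(J^\infty E)$ be the space of horizontal $k$-forms $\alpha$ such that $(j^\infty\phi)^*\alpha$ has compact support for every compactly supported smooth section $\phi$ of $E$ and, if $k=n$, such that the components of $\mathbf E(\alpha)$ along $j^\infty\phi$ also have compact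 support for all such $\phi$. Let $\Omega^{n,1}_0$ be the $\mathrm{Loc}_E$-module locally generated by the $\theta^a\wedge d^nx$, and let $\omega:\Omega^{n,1}_0\times\Omega^{n,1}_0\to\mathrm{Loc}_E$ be skew-symmetric and $\mathrm{Loc}_E$-bilinear, with components of bounded jet order. Put $\tilde l_2(\alpha,\beta)=\omega(\mathbf E(\alpha),\mathbf E(\beta))\,\nu$ for horizontal $n$-forms $\alpha,\beta$. Assume that the bracket $\{\mathcal P,\mathcal Q\}(\phi)=\int_M(j^\infty\phi)^*\tilde l_2(\alpha,\beta)$ of the local functionals $\mathcal P(\phi)=\int_M(j^\infty\phi)^*\alpha$, $\mathcal Q(\phi)=\int_M(j^\infty\phi)^*\beta$ with $\alpha,\beta\in\Omega^{n,0}_c(J^\infty E)$ satisfies the Jacobi identity. Let $G$ be a group (for instance a Lie group) acting on $E$ by smooth automorphisms $\psi_g$ that map each fibre of $E$ to itself (so they cover the identity of $M$; they need not be linear on fibres), and assume that the action is canonical: for all $g\in G$ and all such $\mathcal P,\mathcal Q$, $\{\mathcal P\circ\hat\psi_g,\mathcal Q\circ\hat\psi_g\}=\{\mathcal P,\mathcal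 Q\}\circ\hat\psi_g$ on compactly supported smooth sections, where $\hat\psi_g(\phi)=\psi_g\circ\phi$ (whenever the forms $(j\psi_g)^*\alpha$, $(j\psi_g)^*\beta$ representing $\mathcal P\circ\hat\psi_g$, $\mathcal Q\circ\hat\psi_g$ are again in $\Omega^{n,0}_c(J^\infty E)$, which is automatic if the $\psi_g$ preserve the zero section). Let $\Omega^{k,0}_G(J^\infty E)$ be the space of those $\alpha\in\Omega^{k,0}_c(J^\infty E)$ with $(j\psi_g)^*\alpha=\alpha$ for all $g\in G$. Suppose that the complex $0\to\Omega^{0,0}_c(J^\infty E)\to\cdots\to\Omega^{n,0}_c(J^\infty E)$ with differential $d_H$ is exact (at all places except the last), and suppose the reduction hypothesis: every form in $\Omega^{k,0}_G(J^\infty E)$ that is $d_H$ of a form in $\Omega^{k-1,0}_c(J^\infty E)$ is $d_H$ of a form in $\Omega^{k-1,0}_G(J^\infty E)$. Then: 1. The $\Omega^{k,0}_G(J^\infty E)$ form a subcomplex, and it is exact (at all places except the last). 2. $\tilde l_2$ restricts to a skew-symmetric bilinear map $\Omega^{n,0}_G(J^\infty E)\times\Omega^{n,0}_G(J^\infty E)\to\Omega^{n,0}_G(J^\infty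 E)$ such that (i) $\tilde l_2(\alpha,\beta)\in d_H\Omega^{n-1,0}_G(J^\infty E)$ whenever $\beta\in d_H\Omega^{n-1,0}_G(J^\infty E)$, and (ii) $\tilde l_2(\tilde l_2(\alpha,\beta),\gamma)-\tilde l_2(\tilde l_2(\alpha,\gamma),\beta)+\tilde l_2(\tilde l_2(\beta,\gamma),\alpha)\in d_H\Omega^{n-1,0}_G(J^\infty E)$ for all $\alpha,\beta,\gamma\in\Omega^{n,0}_G(J^\infty E)$. 3. There is an sh-Lie structure $(l_k)_{k\ge1}$ on the graded vector space $X_i=\Omega^{n-i,0}_c(J^\infty E)$ ($0\le i\le n$), with $l_1=d_H$, $l_2=\tilde l_2$ on $X_0$, $l_2$ and $l_3$ zero unless all arguments have degree $0$, and $l_k=0$ for $k\ge4$, which maps $G$-invariant forms to $G$-invariant forms and whose restriction is an sh-Lie structure on the subcomplex $\Omega^{*,0}_G(J^\infty E)$. Here an sh-Lie structure on a graded vector space $X_*$ is a family of graded skew-symmetric multilinear maps $l_k:X_*^{\otimes k}\to X_*$, $k\ge1$, of degree $k-2$ such that for all $N\ge1$ and homogeneous $x_1,\dots,x_N$ $$\sum_{\substack{i+j=N+1\\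 i,j\ge1}}\ \sum_{\sigma\in\mathrm{unsh}(i,N-i)}e(\sigma)(-1)^\sigma(-1)^{i(j-1)}\,l_j\bigl(l_i(x_{\sigma(1)},\dots,x_{\sigma(i)}),x_{\sigma(i+1)},\dots,x_{\sigma(N)}\bigr)=0,$$ with $e(\sigma)$ the Koszul sign. -/

import Mathlib

open Set Bundle
open scoped Manifold ContDiff Topology

namespace HorizontalForms

section Calculus

variable {n m : ℕ} {W : Type*} [NormedAddCommGroup W] [NormedSpace ℝ W]

/-- The multi-indices `I = (I_0, …, I_{n-1})` with `|I| = ∑ I_i ≤ k`. -/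
def idxLE (n k : ℕ) : Finset (Fin n → ℕ) :=
  (Finset.Iic fun _ => k).filter fun I => ∑ i, I i ≤ k

/-- For operators `D_0, …, D_{n-1}`, the operator `D_I = D_0^{I_0} ⋯ D_{n-1}^{I_{n-1}}`. -/
def iterOp {A : Type*} (D : Fin n → A → A) (I : Fin n → ℕ) : A → A :=
  (List.finRange n).foldr (fun i T => (D i)^[I i] ∘ T) id

/-- The `i`-th standard basis vector of `ℝⁿ`. -/
noncomputable def basisVec (i : Fin n) : EuclideanSpace ℝ (Fin n) := EuclideanSpace.single i 1

/-- `∂f/∂x^i` on `ℝⁿ`. -/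
noncomputable def partialD (i : Fin n) (f : EuclideanSpace ℝ (Fin n) → W) :
    EuclideanSpace ℝ (Fin n) → W :=
  fun y => lineDeriv ℝ f y (basisVec i)

/-- The space of jet coordinates `(x^i, u^a_I)`, `I` ranging over all multi-indices. -/
abbrev JetCoord (n m : ℕ) : Type :=
  EuclideanSpace ℝ (Fin n) × ((Fin n → ℕ) → Fin m → ℝ)

/-- The total derivative `D_i = ∂/∂x^i + ∑ u^a_{iJ} ∂/∂u^a_J`, i.e. the derivative along the vector
with `x`-component `e_i` and `u^a_J`-component `u^a_{iJ}`. -/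
noncomputable def totalD (i : Fin n) (f : JetCoord n m → W) : JetCoord n m → W :=
  fun z => lineDeriv ℝ f z (basisVec i, fun J => z.2 (J + Pi.single i 1))

/-- `∂f/∂u^a_I`. -/
noncomputable def jetD (I : Fin n → ℕ) (a : Fin m) (f : JetCoord n m → W) : JetCoord n m → W :=
  fun z => lineDeriv ℝ f z (0, Pi.single I (Pi.single a 1))

/-- The component `E_a(f) = ∑_I (-D)_I (∂f/∂u^a_I)` of the Euler-Lagrange operator. -/
noncomputable def eulerOp (a : Fin m) (f : JetCoord n m → W) : JetCoord n m → W :=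
  fun z => ∑ᶠ I : Fin n → ℕ, (-1 : ℝ) ^ (∑ i, I i) • iterOp totalD I (jetD I a f) z

/-- Over `x ∈ U`, `f` is a smooth function of `x` and the finitely many `u^a_I` with `|I| ≤ k`. -/
def IsSmoothOfOrder (U : Set (EuclideanSpace ℝ (Fin n))) (k : ℕ) (f : JetCoord n m → W) : Prop :=
  ∃ g : EuclideanSpace ℝ (Fin n) × (idxLE n k → Fin m → ℝ) → W,
    ContDiffOn ℝ ∞ g (U ×ˢ univ) ∧ ∀ z, z.1 ∈ U → f z = g (z.1, fun K => z.2 K)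

theorem mem_idxLE {k : ℕ} {I : Fin n → ℕ} : I ∈ idxLE n k ↔ ∑ i, I i ≤ k := by
  simp only [idxLE, Finset.mem_filter, Finset.mem_Iic, and_iff_right_iff_imp]
  intro h i
  exact (Finset.single_le_sum (f := I) (fun _ _ => Nat.zero_le _) (Finset.mem_univ i)).trans h

variable {U : Set (EuclideanSpace ℝ (Fin n))} {k l : ℕ} {f g : JetCoord n m → W}

theorem IsSmoothOfOrder.mono (hf : IsSmoothOfOrder U k f) (h : k ≤ l) :
    IsSmoothOfOrder U l f := by
  obtain ⟨G, hG, hfG⟩ := hf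
  have hsub : ∀ K : idxLE n k, (K : Fin n → ℕ) ∈ idxLE n l := fun K =>
    mem_idxLE.2 ((mem_idxLE.1 K.2).trans h)
  refine ⟨fun y => G (y.1, fun K => y.2 ⟨K, hsub K⟩), ?_, fun z hz => hfG z hz⟩
  refine hG.comp (s := U ×ˢ univ) (ContDiff.contDiffOn (by fun_prop)) ?_
  rintro y ⟨hy, -⟩
  exact ⟨hy, mem_univ _⟩

theorem IsSmoothOfOrder.lin (hf : IsSmoothOfOrder U k f) (hg : IsSmoothOfOrder U l g) (c : ℝ) :
    IsSmoothOfOrder U (max k l) (c • f + g) := by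
  obtain ⟨F, hF, hfF⟩ := hf.mono (le_max_left k l)
  obtain ⟨G, hG, hgG⟩ := hg.mono (le_max_right k l)
  refine ⟨c • F + G, (contDiffOn_const.smul hF).add hG, fun z hz => ?_⟩
  simp [hfF z hz, hgG z hz]

theorem IsSmoothOfOrder.hasLineDerivAt (hU : IsOpen U)
    {G : EuclideanSpace ℝ (Fin n) × (idxLE n k → Fin m → ℝ) → W}
    (hG : ContDiffOn ℝ ∞ G (U ×ˢ univ))
    (hfG : ∀ z, z.1 ∈ U → f z = G (z.1, fun K => z.2 K)) {z : JetCoord n m} (hz : z.1 ∈ U)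
    (v : JetCoord n m) :
    HasLineDerivAt ℝ f (fderiv ℝ G (z.1, fun K => z.2 K) (v.1, fun K => v.2 K)) z v := by
  have hd : DifferentiableAt ℝ G (z.1, fun K => z.2 K) :=
    ((hG.contDiffAt ((hU.prod isOpen_univ).mem_nhds ⟨hz, mem_univ _⟩)).differentiableAt
      (by simp))
  have h1 := hd.hasFDerivAt.hasLineDerivAt (v.1, fun K => v.2 K)
  unfold HasLineDerivAt at h1 ⊢
  refine h1.congr_of_eventuallyEq ?_
  have hc : Continuous fun t : ℝ => z.1 + t • v.1 := by fun_prop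
  have : ∀ᶠ t : ℝ in 𝓝 0, z.1 + t • v.1 ∈ U :=
    hc.continuousAt.eventually_mem (hU.mem_nhds (by simpa using hz))
  filter_upwards [this] with t ht
  exact hfG _ ht

theorem IsSmoothOfOrder.totalD (hU : IsOpen U) (hf : IsSmoothOfOrder U k f) (i : Fin n) :
    IsSmoothOfOrder U (k + 1) (totalD i f) := by
  obtain ⟨G, hG, hfG⟩ := hf
  have h0 : ∀ K : idxLE n k, (K : Fin n → ℕ) ∈ idxLE n (k + 1) := fun K =>
    mem_idxLE.2 ((mem_idxLE.1 K.2).trans (Nat.le_succ k))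
  have h1 : ∀ K : idxLE n k, (K : Fin n → ℕ) + Pi.single i 1 ∈ idxLE n (k + 1) := fun K => by
    rw [mem_idxLE]
    simp only [Pi.add_apply, Finset.sum_add_distrib, Finset.sum_pi_single', Finset.mem_univ,
      if_true]
    exact Nat.add_le_add_right (mem_idxLE.1 K.2) 1
  refine ⟨fun y => fderiv ℝ G (y.1, fun K => y.2 ⟨K, h0 K⟩)
    (basisVec i, fun K => y.2 ⟨_, h1 K⟩), ?_, fun z hz => ?_⟩
  · have hG' : ContDiffOn ℝ ∞ (fderiv ℝ G) (U ×ˢ univ) :=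
      hG.fderiv_of_isOpen (hU.prod isOpen_univ) (by simp)
    refine ContDiffOn.clm_apply (hG'.comp (s := U ×ˢ univ) (ContDiff.contDiffOn (by fun_prop)) ?_)
      (ContDiff.contDiffOn (by fun_prop))
    rintro y ⟨hy, -⟩
    exact ⟨hy, mem_univ _⟩
  · exact (IsSmoothOfOrder.hasLineDerivAt hU hG hfG hz _).lineDeriv

theorem IsSmoothOfOrder.jetD (hU : IsOpen U) (hf : IsSmoothOfOrder U k f) (I : Fin n → ℕ)
    (a : Fin m) : IsSmoothOfOrder U k (jetD I a f) := by
  obtain ⟨G, hG, hfG⟩ := hf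
  refine ⟨fun y => fderiv ℝ G y
    (0, fun K => (Pi.single I (Pi.single a 1) : (Fin n → ℕ) → Fin m → ℝ) K), ?_, fun z hz => ?_⟩
  · have hG' : ContDiffOn ℝ ∞ (fderiv ℝ G) (U ×ˢ univ) :=
      hG.fderiv_of_isOpen (hU.prod isOpen_univ) (by simp)
    exact hG'.clm_apply contDiffOn_const
  · exact (IsSmoothOfOrder.hasLineDerivAt hU hG hfG hz _).lineDeriv

theorem IsSmoothOfOrder.lineDeriv_lin (hU : IsOpen U) (hf : IsSmoothOfOrder U k f)
    (hg : IsSmoothOfOrder U l g) (c : ℝ) {z : JetCoord n m} (hz : z.1 ∈ U) (v : JetCoord n m) :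
    lineDeriv ℝ (c • f + g) z v = c • lineDeriv ℝ f z v + lineDeriv ℝ g z v := by
  obtain ⟨F, hF, hfF⟩ := hf
  obtain ⟨G, hG, hgG⟩ := hg
  have h1 := IsSmoothOfOrder.hasLineDerivAt hU hF hfF hz v
  have h2 := IsSmoothOfOrder.hasLineDerivAt hU hG hgG hz v
  rw [h1.lineDeriv, h2.lineDeriv]
  unfold HasLineDerivAt at h1 h2
  exact ((h1.const_smul c).add h2).deriv

theorem totalD_congr (hU : IsOpen U) (h : ∀ z, z.1 ∈ U → f z = g z) (i : Fin n)
    {z : JetCoord n m} (hz : z.1 ∈ U) : totalD i f z = totalD i g z := by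
  unfold totalD lineDeriv
  refine Filter.EventuallyEq.deriv_eq ?_
  have hc : Continuous fun t : ℝ => z.1 + t • basisVec i := by fun_prop
  have : ∀ᶠ t : ℝ in 𝓝 0, z.1 + t • basisVec i ∈ U :=
    hc.continuousAt.eventually_mem (hU.mem_nhds (by simpa using hz))
  filter_upwards [this] with t ht
  exact h _ ht

/-- `D_I` is linear on smooth functions of finite order. -/
theorem iterOp_totalD_lin (hU : IsOpen U) (c : ℝ) (I : Fin n → ℕ)
    (hf : IsSmoothOfOrder U k f) (hg : IsSmoothOfOrder U l g) :
    ∀ z, z.1 ∈ U → iterOp totalD I (c • f + g) z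
      = c • iterOp totalD I f z + iterOp totalD I g z := by
  have step : ∀ (i : Fin n) (N : ℕ) (f g h : JetCoord n m → W),
      (∃ k, IsSmoothOfOrder U k f) → (∃ k, IsSmoothOfOrder U k g) →
      (∀ z, z.1 ∈ U → h z = c • f z + g z) →
      (∃ k, IsSmoothOfOrder U k ((totalD i)^[N] f)) ∧
      (∃ k, IsSmoothOfOrder U k ((totalD i)^[N] g)) ∧
      ∀ z, z.1 ∈ U → (totalD i)^[N] h z = c • (totalD i)^[N] f z + (totalD i)^[N] g z := by
    intro i N
    induction N with
    | zero => intro f g h hf hg hh; exact ⟨hf, hg, hh⟩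
    | succ N ih =>
      rintro f g h ⟨k, hf⟩ ⟨l, hg⟩ hh
      refine ih _ _ _ ⟨_, hf.totalD hU i⟩ ⟨_, hg.totalD hU i⟩ fun z hz => ?_
      rw [totalD_congr (g := c • f + g) hU hh i hz]
      exact hf.lineDeriv_lin hU hg c hz _
  have main : ∀ L : List (Fin n),
      (∃ k, IsSmoothOfOrder U k (L.foldr (fun i T => (totalD i)^[I i] ∘ T) id f)) ∧
      (∃ k, IsSmoothOfOrder U k (L.foldr (fun i T => (totalD i)^[I i] ∘ T) id g)) ∧
      ∀ z, z.1 ∈ U → L.foldr (fun i T => (totalD i)^[I i] ∘ T) id (c • f + g) z =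
        c • L.foldr (fun i T => (totalD i)^[I i] ∘ T) id f z
          + L.foldr (fun i T => (totalD i)^[I i] ∘ T) id g z := by
    intro L
    induction L with
    | nil => exact ⟨⟨_, hf⟩, ⟨_, hg⟩, fun z _ => rfl⟩
    | cons i L ih => exact step i (I i) _ _ _ ih.1 ih.2.1 ih.2.2
  exact (main _).2.2

theorem iterOp_totalD_congr (hU : IsOpen U) (I : Fin n → ℕ) (h : ∀ z, z.1 ∈ U → f z = g z) :
    ∀ z, z.1 ∈ U → iterOp totalD I f z = iterOp totalD I g z := by
  have step : ∀ (i : Fin n) (N : ℕ) (h h' : JetCoord n m → W),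
      (∀ z, z.1 ∈ U → h z = h' z) → ∀ z, z.1 ∈ U → (totalD i)^[N] h z = (totalD i)^[N] h' z := by
    intro i N
    induction N with
    | zero => intro h h' hh; exact hh
    | succ N ih => intro h h' hh; exact ih _ _ fun z hz => totalD_congr hU hh i hz
  have main : ∀ L : List (Fin n), ∀ z, z.1 ∈ U →
      L.foldr (fun i T => (totalD i)^[I i] ∘ T) id f z
        = L.foldr (fun i T => (totalD i)^[I i] ∘ T) id g z := by
    intro L
    induction L with
    | nil => exact h
    | cons i L ih => exact step i (I i) _ _ ih
  exact main _

theorem iterOp_totalD_zero (hU : IsOpen U) (I : Fin n → ℕ) (hf : ∀ z, z.1 ∈ U → f z = 0) :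
    ∀ z, z.1 ∈ U → iterOp totalD I f z = 0 := by
  have h0 : IsSmoothOfOrder U 0 f := ⟨0, contDiffOn_const, hf⟩
  intro z hz
  have h1 := iterOp_totalD_lin hU (-1) I h0 h0 z hz
  rw [show (-1 : ℝ) • f + f = 0 by simp] at h1
  rw [iterOp_totalD_congr (g := 0) hU I hf z hz, h1]
  simp

theorem jetD_eq_zero (hU : IsOpen U) (hf : IsSmoothOfOrder U k f) {I : Fin n → ℕ}
    (hI : I ∉ idxLE n k) (a : Fin m) {z : JetCoord n m} (hz : z.1 ∈ U) : jetD I a f z = 0 := by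
  obtain ⟨G, hG, hfG⟩ := hf
  rw [jetD, (IsSmoothOfOrder.hasLineDerivAt hU hG hfG hz _).lineDeriv]
  have : (fun K : idxLE n k => (Pi.single I (Pi.single a 1) : (Fin n → ℕ) → Fin m → ℝ) K) = 0 := by
    funext K
    exact Pi.single_eq_of_ne (fun h : (K : Fin n → ℕ) = I => hI (h ▸ K.2)) _
  simp only [this]
  exact map_zero _

theorem eulerOp_support (hU : IsOpen U) (hf : IsSmoothOfOrder U k f) (a : Fin m)
    {z : JetCoord n m} (hz : z.1 ∈ U) :
    (Function.support fun I : Fin n → ℕ =>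
      (-1 : ℝ) ^ (∑ i, I i) • iterOp totalD I (jetD I a f) z).Finite := by
  refine (idxLE n k).finite_toSet.subset fun I hI => ?_
  by_contra hI'
  exact hI (by
    simp only [iterOp_totalD_zero hU I (fun z hz => jetD_eq_zero hU hf hI' a hz) z hz, smul_zero])

/-- The Euler-Lagrange operator is linear on smooth functions of finite order. -/
theorem eulerOp_lin (hU : IsOpen U) (hf : IsSmoothOfOrder U k f) (hg : IsSmoothOfOrder U l g)
    (c : ℝ) (a : Fin m) {z : JetCoord n m} (hz : z.1 ∈ U) :
    eulerOp a (c • f + g) z = c • eulerOp a f z + eulerOp a g z := by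
  unfold eulerOp
  rw [smul_finsum, ← finsum_add_distrib ((eulerOp_support hU hf a hz).subset ?_)
    (eulerOp_support hU hg a hz)]
  · refine finsum_congr fun I => ?_
    rw [iterOp_totalD_congr (f := jetD I a (c • f + g)) (g := c • jetD I a f + jetD I a g) hU I
      (fun z hz => hf.lineDeriv_lin hU hg c hz _) z hz,
      iterOp_totalD_lin hU c I (hf.jetD hU I a) (hg.jetD hU I a) z hz, smul_add, smul_comm c]
  · intro I hI h0
    exact hI (by simp only [h0, smul_zero])

end Calculus

section Geometry

set_option linter.unusedSectionVars false

variable {n m : ℕ} {M : Type*} [TopologicalSpace M] [ChartedSpace (EuclideanSpace ℝ (Fin n)) M]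
  [IsManifold (𝓡 n) ∞ M]
  {E : M → Type*} [∀ p, AddCommGroup (E p)] [∀ p, Module ℝ (E p)] [∀ p, TopologicalSpace (E p)]
  [TopologicalSpace (TotalSpace (Fin m → ℝ) E)] [FiberBundle (Fin m → ℝ) E]
  [VectorBundle ℝ (Fin m → ℝ) E]

/-- The infinite jet bundle `J^∞E`. As Mathlib does for tangent vectors, a jet at `p` is given by
its coordinates `u^a_I` in the preferred chart of `M` and the preferred trivialization of `E`
at `p`; by Borel's lemma all values occur for smooth sections. -/
@[ext]
structure JetInf (n m : ℕ) {M : Type*} (E : M → Type*) where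
  /-- The base point. -/
  pt : M
  /-- The coordinates `u^a_I`. -/
  coeff : (Fin n → ℕ) → Fin m → ℝ

/-- A section in the preferred chart of `M` and the preferred trivialization of `E` at `p`. -/
noncomputable def localExpr (n m : ℕ) {M : Type*} [TopologicalSpace M]
    [ChartedSpace (EuclideanSpace ℝ (Fin n)) M] {E : M → Type*} [∀ p, TopologicalSpace (E p)]
    [TopologicalSpace (TotalSpace (Fin m → ℝ) E)] [FiberBundle (Fin m → ℝ) E]
    (p : M) (s : ∀ q, E q) : EuclideanSpace ℝ (Fin n) → Fin m → ℝ := fun y =>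
  (trivializationAt (Fin m → ℝ) E p
    ⟨(chartAt (EuclideanSpace ℝ (Fin n)) p).symm y,
      s ((chartAt (EuclideanSpace ℝ (Fin n)) p).symm y)⟩).2

/-- The infinite jet `j^∞s(p)` of a section `s` that is smooth near `p`. -/
noncomputable def jet (n m : ℕ) {M : Type*} [TopologicalSpace M]
    [ChartedSpace (EuclideanSpace ℝ (Fin n)) M] {E : M → Type*} [∀ p, TopologicalSpace (E p)]
    [TopologicalSpace (TotalSpace (Fin m → ℝ) E)] [FiberBundle (Fin m → ℝ) E]
    (s : ∀ q, E q) (p : M) : JetInf n m E where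
  pt := p
  coeff I := iterOp partialD I (localExpr n m p s) (chartAt (EuclideanSpace ℝ (Fin n)) p p)

/-- The Taylor polynomial `∑_{|K| ≤ N} u_K (y - x)^K / K!`. -/
noncomputable def taylorPoly (z : JetCoord n m) (N : ℕ) (y : EuclideanSpace ℝ (Fin n)) :
    Fin m → ℝ :=
  ∑ K ∈ idxLE n N, (∏ i, (y i - z.1 i) ^ K i / (K i).factorial) • z.2 K

/-- The local section of `E` whose expression in the preferred chart and trivialization at `p` is
the Taylor polynomial of order `N` with coefficients `z.2` at `z.1`. -/
noncomputable def polySection (E : M → Type*) [∀ p, AddCommGroup (E p)]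
    [∀ p, TopologicalSpace (E p)] [TopologicalSpace (TotalSpace (Fin m → ℝ) E)]
    [FiberBundle (Fin m → ℝ) E] (p : M) (z : JetCoord n m) (N : ℕ) : ∀ q, E q := fun q =>
  (trivializationAt (Fin m → ℝ) E p).symm q
    (taylorPoly z N (chartAt (EuclideanSpace ℝ (Fin n)) p q))

/-- The set of `x`-coordinates of the chart domain at `p` (the points over which both the chart of
`M` and the trivialization of `E` are defined). -/
def chartDom (n m : ℕ) {M : Type*} [TopologicalSpace M]
    [ChartedSpace (EuclideanSpace ℝ (Fin n)) M] (E : M → Type*) [∀ p, TopologicalSpace (E p)]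
    [TopologicalSpace (TotalSpace (Fin m → ℝ) E)] [FiberBundle (Fin m → ℝ) E]
    (p : M) : Set (EuclideanSpace ℝ (Fin n)) :=
  (chartAt (EuclideanSpace ℝ (Fin n)) p).target ∩
    (chartAt (EuclideanSpace ℝ (Fin n)) p).symm ⁻¹' (trivializationAt (Fin m → ℝ) E p).baseSet

theorem isOpen_chartDom (p : M) : IsOpen (chartDom n m E p) :=
  (chartAt (EuclideanSpace ℝ (Fin n)) p).isOpen_inter_preimage_symm
    (trivializationAt (Fin m → ℝ) E p).open_baseSet

/-- The inverse of the coordinate system of `J^∞E` induced by the chart of `M` and the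
trivialization of `E` at `p`: the jet with coordinates `(x, u)` in these. Its coordinate of order
`|I|` in another chart only depends on the Taylor polynomial of order `|I|`. -/
noncomputable def ofCoord (E : M → Type*) [∀ p, AddCommGroup (E p)]
    [∀ p, TopologicalSpace (E p)] [TopologicalSpace (TotalSpace (Fin m → ℝ) E)]
    [FiberBundle (Fin m → ℝ) E] (p : M) (z : JetCoord n m) : JetInf n m E where
  pt := (chartAt (EuclideanSpace ℝ (Fin n)) p).symm z.1
  coeff I := (jet n m (polySection E p z (∑ i, I i))
    ((chartAt (EuclideanSpace ℝ (Fin n)) p).symm z.1)).coeff I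

/-- The coordinates of a jet in the preferred chart and trivialization at its own base point. -/
noncomputable def JetInf.coord (j : JetInf n m E) : JetCoord n m :=
  (chartAt (EuclideanSpace ℝ (Fin n)) j.pt j.pt, j.coeff)

/-- All horizontal `k`-forms on `J^∞E`, without any regularity: `α = α_I dx^I` assigns to every jet
at `p` an alternating `k`-form on `T_pM`. -/
abbrev RawForm (n m : ℕ) {M : Type*} [TopologicalSpace M]
    [ChartedSpace (EuclideanSpace ℝ (Fin n)) M] (E : M → Type*) (k : ℕ) : Type _ :=
  ∀ j : JetInf n m E, TangentSpace (𝓡 n) j.pt [⋀^Fin k]→L[ℝ] ℝ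

/-- A form at `q`, written in the chart of `M` at `p`. -/
noncomputable def formInChart {k : ℕ} (p q : M) (α : TangentSpace (𝓡 n) q [⋀^Fin k]→L[ℝ] ℝ) :
    EuclideanSpace ℝ (Fin n) [⋀^Fin k]→L[ℝ] ℝ :=
  ContinuousAlternatingMap.compContinuousLinearMap (M := EuclideanSpace ℝ (Fin n)) α
    (tangentCoordChange (𝓡 n) p q q)

/-- The expression of a horizontal form in the coordinates `(x, u)` at `p`. -/
noncomputable def inCoord {k : ℕ} (p : M) (α : RawForm n m E k) :
    JetCoord n m → EuclideanSpace ℝ (Fin n) [⋀^Fin k]→L[ℝ] ℝ := fun z =>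
  formInChart p _ (α (ofCoord E p z))

/-- `α` is a smooth horizontal form, pulled back from some finite jet bundle. -/
def IsHorizontal {k : ℕ} (α : RawForm n m E k) : Prop :=
  ∃ N, ∀ p, IsSmoothOfOrder (chartDom n m E p) N (inCoord p α)

/-- The horizontal differential `d_H α = D_i α_I dx^i ∧ dx^I`. -/
noncomputable def dH {k : ℕ} (α : RawForm n m E k) : RawForm n m E (k + 1) := fun j =>
  ContinuousAlternatingMap.alternatizeUncurryFin (E := EuclideanSpace ℝ (Fin n))
    (∑ i, (EuclideanSpace.proj i : EuclideanSpace ℝ (Fin n) →L[ℝ] ℝ).smulRight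
      (totalD i (inCoord j.pt α) j.coord))

/-- The coordinate `v ↦ v^a` on `E_q` in the trivialization at `p`. -/
noncomputable def fibreCoord (m : ℕ) {E : M → Type*} [∀ p, AddCommGroup (E p)]
    [∀ p, Module ℝ (E p)] [∀ p, TopologicalSpace (E p)]
    [TopologicalSpace (TotalSpace (Fin m → ℝ) E)] [FiberBundle (Fin m → ℝ) E]
    [VectorBundle ℝ (Fin m → ℝ) E] (p : M) (a : Fin m) (q : M) : E q →ₗ[ℝ] ℝ :=
  LinearMap.proj a ∘ₗ (trivializationAt (Fin m → ℝ) E p).linearMapAt ℝ q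

/-- The value at `j` of an element of `Ω^{k,1}` generated by the `θ^a ∧ dx^I` with the contact forms
`θ^a = du^a - u^a_i dx^i` of order zero: `θ^a` is `v ↦ v^a` on vertical vectors. -/
abbrev SourceFibre {n m : ℕ} {M : Type*} [TopologicalSpace M]
    [ChartedSpace (EuclideanSpace ℝ (Fin n)) M] {E : M → Type*} [∀ p, AddCommGroup (E p)]
    [∀ p, Module ℝ (E p)] (k : ℕ) (j : JetInf n m E) : Type _ :=
  E j.pt →ₗ[ℝ] TangentSpace (𝓡 n) j.pt [⋀^Fin k]→L[ℝ] ℝ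

/-- The Euler-Lagrange operator `E(L d^nx) = E_a(L) θ^a ∧ d^nx` (only used for `k = n`). -/
noncomputable def euler {k : ℕ} (α : RawForm n m E k) (j : JetInf n m E) : SourceFibre k j :=
  ∑ a, (fibreCoord m j.pt a j.pt).smulRight
    (show TangentSpace (𝓡 n) j.pt [⋀^Fin k]→L[ℝ] ℝ from
      eulerOp (W := EuclideanSpace ℝ (Fin n) [⋀^Fin k]→L[ℝ] ℝ) a (inCoord j.pt α) j.coord)

theorem JetInf.coord_mem (j : JetInf n m E) : j.coord.1 ∈ chartDom n m E j.pt := by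
  refine ⟨mem_chart_target (EuclideanSpace ℝ (Fin n)) j.pt, ?_⟩
  show (chartAt (EuclideanSpace ℝ (Fin n)) j.pt).symm
    (chartAt (EuclideanSpace ℝ (Fin n)) j.pt j.pt)
      ∈ (trivializationAt (Fin m → ℝ) E j.pt).baseSet
  rw [(chartAt (EuclideanSpace ℝ (Fin n)) j.pt).left_inv (mem_chart_source _ _)]
  exact FiberBundle.mem_baseSet_trivializationAt' _

theorem smulRight_lin {V W : Type*} [AddCommGroup V] [Module ℝ V] [AddCommGroup W] [Module ℝ W]
    (f : V →ₗ[ℝ] ℝ) {X Y Z : W} (c : ℝ) (h : X = c • Y + Z) :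
    f.smulRight X = c • f.smulRight Y + f.smulRight Z := by
  ext v
  simp [h, smul_comm c]

theorem euler_lin {k : ℕ} {α β : RawForm n m E k} (hα : IsHorizontal α) (hβ : IsHorizontal β)
    (c : ℝ) (j : JetInf n m E) : euler (c • α + β) j = c • euler α j + euler β j := by
  obtain ⟨N, hα⟩ := hα
  obtain ⟨N', hβ⟩ := hβ
  unfold euler
  rw [Finset.smul_sum, ← Finset.sum_add_distrib]
  refine Finset.sum_congr rfl fun a _ => ?_
  exact smulRight_lin _ c
    (eulerOp_lin (isOpen_chartDom j.pt) (hα j.pt) (hβ j.pt) c a j.coord_mem)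

theorem isHorizontal_zero {k : ℕ} : IsHorizontal (0 : RawForm n m E k) :=
  ⟨0, fun _ => ⟨0, contDiffOn_const, fun _ _ => rfl⟩⟩

theorem euler_zero {k : ℕ} (j : JetInf n m E) : euler (0 : RawForm n m E k) j = 0 := by
  have h := euler_lin (isHorizontal_zero (n := n) (m := m) (E := E) (k := k)) isHorizontal_zero 1 j
  rw [one_smul, one_smul, add_zero] at h
  refine LinearMap.ext fun v => ContinuousAlternatingMap.ext fun w => ?_
  have h' : euler (0 : RawForm n m E k) j v w
      = euler (0 : RawForm n m E k) j v w + euler (0 : RawForm n m E k) j v w :=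
    congrArg (fun e : SourceFibre k j => e v w) h
  exact left_eq_add.1 h'

/-- `s` is a smooth section of `E` with compact support. -/
def IsCompactSection (n m : ℕ) {M : Type*} [TopologicalSpace M]
    [ChartedSpace (EuclideanSpace ℝ (Fin n)) M] {E : M → Type*} [∀ p, AddCommGroup (E p)]
    [∀ p, TopologicalSpace (E p)] [TopologicalSpace (TotalSpace (Fin m → ℝ) E)]
    [FiberBundle (Fin m → ℝ) E] (s : ∀ q, E q) : Prop :=
  ContMDiff (𝓡 n) ((𝓡 n).prod 𝓘(ℝ, Fin m → ℝ)) ∞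
      (fun q => TotalSpace.mk' (Fin m → ℝ) q (s q)) ∧
    ∃ K : Set M, IsCompact K ∧ ∀ q ∉ K, s q = 0

variable (n m E) in
/-- The space `Ω^{k,0}_c(J^∞E)`: horizontal forms whose pull-back along `j^∞s` has compact support
for every smooth section `s` with compact support and, if `k = n`, the same for the components of
their Euler-Lagrange form. -/
noncomputable def omegaC (k : ℕ) : Submodule ℝ (RawForm n m E k) where
  carrier := {α | IsHorizontal α ∧ ∀ s, IsCompactSection n m s →
    (∃ K : Set M, IsCompact K ∧ ∀ p ∉ K, α (jet n m s p) = 0) ∧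
    (k = n → ∃ K : Set M, IsCompact K ∧ ∀ p ∉ K, euler α (jet n m s p) = 0)}
  zero_mem' := by
    exact ⟨isHorizontal_zero, fun s _ => ⟨⟨∅, isCompact_empty, fun p _ => rfl⟩,
      fun _ => ⟨∅, isCompact_empty, fun p _ => euler_zero _⟩⟩⟩
  add_mem' := by
    rintro α β ⟨⟨N, hα⟩, hα'⟩ ⟨⟨N', hβ⟩, hβ'⟩
    refine ⟨⟨max N N', fun p => ?_⟩, fun s hs => ⟨?_, fun hk => ?_⟩⟩
    · have := (hα p).lin (hβ p) 1
      rwa [one_smul] at this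
    · obtain ⟨K, hK, h⟩ := (hα' s hs).1
      obtain ⟨K', hK', h'⟩ := (hβ' s hs).1
      refine ⟨K ∪ K', hK.union hK', fun p hp => ?_⟩
      rw [Pi.add_apply, h p fun hp' => hp (Or.inl hp'), h' p fun hp' => hp (Or.inr hp'), add_zero]
    · obtain ⟨K, hK, h⟩ := (hα' s hs).2 hk
      obtain ⟨K', hK', h'⟩ := (hβ' s hs).2 hk
      refine ⟨K ∪ K', hK.union hK', fun p hp => ?_⟩
      have := euler_lin ⟨N, hα⟩ ⟨N', hβ⟩ 1 (jet n m s p)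
      rw [one_smul, one_smul] at this
      rw [this, h p fun hp' => hp (Or.inl hp'), h' p fun hp' => hp (Or.inr hp'), add_zero]
  smul_mem' := by
    rintro c α ⟨⟨N, hα⟩, hα'⟩
    refine ⟨⟨max N 0, fun p => ?_⟩, fun s hs => ⟨?_, fun hk => ?_⟩⟩
    · have := (hα p).lin (g := (0 : JetCoord n m → EuclideanSpace ℝ (Fin n) [⋀^Fin k]→L[ℝ] ℝ))
        (l := 0) ⟨0, contDiffOn_const, fun z _ => rfl⟩ c
      rwa [add_zero] at this
    · obtain ⟨K, hK, h⟩ := (hα' s hs).1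
      exact ⟨K, hK, fun p hp => by rw [Pi.smul_apply, h p hp, smul_zero]⟩
    · obtain ⟨K, hK, h⟩ := (hα' s hs).2 hk
      refine ⟨K, hK, fun p hp => ?_⟩
      have h2 := euler_lin ⟨N, hα⟩ isHorizontal_zero c (jet n m s p)
      rwa [add_zero, h p hp, euler_zero, smul_zero, add_zero] at h2

/-- A volume form on `M`: a smooth nowhere vanishing `n`-form. -/
structure VolumeForm (n : ℕ) (M : Type*) [TopologicalSpace M]
    [ChartedSpace (EuclideanSpace ℝ (Fin n)) M] [IsManifold (𝓡 n) ∞ M] where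
  /-- The value at a point. -/
  val : ∀ p : M, TangentSpace (𝓡 n) p [⋀^Fin n]→L[ℝ] ℝ
  smooth : ∀ p : M, ContDiffOn ℝ ∞
    (fun y => formInChart p ((chartAt (EuclideanSpace ℝ (Fin n)) p).symm y)
      (val ((chartAt (EuclideanSpace ℝ (Fin n)) p).symm y)))
    (chartAt (EuclideanSpace ℝ (Fin n)) p).target
  ne_zero : ∀ p, val p ≠ 0

/-- `μ` is the measure of the volume form `ν`, for the orientation defined by `ν`: in every chart,
`ν = f dx^1 ∧ ⋯ ∧ dx^n` and `μ` has density `|f|` with respect to Lebesgue measure. On a second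
countable manifold there is exactly one such `μ`. -/
def VolumeForm.IsMeasure (ν : VolumeForm n M) [MeasurableSpace M]
    (μ : MeasureTheory.Measure M) : Prop :=
  ∀ p : M, (μ.restrict (chartAt (EuclideanSpace ℝ (Fin n)) p).source).map
      (chartAt (EuclideanSpace ℝ (Fin n)) p) =
    (MeasureTheory.volume.restrict (chartAt (EuclideanSpace ℝ (Fin n)) p).target).withDensity
      fun y => ENNReal.ofReal |formInChart p ((chartAt (EuclideanSpace ℝ (Fin n)) p).symm y)
        (ν.val ((chartAt (EuclideanSpace ℝ (Fin n)) p).symm y)) basisVec|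

/-- The functional `s ↦ ∫_M P(j^∞s) ν` of the form `P ν`; here `P ν` is divided by `ν` by evaluating
both on a basis of `T_pM`. -/
noncomputable def functional (ν : VolumeForm n M) [MeasurableSpace M]
    (μ : MeasureTheory.Measure M) (α : RawForm n m E n) (s : ∀ q, E q) : ℝ :=
  ∫ p, α (jet n m s p) basisVec / ν.val p basisVec ∂μ

/-- The skew-symmetric tensor `w` (usually written `ω`), i.e. a skew-symmetric `Loc_E`-bilinear map on `Ω^{n,1}_0`, with
components `w^{ab} = w(θ^a ∧ ν, θ^b ∧ ν)` that are local functions. -/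
structure SkewTensor (m : ℕ) (E : M → Type*) [∀ p, AddCommGroup (E p)] [∀ p, Module ℝ (E p)]
    [∀ p, TopologicalSpace (E p)] [TopologicalSpace (TotalSpace (Fin m → ℝ) E)]
    [FiberBundle (Fin m → ℝ) E] [VectorBundle ℝ (Fin m → ℝ) E] (ν : VolumeForm n M) where
  /-- The value at a jet. -/
  val : ∀ j : JetInf n m E, SourceFibre n j →ₗ[ℝ] SourceFibre n j →ₗ[ℝ] ℝ
  skew : ∀ j θ θ', val j θ θ' = -val j θ' θ
  smooth : ∃ N, ∀ p a b, IsSmoothOfOrder (chartDom n m E p) N fun z =>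
    val (ofCoord E p z)
      ((fibreCoord m p a (ofCoord E p z).pt).smulRight (ν.val (ofCoord E p z).pt))
      ((fibreCoord m p b (ofCoord E p z).pt).smulRight (ν.val (ofCoord E p z).pt))

/-- The map `l̃_2(Pν, Qν) = w(E(Pν), E(Qν)) ν`. -/
noncomputable def SkewTensor.l2 {ν : VolumeForm n M} (w : SkewTensor m E ν)
    (α β : RawForm n m E n) : RawForm n m E n := fun j =>
  w.val j (euler α j) (euler β j) • ν.val j.pt

/-- The Jacobi identity for the Poisson bracket `{∫ Pν, ∫ Qν} = ∫ w(E(Pν), E(Qν)) ν` of local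
functionals of compactly supported sections. -/
def SkewTensor.Jacobi {ν : VolumeForm n M} (w : SkewTensor m E ν) [MeasurableSpace M]
    (μ : MeasureTheory.Measure M) : Prop :=
  ∀ α ∈ omegaC n m E n, ∀ β ∈ omegaC n m E n, ∀ γ ∈ omegaC n m E n,
    ∀ s, IsCompactSection n m s →
      functional ν μ (w.l2 (w.l2 α β) γ) s + functional ν μ (w.l2 (w.l2 β γ) α) s
        + functional ν μ (w.l2 (w.l2 γ α) β) s = 0

/-- A left action of `G` on `E` by smooth automorphisms that map every fibre to itself (they cover
the identity of `M`, and need not be linear on fibres). -/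
structure FibreAction (n m : ℕ) (G : Type*) [Group G] {M : Type*} [TopologicalSpace M]
    [ChartedSpace (EuclideanSpace ℝ (Fin n)) M] (E : M → Type*)
    [∀ p, TopologicalSpace (E p)] [TopologicalSpace (TotalSpace (Fin m → ℝ) E)]
    [FiberBundle (Fin m → ℝ) E] where
  /-- The automorphism `ψ_g`. -/
  act : G → ∀ q, E q → E q
  act_one : ∀ q v, act 1 q v = v
  act_mul : ∀ g h q v, act (g * h) q v = act g q (act h q v)
  smooth : ∀ g, ContMDiff ((𝓡 n).prod 𝓘(ℝ, Fin m → ℝ)) ((𝓡 n).prod 𝓘(ℝ, Fin m → ℝ)) ∞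
    (fun v : TotalSpace (Fin m → ℝ) E => TotalSpace.mk' (Fin m → ℝ) v.1 (act g v.1 v.2))

variable {G : Type*} [Group G]

/-- The induced map `jψ_g : J^∞E → J^∞E`, `j^∞s(p) ↦ j^∞(ψ_g ∘ s)(p)`. Coordinates of order `|I|` of
the image only depend on the Taylor polynomial of order `|I|` of `s`. -/
noncomputable def FibreAction.prolong (A : FibreAction n m G E) (g : G) (j : JetInf n m E) :
    JetInf n m E where
  pt := j.pt
  coeff I := (jet n m (fun q => A.act g q (polySection E j.pt j.coord (∑ i, I i) q)) j.pt).coeff I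

/-- The pull-back `(jψ_g)^* α` of a horizontal form. -/
noncomputable def FibreAction.pullback (A : FibreAction n m G E) (g : G) {k : ℕ}
    (α : RawForm n m E k) : RawForm n m E k := fun j =>
  (α (A.prolong g j) : TangentSpace (𝓡 n) j.pt [⋀^Fin k]→L[ℝ] ℝ)

/-- The action is canonical: `{P ∘ ψ̂_g, Q ∘ ψ̂_g} = {P, Q} ∘ ψ̂_g` for the functionals `P`, `Q` of
`α`, `β`, where `ψ̂_g(s) = ψ_g ∘ s`, so that `P ∘ ψ̂_g` is the functional of `(jψ_g)^* α`. -/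
def FibreAction.IsCanonical (A : FibreAction n m G E) {ν : VolumeForm n M} (w : SkewTensor m E ν)
    [MeasurableSpace M] (μ : MeasureTheory.Measure M) : Prop :=
  ∀ g, ∀ α ∈ omegaC n m E n, ∀ β ∈ omegaC n m E n,
    A.pullback g α ∈ omegaC n m E n → A.pullback g β ∈ omegaC n m E n →
    ∀ s, IsCompactSection n m s →
      functional ν μ (w.l2 (A.pullback g α) (A.pullback g β)) s
        = functional ν μ (w.l2 α β) (fun q => A.act g q (s q))

/-- The space `Ω^{k,0}_G(J^∞E)` of `G`-invariant forms in `Ω^{k,0}_c(J^∞E)`. -/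
noncomputable def omegaG (A : FibreAction n m G E) (k : ℕ) : Submodule ℝ (RawForm n m E k) where
  carrier := {α | α ∈ omegaC n m E k ∧ ∀ g, A.pullback g α = α}
  zero_mem' := ⟨Submodule.zero_mem _, fun _ => rfl⟩
  add_mem' := by
    rintro α β ⟨hα, hα'⟩ ⟨hβ, hβ'⟩
    refine ⟨Submodule.add_mem _ hα hβ, fun g => ?_⟩
    calc A.pullback g (α + β) = A.pullback g α + A.pullback g β := rfl
      _ = α + β := by rw [hα', hβ']
  smul_mem' := by
    rintro c α ⟨hα, hα'⟩
    refine ⟨Submodule.smul_mem _ c hα, fun g => ?_⟩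
    calc A.pullback g (c • α) = c • A.pullback g α := rfl
      _ = c • α := by rw [hα']

/-- `α` is `d_H` of a form in `Ω`; in degree zero only `0` is. -/
def IsExactIn (Ω : ∀ k, Submodule ℝ (RawForm n m E k)) : ∀ {k : ℕ}, RawForm n m E k → Prop
  | 0, α => α = 0
  | k + 1, α => ∃ β ∈ Ω k, dH β = α

/-- The complex `0 → Ω^0 → Ω^1 → ⋯ → Ω^n` is exact, at all places but the last one. -/
def IsExactComplex (Ω : ∀ k, Submodule ℝ (RawForm n m E k)) : Prop :=
  ∀ k < n, ∀ α ∈ Ω k, dH α = 0 → IsExactIn Ω α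

/-- The total space `⨁_k Ω^k` of the complex (forms of degree `k > n` are zero). -/
noncomputable def totalSpace (Ω : ∀ k, Submodule ℝ (RawForm n m E k)) : Submodule ℝ (∀ k, RawForm n m E k) :=
  Submodule.pi univ Ω

/-- The grading `X_i = Ω^{n-i}`, `i ∈ ℤ`, of the total space. -/
noncomputable def degreePart (Ω : ∀ k, Submodule ℝ (RawForm n m E k)) (i : ℤ) :
    Submodule ℝ (totalSpace Ω) where
  carrier := {x | ∀ k : ℕ, (k : ℤ) ≠ n - i → x.1 k = 0}
  zero_mem' := fun _ _ => rfl
  add_mem' := by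
    intro x y hx hy k hk
    show x.1 k + y.1 k = 0
    rw [hx k hk, hy k hk, add_zero]
  smul_mem' := by
    intro c x hx k hk
    show c • x.1 k = 0
    rw [hx k hk, smul_zero]

/-- `d_H` on the total space. -/
noncomputable def dTotal (x : ∀ k, RawForm n m E k) : ∀ k, RawForm n m E k
  | 0 => 0
  | k + 1 => dH (x k)

theorem totalSpace_omegaG_le (A : FibreAction n m G E) :
    totalSpace (omegaG A) ≤ totalSpace (omegaC n m E) :=
  fun _ hx k hk => (hx k hk).1

end Geometry

section ShLie

/-- The Koszul sign `e(σ)` of `x_0 ⋯ x_{N-1} ↦ x_{σ(0)} ⋯ x_{σ(N-1)}` for `x_i` of degree `d i`. -/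
def koszulSign {N : ℕ} (d : Fin N → ℤ) (σ : Equiv.Perm (Fin N)) : ℤ :=
  ∏ a, ∏ b, if a < b ∧ σ b < σ a ∧ Odd (d (σ a)) ∧ Odd (d (σ b)) then -1 else 1

/-- `σ` is a `(p, N - p)`-unshuffle. -/
def IsUnshuffle {N : ℕ} (p : ℕ) (σ : Equiv.Perm (Fin N)) : Prop :=
  (∀ a b : Fin N, a < b → (b : ℕ) < p → σ a < σ b) ∧
    ∀ a b : Fin N, a < b → p ≤ (a : ℕ) → σ a < σ b

open Classical in
/-- An sh-Lie structure on the graded vector space `V = ⨁ X_i`: graded skew-symmetric multilinear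
maps `l_k`, `k ≥ 1`, of degree `k - 2` (with `l_0 = 0`), such that for all `N ≥ 1` and homogeneous
`x_0, …, x_{N-1}` the sum over `i + j = N + 1`, `i, j ≥ 1`, and over the `(i, N - i)`-unshuffles `σ` of
`e(σ) (-1)^σ (-1)^{i(j-1)} l_j(l_i(x_{σ(0)}, …, x_{σ(i-1)}), x_{σ(i)}, …, x_{σ(N-1)})` vanishes. Below
`i` is written `i + 1` with `0 ≤ i < N`, so that `j - 1 = N - (i + 1)`. -/
structure ShLieStructure {V : Type*} [AddCommGroup V] [Module ℝ V]
    (X : ℤ → Submodule ℝ V) where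
  internal : DirectSum.IsInternal X
  /-- The structure maps. -/
  l : ∀ k : ℕ, MultilinearMap ℝ (fun _ : Fin k => V) V
  l_zero : l 0 = 0
  degree : ∀ (k : ℕ) (d : Fin k → ℤ) (x : Fin k → V), (∀ r, x r ∈ X (d r)) →
    l k x ∈ X (∑ r, d r + k - 2)
  skew : ∀ (k : ℕ) (d : Fin k → ℤ) (x : Fin k → V), (∀ r, x r ∈ X (d r)) →
    ∀ σ : Equiv.Perm (Fin k),
      l k (fun r => x (σ r)) = ((Equiv.Perm.sign σ : ℤ) * koszulSign d σ) • l k x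
  relation : ∀ (N : ℕ) (d : Fin N → ℤ) (x : Fin N → V), (∀ r, x r ∈ X (d r)) →
    ∑ i : Fin N, ∑ σ : Equiv.Perm (Fin N), (if IsUnshuffle (i + 1) σ then
      (koszulSign d σ * (Equiv.Perm.sign σ : ℤ) * (-1) ^ ((i + 1 : ℕ) * (N - (i + 1)))) •
        l (N - (i + 1) + 1) (Fin.cons (l (i + 1) fun r => x (σ (Fin.castLE i.2 r)))
          fun r => x (σ ⟨i + 1 + r, by omega⟩))
      else 0) = 0

end ShLie

section Extension

variable {n m : ℕ} {M : Type*} [TopologicalSpace M] [ChartedSpace (EuclideanSpace ℝ (Fin n)) M]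
  [IsManifold (𝓡 n) ∞ M]
  {E : M → Type*} [∀ p, AddCommGroup (E p)] [∀ p, Module ℝ (E p)] [∀ p, TopologicalSpace (E p)]
  [TopologicalSpace (TotalSpace (Fin m → ℝ) E)] [FiberBundle (Fin m → ℝ) E]
  [VectorBundle ℝ (Fin m → ℝ) E]

/-- The sh-Lie structure on the complex `X_i = Ω^{n-i}` extends `d_H` and `l̃_2`: `l_1 = d_H`, `l_2` is
`l̃_2` in degree zero, `l_2` and `l_3` vanish unless all arguments have degree zero, and `l_k = 0` for
`k ≥ 4`. -/
structure Extends {ν : VolumeForm n M} (w : SkewTensor m E ν)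
    {Ω : ∀ k, Submodule ℝ (RawForm n m E k)} (L : ShLieStructure (V := totalSpace Ω) (degreePart Ω)) : Prop where
  l_one : ∀ x, (L.l 1 ![x]).1 = dTotal x.1
  l_two : ∀ x ∈ degreePart Ω 0, ∀ y ∈ degreePart Ω 0, (L.l 2 ![x, y]).1 n = w.l2 (x.1 n) (y.1 n)
  degree_zero : ∀ k, 2 ≤ k → ∀ (d : Fin k → ℤ) (x : Fin k → totalSpace Ω),
    (∀ r, x r ∈ degreePart Ω (d r)) → (∃ r, d r ≠ 0) → L.l k x = 0
  l_ge_four : ∀ k, 4 ≤ k → L.l k = 0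

end Extension

end HorizontalForms

open HorizontalForms

namespace HorizontalForms

open MeasureTheory

local notation "𝔼" => EuclideanSpace ℝ

section IterOp

variable {n : ℕ} {A B : Type*}

theorem iterOp_rel {D : Fin n → A → A} {D' : Fin n → B → B} (R : A → B → Prop)
    (hR : ∀ i a b, R a b → R (D i a) (D' i b)) (I : Fin n → ℕ) {a : A} {b : B} (h : R a b) :
    R (iterOp D I a) (iterOp D' I b) := by
  have step : ∀ (i : Fin n) (N : ℕ) (a : A) (b : B), R a b → R ((D i)^[N] a) ((D' i)^[N] b) := by
    intro i N
    induction N with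
    | zero => exact fun a b h => h
    | succ N ih => exact fun a b h => ih _ _ (hR i a b h)
  unfold iterOp
  induction List.finRange n with
  | nil => exact h
  | cons i L ih => exact step i (I i) _ _ ih

theorem iterOp_induction {D : Fin n → A → A} (P : A → Prop) (hP : ∀ i a, P a → P (D i a))
    (I : Fin n → ℕ) {a : A} (h : P a) : P (iterOp D I a) :=
  iterOp_rel (D' := D) (fun a _ => P a) (fun i a _ => hP i a) I (b := a) h

theorem iterOp_zero (D : Fin n → A → A) (a : A) : iterOp D 0 a = a := by
  unfold iterOp
  induction List.finRange n with
  | nil => rfl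
  | cons i L ih => simp

theorem iterOp_add_single_of_comm (D : Fin n → A → A) (hD : ∀ i j a, D i (D j a) = D j (D i a))
    (I : Fin n → ℕ) (i : Fin n) (a : A) : iterOp D (I + Pi.single i 1) a = D i (iterOp D I a) := by
  have pass : ∀ (j : Fin n) (N : ℕ) (a : A), (D j)^[N] (D i a) = D i ((D j)^[N] a) := by
    intro j N
    induction N with
    | zero => exact fun a => rfl
    | succ N ih => intro a; rw [Function.iterate_succ_apply, hD j i, ih, Function.iterate_succ_apply]
  obtain ⟨I', hI', hi', hne⟩ : ∃ I' : Fin n → ℕ, I + Pi.single i 1 = I' ∧ I' i = I i + 1 ∧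
      ∀ j, j ≠ i → I' j = I j :=
    ⟨_, rfl, by simp, fun j hj => by simp [hj]⟩
  rw [hI']
  have main : ∀ L : List (Fin n), L.Nodup →
      (i ∉ L → L.foldr (fun j T => (D j)^[I' j] ∘ T) id a
        = L.foldr (fun j T => (D j)^[I j] ∘ T) id a) ∧
      (i ∈ L → L.foldr (fun j T => (D j)^[I' j] ∘ T) id a
        = D i (L.foldr (fun j T => (D j)^[I j] ∘ T) id a)) := by
    intro L
    induction L with
    | nil => simp
    | cons j L ih =>
      intro hL
      obtain ⟨hj, hL⟩ := List.nodup_cons.1 hL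
      obtain ⟨h1, h2⟩ := ih hL
      constructor
      · intro hi
        simp only [List.mem_cons, not_or] at hi
        simp [h1 hi.2, hne j (Ne.symm hi.1)]
      · intro hi
        by_cases hij : j = i
        · subst hij
          simp only [List.foldr_cons, Function.comp_apply, h1 hj, hi', Function.iterate_succ_apply']
        · have hiL : i ∈ L := by simpa [Ne.symm hij] using hi
          simp [h2 hiL, hne j hij, pass]
  exact (main _ (List.nodup_finRange n)).2 (List.mem_finRange i)

end IterOp

theorem sum_add_single {n : ℕ} (I : Fin n → ℕ) (i : Fin n) :
    ∑ j, (I + Pi.single i 1 : Fin n → ℕ) j = ∑ j, I j + 1 := by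
  simp [Finset.sum_add_distrib]

theorem multiIndex_induction {n : ℕ} {P : (Fin n → ℕ) → Prop} (h0 : P 0)
    (h1 : ∀ I i, P I → P (I + Pi.single i 1)) (I : Fin n → ℕ) : P I := by
  induction h : ∑ j, I j generalizing I with
  | zero =>
    have : I = 0 := by
      funext j
      exact (Finset.sum_eq_zero_iff.1 h) j (Finset.mem_univ j)
    rwa [this]
  | succ N ih =>
    have : ∃ i, I i ≠ 0 := by
      by_contra hc
      push Not at hc
      simp [hc] at h
    obtain ⟨i, hi⟩ := this
    have hI : I = (I - Pi.single i 1) + Pi.single i 1 := by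
      funext j
      by_cases hj : j = i
      · subst hj; simp; omega
      · simp [hj]
    rw [hI] at h ⊢
    rw [sum_add_single] at h
    exact h1 _ _ (ih _ (by omega))

section SecondDerivative

variable {V W : Type*} [NormedAddCommGroup V] [NormedSpace ℝ V] [NormedAddCommGroup W]
  [NormedSpace ℝ W] {F : V → W} {Ω : Set V}

theorem contDiffOn_fderiv_apply (hΩ : IsOpen Ω) (hF : ContDiffOn ℝ ∞ F Ω) (a : V) :
    ContDiffOn ℝ ∞ (fun x => fderiv ℝ F x a) Ω :=
  (hF.fderiv_of_isOpen hΩ (by simp)).clm_apply contDiffOn_const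

theorem _root_.ContDiffOn.differentiableAt_of_isOpen (hF : ContDiffOn ℝ ∞ F Ω) (hΩ : IsOpen Ω) {x : V}
    (hx : x ∈ Ω) : DifferentiableAt ℝ F x :=
  (hF.contDiffAt (hΩ.mem_nhds hx)).differentiableAt (by simp)

theorem fderiv_fderiv_apply (hΩ : IsOpen Ω) (hF : ContDiffOn ℝ ∞ F Ω) (a b : V) {x : V}
    (hx : x ∈ Ω) :
    fderiv ℝ (fun x => fderiv ℝ F x a) x b = fderiv ℝ (fderiv ℝ F) x b a := by
  have h := ((hF.fderiv_of_isOpen hΩ (m := ∞) (by simp)).differentiableAt_of_isOpen hΩ hx)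
  rw [fderiv_clm_apply h (differentiableAt_const a)]
  simp

theorem fderiv_fderiv_comm (hΩ : IsOpen Ω) (hF : ContDiffOn ℝ ∞ F Ω) (a b : V) {x : V}
    (hx : x ∈ Ω) :
    fderiv ℝ (fun x => fderiv ℝ F x a) x b = fderiv ℝ (fun x => fderiv ℝ F x b) x a := by
  rw [fderiv_fderiv_apply hΩ hF a b hx, fderiv_fderiv_apply hΩ hF b a hx]
  have h : IsSymmSndFDerivAt ℝ F x :=
    (hF.contDiffAt (hΩ.mem_nhds hx)).isSymmSndFDerivAt
      (by rw [minSmoothness_of_isRCLikeNormedField]; exact WithTop.coe_le_coe.2 (le_top : (2 : ℕ∞) ≤ ⊤))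
  exact h b a

end SecondDerivative

section PartialD

variable {n : ℕ} {W W' : Type*} [NormedAddCommGroup W] [NormedSpace ℝ W]
  [NormedAddCommGroup W'] [NormedSpace ℝ W'] {U : Set (𝔼 (Fin n))} {f g : 𝔼 (Fin n) → W}

theorem partialD_eq_fderiv {y : 𝔼 (Fin n)} (i : Fin n) (hf : DifferentiableAt ℝ f y) :
    partialD i f y = fderiv ℝ f y (basisVec i) :=
  hf.lineDeriv_eq_fderiv

theorem partialD_eqOn_fderiv (hU : IsOpen U) (hf : ContDiffOn ℝ ∞ f U) (i : Fin n) :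
    EqOn (partialD i f) (fun y => fderiv ℝ f y (basisVec i)) U := fun _ hy =>
  partialD_eq_fderiv i (hf.differentiableAt_of_isOpen hU hy)

theorem contDiffOn_partialD (hU : IsOpen U) (hf : ContDiffOn ℝ ∞ f U) (i : Fin n) :
    ContDiffOn ℝ ∞ (partialD i f) U :=
  (contDiffOn_fderiv_apply hU hf _).congr (partialD_eqOn_fderiv hU hf i)

theorem lineDeriv_congr_nhds {V : Type*} [NormedAddCommGroup V] [NormedSpace ℝ V]
    {f g : V → W} {y : V} (h : f =ᶠ[𝓝 y] g) (v : V) : lineDeriv ℝ f y v = lineDeriv ℝ g y v := by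
  unfold lineDeriv
  refine Filter.EventuallyEq.deriv_eq ?_
  have hc : Continuous fun t : ℝ => y + t • v := by fun_prop
  have := hc.tendsto 0
  rw [zero_smul, add_zero] at this
  exact this.eventually h

theorem partialD_congr_nhds {y : 𝔼 (Fin n)} (h : f =ᶠ[𝓝 y] g) (i : Fin n) :
    partialD i f y = partialD i g y := lineDeriv_congr_nhds h _

theorem partialD_congr (hU : IsOpen U) (h : EqOn f g U) (i : Fin n) :
    EqOn (partialD i f) (partialD i g) U := fun _ hy =>
  partialD_congr_nhds (h.eventuallyEq_of_mem (hU.mem_nhds hy)) i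

theorem contDiffOn_iterOp_partialD (hU : IsOpen U) (hf : ContDiffOn ℝ ∞ f U) (I : Fin n → ℕ) :
    ContDiffOn ℝ ∞ (iterOp partialD I f) U :=
  iterOp_induction (fun f => ContDiffOn ℝ ∞ f U) (fun i _ h => contDiffOn_partialD hU h i) I hf

theorem iterOp_partialD_congr (hU : IsOpen U) (h : EqOn f g U) (I : Fin n → ℕ) :
    EqOn (iterOp partialD I f) (iterOp partialD I g) U :=
  iterOp_rel (fun f g => EqOn f g U) (fun i _ _ h => partialD_congr hU h i) I h

theorem partialD_comm (hU : IsOpen U) (hf : ContDiffOn ℝ ∞ f U) (i j : Fin n) :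
    EqOn (partialD i (partialD j f)) (partialD j (partialD i f)) U := by
  intro y hy
  rw [partialD_congr hU (partialD_eqOn_fderiv hU hf j) i hy,
    partialD_congr hU (partialD_eqOn_fderiv hU hf i) j hy,
    partialD_eqOn_fderiv hU (contDiffOn_fderiv_apply hU hf _) i hy,
    partialD_eqOn_fderiv hU (contDiffOn_fderiv_apply hU hf _) j hy]
  exact fderiv_fderiv_comm hU hf _ _ hy

open Classical in
/-- `∂_i` on the smooth functions on `U`, extended by zero. -/
noncomputable def partialDOn (U : Set (𝔼 (Fin n))) (hU : IsOpen U) (i : Fin n)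
    (f : {f : 𝔼 (Fin n) → W // ContDiffOn ℝ ∞ f U}) :
    {f : 𝔼 (Fin n) → W // ContDiffOn ℝ ∞ f U} :=
  ⟨U.indicator (partialD i f.1), (contDiffOn_partialD hU f.2 i).congr
    fun _ hy => indicator_of_mem hy _⟩

theorem partialDOn_eqOn (hU : IsOpen U) (i : Fin n)
    (f : {f : 𝔼 (Fin n) → W // ContDiffOn ℝ ∞ f U}) :
    EqOn (partialDOn U hU i f).1 (partialD i f.1) U := fun _ hy => indicator_of_mem hy _

theorem partialDOn_comm (hU : IsOpen U) (i j : Fin n)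
    (f : {f : 𝔼 (Fin n) → W // ContDiffOn ℝ ∞ f U}) :
    partialDOn U hU i (partialDOn U hU j f) = partialDOn U hU j (partialDOn U hU i f) := by
  apply Subtype.ext
  funext y
  by_cases hy : y ∈ U
  · rw [partialDOn_eqOn hU i _ hy, partialDOn_eqOn hU j _ hy,
      partialD_congr hU (partialDOn_eqOn hU j f) i hy,
      partialD_congr hU (partialDOn_eqOn hU i f) j hy, partialD_comm hU f.2 i j hy]
  · exact (indicator_of_notMem hy _).trans (indicator_of_notMem hy _).symm

theorem iterOp_partialDOn_eqOn (hU : IsOpen U) (hf : ContDiffOn ℝ ∞ f U) (I : Fin n → ℕ) :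
    EqOn (iterOp (partialDOn U hU) I ⟨f, hf⟩).1 (iterOp partialD I f) U :=
  iterOp_rel (fun (a : {f : 𝔼 (Fin n) → W // ContDiffOn ℝ ∞ f U}) b => EqOn a.1 b U)
    (fun i a _ h => (partialDOn_eqOn hU i a).trans (partialD_congr hU h i)) I fun _ _ => rfl

theorem iterOp_partialD_add_single (hU : IsOpen U) (hf : ContDiffOn ℝ ∞ f U) (I : Fin n → ℕ)
    (i : Fin n) :
    EqOn (iterOp partialD (I + Pi.single i 1) f) (partialD i (iterOp partialD I f)) U := by
  intro y hy
  rw [← iterOp_partialDOn_eqOn hU hf _ hy, iterOp_add_single_of_comm _ (partialDOn_comm hU),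
    partialDOn_eqOn hU i _ hy, partialD_congr hU (iterOp_partialDOn_eqOn hU hf I) i hy]

theorem iterOp_partialD_partialD (hU : IsOpen U) (hf : ContDiffOn ℝ ∞ f U) (I : Fin n → ℕ)
    (i : Fin n) :
    EqOn (iterOp partialD I (partialD i f)) (partialD i (iterOp partialD I f)) U :=
  (iterOp_rel (fun a b => ContDiffOn ℝ ∞ b U ∧ EqOn a (partialD i b) U)
    (fun j _ _ h => ⟨contDiffOn_partialD hU h.1 j, (partialD_congr hU h.2 j).trans
      (partialD_comm hU h.1 j i)⟩) I
    (⟨hf, fun _ _ => rfl⟩ : ContDiffOn ℝ ∞ f U ∧ EqOn (partialD i f) (partialD i f) U)).2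

theorem partialD_clm (T : W →L[ℝ] W') {y : 𝔼 (Fin n)} (hf : DifferentiableAt ℝ f y) (i : Fin n) :
    partialD i (fun y => T (f y)) y = T (partialD i f y) := by
  show partialD i (T ∘ f) y = _
  rw [partialD_eq_fderiv i hf, partialD_eq_fderiv i (T.differentiableAt.comp y hf),
    fderiv_comp y T.differentiableAt hf]
  simp

theorem iterOp_partialD_clm (T : W →L[ℝ] W') (hU : IsOpen U) (hf : ContDiffOn ℝ ∞ f U)
    (I : Fin n → ℕ) :
    EqOn (iterOp partialD I fun y => T (f y)) (fun y => T (iterOp partialD I f y)) U :=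
  (iterOp_rel (fun a b => ContDiffOn ℝ ∞ b U ∧ EqOn a (fun y => T (b y)) U)
    (fun j _ _ h => ⟨contDiffOn_partialD hU h.1 j, fun y hy => (partialD_congr hU h.2 j hy).trans
      (partialD_clm T (h.1.differentiableAt_of_isOpen hU hy) j)⟩) I
    (⟨hf, fun _ _ => rfl⟩ : ContDiffOn ℝ ∞ f U ∧
      EqOn (fun y => T (f y)) (fun y => T (f y)) U)).2

theorem iterOp_partialD_add (hU : IsOpen U) (hf : ContDiffOn ℝ ∞ f U) (hg : ContDiffOn ℝ ∞ g U)
    (I : Fin n → ℕ) : EqOn (iterOp partialD I (fun y => f y + g y))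
      (fun y => iterOp partialD I f y + iterOp partialD I g y) U := by
  intro y hy
  have h := hf.prodMk hg
  have h1 := iterOp_partialD_clm (ContinuousLinearMap.fst ℝ W W) hU h I hy
  have h2 := iterOp_partialD_clm (ContinuousLinearMap.snd ℝ W W) hU h I hy
  have h3 := iterOp_partialD_clm
    (ContinuousLinearMap.fst ℝ W W + ContinuousLinearMap.snd ℝ W W) hU h I hy
  simp only [_root_.add_apply, ContinuousLinearMap.coe_fst',
    ContinuousLinearMap.coe_snd'] at h1 h2 h3
  rw [h3, ← h1, ← h2]

theorem iterOp_partialD_smul (hU : IsOpen U) (hf : ContDiffOn ℝ ∞ f U) (c : ℝ) (I : Fin n → ℕ) :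
    EqOn (iterOp partialD I (fun y => c • f y)) (fun y => c • iterOp partialD I f y) U :=
  iterOp_partialD_clm (c • ContinuousLinearMap.id ℝ W) hU hf I

theorem iterOp_partialD_zero (I : Fin n → ℕ) (y : 𝔼 (Fin n)) :
    iterOp partialD I (fun _ : 𝔼 (Fin n) => (0 : W)) y = 0 := by
  have := iterOp_partialD_smul isOpen_univ (contDiffOn_const (c := (0 : W))) 0 I (mem_univ y)
  simpa using this

theorem iterOp_partialD_eq_zero (hU : IsOpen U) (hf : ∀ y ∈ U, f y = 0) (I : Fin n → ℕ)
    {y : 𝔼 (Fin n)} (hy : y ∈ U) : iterOp partialD I f y = 0 := by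
  rw [iterOp_partialD_congr hU (g := fun _ => 0) hf I hy, iterOp_partialD_zero]

theorem iterOp_partialD_sum {ι : Type*} (s : Finset ι) {F : ι → 𝔼 (Fin n) → W} (hU : IsOpen U)
    (hF : ∀ i ∈ s, ContDiffOn ℝ ∞ (F i) U) (I : Fin n → ℕ) :
    EqOn (iterOp partialD I (fun y => ∑ i ∈ s, F i y))
      (fun y => ∑ i ∈ s, iterOp partialD I (F i) y) U := by
  classical
  induction s using Finset.induction_on with
  | empty => intro y _; simp [iterOp_partialD_zero]
  | insert i s hi ih =>
    intro y hy
    simp only [Finset.sum_insert hi]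
    rw [iterOp_partialD_add hU (hF i (Finset.mem_insert_self i s))
      (ContDiffOn.sum fun j hj => hF j (Finset.mem_insert_of_mem hj)) I hy]
    exact congrArg _ (ih (fun j hj => hF j (Finset.mem_insert_of_mem hj)) hy)

/-- `c` is locally constant at the points of `U`. -/
def IsLocConstOn {V : Type*} [TopologicalSpace V] (U : Set V) (c : V → ℝ) : Prop :=
  ∀ y ∈ U, ∀ᶠ y' in 𝓝 y, c y' = c y

theorem IsLocConstOn.contDiffOn {V : Type*} [NormedAddCommGroup V] [NormedSpace ℝ V] {U : Set V}
    {c : V → ℝ} (hc : IsLocConstOn U c) : ContDiffOn ℝ ∞ c U := fun y hy =>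
  ((contDiffAt_const (c := c y)).congr_of_eventuallyEq (hc y hy)).contDiffWithinAt

theorem iterOp_partialD_locConst {c : 𝔼 (Fin n) → ℝ} (hc : IsLocConstOn U c) (hU : IsOpen U)
    (hf : ContDiffOn ℝ ∞ f U) (I : Fin n → ℕ) :
    EqOn (iterOp partialD I (fun y => c y • f y)) (fun y => c y • iterOp partialD I f y) U := by
  refine (iterOp_rel (fun a b => ContDiffOn ℝ ∞ b U ∧ EqOn a (fun y => c y • b y) U)
    (fun j a b h => ⟨contDiffOn_partialD hU h.1 j, fun y hy => ?_⟩) I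
    (⟨hf, fun _ _ => rfl⟩ : ContDiffOn ℝ ∞ f U ∧
      EqOn (fun y => c y • f y) (fun y => c y • f y) U)).2
  rw [partialD_congr hU h.2 j hy,
    partialD_congr_nhds (g := fun y' => (c y • ContinuousLinearMap.id ℝ W) (b y'))
      (by filter_upwards [hc y hy] with y' hy'; simp [hy']) j,
    partialD_clm _ (h.1.differentiableAt_of_isOpen hU hy)]
  simp

end PartialD

section JetOf

variable {n m : ℕ} {W W' : Type*} [NormedAddCommGroup W] [NormedSpace ℝ W]
  [NormedAddCommGroup W'] [NormedSpace ℝ W'] {U : Set (𝔼 (Fin n))} {k : ℕ}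
  {u : 𝔼 (Fin n) → Fin m → ℝ} {f : JetCoord n m → W}

/-- The jet coordinates of the function `u` at `y`. -/
noncomputable def jetOf (u : 𝔼 (Fin n) → Fin m → ℝ) (y : 𝔼 (Fin n)) : JetCoord n m :=
  (y, fun I => iterOp partialD I u y)

theorem contDiffOn_comp_jetOf (hU : IsOpen U) (hf : IsSmoothOfOrder U k f)
    (hu : ContDiffOn ℝ ∞ u U) : ContDiffOn ℝ ∞ (fun y => f (jetOf u y)) U := by
  obtain ⟨G, hG, hfG⟩ := hf
  have h : ContDiffOn ℝ ∞ (fun y => (y, fun K : idxLE n k => iterOp partialD (K : Fin n → ℕ) u y)) U :=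
    contDiffOn_id.prodMk (contDiffOn_pi.2 fun K => contDiffOn_iterOp_partialD hU hu _)
  exact (hG.comp h fun y hy => ⟨hy, mem_univ _⟩).congr fun y hy => hfG _ hy

theorem totalD_jetOf (hU : IsOpen U) (hf : IsSmoothOfOrder U k f) (hu : ContDiffOn ℝ ∞ u U)
    (i : Fin n) : EqOn (fun y => totalD i f (jetOf u y)) (partialD i fun y => f (jetOf u y)) U := by
  intro y hy
  obtain ⟨G, hG, hfG⟩ := hf
  have h : ContDiffOn ℝ ∞ (fun y => (y, fun K : idxLE n k => iterOp partialD (K : Fin n → ℕ) u y)) U :=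
    contDiffOn_id.prodMk (contDiffOn_pi.2 fun K => contDiffOn_iterOp_partialD hU hu _)
  have hz : (jetOf u y).1 ∈ U := hy
  have h1 := (IsSmoothOfOrder.hasLineDerivAt hU hG hfG hz
    (basisVec i, fun J => (jetOf u y).2 (J + Pi.single i 1))).lineDeriv
  have hGd : DifferentiableAt ℝ G (y, fun K : idxLE n k => iterOp partialD (K : Fin n → ℕ) u y) :=
    hG.differentiableAt_of_isOpen (hU.prod isOpen_univ) ⟨hy, mem_univ _⟩
  have hhd := h.differentiableAt_of_isOpen hU hy
  show totalD i f (jetOf u y) = _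
  rw [totalD, h1, partialD_congr hU (fun y hy => hfG (jetOf u y) hy) i hy]
  rw [partialD_eq_fderiv i (f := fun y => G ((jetOf u y).1, fun K : idxLE n k => (jetOf u y).2 K))
    (hGd.comp y hhd)]
  have h2 := fderiv_comp (𝕜 := ℝ) y hGd hhd
  show _ = fderiv ℝ (G ∘ fun y => (y, fun K : idxLE n k => iterOp partialD (K : Fin n → ℕ) u y)) y (basisVec i)
  rw [h2]
  show _ = fderiv ℝ G (y, fun K : idxLE n k => iterOp partialD (K : Fin n → ℕ) u y) _
  congr 1
  have hcomp : ∀ K : idxLE n k, DifferentiableAt ℝ (iterOp partialD (K : Fin n → ℕ) u) y :=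
    fun K => (contDiffOn_iterOp_partialD hU hu _).differentiableAt_of_isOpen hU hy
  have h3 := (differentiableAt_id (𝕜 := ℝ) (x := y)).fderiv_prodMk (differentiableAt_pi.2 hcomp)
  simp only [id_eq] at h3
  rw [h3]
  refine Prod.ext (by simp) ?_
  funext K
  show iterOp partialD ((K : Fin n → ℕ) + Pi.single i 1) u y
    = (fderiv ℝ (fun x (K : idxLE n k) => iterOp partialD (K : Fin n → ℕ) u x) y) (basisVec i) K
  rw [fderiv_pi hcomp]
  simp only [ContinuousLinearMap.coe_pi']
  rw [iterOp_partialD_add_single hU hu _ i hy, partialD_eq_fderiv i (hcomp K)]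

theorem iterOp_totalD_jetOf (hU : IsOpen U) (hf : IsSmoothOfOrder U k f) (hu : ContDiffOn ℝ ∞ u U)
    (I : Fin n → ℕ) :
    EqOn (fun y => iterOp totalD I f (jetOf u y)) (iterOp partialD I fun y => f (jetOf u y)) U :=
  (iterOp_rel (fun a b => (∃ k, IsSmoothOfOrder U k a) ∧ EqOn (fun y => a (jetOf u y)) b U)
    (fun i a b h => ⟨h.1.imp' (· + 1) fun k hk => hk.totalD hU i, fun y hy => by
      obtain ⟨⟨k, hk⟩, h2⟩ := h
      rw [totalD_jetOf hU hk hu i hy, partialD_congr hU h2 i hy]⟩) I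
    (⟨⟨k, hf⟩, fun _ _ => rfl⟩ : (∃ k, IsSmoothOfOrder U k f) ∧
      EqOn (fun y => f (jetOf u y)) (fun y => f (jetOf u y)) U)).2

theorem IsSmoothOfOrder.clm (hf : IsSmoothOfOrder U k f) (T : W →L[ℝ] W') :
    IsSmoothOfOrder U k fun z => T (f z) := by
  obtain ⟨G, hG, hfG⟩ := hf
  exact ⟨fun y => T (G y), T.contDiff.comp_contDiffOn hG, fun z hz => congrArg T (hfG z hz)⟩

theorem IsSmoothOfOrder.lineDeriv_clm (hU : IsOpen U) (hf : IsSmoothOfOrder U k f)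
    (T : W →L[ℝ] W') {z : JetCoord n m} (hz : z.1 ∈ U) (v : JetCoord n m) :
    lineDeriv ℝ (fun z => T (f z)) z v = T (lineDeriv ℝ f z v) := by
  obtain ⟨G, hG, hfG⟩ := hf
  have h := IsSmoothOfOrder.hasLineDerivAt hU hG hfG hz v
  rw [h.lineDeriv]
  exact (T.hasFDerivAt.comp_hasDerivAt (0 : ℝ) h).deriv

theorem iterOp_totalD_clm (hU : IsOpen U) (hf : IsSmoothOfOrder U k f) (T : W →L[ℝ] W')
    (I : Fin n → ℕ) {z : JetCoord n m} (hz : z.1 ∈ U) :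
    iterOp totalD I (fun z => T (f z)) z = T (iterOp totalD I f z) :=
  (iterOp_rel (fun (a : JetCoord n m → W') (b : JetCoord n m → W) =>
      (∃ k, IsSmoothOfOrder U k b) ∧ ∀ z, z.1 ∈ U → a z = T (b z))
    (fun i a b h => ⟨h.1.imp' (· + 1) fun k hk => hk.totalD hU i, fun z hz => by
      obtain ⟨⟨k, hk⟩, h2⟩ := h
      rw [totalD_congr hU h2 i hz]
      exact hk.lineDeriv_clm hU T hz _⟩) I
    (⟨⟨k, hf⟩, fun _ _ => rfl⟩ : (∃ k, IsSmoothOfOrder U k f) ∧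
      ∀ z, z.1 ∈ U → (fun z => T (f z)) z = T (f z))).2 z hz

theorem eulerOp_eq_sum (hU : IsOpen U) (hf : IsSmoothOfOrder U k f) (a : Fin m)
    {z : JetCoord n m} (hz : z.1 ∈ U) :
    eulerOp a f z
      = ∑ I ∈ idxLE n k, (-1 : ℝ) ^ (∑ i, I i) • iterOp totalD I (jetD I a f) z := by
  unfold eulerOp
  refine finsum_eq_sum_of_support_subset _ fun I hI => ?_
  by_contra hI'
  exact hI (by
    simp only [iterOp_totalD_zero hU I (fun z hz => jetD_eq_zero hU hf hI' a hz) z hz, smul_zero])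

theorem eulerOp_clm (hU : IsOpen U) (hf : IsSmoothOfOrder U k f) (T : W →L[ℝ] W') (a : Fin m)
    {z : JetCoord n m} (hz : z.1 ∈ U) :
    eulerOp a (fun z => T (f z)) z = T (eulerOp a f z) := by
  rw [eulerOp_eq_sum hU hf a hz, eulerOp_eq_sum hU (hf.clm T) a hz, map_sum]
  refine Finset.sum_congr rfl fun I _ => ?_
  rw [map_smul, ← iterOp_totalD_clm hU (hf.jetD hU I a) T I hz]
  congr 1
  exact iterOp_totalD_congr hU I (fun z hz => hf.lineDeriv_clm hU T hz _) z hz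

theorem jetD_congr (hU : IsOpen U) {f g : JetCoord n m → W} (h : ∀ z, z.1 ∈ U → f z = g z)
    (I : Fin n → ℕ) (a : Fin m) {z : JetCoord n m} (hz : z.1 ∈ U) : jetD I a f z = jetD I a g z := by
  unfold jetD lineDeriv
  congr 1
  funext t
  exact h _ (by simpa using hz)

theorem eulerOp_congr (hU : IsOpen U) {f g : JetCoord n m → W} (h : ∀ z, z.1 ∈ U → f z = g z)
    (a : Fin m) {z : JetCoord n m} (hz : z.1 ∈ U) : eulerOp a f z = eulerOp a g z := by
  unfold eulerOp
  refine finsum_congr fun I => ?_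
  rw [iterOp_totalD_congr hU I (fun z hz => jetD_congr hU h I a hz) z hz]

end JetOf

section Families

variable {n m : ℕ} {P W : Type*} [NormedAddCommGroup P] [NormedSpace ℝ P]
  [NormedAddCommGroup W] [NormedSpace ℝ W] {U : Set (𝔼 (Fin n))}

theorem contDiffOn_slice {u : P → 𝔼 (Fin n) → W}
    (hu : ContDiffOn ℝ ∞ (fun q : P × 𝔼 (Fin n) => u q.1 q.2) (univ ×ˢ U)) (a : P) :
    ContDiffOn ℝ ∞ (u a) U :=
  hu.comp (s := U) (f := fun y => (a, y)) (contDiffOn_const.prodMk contDiffOn_id)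
    fun _ hy => ⟨mem_univ _, hy⟩

theorem partialD_slice (hU : IsOpen U) {u : P → 𝔼 (Fin n) → W}
    (hu : ContDiffOn ℝ ∞ (fun q : P × 𝔼 (Fin n) => u q.1 q.2) (univ ×ˢ U)) (i : Fin n) :
    EqOn (fun q : P × 𝔼 (Fin n) => partialD i (u q.1) q.2)
      (fun q => fderiv ℝ (fun q : P × 𝔼 (Fin n) => u q.1 q.2) q (0, basisVec i)) (univ ×ˢ U) := by
  rintro ⟨a, y⟩ ⟨-, hy⟩
  have hd := hu.differentiableAt_of_isOpen (isOpen_univ.prod hU) (x := (a, y)) ⟨mem_univ _, hy⟩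
  show partialD i (u a) y = _
  have h1 : HasFDerivAt (fun y : 𝔼 (Fin n) => (a, y)) (ContinuousLinearMap.inr ℝ P _) y :=
    hasFDerivAt_prodMk_right a y
  have h2 := hd.hasFDerivAt.comp y h1
  rw [partialD_eq_fderiv i ((contDiffOn_slice hu a).differentiableAt_of_isOpen hU hy)]
  have h3 := h2.fderiv
  change fderiv ℝ (u a) y = _ at h3
  rw [h3]
  rfl

theorem contDiffOn_partialD_slice (hU : IsOpen U) {u : P → 𝔼 (Fin n) → W}
    (hu : ContDiffOn ℝ ∞ (fun q : P × 𝔼 (Fin n) => u q.1 q.2) (univ ×ˢ U)) (i : Fin n) :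
    ContDiffOn ℝ ∞ (fun q : P × 𝔼 (Fin n) => partialD i (u q.1) q.2) (univ ×ˢ U) :=
  (contDiffOn_fderiv_apply (isOpen_univ.prod hU) hu _).congr (partialD_slice hU hu i)

theorem contDiffOn_iterOp_slice (hU : IsOpen U) {u : P → 𝔼 (Fin n) → W}
    (hu : ContDiffOn ℝ ∞ (fun q : P × 𝔼 (Fin n) => u q.1 q.2) (univ ×ˢ U)) (I : Fin n → ℕ) :
    ContDiffOn ℝ ∞ (fun q : P × 𝔼 (Fin n) => iterOp partialD I (u q.1) q.2) (univ ×ˢ U) := by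
  have key := iterOp_rel (D := fun i (v : P → 𝔼 (Fin n) → W) a => partialD i (v a))
    (D' := fun i (v : P → 𝔼 (Fin n) → W) a => partialD i (v a))
    (fun v _ => ContDiffOn ℝ ∞ (fun q : P × 𝔼 (Fin n) => v q.1 q.2) (univ ×ˢ U))
    (fun i v _ hv => contDiffOn_partialD_slice hU hv i) I (a := u) (b := u) hu
  have h2 : ∀ a, iterOp (fun i (v : P → 𝔼 (Fin n) → W) a => partialD i (v a)) I u a
      = iterOp partialD I (u a) := fun a =>
    iterOp_rel (D := fun i (v : P → 𝔼 (Fin n) → W) a => partialD i (v a)) (D' := partialD)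
      (fun v w => v a = w) (fun i v w h => congrArg (partialD i) h) I rfl
  simpa only [h2] using key

theorem hasDerivAt_partialD (hU : IsOpen U) {u : ℝ → 𝔼 (Fin n) → W} {h : 𝔼 (Fin n) → W} {ε : ℝ}
    (hu : ContDiffOn ℝ ∞ (fun q : ℝ × 𝔼 (Fin n) => u q.1 q.2) (univ ×ˢ U))
    (hh : ∀ y ∈ U, HasDerivAt (fun ε => u ε y) (h y) ε) (i : Fin n) :
    ∀ y ∈ U, HasDerivAt (fun ε => partialD i (u ε) y) (partialD i h y) ε := by
  intro y hy
  have hΩ : IsOpen ((univ : Set ℝ) ×ˢ U) := isOpen_univ.prod hU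
  have curve : ∀ {v : ℝ × 𝔼 (Fin n) → W}, ContDiffOn ℝ ∞ v (univ ×ˢ U) → ∀ y ∈ U,
      HasDerivAt (fun ε => v (ε, y)) (fderiv ℝ v (ε, y) (1, 0)) ε := by
    intro v hv y hy
    have h1 : HasDerivAt (fun ε : ℝ => (ε, y)) (1, 0) ε :=
      (hasDerivAt_id ε).prodMk (hasDerivAt_const ε y)
    exact (hv.differentiableAt_of_isOpen hΩ (x := (ε, y)) ⟨mem_univ _, hy⟩).hasFDerivAt.comp_hasDerivAt
      ε h1
  have e1 : EqOn h (fun y => fderiv ℝ (fun q : ℝ × 𝔼 (Fin n) => u q.1 q.2) (ε, y) (1, 0)) U :=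
    fun y hy => (hh y hy).unique (curve hu y hy)
  have h1 := contDiffOn_fderiv_apply hΩ hu ((0 : ℝ), basisVec i)
  have h2 := contDiffOn_fderiv_apply hΩ hu ((1 : ℝ), (0 : 𝔼 (Fin n)))
  have e2 := partialD_slice hU (u := fun ε y =>
    fderiv ℝ (fun q : ℝ × 𝔼 (Fin n) => u q.1 q.2) (ε, y) (1, 0)) h2 i
    (show (ε, y) ∈ univ ×ˢ U from ⟨mem_univ _, hy⟩)
  simp only at e2
  rw [partialD_congr hU e1 i hy, e2, fderiv_fderiv_comm hΩ hu _ _ ⟨mem_univ _, hy⟩]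
  refine (curve h1 y hy).congr_of_eventuallyEq (Filter.Eventually.of_forall fun ε' => ?_)
  exact partialD_slice hU hu i (show (ε', y) ∈ univ ×ˢ U from ⟨mem_univ _, hy⟩)

theorem hasDerivAt_iterOp_partialD (hU : IsOpen U) {u : ℝ → 𝔼 (Fin n) → W} {h : 𝔼 (Fin n) → W}
    {ε : ℝ} (hu : ContDiffOn ℝ ∞ (fun q : ℝ × 𝔼 (Fin n) => u q.1 q.2) (univ ×ˢ U))
    (hh : ∀ y ∈ U, HasDerivAt (fun ε => u ε y) (h y) ε) (I : Fin n → ℕ) :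
    ∀ y ∈ U, HasDerivAt (fun ε => iterOp partialD I (u ε) y) (iterOp partialD I h y) ε := by
  have key := iterOp_rel (D := fun i (v : ℝ → 𝔼 (Fin n) → W) a => partialD i (v a))
    (D' := partialD)
    (fun v h => ContDiffOn ℝ ∞ (fun q : ℝ × 𝔼 (Fin n) => v q.1 q.2) (univ ×ˢ U) ∧
      ∀ y ∈ U, HasDerivAt (fun ε => v ε y) (h y) ε)
    (fun i v h hv => ⟨contDiffOn_partialD_slice hU hv.1 i, hasDerivAt_partialD hU hv.1 hv.2 i⟩) I
    (a := u) (b := h) ⟨hu, hh⟩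
  have h2 : ∀ a, iterOp (fun i (v : ℝ → 𝔼 (Fin n) → W) a => partialD i (v a)) I u a
      = iterOp partialD I (u a) := fun a =>
    iterOp_rel (D := fun i (v : ℝ → 𝔼 (Fin n) → W) a => partialD i (v a)) (D' := partialD)
      (fun v w => v a = w) (fun i v w h => congrArg (partialD i) h) I rfl
  simpa only [h2] using key.2

variable {k : ℕ}

/-- The first variation `∑ v^a_I ∂f/∂u^a_I`. -/
noncomputable def firstVar (k : ℕ) (f : JetCoord n m → W) (z : JetCoord n m)
    (v : (Fin n → ℕ) → Fin m → ℝ) : W :=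
  ∑ I ∈ idxLE n k, ∑ a, v I a • jetD I a f z

theorem hasDerivAt_comp_jetOf (hU : IsOpen U) {f : JetCoord n m → W} (hf : IsSmoothOfOrder U k f)
    {u : ℝ → 𝔼 (Fin n) → Fin m → ℝ} {h : 𝔼 (Fin n) → Fin m → ℝ} {ε : ℝ}
    (hu : ContDiffOn ℝ ∞ (fun q : ℝ × 𝔼 (Fin n) => u q.1 q.2) (univ ×ˢ U))
    (hh : ∀ y ∈ U, HasDerivAt (fun ε => u ε y) (h y) ε) :
    ∀ y ∈ U, HasDerivAt (fun ε => f (jetOf (u ε) y))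
      (firstVar k f (jetOf (u ε) y) (jetOf h y).2) ε := by
  intro y hy
  obtain ⟨G, hG, hfG⟩ := hf
  have hc : HasDerivAt (fun ε => (y, fun K : idxLE n k => iterOp partialD (K : Fin n → ℕ) (u ε) y))
      (0, fun K : idxLE n k => iterOp partialD (K : Fin n → ℕ) h y) ε :=
    (hasDerivAt_const ε y).prodMk
      (hasDerivAt_pi.2 fun K => hasDerivAt_iterOp_partialD hU hu hh _ y hy)
  have hGd : DifferentiableAt ℝ G
      (y, fun K : idxLE n k => iterOp partialD (K : Fin n → ℕ) (u ε) y) :=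
    hG.differentiableAt_of_isOpen (hU.prod isOpen_univ) ⟨hy, mem_univ _⟩
  have h1 := hGd.hasFDerivAt.comp_hasDerivAt ε hc
  have e : (fun ε => f (jetOf (u ε) y))
      = G ∘ fun ε => (y, fun K : idxLE n k => iterOp partialD (K : Fin n → ℕ) (u ε) y) :=
    funext fun ε => hfG (jetOf (u ε) y) hy
  rw [e]
  convert h1 using 1
  set z := jetOf (u ε) y with hz
  have e2 : ((0 : 𝔼 (Fin n)), fun K : idxLE n k => iterOp partialD (K : Fin n → ℕ) h y)
      = ∑ K : idxLE n k, ∑ a, (iterOp partialD (K : Fin n → ℕ) h y a) •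
        ((0 : 𝔼 (Fin n)), (fun K' : idxLE n k =>
          (Pi.single (K : Fin n → ℕ) (Pi.single a (1 : ℝ)) : (Fin n → ℕ) → Fin m → ℝ) K')) := by
    refine Prod.ext ?_ ?_
    · simp [Prod.fst_sum]
    · simp only [Prod.snd_sum, Prod.smul_mk]
      funext K b
      simp only [Finset.sum_apply, Pi.smul_apply]
      rw [Finset.sum_eq_single K]
      · simp [Pi.single_apply]
      · intro K' _ hK'
        have : (K : Fin n → ℕ) ≠ K' := fun h => hK' (Subtype.ext h.symm)
        simp [Pi.single_eq_of_ne this]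
      · simp
  rw [e2, map_sum, firstVar, ← Finset.sum_coe_sort]
  refine Finset.sum_congr rfl fun K _ => ?_
  rw [map_sum]
  refine Finset.sum_congr rfl fun a _ => ?_
  rw [map_smul, jetD, (IsSmoothOfOrder.hasLineDerivAt hU hG hfG (z := z) hy _).lineDeriv]
  rfl

end Families

section IntegrationByParts

variable {n m : ℕ} {U : Set (𝔼 (Fin n))} {k : ℕ}

theorem contDiff_mul_of_tsupport {V : Type*} [NormedAddCommGroup V] [NormedSpace ℝ V] {U : Set V}
    (hU : IsOpen U) {p g : V → ℝ} (hp : ContDiffOn ℝ ∞ p U) (hg : ContDiff ℝ ∞ g)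
    (hs : tsupport g ⊆ U) : ContDiff ℝ ∞ fun y => p y * g y := by
  rw [contDiff_iff_contDiffAt]
  intro y
  by_cases hy : y ∈ tsupport g
  · exact (hp.contDiffAt (hU.mem_nhds (hs hy))).mul hg.contDiffAt
  · refine (contDiffAt_const (c := (0 : ℝ))).congr_of_eventuallyEq ?_
    filter_upwards [notMem_tsupport_iff_eventuallyEq.1 hy] with y' hy'
    simp [hy']

theorem integrable_mul_of_tsupport (hU : IsOpen U) {p g : 𝔼 (Fin n) → ℝ}
    (hp : ContDiffOn ℝ ∞ p U) (hg : ContDiff ℝ ∞ g) (hc : HasCompactSupport g)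
    (hs : tsupport g ⊆ U) : Integrable fun y => p y * g y :=
  (contDiff_mul_of_tsupport hU hp hg hs).continuous.integrable_of_hasCompactSupport hc.mul_left

theorem contDiff_partialD {W : Type*} [NormedAddCommGroup W] [NormedSpace ℝ W]
    {g : 𝔼 (Fin n) → W} (hg : ContDiff ℝ ∞ g) (i : Fin n) :
    ContDiff ℝ ∞ (partialD i g) :=
  contDiffOn_univ.1 (contDiffOn_partialD isOpen_univ hg.contDiffOn i)

theorem contDiff_iterOp_partialD {W : Type*} [NormedAddCommGroup W] [NormedSpace ℝ W]
    {g : 𝔼 (Fin n) → W} (hg : ContDiff ℝ ∞ g) (I : Fin n → ℕ) :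
    ContDiff ℝ ∞ (iterOp partialD I g) :=
  contDiffOn_univ.1 (contDiffOn_iterOp_partialD isOpen_univ hg.contDiffOn I)

theorem tsupport_iterOp_partialD_subset {W : Type*} [NormedAddCommGroup W] [NormedSpace ℝ W]
    (g : 𝔼 (Fin n) → W) (I : Fin n → ℕ) :
    tsupport (iterOp partialD I g) ⊆ tsupport g := by
  refine closure_minimal (fun y hy => ?_) (isClosed_tsupport g)
  by_contra hc
  refine hy (iterOp_partialD_eq_zero (isClosed_tsupport g).isOpen_compl (fun y hy => ?_) I hc)
  exact image_eq_zero_of_notMem_tsupport hy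

theorem tsupport_partialD_subset {W : Type*} [NormedAddCommGroup W] [NormedSpace ℝ W]
    (g : 𝔼 (Fin n) → W) (i : Fin n) :
    tsupport (partialD i g) ⊆ tsupport g := by
  refine closure_minimal (fun y hy => ?_) (isClosed_tsupport g)
  by_contra hc
  refine hy ?_
  rw [partialD_congr_nhds (notMem_tsupport_iff_eventuallyEq.1 hc) i]
  show partialD i (fun _ => (0 : W)) y = 0
  simp [partialD, lineDeriv]

theorem integral_mul_partialD (hU : IsOpen U) {p g : 𝔼 (Fin n) → ℝ}
    (hp : ContDiffOn ℝ ∞ p U) (hg : ContDiff ℝ ∞ g) (hc : HasCompactSupport g)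
    (hs : tsupport g ⊆ U) (i : Fin n) :
    ∫ y, p y * partialD i g y = -∫ y, partialD i p y * g y := by
  have hgd : ∀ y, partialD i g y = fderiv ℝ g y (basisVec i) := fun y =>
    partialD_eq_fderiv i (hg.differentiable (by simp) y)
  have e1 : (fun y => partialD i p y * g y) = fun y => fderiv ℝ p y (basisVec i) * g y := by
    funext y
    by_cases hy : y ∈ U
    · rw [partialD_eqOn_fderiv hU hp i hy]
    · simp [image_eq_zero_of_notMem_tsupport fun h => hy (hs h)]
  rw [e1]
  simp only [hgd]
  refine integral_mul_fderiv_eq_neg_fderiv_mul_of_integrable ?_ ?_ ?_ ?_ ?_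
  · rw [← e1]
    exact integrable_mul_of_tsupport hU (contDiffOn_partialD hU hp i) hg hc hs
  · simp only [← hgd]
    exact integrable_mul_of_tsupport hU hp (contDiff_partialD hg i)
      (hc.of_isClosed_subset (isClosed_tsupport _) (tsupport_partialD_subset g i))
      ((tsupport_partialD_subset g i).trans hs)
  · exact integrable_mul_of_tsupport hU hp hg hc hs
  · exact fun y hy => hp.differentiableAt_of_isOpen hU (hs hy)
  · exact fun y _ => hg.differentiable (by simp) y

theorem integral_partialD_eq_zero {g : 𝔼 (Fin n) → ℝ} (hg : ContDiff ℝ ∞ g)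
    (hc : HasCompactSupport g) (i : Fin n) : ∫ y, partialD i g y = 0 := by
  have h := integral_mul_partialD isOpen_univ (contDiffOn_const (c := (1 : ℝ))) hg hc
    (subset_univ _) i
  have h0 : ∀ y, partialD i (fun _ : 𝔼 (Fin n) => (1 : ℝ)) y = 0 := fun y => by
    simp [partialD, lineDeriv]
  simpa [h0] using h

theorem integral_mul_iterOp_partialD (hU : IsOpen U) (I : Fin n → ℕ) :
    ∀ {p g : 𝔼 (Fin n) → ℝ}, ContDiffOn ℝ ∞ p U → ContDiff ℝ ∞ g → HasCompactSupport g →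
      tsupport g ⊆ U →
      ∫ y, p y * iterOp partialD I g y
        = (-1 : ℝ) ^ (∑ i, I i) * ∫ y, iterOp partialD I p y * g y := by
  induction I using multiIndex_induction with
  | h0 => intro p g _ _ _ _; simp [iterOp_zero]
  | h1 I i ih =>
    intro p g hp hg hc hs
    have e1 : (fun y => p y * iterOp partialD (I + Pi.single i 1) g y)
        = fun y => p y * partialD i (iterOp partialD I g) y := by
      funext y
      rw [iterOp_partialD_add_single isOpen_univ hg.contDiffOn I i (mem_univ y)]
    have hsub := tsupport_iterOp_partialD_subset g I
    rw [e1, integral_mul_partialD hU hp (contDiff_iterOp_partialD hg I)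
      (hc.of_isClosed_subset (isClosed_tsupport _) hsub) (hsub.trans hs),
      ih (contDiffOn_partialD hU hp i) hg hc hs, sum_add_single, pow_succ, mul_neg_one, neg_mul]
    congr 3
    funext y
    by_cases hy : y ∈ U
    · rw [iterOp_partialD_partialD hU hp I i hy, iterOp_partialD_add_single hU hp I i hy]
    · simp [image_eq_zero_of_notMem_tsupport fun h => hy (hs h)]

theorem iterOp_partialD_apply {W : Type*} [NormedAddCommGroup W] [NormedSpace ℝ W] {ι : Type*}
    [Fintype ι] (hU : IsOpen U) {h : 𝔼 (Fin n) → ι → W}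
    (hh : ContDiffOn ℝ ∞ h U) (I : Fin n → ℕ) (a : ι) {y : 𝔼 (Fin n)} (hy : y ∈ U) :
    iterOp partialD I h y a = iterOp partialD I (fun y => h y a) y :=
  (iterOp_partialD_clm (ContinuousLinearMap.proj (R := ℝ) (φ := fun _ : ι => W) a) hU hh I hy).symm

theorem integral_firstVar (hU : IsOpen U) {f : JetCoord n m → ℝ} (hf : IsSmoothOfOrder U k f)
    {u h : 𝔼 (Fin n) → Fin m → ℝ} (hu : ContDiffOn ℝ ∞ u U) (hh : ContDiff ℝ ∞ h)
    (hc : HasCompactSupport h) (hs : tsupport h ⊆ U) {c : 𝔼 (Fin n) → ℝ} (hcU : IsLocConstOn U c) :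
    ∫ y, c y * firstVar k f (jetOf u y) (jetOf h y).2
      = ∫ y, c y * ∑ a, h y a * eulerOp a f (jetOf u y) := by
  have hha : ∀ a, ContDiff ℝ ∞ fun y => h y a := fun a => contDiff_pi.1 hh a
  have hsa : ∀ a, tsupport (fun y => h y a) ⊆ tsupport h := fun a =>
    closure_mono fun y hy h0 => hy (by simp [h0])
  have hca : ∀ a, HasCompactSupport fun y => h y a := fun a =>
    hc.of_isClosed_subset (isClosed_tsupport _) (hsa a)
  have hp : ∀ I a, ContDiffOn ℝ ∞ (fun y => jetD I a f (jetOf u y)) U := fun I a =>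
    contDiffOn_comp_jetOf hU (hf.jetD hU I a) hu
  have hcp : ∀ I a, ContDiffOn ℝ ∞ (fun y => c y * jetD I a f (jetOf u y)) U := fun I a =>
    hcU.contDiffOn.mul (hp I a)
  have hI : ∀ I a, Integrable fun y =>
      c y * jetD I a f (jetOf u y) * iterOp partialD I (fun y => h y a) y := fun I a =>
    integrable_mul_of_tsupport hU (hcp I a) (contDiff_iterOp_partialD (hha a) I)
      ((hca a).of_isClosed_subset (isClosed_tsupport _) (tsupport_iterOp_partialD_subset _ I))
      ((tsupport_iterOp_partialD_subset _ I).trans ((hsa a).trans hs))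
  have hJ : ∀ I a, Integrable fun y =>
      iterOp partialD I (fun y => c y * jetD I a f (jetOf u y)) y * h y a := fun I a =>
    integrable_mul_of_tsupport hU (contDiffOn_iterOp_partialD hU (hcp I a) I) (hha a) (hca a)
      ((hsa a).trans hs)
  have e1 : (fun y => c y * firstVar k f (jetOf u y) (jetOf h y).2) = fun y =>
      ∑ I ∈ idxLE n k, ∑ a,
        c y * jetD I a f (jetOf u y) * iterOp partialD I (fun y => h y a) y := by
    funext y
    rw [firstVar, Finset.mul_sum]
    refine Finset.sum_congr rfl fun I _ => ?_
    rw [Finset.mul_sum]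
    refine Finset.sum_congr rfl fun a _ => ?_
    rw [← iterOp_partialD_apply isOpen_univ hh.contDiffOn I a (mem_univ y), smul_eq_mul, jetOf]
    ring
  have e2 : (fun y => c y * ∑ a, h y a * eulerOp a f (jetOf u y)) = fun y =>
      ∑ I ∈ idxLE n k, ∑ a, (-1 : ℝ) ^ (∑ i, I i) *
        (iterOp partialD I (fun y => c y * jetD I a f (jetOf u y)) y * h y a) := by
    funext y
    rw [Finset.sum_comm, Finset.mul_sum]
    refine Finset.sum_congr rfl fun a _ => ?_
    by_cases hy : y ∈ U
    · rw [eulerOp_eq_sum hU hf a (z := jetOf u y) hy, Finset.mul_sum, Finset.mul_sum]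
      refine Finset.sum_congr rfl fun I _ => ?_
      have h1 := iterOp_partialD_locConst hcU hU (hp I a) I hy
      simp only [smul_eq_mul] at h1
      have h2 := iterOp_totalD_jetOf hU (hf.jetD hU I a) hu I hy
      simp only at h2
      rw [h1, h2, smul_eq_mul]
      ring
    · have : h y = 0 := image_eq_zero_of_notMem_tsupport fun h => hy (hs h)
      simp [this]
  rw [e1, e2, integral_finsetSum _ fun I _ => integrable_finsetSum _ fun a _ => hI I a,
    integral_finsetSum _ fun I _ => integrable_finsetSum _ fun a _ => (hJ I a).const_mul _]
  refine Finset.sum_congr rfl fun I _ => ?_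
  rw [integral_finsetSum _ fun a _ => hI I a,
    integral_finsetSum _ fun a _ => (hJ I a).const_mul _]
  refine Finset.sum_congr rfl fun a _ => ?_
  rw [integral_mul_iterOp_partialD hU I (hcp I a) (hha a) (hca a) ((hsa a).trans hs),
    integral_const_mul]

end IntegrationByParts

section Agree

/-- The derivatives of `u` and `v` at `x` agree up to order `N`. -/
def AgreeTo {V W : Type*} [NormedAddCommGroup V] [NormedSpace ℝ V] [NormedAddCommGroup W]
    [NormedSpace ℝ W] (N : ℕ) (u v : V → W) (x : V) : Prop :=
  ∀ k ≤ N, iteratedFDeriv ℝ k u x = iteratedFDeriv ℝ k v x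

section

variable {V V' W W' : Type*} [NormedAddCommGroup V] [NormedSpace ℝ V] [NormedAddCommGroup V']
  [NormedSpace ℝ V'] [NormedAddCommGroup W] [NormedSpace ℝ W] [NormedAddCommGroup W']
  [NormedSpace ℝ W'] {N : ℕ} {u v : V → W} {x : V}

theorem AgreeTo.eq (h : AgreeTo N u v x) : u x = v x := by
  have := congrArg (fun T => T 0) (h 0 (Nat.zero_le N))
  simpa using this

theorem AgreeTo.congr {u' v' : V → W} (h : AgreeTo N u v x) (hu : u' =ᶠ[𝓝 x] u)
    (hv : v' =ᶠ[𝓝 x] v) : AgreeTo N u' v' x := fun k hk => by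
  rw [(hu.iteratedFDeriv ℝ k).eq_of_nhds, (hv.iteratedFDeriv ℝ k).eq_of_nhds, h k hk]

theorem taylorComp_congr {q q' : FormalMultilinearSeries ℝ W W'}
    {p p' : FormalMultilinearSeries ℝ V W} {k : ℕ} (hq : ∀ j ≤ k, q j = q' j)
    (hp : ∀ j ≤ k, p j = p' j) : q.taylorComp p k = q'.taylorComp p' k := by
  unfold FormalMultilinearSeries.taylorComp
  refine Finset.sum_congr rfl fun c _ => ?_
  unfold FormalMultilinearSeries.compAlongOrderedFinpartition
  rw [hq _ c.length_le]
  congr 1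
  funext r
  exact hp _ (c.partSize_le r)

theorem AgreeTo.comp_left (h : AgreeTo N u v x) {g : W → W'} (hg : ContDiffAt ℝ ∞ g (u x))
    (hu : ContDiffAt ℝ ∞ u x) (hv : ContDiffAt ℝ ∞ v x) : AgreeTo N (g ∘ u) (g ∘ v) x := by
  intro k hk
  rw [iteratedFDeriv_comp hg hu (mod_cast le_top),
    iteratedFDeriv_comp (h.eq ▸ hg) hv (mod_cast le_top), h.eq]
  exact taylorComp_congr (fun _ _ => rfl) fun j hj => h j (hj.trans hk)

theorem AgreeTo.comp_right {τ : V' → V} {x' : V'} (h : AgreeTo N u v (τ x'))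
    (hτ : ContDiffAt ℝ ∞ τ x') (hu : ContDiffAt ℝ ∞ u (τ x')) (hv : ContDiffAt ℝ ∞ v (τ x')) :
    AgreeTo N (u ∘ τ) (v ∘ τ) x' := by
  intro k hk
  rw [iteratedFDeriv_comp hu hτ (mod_cast le_top), iteratedFDeriv_comp hv hτ (mod_cast le_top)]
  exact taylorComp_congr (fun j hj => h j (hj.trans hk)) fun j hj => rfl

theorem AgreeTo.prodMk_left (h : AgreeTo N u v x) {g : V → W'} (hg : ContDiffAt ℝ ∞ g x)
    (hu : ContDiffAt ℝ ∞ u x) (hv : ContDiffAt ℝ ∞ v x) :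
    AgreeTo N (fun y => (g y, u y)) (fun y => (g y, v y)) x := by
  intro k hk
  rw [iteratedFDeriv_prodMk hg hu (mod_cast le_top), iteratedFDeriv_prodMk hg hv (mod_cast le_top),
    h k hk]

theorem AgreeTo.transform {τ : V → V} {x' : V} (h : AgreeTo N u v (τ x'))
    (hτ : ContDiffAt ℝ ∞ τ x') (hu : ContDiffAt ℝ ∞ u (τ x')) (hv : ContDiffAt ℝ ∞ v (τ x'))
    {F : V × W → W'} (hF : ContDiffAt ℝ ∞ F (x', u (τ x'))) :
    AgreeTo N (fun y => F (y, u (τ y))) (fun y => F (y, v (τ y))) x' :=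
  ((h.comp_right hτ hu hv).prodMk_left contDiffAt_id (hu.comp x' hτ) (hv.comp x' hτ)).comp_left
    (u := fun y => (y, u (τ y))) (v := fun y => (y, v (τ y))) hF
    (contDiffAt_id.prodMk (hu.comp x' hτ)) (contDiffAt_id.prodMk (hv.comp x' hτ))

end

variable {n : ℕ} {W : Type*} [NormedAddCommGroup W] [NormedSpace ℝ W] {U : Set (𝔼 (Fin n))}

theorem partialD_iteratedFDeriv (hU : IsOpen U) {f : 𝔼 (Fin n) → W} (hf : ContDiffOn ℝ ∞ f U)
    (k : ℕ) (v : Fin k → 𝔼 (Fin n)) (i : Fin n) {y : 𝔼 (Fin n)} (hy : y ∈ U) :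
    partialD i (fun y => iteratedFDeriv ℝ k f y v) y
      = iteratedFDeriv ℝ (k + 1) f y (Fin.cons (basisVec i) v) := by
  have hd : DifferentiableAt ℝ (iteratedFDeriv ℝ k f) y :=
    (hf.contDiffAt (hU.mem_nhds hy)).differentiableAt_iteratedFDeriv
      (mod_cast WithTop.coe_lt_coe.2 (WithTop.coe_lt_top k))
  rw [iteratedFDeriv_succ_apply_left, Fin.cons_zero, Fin.tail_cons]
  have h := partialD_clm (ContinuousMultilinearMap.apply ℝ (fun _ : Fin k => 𝔼 (Fin n)) W v) hd i
  rw [partialD_eq_fderiv i hd] at h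
  exact h

theorem exists_iterOp_eq_iteratedFDeriv (hU : IsOpen U) (I : Fin n → ℕ) :
    ∀ k, ∑ i, I i = k → ∃ v : Fin k → 𝔼 (Fin n), ∀ f : 𝔼 (Fin n) → W, ContDiffOn ℝ ∞ f U →
      EqOn (iterOp partialD I f) (fun y => iteratedFDeriv ℝ k f y v) U := by
  induction I using multiIndex_induction with
  | h0 =>
    rintro k hk
    obtain rfl : 0 = k := by simpa using hk
    exact ⟨0, fun f _ y _ => by simp [iterOp_zero]⟩
  | h1 I i ih =>
    rintro k hk
    obtain ⟨k, rfl⟩ : ∃ l, k = l + 1 := ⟨_, by rw [← hk, sum_add_single]⟩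
    rw [sum_add_single] at hk
    obtain ⟨v, hv⟩ := ih k (by omega)
    refine ⟨Fin.cons (basisVec i) v, fun f hf y hy => ?_⟩
    rw [iterOp_partialD_add_single hU hf I i hy, partialD_congr hU (hv f hf) i hy,
      partialD_iteratedFDeriv hU hf k v i hy]

theorem exists_iteratedFDeriv_eq_iterOp (hU : IsOpen U) (k : ℕ) (w : Fin k → Fin n) :
    ∃ I : Fin n → ℕ, ∑ i, I i = k ∧ ∀ f : 𝔼 (Fin n) → W, ContDiffOn ℝ ∞ f U →
      EqOn (fun y => iteratedFDeriv ℝ k f y fun r => basisVec (w r)) (iterOp partialD I f) U := by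
  induction k with
  | zero => exact ⟨0, by simp, fun f _ y _ => by simp [iterOp_zero]⟩
  | succ k ih =>
    obtain ⟨I, hI, h⟩ := ih (Fin.tail w)
    refine ⟨I + Pi.single (w 0) 1, by rw [sum_add_single, hI], fun f hf y hy => ?_⟩
    rw [iterOp_partialD_add_single hU hf I _ hy, ← partialD_congr hU (h f hf) (w 0) hy,
      partialD_iteratedFDeriv hU hf k _ _ hy]
    congr 1

theorem agreeTo_iff (hU : IsOpen U) {u v : 𝔼 (Fin n) → W} (hu : ContDiffOn ℝ ∞ u U)
    (hv : ContDiffOn ℝ ∞ v U) {x : 𝔼 (Fin n)} (hx : x ∈ U) (N : ℕ) :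
    AgreeTo N u v x ↔ ∀ I : Fin n → ℕ, ∑ i, I i ≤ N → iterOp partialD I u x = iterOp partialD I v x := by
  constructor
  · intro h I hI
    obtain ⟨w, hw⟩ := exists_iterOp_eq_iteratedFDeriv (W := W) hU I _ rfl
    rw [hw u hu hx, hw v hv hx]
    simp only
    rw [h _ hI]
  · intro h k hk
    apply ContinuousMultilinearMap.toMultilinearMap_injective
    refine Module.Basis.ext_multilinear (fun _ => (EuclideanSpace.basisFun (Fin n) ℝ).toBasis) fun w => ?_
    obtain ⟨I, hI, hw⟩ := exists_iteratedFDeriv_eq_iterOp (W := W) hU k w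
    have h1 := hw u hu hx
    have h2 := hw v hv hx
    simp only [basisVec] at h1 h2
    simp only [OrthonormalBasis.coe_toBasis, EuclideanSpace.basisFun_apply,
      ContinuousMultilinearMap.coe_coe]
    rw [h1, h2, h I (hI.le.trans hk)]

end Agree

section Taylor

variable {n m : ℕ}

/-- The monomial `(y - x)^K / K!`. -/
noncomputable def monomial (x : 𝔼 (Fin n)) (K : Fin n → ℕ) (y : 𝔼 (Fin n)) : ℝ :=
  ∏ i, (y i - x i) ^ K i / (K i).factorial

theorem contDiff_monomial (x : 𝔼 (Fin n)) (K : Fin n → ℕ) : ContDiff ℝ ∞ (monomial x K) := by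
  unfold monomial
  fun_prop

theorem partialD_monomial (x : 𝔼 (Fin n)) (K : Fin n → ℕ) (i : Fin n) (y : 𝔼 (Fin n)) :
    partialD i (monomial x K) y
      = if K i = 0 then 0 else monomial x (K - Pi.single i 1) y := by
  have e : ∀ t : ℝ, monomial x K (y + t • basisVec i) = (y i + t - x i) ^ K i / (K i).factorial *
      ∏ j ∈ Finset.univ.erase i, (y j - x j) ^ K j / (K j).factorial := by
    intro t
    rw [monomial, ← Finset.mul_prod_erase _ _ (Finset.mem_univ i)]
    congr 1
    · simp [basisVec]
    · refine Finset.prod_congr rfl fun j hj => ?_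
      simp [basisVec, Finset.ne_of_mem_erase hj]
  have hd : HasDerivAt (fun t : ℝ => monomial x K (y + t • basisVec i))
      (K i * (y i + 0 - x i) ^ (K i - 1) / (K i).factorial *
        ∏ j ∈ Finset.univ.erase i, (y j - x j) ^ K j / (K j).factorial) 0 := by
    simp only [e]
    have h1 : HasDerivAt (fun t : ℝ => y i + t - x i) 1 0 :=
      ((hasDerivAt_id (0 : ℝ)).const_add (y i)).sub_const (x i)
    have h2 := ((h1.pow (K i)).div_const ((K i).factorial : ℝ)).mul_const
      (∏ j ∈ Finset.univ.erase i, (y j - x j) ^ K j / (K j).factorial)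
    simpa using h2
  rw [partialD, lineDeriv, hd.deriv]
  split_ifs with h
  · simp [h]
  · rw [monomial, ← Finset.mul_prod_erase _ _ (Finset.mem_univ i)]
    congr 1
    · obtain ⟨N, hN⟩ := Nat.exists_eq_succ_of_ne_zero h
      simp only [Pi.sub_apply, Pi.single_eq_same, hN, Nat.succ_eq_add_one, Nat.add_sub_cancel,
        Nat.factorial_succ, add_zero]
      push_cast
      field_simp
    · refine Finset.prod_congr rfl fun j hj => ?_
      simp [Finset.ne_of_mem_erase hj]

open Classical in
theorem iterOp_partialD_monomial (x : 𝔼 (Fin n)) (K I : Fin n → ℕ) :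
    iterOp partialD I (monomial x K) = if I ≤ K then monomial x (K - I) else 0 := by
  induction I using multiIndex_induction with
  | h0 => simp [iterOp_zero]
  | h1 I i ih =>
    funext y
    rw [iterOp_partialD_add_single isOpen_univ (contDiff_monomial x K).contDiffOn I i (mem_univ y),
      ih]
    by_cases hI : I ≤ K
    · rw [if_pos hI, partialD_monomial]
      by_cases hi : K i - I i = 0
      · have : ¬ I + Pi.single i 1 ≤ K := fun h => by
          have := h i
          simp at this
          omega
        simp [hi, this]
      · have : I + Pi.single i 1 ≤ K := fun j => by
          by_cases hj : j = i
          · subst hj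
            simp
            omega
          · simpa [hj] using hI j
        rw [if_neg (by simpa using hi), if_pos this, tsub_tsub]
    · have : ¬ I + Pi.single i 1 ≤ K := fun h => hI ((le_add_of_nonneg_right (by simp)).trans h)
      rw [if_neg hI, if_neg this]
      show partialD i (fun _ => (0 : ℝ)) y = 0
      simp [partialD, lineDeriv]

theorem monomial_self (x : 𝔼 (Fin n)) (K : Fin n → ℕ) : monomial x K x = if K = 0 then 1 else 0 := by
  split_ifs with h
  · simp [h, monomial]
  · obtain ⟨i, hi⟩ := Function.ne_iff.1 h
    exact Finset.prod_eq_zero (Finset.mem_univ i) (by simp [show K i ≠ 0 from hi])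

theorem contDiff_taylorPoly (z : JetCoord n m) (N : ℕ) : ContDiff ℝ ∞ (taylorPoly z N) := by
  unfold taylorPoly
  fun_prop

theorem iterOp_partialD_taylorPoly (z : JetCoord n m) (N : ℕ) (I : Fin n → ℕ)
    (hI : ∑ i, I i ≤ N) : iterOp partialD I (taylorPoly z N) z.1 = z.2 I := by
  have hsm : ∀ K : Fin n → ℕ, ContDiffOn ℝ ∞ (fun y => monomial z.1 K y • z.2 K) univ := fun K =>
    ((contDiff_monomial z.1 K).smul contDiff_const).contDiffOn
  have h1 := iterOp_partialD_sum (idxLE n N) (F := fun K y => monomial z.1 K y • z.2 K) isOpen_univ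
    (fun K _ => hsm K) I (mem_univ z.1)
  have h2 : ∀ K, iterOp partialD I (fun y => monomial z.1 K y • z.2 K) z.1
      = if K = I then z.2 K else 0 := by
    intro K
    have h3 := iterOp_partialD_clm ((ContinuousLinearMap.id ℝ ℝ).smulRight (z.2 K)) isOpen_univ
      (contDiff_monomial z.1 K).contDiffOn I (mem_univ z.1)
    simp only [ContinuousLinearMap.smulRight_apply, ContinuousLinearMap.id_apply] at h3
    rw [h3, iterOp_partialD_monomial]
    by_cases hIK : I ≤ K
    · rw [if_pos hIK, monomial_self]
      by_cases hK : K = I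
      · simp [hK]
      · have : K - I ≠ 0 := fun h => hK (le_antisymm (tsub_eq_zero_iff_le.1 h) hIK)
        simp [hK, this]
    · have : K ≠ I := fun h => hIK h.ge
      simp [hIK, this]
  show iterOp partialD I (fun y => ∑ K ∈ idxLE n N, monomial z.1 K y • z.2 K) z.1 = _
  rw [h1]
  simp only [h2]
  rw [Finset.sum_ite_eq' (idxLE n N) I, if_pos (mem_idxLE.2 hI)]

end Taylor

section Sections
set_option linter.unusedSectionVars false

variable {n m : ℕ} {M : Type*} [TopologicalSpace M] [ChartedSpace (EuclideanSpace ℝ (Fin n)) M]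
  [IsManifold (𝓡 n) ∞ M]
  {E : M → Type*} [∀ p, AddCommGroup (E p)] [∀ p, Module ℝ (E p)] [∀ p, TopologicalSpace (E p)]
  [TopologicalSpace (TotalSpace (Fin m → ℝ) E)] [FiberBundle (Fin m → ℝ) E]
  [VectorBundle ℝ (Fin m → ℝ) E] [ContMDiffVectorBundle ∞ (Fin m → ℝ) E (𝓡 n)]

local notation "ch" => chartAt (EuclideanSpace ℝ (Fin n))
local notation "tr" => trivializationAt (Fin m → ℝ) E

/-- `s` is smooth at `r`. -/
abbrev SmoothSecAt (n m : ℕ) {M : Type*} [TopologicalSpace M]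
    [ChartedSpace (EuclideanSpace ℝ (Fin n)) M] {E : M → Type*}
    [∀ p, TopologicalSpace (E p)] [TopologicalSpace (TotalSpace (Fin m → ℝ) E)]
    [FiberBundle (Fin m → ℝ) E] (s : ∀ q, E q) (r : M) : Prop :=
  ContMDiffAt (𝓡 n) ((𝓡 n).prod 𝓘(ℝ, Fin m → ℝ)) ∞ (fun q => TotalSpace.mk' (Fin m → ℝ) q (s q)) r

/-- The fibre-preserving map `a` is smooth. -/
abbrev SmoothFibreMap (n m : ℕ) {M : Type*} [TopologicalSpace M]
    [ChartedSpace (EuclideanSpace ℝ (Fin n)) M] {E : M → Type*}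
    [∀ p, TopologicalSpace (E p)] [TopologicalSpace (TotalSpace (Fin m → ℝ) E)]
    [FiberBundle (Fin m → ℝ) E] (a : ∀ q, E q → E q) : Prop :=
  ContMDiff ((𝓡 n).prod 𝓘(ℝ, Fin m → ℝ)) ((𝓡 n).prod 𝓘(ℝ, Fin m → ℝ)) ∞
    (fun v : TotalSpace (Fin m → ℝ) E => TotalSpace.mk' (Fin m → ℝ) v.1 (a v.1 v.2))

theorem smoothFibreMap_id : SmoothFibreMap n m (E := E) fun _ v => v := contMDiff_id

theorem contMDiffAt_chart_symm {p : M} {y : 𝔼 (Fin n)} (hy : y ∈ (ch p).target) :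
    ContMDiffAt (𝓡 n) (𝓡 n) ∞ (ch p).symm y :=
  (contMDiffOn_chart_symm (I := 𝓡 n) (x := p)).contMDiffAt ((ch p).open_target.mem_nhds hy)

theorem contMDiffAt_chart {p r : M} (hr : r ∈ (ch p).source) :
    ContMDiffAt (𝓡 n) (𝓡 n) ∞ (ch p) r :=
  (contMDiffOn_chart (I := 𝓡 n) (x := p)).contMDiffAt ((ch p).open_source.mem_nhds hr)

theorem contDiffAt_transition {p q : M} {y : 𝔼 (Fin n)} (hy : y ∈ (ch q).target)
    (hp : (ch q).symm y ∈ (ch p).source) : ContDiffAt ℝ ∞ (ch p ∘ (ch q).symm) y :=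
  contMDiffAt_iff_contDiffAt.1 ((contMDiffAt_chart hp).comp y (contMDiffAt_chart_symm hy))

theorem contDiffAt_localExpr {s : ∀ q, E q} {p : M} {y : 𝔼 (Fin n)} (hy : y ∈ chartDom n m E p)
    (hs : SmoothSecAt n m s ((ch p).symm y)) : ContDiffAt ℝ ∞ (localExpr n m p s) y := by
  have h1 := ((tr p).contMDiffAt_section_iff (IB := 𝓡 n) hy.2).1 hs
  exact contMDiffAt_iff_contDiffAt.1 (h1.comp y (contMDiffAt_chart_symm hy.1))

/-- The domain of the chart at `p`, over the set `O`. -/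
def domOn (n m : ℕ) {M : Type*} [TopologicalSpace M]
    [ChartedSpace (EuclideanSpace ℝ (Fin n)) M] (E : M → Type*) [∀ p, TopologicalSpace (E p)]
    [TopologicalSpace (TotalSpace (Fin m → ℝ) E)] [FiberBundle (Fin m → ℝ) E]
    (p : M) (O : Set M) : Set (𝔼 (Fin n)) :=
  chartDom n m E p ∩ ((chartAt (𝔼 (Fin n)) p).target ∩ (chartAt (𝔼 (Fin n)) p).symm ⁻¹' O)

theorem isOpen_domOn (p : M) {O : Set M} (hO : IsOpen O) : IsOpen (domOn n m E p O) :=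
  (isOpen_chartDom p).inter ((ch p).isOpen_inter_preimage_symm hO)

theorem contDiffOn_localExpr {s : ∀ q, E q} {p : M} {O : Set M}
    (hs : ∀ r ∈ O, SmoothSecAt n m s r) : ContDiffOn ℝ ∞ (localExpr n m p s) (domOn n m E p O) :=
  fun _ hy => (contDiffAt_localExpr hy.1 (hs _ hy.2.2)).contDiffWithinAt

theorem contDiffOn_localExpr_univ {s : ∀ q, E q} (p : M) (hs : ∀ r, SmoothSecAt n m s r) :
    ContDiffOn ℝ ∞ (localExpr n m p s) (chartDom n m E p) :=
  fun _ hy => (contDiffAt_localExpr hy (hs _)).contDiffWithinAt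

theorem chart_mem_chartDom {p r : M} (h1 : r ∈ (ch p).source) (h2 : r ∈ (tr p).baseSet) :
    ch p r ∈ chartDom n m E p :=
  ⟨(ch p).map_source h1, by rwa [mem_preimage, (ch p).left_inv h1]⟩

/-- The expression of the fibre-preserving map `a`, from the trivialization at `p` to the one at
`q`, in the chart at `q`. -/
noncomputable def fibreExpr (n m : ℕ) {M : Type*} [TopologicalSpace M]
    [ChartedSpace (EuclideanSpace ℝ (Fin n)) M] {E : M → Type*} [∀ p, AddCommGroup (E p)]
    [∀ p, TopologicalSpace (E p)] [TopologicalSpace (TotalSpace (Fin m → ℝ) E)]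
    [FiberBundle (Fin m → ℝ) E] (p q : M) (a : ∀ q, E q → E q) :
    𝔼 (Fin n) × (Fin m → ℝ) → Fin m → ℝ := fun w =>
  (trivializationAt (Fin m → ℝ) E q ⟨(chartAt (𝔼 (Fin n)) q).symm w.1, a _
    ((trivializationAt (Fin m → ℝ) E p).symm ((chartAt (𝔼 (Fin n)) q).symm w.1) w.2)⟩).2

theorem contMDiffAt_fibrePoint {V : Type*} [NormedAddCommGroup V] [NormedSpace ℝ V] {p : M}
    {a : ∀ q, E q → E q} (ha : SmoothFibreMap n m a) {b : V → M} {v : V → Fin m → ℝ} {w : V}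
    (hb : ContMDiffAt 𝓘(ℝ, V) (𝓡 n) ∞ b w) (hv : ContDiffAt ℝ ∞ v w)
    (hp : b w ∈ (tr p).baseSet) :
    ContMDiffAt 𝓘(ℝ, V) ((𝓡 n).prod 𝓘(ℝ, Fin m → ℝ)) ∞
      (fun w => TotalSpace.mk' (Fin m → ℝ) (b w) (a _ ((tr p).symm (b w) (v w)))) w := by
  have h1 : ContMDiffAt 𝓘(ℝ, V) ((𝓡 n).prod 𝓘(ℝ, Fin m → ℝ)) ∞ (fun w => (b w, v w)) w :=
    hb.prodMk hv.contMDiffAt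
  have ht : (b w, v w) ∈ (tr p).target := by rw [(tr p).mem_target]; exact hp
  have h2 := ((tr p).contMDiffOn_symm (IB := 𝓡 n) (n := ∞)).contMDiffAt
    ((tr p).open_target.mem_nhds ht)
  have h3 := (ha _).comp w (h2.comp w h1)
  refine h3.congr_of_eventuallyEq ?_
  have : ∀ᶠ w' in 𝓝 w, b w' ∈ (tr p).baseSet :=
    hb.continuousAt.eventually_mem ((tr p).open_baseSet.mem_nhds hp)
  filter_upwards [this] with w' hw'
  simp only [Function.comp_apply]
  rw [← (tr p).mk_symm hw']

theorem contDiffAt_fibreExpr {a : ∀ q, E q → E q} (ha : SmoothFibreMap n m a) {p q : M}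
    {w : 𝔼 (Fin n) × (Fin m → ℝ)} (hq : w.1 ∈ chartDom n m E q)
    (hp : (ch q).symm w.1 ∈ (tr p).baseSet) : ContDiffAt ℝ ∞ (fibreExpr n m p q a) w := by
  have hb : ContMDiffAt 𝓘(ℝ, 𝔼 (Fin n) × (Fin m → ℝ)) (𝓡 n) ∞
      (fun w : 𝔼 (Fin n) × (Fin m → ℝ) => (ch q).symm w.1) w :=
    (contMDiffAt_chart_symm hq.1).comp w contDiffAt_fst.contMDiffAt
  have h := contMDiffAt_fibrePoint (p := p) ha hb contDiffAt_snd hp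
  have h2 := ((tr q).contMDiffAt_iff (IB := 𝓡 n) (by rw [(tr q).mem_source]; exact hq.2)).1 h
  exact contMDiffAt_iff_contDiffAt.1 h2.2

theorem localExpr_fibreMap {s : ∀ q, E q} (a : ∀ q, E q → E q) (p q : M) {y : 𝔼 (Fin n)}
    (hp : (ch q).symm y ∈ (ch p).source) (hp' : (ch q).symm y ∈ (tr p).baseSet) :
    localExpr n m q (fun r => a r (s r)) y
      = fibreExpr n m p q a (y, localExpr n m p s ((ch p ∘ (ch q).symm) y)) := by
  simp only [localExpr, fibreExpr, Function.comp_apply]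
  rw [(ch p).left_inv hp, (tr p).symm_apply_apply_mk hp']

theorem localExpr_polySection (p : M) (z : JetCoord n m) (N : ℕ) {y : 𝔼 (Fin n)}
    (hy : y ∈ chartDom n m E p) : localExpr n m p (polySection E p z N) y = taylorPoly z N y := by
  simp only [localExpr, polySection]
  rw [(tr p).apply_mk_symm hy.2, (ch p).right_inv hy.1]

theorem smoothSecAt_polySection (p : M) (z : JetCoord n m) (N : ℕ) {r : M}
    (h1 : r ∈ (ch p).source) (h2 : r ∈ (tr p).baseSet) :
    SmoothSecAt n m (polySection E p z N) r := by
  refine ((tr p).contMDiffAt_section_iff (IB := 𝓡 n) h2).2 ?_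
  have h3 : ContMDiffAt (𝓡 n) 𝓘(ℝ, Fin m → ℝ) ∞ (fun r => taylorPoly z N (ch p r)) r :=
    (contDiff_taylorPoly z N).contDiffAt.contMDiffAt.comp r (contMDiffAt_chart h1)
  refine h3.congr_of_eventuallyEq ?_
  filter_upwards [(tr p).open_baseSet.mem_nhds h2] with r' hr'
  exact congrArg Prod.snd ((tr p).apply_mk_symm hr' _)

/-- The domain in `M` of the coordinates at `p`. -/
def coordDom (n m : ℕ) {M : Type*} [TopologicalSpace M]
    [ChartedSpace (EuclideanSpace ℝ (Fin n)) M] (E : M → Type*) [∀ p, TopologicalSpace (E p)]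
    [TopologicalSpace (TotalSpace (Fin m → ℝ) E)] [FiberBundle (Fin m → ℝ) E] (p : M) : Set M :=
  (chartAt (𝔼 (Fin n)) p).source ∩ (trivializationAt (Fin m → ℝ) E p).baseSet

theorem isOpen_coordDom (p : M) : IsOpen (coordDom n m E p) :=
  (ch p).open_source.inter (tr p).open_baseSet

theorem mem_coordDom_self (p : M) : p ∈ coordDom n m E p :=
  ⟨mem_chart_source _ p, FiberBundle.mem_baseSet_trivializationAt' p⟩

theorem symm_mem_coordDom {p : M} {y : 𝔼 (Fin n)} (hy : y ∈ chartDom n m E p) :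
    (ch p).symm y ∈ coordDom n m E p :=
  ⟨(ch p).map_target hy.1, hy.2⟩

theorem jets_agree_transform {a : ∀ q, E q → E q} (ha : SmoothFibreMap n m a) {p q r : M}
    (hp : r ∈ coordDom n m E p) (hq : r ∈ coordDom n m E q) {s s' : ∀ q, E q} {O : Set M}
    (hO : IsOpen O) (hr : r ∈ O) (hs : ∀ r ∈ O, SmoothSecAt n m s r)
    (hs' : ∀ r ∈ O, SmoothSecAt n m s' r) {N : ℕ}
    (h : ∀ I : Fin n → ℕ, ∑ i, I i ≤ N →
      iterOp partialD I (localExpr n m p s) (ch p r) = iterOp partialD I (localExpr n m p s') (ch p r)) :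
    ∀ I : Fin n → ℕ, ∑ i, I i ≤ N →
      iterOp partialD I (localExpr n m q fun r => a r (s r)) (ch q r)
        = iterOp partialD I (localExpr n m q fun r => a r (s' r)) (ch q r) := by
  set O' := O ∩ coordDom n m E p
  have hO' : IsOpen O' := hO.inter (isOpen_coordDom p)
  have hyp : ch p r ∈ domOn n m E p O :=
    ⟨chart_mem_chartDom hp.1 hp.2, (ch p).map_source hp.1, by rwa [mem_preimage, (ch p).left_inv hp.1]⟩
  have hyq : ch q r ∈ domOn n m E q O' :=
    ⟨chart_mem_chartDom hq.1 hq.2, (ch q).map_source hq.1, by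
      rw [mem_preimage, (ch q).left_inv hq.1]; exact ⟨hr, hp⟩⟩
  have hag := (agreeTo_iff (isOpen_domOn p hO) (contDiffOn_localExpr hs) (contDiffOn_localExpr hs')
    hyp N).2 h
  have hτ : (ch p ∘ (ch q).symm) (ch q r) = ch p r :=
    congrArg (ch p) ((ch q).left_inv hq.1)
  have hsm : ∀ {s : ∀ q, E q}, (∀ r ∈ O, SmoothSecAt n m s r) →
      ContDiffOn ℝ ∞ (localExpr n m q fun r => a r (s r)) (domOn n m E q O') ∧
      EqOn (localExpr n m q fun r => a r (s r))
        (fun y => fibreExpr n m p q a (y, localExpr n m p s ((ch p ∘ (ch q).symm) y)))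
        (domOn n m E q O') := by
    intro s hs
    have heq : EqOn (localExpr n m q fun r => a r (s r))
        (fun y => fibreExpr n m p q a (y, localExpr n m p s ((ch p ∘ (ch q).symm) y)))
        (domOn n m E q O') := fun y hy => localExpr_fibreMap a p q hy.2.2.2.1 hy.2.2.2.2
    refine ⟨ContDiffOn.congr (fun y hy => ContDiffAt.contDiffWithinAt ?_) heq, heq⟩
    have h1 := contDiffAt_transition hy.2.1 hy.2.2.2.1
    have h2 : ContDiffAt ℝ ∞ (localExpr n m p s) ((ch p ∘ (ch q).symm) y) :=
      contDiffAt_localExpr (chart_mem_chartDom hy.2.2.2.1 hy.2.2.2.2) (by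
        simp only [Function.comp_apply]
        rw [(ch p).left_inv hy.2.2.2.1]
        exact hs _ hy.2.2.1)
    exact ContDiffAt.comp (g := fibreExpr n m p q a)
      (f := fun y => (y, localExpr n m p s ((ch p ∘ (ch q).symm) y))) y
      (contDiffAt_fibreExpr ha hy.1 hy.2.2.2.2) (contDiffAt_id.prodMk (h2.comp y h1))
  refine (agreeTo_iff (isOpen_domOn q hO') (hsm hs).1 (hsm hs').1 hyq N).1 ?_
  have hnhds := (isOpen_domOn q hO').mem_nhds hyq
  refine AgreeTo.congr ?_ ((hsm hs).2.eventuallyEq_of_mem hnhds)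
    ((hsm hs').2.eventuallyEq_of_mem hnhds)
  rw [← hτ] at hag
  have hc : ∀ {s : ∀ q, E q}, (∀ r ∈ O, SmoothSecAt n m s r) →
      ContDiffAt ℝ ∞ (localExpr n m p s) ((ch p ∘ (ch q).symm) (ch q r)) := fun hs => by
    rw [hτ]
    exact (contDiffOn_localExpr hs).contDiffAt ((isOpen_domOn p hO).mem_nhds hyp)
  exact hag.transform (contDiffAt_transition hyq.2.1 hyq.2.2.2.1) (hc hs) (hc hs')
    (contDiffAt_fibreExpr ha (w := (_, _)) hyq.1 hyq.2.2.2.2)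

theorem jet_coeff (s : ∀ q, E q) (p : M) (I : Fin n → ℕ) :
    (jet n m s p).coeff I = iterOp partialD I (localExpr n m p s) (ch p p) := rfl

/-- `s` has the jet coordinates `z` up to order `N` in the chart at `p`. -/
def HasCoords (p : M) (s : ∀ q, E q) (N : ℕ) (z : JetCoord n m) : Prop :=
  ∀ I : Fin n → ℕ, ∑ i, I i ≤ N → iterOp partialD I (localExpr n m p s) z.1 = z.2 I

theorem hasCoords_jetOf (p : M) (s : ∀ q, E q) (N : ℕ) (y : 𝔼 (Fin n)) :
    HasCoords p s N (jetOf (localExpr n m p s) y) := fun _ _ => rfl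

theorem hasCoords_polySection {p : M} {z : JetCoord n m} (hz : z.1 ∈ chartDom n m E p) (N : ℕ) :
    HasCoords p (polySection E p z N) N z := fun I hI => by
  rw [iterOp_partialD_congr (isOpen_chartDom p)
    (fun y hy => localExpr_polySection p z N hy) I hz, iterOp_partialD_taylorPoly z N I hI]

/-- Coordinates at `q` of the image of the jet with coordinates `z` at `p`. -/
theorem HasCoords.polySection_transform {a : ∀ q, E q → E q} (ha : SmoothFibreMap n m a) {p q : M}
    {z : JetCoord n m} (hz : z.1 ∈ chartDom n m E p) (hq : (ch p).symm z.1 ∈ coordDom n m E q)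
    {s : ∀ q, E q} {O : Set M} (hO : IsOpen O) (hr : (ch p).symm z.1 ∈ O)
    (hs : ∀ r ∈ O, SmoothSecAt n m s r) {N : ℕ} (h : HasCoords p s N z)
    (I : Fin n → ℕ) (hI : ∑ i, I i ≤ N) :
    iterOp partialD I (localExpr n m q fun r => a r (polySection E p z (∑ i, I i) r))
        (ch q ((ch p).symm z.1))
      = iterOp partialD I (localExpr n m q fun r => a r (s r)) (ch q ((ch p).symm z.1)) := by
  refine jets_agree_transform ha (p := p) (symm_mem_coordDom hz) hq (hO.inter (isOpen_coordDom p))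
    ⟨hr, symm_mem_coordDom hz⟩ (fun r hr => smoothSecAt_polySection p z _ hr.2.1 hr.2.2)
    (fun r hr => hs r hr.1) (N := ∑ i, I i) (fun J hJ => ?_) I le_rfl
  rw [(ch p).right_inv hz.1, hasCoords_polySection hz _ J hJ, h J (hJ.trans hI)]

theorem ofCoord_coeff {p : M} {z : JetCoord n m} (hz : z.1 ∈ chartDom n m E p) {s : ∀ q, E q}
    {O : Set M} (hO : IsOpen O) (hr : (ch p).symm z.1 ∈ O) (hs : ∀ r ∈ O, SmoothSecAt n m s r)
    {N : ℕ} (h : HasCoords p s N z) (I : Fin n → ℕ) (hI : ∑ i, I i ≤ N) :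
    (ofCoord E p z).coeff I = (jet n m s ((ch p).symm z.1)).coeff I :=
  h.polySection_transform smoothFibreMap_id hz (mem_coordDom_self _) hO hr hs I hI

theorem JetInf.symm_coord (j : JetInf n m E) : (ch j.pt).symm j.coord.1 = j.pt :=
  (ch j.pt).left_inv (mem_chart_source _ _)

theorem ofCoord_coord (j : JetInf n m E) : ofCoord E j.pt j.coord = j := by
  refine JetInf.ext j.symm_coord (funext fun I => ?_)
  have h := hasCoords_polySection (E := E) j.coord_mem (∑ i, I i)
  rw [ofCoord_coeff j.coord_mem (isOpen_coordDom j.pt) (symm_mem_coordDom j.coord_mem)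
    (fun r hr => smoothSecAt_polySection j.pt j.coord (∑ i, I i) hr.1 hr.2) h I le_rfl]
  rw [j.symm_coord]
  exact h I le_rfl

theorem FibreAction.prolong_coeff {G : Type*} [Group G] (A : FibreAction n m G E) (g : G)
    (j : JetInf n m E) {s : ∀ q, E q} {O : Set M} (hO : IsOpen O) (hr : j.pt ∈ O)
    (hs : ∀ r ∈ O, SmoothSecAt n m s r) {N : ℕ} (h : HasCoords j.pt s N j.coord)
    (I : Fin n → ℕ) (hI : ∑ i, I i ≤ N) :
    (A.prolong g j).coeff I = (jet n m (fun q => A.act g q (s q)) j.pt).coeff I := by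
  have := h.polySection_transform (A.smooth g) (q := j.pt) j.coord_mem
    (j.symm_coord.symm ▸ mem_coordDom_self j.pt) hO (j.symm_coord.symm ▸ hr) hs I hI
  rwa [j.symm_coord] at this

theorem FibreAction.prolong_jet {G : Type*} [Group G] (A : FibreAction n m G E) (g : G)
    {s : ∀ q, E q} {O : Set M} (hO : IsOpen O) (hs : ∀ r ∈ O, SmoothSecAt n m s r) {p : M}
    (hp : p ∈ O) : A.prolong g (jet n m s p) = jet n m (fun q => A.act g q (s q)) p :=
  JetInf.ext rfl (funext fun I => A.prolong_coeff g (jet n m s p) hO hp hs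
    (N := ∑ i, I i) (fun _ _ => rfl) I le_rfl)

end Sections

section Forms
set_option linter.unusedSectionVars false

variable {n m : ℕ} {M : Type*} [TopologicalSpace M] [ChartedSpace (EuclideanSpace ℝ (Fin n)) M]
  [IsManifold (𝓡 n) ∞ M]
  {E : M → Type*} [∀ p, AddCommGroup (E p)] [∀ p, Module ℝ (E p)] [∀ p, TopologicalSpace (E p)]
  [TopologicalSpace (TotalSpace (Fin m → ℝ) E)] [FiberBundle (Fin m → ℝ) E]
  [VectorBundle ℝ (Fin m → ℝ) E] [ContMDiffVectorBundle ∞ (Fin m → ℝ) E (𝓡 n)]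

local notation "ch" => chartAt (EuclideanSpace ℝ (Fin n))
local notation "tr" => trivializationAt (Fin m → ℝ) E

variable {k N : ℕ}

theorem iterOp_partialD_congr_nhds {W : Type*} [NormedAddCommGroup W] [NormedSpace ℝ W]
    {f g : 𝔼 (Fin n) → W} {y : 𝔼 (Fin n)} (h : f =ᶠ[𝓝 y] g) (I : Fin n → ℕ) :
    iterOp partialD I f y = iterOp partialD I g y := by
  obtain ⟨V, hV, hVo, hy⟩ := eventually_nhds_iff.1 h
  exact iterOp_partialD_congr hVo hV I hy

theorem formInChart_self (p : M) (A : TangentSpace (𝓡 n) p [⋀^Fin k]→L[ℝ] ℝ) :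
    formInChart p p A = A :=
  ContinuousAlternatingMap.ext fun _ =>
    congrArg A (funext fun _ => tangentCoordChange_self (mem_extChartAt_source (I := 𝓡 n) p))

theorem formInChart_trans {p q r : M} (hp : r ∈ (ch p).source) (hq : r ∈ (ch q).source)
    (A : TangentSpace (𝓡 n) r [⋀^Fin k]→L[ℝ] ℝ) :
    formInChart p r A = (formInChart q r A).compContinuousLinearMap
      (tangentCoordChange (𝓡 n) p q r) := by
  refine ContinuousAlternatingMap.ext fun _ =>
    congrArg A (funext fun _ => (tangentCoordChange_comp ?_).symm)
  simp only [extChartAt_source]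
  exact ⟨⟨hp, hq⟩, mem_chart_source _ r⟩

theorem tangentCoordChange_eq_fderiv (p q r : M) :
    tangentCoordChange (𝓡 n) p q r = fderiv ℝ (ch q ∘ (ch p).symm) (ch p r) := by
  rw [tangentCoordChange_def]
  simp only [mfld_simps, fderivWithin_univ]

theorem formInChart_smul (p q : M) (c : ℝ) (A : TangentSpace (𝓡 n) q [⋀^Fin k]→L[ℝ] ℝ) :
    formInChart p q (c • A) = c • formInChart p q A := rfl

theorem formInChart_zero (p q : M) :
    formInChart p q (0 : TangentSpace (𝓡 n) q [⋀^Fin k]→L[ℝ] ℝ) = 0 := rfl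

theorem formInChart_injective {p q : M} (hq : q ∈ (ch p).source) :
    Function.Injective (formInChart (n := n) (k := k) p q) := by
  intro A B h
  have h1 := formInChart_trans (mem_chart_source _ q) hq A
  have h2 := formInChart_trans (mem_chart_source _ q) hq B
  rw [h, ← h2, formInChart_self, formInChart_self] at h1
  exact h1

/-- `α` is horizontal and smooth, of jet order at most `N`. -/
def HasOrder (N : ℕ) (α : RawForm n m E k) : Prop :=
  ∀ p, IsSmoothOfOrder (chartDom n m E p) N (inCoord p α)

/-- `F` only depends on jet coordinates of order at most `N`. -/
def DependsTo {M : Type*} {E : M → Type*} {T : M → Type*} (N : ℕ)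
    (F : ∀ j : JetInf n m E, T j.pt) : Prop :=
  ∀ p (c c' : (Fin n → ℕ) → Fin m → ℝ), (∀ I, ∑ i, I i ≤ N → c I = c' I) → F ⟨p, c⟩ = F ⟨p, c'⟩

/-- The value of a form at the jet over `r` with coordinates `c`. -/
noncomputable def formAt (α : RawForm n m E k) (r : M) (c : (Fin n → ℕ) → Fin m → ℝ) :
    TangentSpace (𝓡 n) r [⋀^Fin k]→L[ℝ] ℝ := α ⟨r, c⟩

/-- `DependsTo` for forms. -/
abbrev FormDependsTo (N : ℕ) (α : RawForm n m E k) : Prop :=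
  DependsTo (T := fun p => TangentSpace (𝓡 n) p [⋀^Fin k]→L[ℝ] ℝ) N α

theorem IsSmoothOfOrder.congr_jets {W : Type*} [NormedAddCommGroup W] [NormedSpace ℝ W]
    {U : Set (𝔼 (Fin n))} {f : JetCoord n m → W} (hf : IsSmoothOfOrder U N f)
    {y : 𝔼 (Fin n)} (hy : y ∈ U) {c c' : (Fin n → ℕ) → Fin m → ℝ}
    (h : ∀ I, ∑ i, I i ≤ N → c I = c' I) : f (y, c) = f (y, c') := by
  obtain ⟨G, -, hG⟩ := hf
  rw [hG _ hy, hG _ hy]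
  congr 2
  funext K
  exact h _ (mem_idxLE.1 K.2)

theorem inCoord_coord (α : RawForm n m E k) (j : JetInf n m E) : inCoord j.pt α j.coord = α j := by
  have h := congrArg (fun j' => formInChart j.pt j'.pt (α j')) (ofCoord_coord j)
  exact h.trans (formInChart_self _ _)

theorem HasOrder.dependsTo {α : RawForm n m E k} (hα : HasOrder N α) : FormDependsTo N α := by
  intro p c c' h
  have h1 := inCoord_coord α ⟨p, c⟩
  have h2 := inCoord_coord α ⟨p, c'⟩
  rw [← h1, ← h2]
  exact (hα p).congr_jets (JetInf.coord_mem (⟨p, c⟩ : JetInf n m E)) h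

theorem inCoord_eq {α : RawForm n m E k} (hα : FormDependsTo N α) {p : M} {z : JetCoord n m}
    (hz : z.1 ∈ chartDom n m E p) {s : ∀ q, E q} {O : Set M} (hO : IsOpen O)
    (hr : (ch p).symm z.1 ∈ O) (hs : ∀ r ∈ O, SmoothSecAt n m s r) (h : HasCoords p s N z) :
    inCoord p α z = formInChart p ((ch p).symm z.1) (α (jet n m s ((ch p).symm z.1))) :=
  congrArg (formInChart p ((ch p).symm z.1))
    (hα _ (ofCoord E p z).coeff (jet n m s ((ch p).symm z.1)).coeff
      fun I hI => ofCoord_coeff hz hO hr hs h I hI)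

theorem formInChart_jet {α : RawForm n m E k} (hα : FormDependsTo N α) {p r : M}
    (hp : r ∈ coordDom n m E p) {s : ∀ q, E q} {O : Set M} (hO : IsOpen O)
    (hr : r ∈ O) (hs : ∀ r ∈ O, SmoothSecAt n m s r) :
    formInChart p r (α (jet n m s r)) = inCoord p α (jetOf (localExpr n m p s) (ch p r)) := by
  have e : (ch p).symm (ch p r) = r := (ch p).left_inv hp.1
  have h := inCoord_eq hα (z := jetOf (localExpr n m p s) (ch p r))
    (chart_mem_chartDom (E := E) hp.1 hp.2) hO
    (show (ch p).symm (ch p r) ∈ O from e.symm ▸ hr) hs (hasCoords_jetOf p s N _)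
  rw [h]
  change formInChart p r (α (jet n m s r))
    = formInChart p ((ch p).symm (ch p r)) (α (jet n m s ((ch p).symm (ch p r))))
  rw [e]

theorem fderiv_eq_sum {W : Type*} [NormedAddCommGroup W] [NormedSpace ℝ W]
    {f : 𝔼 (Fin n) → W} {y : 𝔼 (Fin n)} (hf : DifferentiableAt ℝ f y) :
    fderiv ℝ f y
      = ∑ i, (EuclideanSpace.proj i : 𝔼 (Fin n) →L[ℝ] ℝ).smulRight (partialD i f y) := by
  ext v
  have hv : v = ∑ i, v i • (basisVec i : 𝔼 (Fin n)) := by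
    have := (EuclideanSpace.basisFun (Fin n) ℝ).sum_repr v
    simpa [basisVec] using this.symm
  conv_lhs => rw [hv]
  simp [map_sum, partialD_eq_fderiv _ hf, _root_.sum_apply]

theorem contDiffOn_inCoord_jetOf {α : RawForm n m E k} (hα : HasOrder N α) {p : M}
    {s : ∀ q, E q} {O : Set M} (hO : IsOpen O) (hs : ∀ r ∈ O, SmoothSecAt n m s r) :
    ContDiffOn ℝ ∞ (fun y => inCoord p α (jetOf (localExpr n m p s) y)) (domOn n m E p O) := by
  obtain ⟨G, hG, hfG⟩ := hα p
  exact contDiffOn_comp_jetOf (isOpen_domOn p hO)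
    ⟨G, hG.mono (prod_mono_left inter_subset_left), fun z hz => hfG z hz.1⟩ (contDiffOn_localExpr hs)

theorem mem_domOn {p r : M} (hp : r ∈ coordDom n m E p) {O : Set M} (hr : r ∈ O) :
    ch p r ∈ domOn n m E p O :=
  ⟨chart_mem_chartDom hp.1 hp.2, (ch p).map_source hp.1, by rwa [mem_preimage, (ch p).left_inv hp.1]⟩

/-- The coordinate expression of `d_H` in terms of total derivatives. -/
noncomputable def dCoord {k : ℕ} (f : JetCoord n m → 𝔼 (Fin n) [⋀^Fin k]→L[ℝ] ℝ) (z : JetCoord n m) :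
    𝔼 (Fin n) [⋀^Fin (k + 1)]→L[ℝ] ℝ :=
  ContinuousAlternatingMap.alternatizeUncurryFin
    (∑ i, (EuclideanSpace.proj i : 𝔼 (Fin n) →L[ℝ] ℝ).smulRight (totalD i f z))

theorem dCoord_jetOf {U : Set (𝔼 (Fin n))} (hU : IsOpen U)
    {f : JetCoord n m → 𝔼 (Fin n) [⋀^Fin k]→L[ℝ] ℝ} (hf : IsSmoothOfOrder U N f)
    {u : 𝔼 (Fin n) → Fin m → ℝ} (hu : ContDiffOn ℝ ∞ u U) {y : 𝔼 (Fin n)} (hy : y ∈ U) :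
    dCoord f (jetOf u y) = extDeriv (fun y => f (jetOf u y)) y := by
  unfold dCoord extDeriv
  rw [fderiv_eq_sum ((contDiffOn_comp_jetOf hU hf hu).differentiableAt_of_isOpen hU hy)]
  congr 1
  refine Finset.sum_congr rfl fun i _ => ?_
  rw [← totalD_jetOf hU hf hu i hy]

theorem HasOrder.isSmoothOfOrder_domOn {α : RawForm n m E k} (hα : HasOrder N α) (p : M) (O : Set M) :
    IsSmoothOfOrder (domOn n m E p O) N (inCoord p α) := by
  obtain ⟨G, hG, hfG⟩ := hα p
  exact ⟨G, hG.mono (prod_mono_left inter_subset_left), fun z hz => hfG z hz.1⟩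

theorem formInChart_dH_jet {α : RawForm n m E k} (hα : HasOrder N α) {p r : M}
    (hp : r ∈ coordDom n m E p) {s : ∀ q, E q} {O : Set M} (hO : IsOpen O)
    (hr : r ∈ O) (hs : ∀ r ∈ O, SmoothSecAt n m s r) :
    formInChart p r (dH α (jet n m s r))
      = extDeriv (fun y => inCoord p α (jetOf (localExpr n m p s) y)) (ch p r) := by
  have hself : dH α (jet n m s r)
      = extDeriv (fun y => inCoord r α (jetOf (localExpr n m r s) y)) (ch r r) :=
    dCoord_jetOf (isOpen_domOn r hO) (hα.isSmoothOfOrder_domOn r O) (contDiffOn_localExpr hs)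
      (mem_domOn (mem_coordDom_self r) hr)
  have hrr := mem_coordDom_self (n := n) (m := m) (E := E) r
  refine (formInChart_trans hp.1 (mem_chart_source _ r) (dH α (jet n m s r))).trans ?_
  refine (congrArg₂ (fun (B : 𝔼 (Fin n) [⋀^Fin (k + 1)]→L[ℝ] ℝ) (T : 𝔼 (Fin n) →L[ℝ] 𝔼 (Fin n)) =>
    B.compContinuousLinearMap T) ((formInChart_self r (dH α (jet n m s r))).trans hself)
    (tangentCoordChange_eq_fderiv p r r)).trans ?_
  have hτ : (ch r ∘ (ch p).symm) (ch p r) = ch r r := congrArg (ch r) ((ch p).left_inv hp.1)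
  have hpre : extDeriv (fun y => (inCoord r α (jetOf (localExpr n m r s)
        ((ch r ∘ (ch p).symm) y))).compContinuousLinearMap (fderiv ℝ (ch r ∘ (ch p).symm) y)) (ch p r)
      = (extDeriv (fun y => inCoord r α (jetOf (localExpr n m r s) y))
          ((ch r ∘ (ch p).symm) (ch p r))).compContinuousLinearMap
          (fderiv ℝ (ch r ∘ (ch p).symm) (ch p r)) := extDeriv_pullback (r := ∞)
    (by
      rw [hτ]
      exact (contDiffOn_inCoord_jetOf hα hO hs).differentiableAt_of_isOpen (isOpen_domOn r hO)
        (mem_domOn hrr hr))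
    (contDiffAt_transition ((ch p).map_source hp.1) (by
      rw [(ch p).left_inv hp.1]; exact mem_chart_source _ r))
    (by rw [minSmoothness_of_isRCLikeNormedField]; exact WithTop.coe_le_coe.2 (le_top : (2 : ℕ∞) ≤ ⊤))
  rw [hτ] at hpre
  rw [← hpre]
  have hev : (fun y => (inCoord r α (jetOf (localExpr n m r s) ((ch r ∘ (ch p).symm) y))).compContinuousLinearMap
      (fderiv ℝ (ch r ∘ (ch p).symm) y)) =ᶠ[𝓝 (ch p r)]
      fun y => inCoord p α (jetOf (localExpr n m p s) y) := by
    have hO' : IsOpen (O ∩ coordDom n m E r) := hO.inter (isOpen_coordDom r)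
    filter_upwards [(isOpen_domOn p hO').mem_nhds (mem_domOn hp ⟨hr, hrr⟩)] with y hy
    have hy' := symm_mem_coordDom hy.1
    have e : ch p ((ch p).symm y) = y := (ch p).right_inv hy.1.1
    have h1 := formInChart_jet hα.dependsTo hy' hO hy.2.2.1 hs
    have h2 := formInChart_jet hα.dependsTo hy.2.2.2 hO hy.2.2.1 hs
    rw [e] at h1
    have h3 := formInChart_trans (n := n) hy'.1 hy.2.2.2.1 (α (jet n m s ((ch p).symm y)))
    have h4 := tangentCoordChange_eq_fderiv (n := n) p r ((ch p).symm y)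
    rw [e] at h4
    exact ((congrArg₂ (fun (B : 𝔼 (Fin n) [⋀^Fin k]→L[ℝ] ℝ) (T : 𝔼 (Fin n) →L[ℝ] 𝔼 (Fin n)) =>
      B.compContinuousLinearMap T) h2 h4).symm.trans h3.symm).trans h1
  unfold extDeriv
  rw [hev.fderiv_eq]

theorem isSmoothOfOrder_dCoord {U : Set (𝔼 (Fin n))} (hU : IsOpen U)
    {f : JetCoord n m → 𝔼 (Fin n) [⋀^Fin k]→L[ℝ] ℝ} (hf : IsSmoothOfOrder U N f) :
    IsSmoothOfOrder U (N + 1) (dCoord f) := by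
  have h : ∀ i, IsSmoothOfOrder U (N + 1) (totalD i f) := fun i => hf.totalD hU i
  choose G hG hfG using h
  refine ⟨fun y => ContinuousAlternatingMap.alternatizeUncurryFinCLM ℝ (𝔼 (Fin n)) ℝ
    (∑ i, (EuclideanSpace.proj i : 𝔼 (Fin n) →L[ℝ] ℝ).smulRight (G i y)), ?_, fun z hz => ?_⟩
  · have hL : ContDiff ℝ ∞ fun T : 𝔼 (Fin n) →L[ℝ] 𝔼 (Fin n) [⋀^Fin k]→L[ℝ] ℝ =>
        ContinuousAlternatingMap.alternatizeUncurryFinCLM ℝ (𝔼 (Fin n)) ℝ T :=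
      ContinuousLinearMap.contDiff _
    refine hL.comp_contDiffOn (ContDiffOn.sum fun i _ => ?_)
    have hR : ContDiff ℝ ∞ fun T : 𝔼 (Fin n) [⋀^Fin k]→L[ℝ] ℝ =>
        (EuclideanSpace.proj i : 𝔼 (Fin n) →L[ℝ] ℝ).smulRight T :=
      contDiff_const.smulRight contDiff_id
    exact hR.comp_contDiffOn (hG i)
  · unfold dCoord
    simp only [hfG _ z hz]
    rfl

theorem dH_dependsTo {α : RawForm n m E k} (hα : HasOrder N α) : FormDependsTo (N + 1) (dH α) := by
  intro p c c' h
  show dCoord (inCoord p α) (ch p p, c) = dCoord (inCoord p α) (ch p p, c')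
  exact (isSmoothOfOrder_dCoord (isOpen_chartDom p) (hα p)).congr_jets
    (JetInf.coord_mem (⟨p, c⟩ : JetInf n m E)) h

theorem inCoord_dH {α : RawForm n m E k} (hα : HasOrder N α) (p : M) {z : JetCoord n m}
    (hz : z.1 ∈ chartDom n m E p) : inCoord p (dH α) z = dCoord (inCoord p α) z := by
  have hs : ∀ r ∈ coordDom n m E p, SmoothSecAt n m (polySection E p z (N + 1)) r :=
    fun r hr => smoothSecAt_polySection p z _ hr.1 hr.2
  have hc := hasCoords_polySection (E := E) hz (N + 1)
  have hr := symm_mem_coordDom hz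
  rw [inCoord_eq (dH_dependsTo hα) hz (isOpen_coordDom p) hr hs hc,
    formInChart_dH_jet hα hr (isOpen_coordDom p) hr hs, (ch p).right_inv hz.1]
  have hz' : z.1 ∈ domOn n m E p (coordDom n m E p) := ⟨hz, hz.1, hr⟩
  rw [← dCoord_jetOf (isOpen_domOn p (isOpen_coordDom p)) (hα.isSmoothOfOrder_domOn p _)
    (contDiffOn_localExpr hs) hz']
  exact (isSmoothOfOrder_dCoord (isOpen_chartDom p) (hα p)).congr_jets hz fun I hI => hc I hI

theorem HasOrder.dH {α : RawForm n m E k} (hα : HasOrder N α) : HasOrder (N + 1) (dH α) := by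
  intro p
  obtain ⟨G, hG, hfG⟩ := isSmoothOfOrder_dCoord (isOpen_chartDom p) (hα p)
  exact ⟨G, hG, fun z hz => (inCoord_dH hα p hz).trans (hfG z hz)⟩

theorem HasOrder.mono {N' : ℕ} {α : RawForm n m E k} (hα : HasOrder N α) (h : N ≤ N') :
    HasOrder N' α := fun p => (hα p).mono h

theorem exists_polySection (j : JetInf n m E) (N : ℕ) :
    ∃ s : ∀ q, E q, (∀ r ∈ coordDom n m E j.pt, SmoothSecAt n m s r) ∧
      ∀ I, ∑ i, I i ≤ N → (jet n m s j.pt).coeff I = j.coeff I :=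
  ⟨polySection E j.pt j.coord N, fun _ hr => smoothSecAt_polySection j.pt _ _ hr.1 hr.2,
    hasCoords_polySection j.coord_mem N⟩

theorem dH_dH {α : RawForm n m E k} (hα : HasOrder N α) : dH (dH α) = 0 := by
  funext j
  obtain ⟨s, hs, hj⟩ := exists_polySection j (N + 2)
  have h0 : dH (dH α) j = dH (dH α) (jet n m s j.pt) :=
    dH_dependsTo hα.dH _ _ _ fun I hI => (hj I hI).symm
  have hO := isOpen_coordDom (n := n) (m := m) (E := E) j.pt
  have hself := mem_coordDom_self (n := n) (m := m) (E := E) j.pt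
  rw [h0, ← formInChart_self j.pt (dH (dH α) (jet n m s j.pt))]
  refine (formInChart_dH_jet hα.dH hself hO hself hs).trans ?_
  have hev : (fun y => inCoord j.pt (dH α) (jetOf (localExpr n m j.pt s) y)) =ᶠ[𝓝 (ch j.pt j.pt)]
      extDeriv (fun y => inCoord j.pt α (jetOf (localExpr n m j.pt s) y)) := by
    filter_upwards [(isOpen_domOn j.pt hO).mem_nhds (mem_domOn hself hself)] with y hy
    have hy' := symm_mem_coordDom hy.1
    have e : ch j.pt ((ch j.pt).symm y) = y := (ch j.pt).right_inv hy.1.1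
    have h1 := formInChart_dH_jet hα hy' hO hy' hs
    rw [formInChart_jet hα.dH.dependsTo hy' hO hy' hs, e] at h1
    exact h1
  have h2 : extDeriv (fun y => inCoord j.pt (dH α) (jetOf (localExpr n m j.pt s) y)) (ch j.pt j.pt)
      = extDeriv (extDeriv (fun y => inCoord j.pt α (jetOf (localExpr n m j.pt s) y))) (ch j.pt j.pt) := by
    unfold extDeriv at hev ⊢
    rw [hev.fderiv_eq]
  rw [h2]
  exact extDeriv_extDeriv_apply (r := ∞) ((contDiffOn_inCoord_jetOf hα hO hs).contDiffAt
    ((isOpen_domOn j.pt hO).mem_nhds (mem_domOn hself hself)))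
    (by rw [minSmoothness_of_isRCLikeNormedField]; exact WithTop.coe_le_coe.2 (le_top : (2 : ℕ∞) ≤ ⊤))

theorem FibreAction.pullback_jet {G : Type*} [Group G] (A : FibreAction n m G E) (g : G)
    (α : RawForm n m E k) {s : ∀ q, E q} {O : Set M} (hO : IsOpen O)
    (hs : ∀ r ∈ O, SmoothSecAt n m s r) {r : M} (hr : r ∈ O) :
    A.pullback g α (jet n m s r) = α (jet n m (fun q => A.act g q (s q)) r) := by
  exact congrArg (formAt α r) (congrArg JetInf.coeff (A.prolong_jet g hO hs hr))

theorem smoothSecAt_fibreMap {a : ∀ q, E q → E q} (ha : SmoothFibreMap n m a) {s : ∀ q, E q} {r : M}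
    (hs : SmoothSecAt n m s r) : SmoothSecAt n m (fun q => a q (s q)) r :=
  (ha _).comp r hs

theorem FibreAction.pullback_dH {G : Type*} [Group G] (A : FibreAction n m G E) (g : G)
    {α : RawForm n m E k} (hα : HasOrder N α) (hα' : HasOrder N (A.pullback g α)) :
    A.pullback g (dH α) = dH (A.pullback g α) := by
  funext j
  obtain ⟨s, hs, hj⟩ := exists_polySection j (N + 1)
  have hO := isOpen_coordDom (n := n) (m := m) (E := E) j.pt
  have hself := mem_coordDom_self (n := n) (m := m) (E := E) j.pt
  have h0 : dH (A.pullback g α) j = dH (A.pullback g α) (jet n m s j.pt) :=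
    dH_dependsTo hα' _ _ _ fun I hI => (hj I hI).symm
  have h1 : A.pullback g (dH α) j = dH α (jet n m (fun q => A.act g q (s q)) j.pt) :=
    dH_dependsTo hα j.pt _ _ fun I hI => A.prolong_coeff g j hO hself hs hj I hI
  have hs' : ∀ r ∈ coordDom n m E j.pt, SmoothSecAt n m (fun q => A.act g q (s q)) r := fun r hr =>
    smoothSecAt_fibreMap (A.smooth g) (hs r hr)
  refine h1.trans (Eq.trans ?_ h0.symm)
  refine (formInChart_self j.pt _).symm.trans (Eq.trans ?_ (formInChart_self j.pt _))
  refine (formInChart_dH_jet hα hself hO hself hs').trans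
    (Eq.trans ?_ (formInChart_dH_jet hα' hself hO hself hs).symm)
  have hev : (fun y => inCoord j.pt α (jetOf (localExpr n m j.pt fun q => A.act g q (s q)) y))
      =ᶠ[𝓝 (ch j.pt j.pt)]
      fun y => inCoord j.pt (A.pullback g α) (jetOf (localExpr n m j.pt s) y) := by
    filter_upwards [(isOpen_domOn j.pt hO).mem_nhds (mem_domOn hself hself)] with y hy
    have hy' := symm_mem_coordDom hy.1
    have e : ch j.pt ((ch j.pt).symm y) = y := (ch j.pt).right_inv hy.1.1
    have h1 := formInChart_jet hα'.dependsTo hy' hO hy' hs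
    have h2 := formInChart_jet hα.dependsTo hy' hO hy' hs'
    rw [A.pullback_jet g α hO hs hy', h2, e] at h1
    exact h1
  unfold extDeriv
  rw [hev.fderiv_eq]

end Forms

section Bump
set_option linter.unusedSectionVars false
variable {n m : ℕ} {M : Type*} [TopologicalSpace M] [ChartedSpace (EuclideanSpace ℝ (Fin n)) M]
  [IsManifold (𝓡 n) ∞ M]
  {E : M → Type*} [∀ p, AddCommGroup (E p)] [∀ p, Module ℝ (E p)] [∀ p, TopologicalSpace (E p)]
  [TopologicalSpace (TotalSpace (Fin m → ℝ) E)] [FiberBundle (Fin m → ℝ) E]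
  [VectorBundle ℝ (Fin m → ℝ) E] [ContMDiffVectorBundle ∞ (Fin m → ℝ) E (𝓡 n)]

local notation "ch" => chartAt (EuclideanSpace ℝ (Fin n))
local notation "tr" => trivializationAt (Fin m → ℝ) E

variable [T2Space M] {k N : ℕ}

theorem exists_bump {r : M} {O : Set M} (hO : IsOpen O) (hr : r ∈ O) :
    ∃ f : M → ℝ, ContMDiff (𝓡 n) 𝓘(ℝ) ∞ f ∧ HasCompactSupport f ∧ tsupport f ⊆ O ∧
      ∀ᶠ q in 𝓝 r, f q = 1 := by
  obtain ⟨f, -, hf⟩ := (SmoothBumpFunction.nhds_basis_tsupport (I := 𝓡 n) r).mem_iff.1 (hO.mem_nhds hr)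
  exact ⟨f, f.contMDiff, f.hasCompactSupport, hf, f.eventuallyEq_one⟩

theorem smoothSecAt_zero (r : M) : SmoothSecAt n m (fun q => (0 : E q)) r :=
  contMDiff_zeroSection ℝ E r

theorem SmoothSecAt.add {s h : ∀ q, E q} {r : M} (hs : SmoothSecAt n m s r)
    (hh : SmoothSecAt n m h r) : SmoothSecAt n m (fun q => s q + h q) r :=
  ContMDiffAt.add_section hs hh

theorem SmoothSecAt.smul {f : M → ℝ} {h : ∀ q, E q} {r : M} (hf : ContMDiffAt (𝓡 n) 𝓘(ℝ) ∞ f r)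
    (hh : SmoothSecAt n m h r) : SmoothSecAt n m (fun q => f q • h q) r :=
  ContMDiffAt.smul_section hf hh

theorem SmoothSecAt.const_smul {h : ∀ q, E q} {r : M} (c : ℝ)
    (hh : SmoothSecAt n m h r) : SmoothSecAt n m (fun q => c • h q) r :=
  hh.smul contMDiffAt_const

theorem SmoothSecAt.congr {s h : ∀ q, E q} {r : M} (hs : SmoothSecAt n m s r)
    (hh : ∀ᶠ q in 𝓝 r, h q = s q) : SmoothSecAt n m h r := by
  refine ContMDiffAt.congr_of_eventuallyEq hs ?_
  filter_upwards [hh] with q hq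
  rw [hq]

theorem smoothSecAt_smul_of_tsupport {f : M → ℝ} (hf : ContMDiff (𝓡 n) 𝓘(ℝ) ∞ f) {O : Set M}
    (hfO : tsupport f ⊆ O) {s : ∀ q, E q} (hs : ∀ r ∈ O, SmoothSecAt n m s r) (r : M) :
    SmoothSecAt n m (fun q => f q • s q) r := by
  by_cases hr : r ∈ tsupport f
  · exact SmoothSecAt.smul (hf r) (hs r (hfO hr))
  · refine (smoothSecAt_zero r).congr ?_
    filter_upwards [notMem_tsupport_iff_eventuallyEq.1 hr] with q hq
    simp [hq]

/-- `s` is smooth and vanishes off `K`. -/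
structure SecIn (n m : ℕ) {M : Type*} [TopologicalSpace M]
    [ChartedSpace (EuclideanSpace ℝ (Fin n)) M] {E : M → Type*} [∀ p, AddCommGroup (E p)]
    [∀ p, TopologicalSpace (E p)] [TopologicalSpace (TotalSpace (Fin m → ℝ) E)]
    [FiberBundle (Fin m → ℝ) E] (K : Set M) (s : ∀ q, E q) : Prop where
  smooth : ∀ r, SmoothSecAt n m s r
  eq_zero : ∀ q ∉ K, s q = 0

theorem SecIn.isCompactSection {K : Set M} {s : ∀ q, E q} (h : SecIn n m K s) (hK : IsCompact K) :
    IsCompactSection n m s := ⟨h.smooth, K, hK, h.eq_zero⟩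

theorem IsCompactSection.add_secIn {K : Set M} {s h : ∀ q, E q} (hs : IsCompactSection n m s)
    (hh : SecIn n m K h) (hK : IsCompact K) : IsCompactSection n m (fun q => s q + h q) := by
  obtain ⟨hs, K', hK', h0⟩ := hs
  refine ⟨fun r => SmoothSecAt.add (hs r) (hh.smooth r), K' ∪ K, hK'.union hK, fun q hq => ?_⟩
  show s q + h q = 0
  rw [h0 q fun h => hq (Or.inl h), hh.eq_zero q fun h => hq (Or.inr h), add_zero]

theorem SecIn.const_smul {K : Set M} {h : ∀ q, E q} (hh : SecIn n m K h) (c : ℝ) :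
    SecIn n m K fun q => c • h q :=
  ⟨fun r => (hh.smooth r).const_smul c, fun q hq => by rw [hh.eq_zero q hq, smul_zero]⟩

theorem SecIn.smul {K : Set M} {h : ∀ q, E q} (hh : SecIn n m K h) {f : M → ℝ}
    (hf : ContMDiff (𝓡 n) 𝓘(ℝ) ∞ f) : SecIn n m (K ∩ tsupport f) fun q => f q • h q := by
  refine ⟨fun r => SmoothSecAt.smul (hf r) (hh.smooth r), fun q hq => ?_⟩
  by_cases h1 : q ∈ K
  · rw [image_eq_zero_of_notMem_tsupport fun h2 => hq ⟨h1, h2⟩, zero_smul]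
  · rw [hh.eq_zero q h1, smul_zero]

theorem localExpr_congr_nhds {p : M} {s s' : ∀ q, E q} {y : 𝔼 (Fin n)} (hy : y ∈ (ch p).target)
    (h : ∀ᶠ q in 𝓝 ((ch p).symm y), s q = s' q) :
    localExpr n m p s =ᶠ[𝓝 y] localExpr n m p s' := by
  filter_upwards [((ch p).continuousAt_symm hy).eventually h] with y' hy'
  simp only [localExpr]
  rw [hy']

theorem jetOf_congr_nhds {u u' : 𝔼 (Fin n) → Fin m → ℝ} {y : 𝔼 (Fin n)} (h : u =ᶠ[𝓝 y] u') :
    jetOf u y = jetOf u' y :=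
  Prod.ext rfl (funext fun I => iterOp_partialD_congr_nhds h I)

theorem jet_congr_nhds {r : M} {s s' : ∀ q, E q} (h : ∀ᶠ q in 𝓝 r, s q = s' q) :
    jet n m s r = jet n m s' r := by
  refine JetInf.ext rfl (funext fun I => iterOp_partialD_congr_nhds
    (localExpr_congr_nhds (mem_chart_target _ r) ?_) I)
  rwa [(ch r).left_inv (mem_chart_source _ r)]

theorem exists_secIn_congr {s : ∀ q, E q} {O : Set M} (hO : IsOpen O)
    (hs : ∀ r ∈ O, SmoothSecAt n m s r) {r : M} (hr : r ∈ O) :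
    ∃ K s', IsCompact K ∧ K ⊆ O ∧ SecIn n m K s' ∧ ∀ᶠ q in 𝓝 r, s' q = s q := by
  obtain ⟨f, hf, hfc, hfO, hf1⟩ := exists_bump (n := n) hO hr
  refine ⟨tsupport f, fun q => f q • s q, hfc, hfO,
    ⟨smoothSecAt_smul_of_tsupport hf hfO hs, fun q hq => ?_⟩, ?_⟩
  · rw [image_eq_zero_of_notMem_tsupport hq, zero_smul]
  · filter_upwards [hf1] with q hq
    rw [hq, one_smul]

theorem exists_section_hasCoords {p : M} {z : JetCoord n m} (hz : z.1 ∈ chartDom n m E p) (N : ℕ) :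
    ∃ s : ∀ q, E q, IsCompactSection n m s ∧ HasCoords p s N z := by
  obtain ⟨K, s, hK, -, hs, h⟩ := exists_secIn_congr (isOpen_coordDom p)
    (fun r hr => smoothSecAt_polySection (E := E) p z N hr.1 hr.2) (symm_mem_coordDom hz)
  refine ⟨s, hs.isCompactSection hK, fun I hI => ?_⟩
  rw [iterOp_partialD_congr_nhds (localExpr_congr_nhds hz.1 h) I]
  exact hasCoords_polySection hz N I hI

theorem exists_section_jet (j : JetInf n m E) (N : ℕ) :
    ∃ s : ∀ q, E q, IsCompactSection n m s ∧
      ∀ I, ∑ i, I i ≤ N → (jet n m s j.pt).coeff I = j.coeff I :=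
  exists_section_hasCoords j.coord_mem N

/-- A smooth section with compact support in `O` through a given vector. -/
theorem exists_secIn_value {r : M} {O : Set M} (hO : IsOpen O) (hr : r ∈ O) (v : E r) :
    ∃ K h, IsCompact K ∧ K ⊆ O ∧ SecIn n m K h ∧ h r = v := by
  set z : JetCoord n m := (ch r r, fun _ => (tr r ⟨r, v⟩).2)
  have hr0 := mem_coordDom_self (n := n) (m := m) (E := E) r
  obtain ⟨K, h, hK, hKO, hh, he⟩ := exists_secIn_congr (hO.inter (isOpen_coordDom r))
    (fun q hq => smoothSecAt_polySection (E := E) r z 0 hq.2.1 hq.2.2) ⟨hr, hr0⟩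
  refine ⟨K, h, hK, hKO.trans inter_subset_left, hh, ?_⟩
  rw [he.self_of_nhds]
  have h1 : taylorPoly z 0 (ch r r) = (tr r ⟨r, v⟩).2 := by
    have := iterOp_partialD_taylorPoly z 0 (0 : Fin n → ℕ) (by simp)
    rwa [iterOp_zero] at this
  unfold polySection
  rw [h1]
  exact (tr r).symm_apply_apply_mk hr0.2 v

theorem form_ext {α β : RawForm n m E k} (hα : FormDependsTo N α) (hβ : FormDependsTo N β)
    (h : ∀ s, IsCompactSection n m s → ∀ r, α (jet n m s r) = β (jet n m s r)) : α = β := by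
  funext j
  obtain ⟨s, hs, hj⟩ := exists_section_jet j N
  exact (hα _ _ _ fun I hI => (hj I hI).symm).trans
    ((h s hs j.pt).trans (hβ _ _ _ fun I hI => hj I hI))

end Bump

section Volume
set_option linter.unusedSectionVars false
variable {n m : ℕ} {M : Type*} [TopologicalSpace M] [ChartedSpace (EuclideanSpace ℝ (Fin n)) M]
  [IsManifold (𝓡 n) ∞ M]
  {E : M → Type*} [∀ p, AddCommGroup (E p)] [∀ p, Module ℝ (E p)] [∀ p, TopologicalSpace (E p)]
  [TopologicalSpace (TotalSpace (Fin m → ℝ) E)] [FiberBundle (Fin m → ℝ) E]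
  [VectorBundle ℝ (Fin m → ℝ) E] [ContMDiffVectorBundle ∞ (Fin m → ℝ) E (𝓡 n)]

local notation "ch" => chartAt (EuclideanSpace ℝ (Fin n))
local notation "tr" => trivializationAt (Fin m → ℝ) E

theorem topForm_ext {A B : 𝔼 (Fin n) [⋀^Fin n]→L[ℝ] ℝ} (h : A basisVec = B basisVec) : A = B := by
  have hb : ((EuclideanSpace.basisFun (Fin n) ℝ).toBasis : Fin n → 𝔼 (Fin n)) = basisVec := by
    funext i
    simp [basisVec]
  refine ContinuousAlternatingMap.toAlternatingMap_injective ?_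
  rw [A.toAlternatingMap.eq_smul_basis_det (EuclideanSpace.basisFun (Fin n) ℝ).toBasis,
    B.toAlternatingMap.eq_smul_basis_det (EuclideanSpace.basisFun (Fin n) ℝ).toBasis, hb]
  exact congrArg (· • _) h

theorem topForm_ne_zero {A : 𝔼 (Fin n) [⋀^Fin n]→L[ℝ] ℝ} (h : A ≠ 0) : A basisVec ≠ 0 :=
  fun h0 => h (topForm_ext h0)

theorem topForm_eq_smul (A : 𝔼 (Fin n) [⋀^Fin n]→L[ℝ] ℝ) {B : 𝔼 (Fin n) [⋀^Fin n]→L[ℝ] ℝ} (h : B ≠ 0) :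
    A = (A basisVec / B basisVec) • B := by
  refine topForm_ext ?_
  have := topForm_ne_zero h
  simp [this]

/-- The component of `ν` in the chart at `p`. -/
noncomputable def VolumeForm.comp (ν : VolumeForm n M) (p : M) (y : 𝔼 (Fin n)) : ℝ :=
  formInChart p ((ch p).symm y) (ν.val ((ch p).symm y)) basisVec

theorem VolumeForm.formInChart_ne_zero (ν : VolumeForm n M) {p q : M} (hq : q ∈ (ch p).source) :
    formInChart p q (ν.val q) ≠ 0 := fun h =>
  ν.ne_zero q (formInChart_injective hq (h.trans (formInChart_zero p q).symm))

theorem VolumeForm.comp_ne_zero (ν : VolumeForm n M) {p : M} {y : 𝔼 (Fin n)}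
    (hy : y ∈ (ch p).target) : ν.comp p y ≠ 0 :=
  topForm_ne_zero (ν.formInChart_ne_zero ((ch p).map_target hy))

theorem VolumeForm.contDiffOn_comp (ν : VolumeForm n M) (p : M) :
    ContDiffOn ℝ ∞ (ν.comp p) (ch p).target :=
  (ContinuousAlternatingMap.apply ℝ (𝔼 (Fin n)) ℝ (basisVec : Fin n → 𝔼 (Fin n))).contDiff.comp_contDiffOn
    (ν.smooth p)

/-- The quotient `A / ν` of two `n`-forms at a point. -/
noncomputable def VolumeForm.quot (ν : VolumeForm n M) (q : M)
    (A : TangentSpace (𝓡 n) q [⋀^Fin n]→L[ℝ] ℝ) : ℝ := A basisVec / ν.val q basisVec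

theorem VolumeForm.quot_smul_val (ν : VolumeForm n M) (q : M)
    (A : TangentSpace (𝓡 n) q [⋀^Fin n]→L[ℝ] ℝ) : ν.quot q A • ν.val q = A :=
  (topForm_eq_smul A (ν.ne_zero q)).symm

theorem VolumeForm.quot_self_smul (ν : VolumeForm n M) (q : M) (c : ℝ) :
    ν.quot q (c • ν.val q) = c :=
  mul_div_cancel_right₀ c (topForm_ne_zero (A := ν.val q) (ν.ne_zero q))

theorem VolumeForm.quot_eq_zero (ν : VolumeForm n M) {q : M}
    {A : TangentSpace (𝓡 n) q [⋀^Fin n]→L[ℝ] ℝ} (h : ν.quot q A = 0) : A = 0 := by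
  rw [← ν.quot_smul_val q A, h, zero_smul]

/-- `A ↦ A / ν` as a linear map. -/
noncomputable def VolumeForm.quotₗ (ν : VolumeForm n M) (q : M) :
    (TangentSpace (𝓡 n) q [⋀^Fin n]→L[ℝ] ℝ) →ₗ[ℝ] ℝ where
  toFun := ν.quot q
  map_add' A B := add_div (A basisVec) (B basisVec) _
  map_smul' c A := mul_div_assoc c (A basisVec) _

theorem VolumeForm.quot_eq_formInChart (ν : VolumeForm n M) {p q : M} (hq : q ∈ (ch p).source)
    (A : TangentSpace (𝓡 n) q [⋀^Fin n]→L[ℝ] ℝ) :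
    ν.quot q A = formInChart p q A basisVec / ν.comp p (ch p q) := by
  have h1 : formInChart p q A = ν.quot q A • formInChart p q (ν.val q) := by
    rw [← formInChart_smul, ν.quot_smul_val]
  have h2 : ν.comp p (ch p q) = formInChart p q (ν.val q) basisVec := by
    unfold VolumeForm.comp
    rw [(ch p).left_inv hq]
  have h3 := topForm_ne_zero (ν.formInChart_ne_zero hq)
  rw [h1, h2]
  simp [h3]

variable [MeasurableSpace M] [BorelSpace M] {ν : VolumeForm n M} {μ : Measure M}

theorem VolumeForm.IsMeasure.lintegral_eq (hμ : ν.IsMeasure μ) (p : M) {A : Set (𝔼 (Fin n))} (hA : MeasurableSet A)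
    (hAt : A ⊆ (ch p).target) :
    μ ((ch p).source ∩ ch p ⁻¹' A) = ∫⁻ y in A, ENNReal.ofReal |ν.comp p y| := by
  have hm : AEMeasurable (ch p) (μ.restrict (ch p).source) :=
    (ch p).continuousOn_toFun.aemeasurable (ch p).open_source.measurableSet
  have h := congrArg (fun m => m A) (hμ p)
  rw [Measure.map_apply_of_aemeasurable hm hA, withDensity_apply _ hA, Measure.restrict_restrict hA,
    inter_eq_left.2 hAt, Measure.restrict_apply₀' (ch p).open_source.measurableSet.nullMeasurableSet,
    inter_comm] at h
  exact h

theorem VolumeForm.IsMeasure.isLocallyFinite (hμ : ν.IsMeasure μ) : IsLocallyFiniteMeasure μ := by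
  refine ⟨fun p => ?_⟩
  obtain ⟨K, hKn, hKt, hK⟩ := local_compact_nhds ((ch p).open_target.mem_nhds (mem_chart_target _ p))
  refine ⟨(ch p).source ∩ ch p ⁻¹' K, Filter.inter_mem ((ch p).open_source.mem_nhds (mem_chart_source _ p))
    (((ch p).continuousAt (mem_chart_source _ p)).preimage_mem_nhds hKn), ?_⟩
  rw [hμ.lintegral_eq p hK.measurableSet hKt]
  have hc : ContinuousOn (fun y => |ν.comp p y|) K := ((ν.contDiffOn_comp p).continuousOn.mono hKt).abs
  have hi : IntegrableOn (fun y => |ν.comp p y|) K := hc.integrableOn_compact hK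
  have := hi.2
  rw [hasFiniteIntegral_iff_norm] at this
  simpa using this

theorem VolumeForm.IsMeasure.isOpenPos (hμ : ν.IsMeasure μ) : μ.IsOpenPosMeasure := by
  refine ⟨fun U hU ⟨r, hr⟩ h0 => ?_⟩
  set A : Set (𝔼 (Fin n)) := (ch r).target ∩ (ch r).symm ⁻¹' U
  have hA : IsOpen A := (ch r).isOpen_inter_preimage_symm hU
  have hAne : A.Nonempty := ⟨ch r r, mem_chart_target _ r, by
    rwa [mem_preimage, (ch r).left_inv (mem_chart_source _ r)]⟩
  have h1 := hμ.lintegral_eq r hA.measurableSet inter_subset_left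
  have h2 : μ ((ch r).source ∩ ch r ⁻¹' A) = 0 := by
    refine measure_mono_null (fun q hq => ?_) h0
    have := hq.2.2
    rwa [mem_preimage, (ch r).left_inv hq.1] at this
  rw [h2] at h1
  have hm : AEMeasurable (fun y => ENNReal.ofReal |ν.comp r y|) (volume.restrict A) :=
    (((ν.contDiffOn_comp r).continuousOn.mono inter_subset_left).abs.aemeasurable hA.measurableSet).ennreal_ofReal
  have h3 := (lintegral_eq_zero_iff' hm).1 h1.symm
  have h4 : ∀ᵐ y, y ∉ A := by
    filter_upwards [(ae_restrict_iff' hA.measurableSet).1 h3] with y hy hyA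
    have := hy hyA
    simp only [Pi.zero_apply, ENNReal.ofReal_eq_zero, abs_nonpos_iff] at this
    exact ν.comp_ne_zero hyA.1 this
  have h5 : volume A = 0 := by
    have := ae_iff.1 h4
    simpa using this
  exact hA.measure_ne_zero volume hAne h5

theorem VolumeForm.IsMeasure.integral_chart (hμ : ν.IsMeasure μ) (p : M) {F : M → ℝ}
    (hF0 : ∀ q ∉ (ch p).source, F q = 0) (hF : ContinuousOn (fun y => F ((ch p).symm y)) (ch p).target)
    {Φ : 𝔼 (Fin n) → ℝ} (hΦ0 : ∀ y ∉ (ch p).target, Φ y = 0)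
    (hΦ : ∀ y ∈ (ch p).target, Φ y = |ν.comp p y| * F ((ch p).symm y)) :
    ∫ q, F q ∂μ = ∫ y, Φ y := by
  have ht := (ch p).open_target.measurableSet
  have hm : AEMeasurable (ch p) (μ.restrict (ch p).source) :=
    (ch p).continuousOn_toFun.aemeasurable (ch p).open_source.measurableSet
  rw [← setIntegral_eq_integral_of_forall_compl_eq_zero hF0,
    ← setIntegral_eq_integral_of_forall_compl_eq_zero hΦ0, setIntegral_congr_fun ht hΦ]
  have hd : AEMeasurable (fun y => ENNReal.ofReal |ν.comp p y|) (volume.restrict (ch p).target) :=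
    ((ν.contDiffOn_comp p).continuousOn.abs.aemeasurable ht).ennreal_ofReal
  have hs : AEStronglyMeasurable (fun y => F ((ch p).symm y))
      ((μ.restrict (ch p).source).map (ch p)) := by
    rw [hμ p]
    exact (hF.aestronglyMeasurable ht).mono_ac (withDensity_absolutelyContinuous _ _)
  have h1 : ∫ q in (ch p).source, F q ∂μ = ∫ y, F ((ch p).symm y) ∂((μ.restrict (ch p).source).map (ch p)) := by
    rw [integral_map hm hs]
    refine setIntegral_congr_fun (ch p).open_source.measurableSet fun q hq => ?_
    simp only [(ch p).left_inv hq]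
  rw [h1, hμ p]
  refine (integral_withDensity_eq_integral_toReal_smul₀ hd (by simp) _).trans ?_
  refine integral_congr_ae (.of_forall fun y => ?_)
  simp only [ENNReal.toReal_ofReal (abs_nonneg _), smul_eq_mul]

end Volume

section Order

variable {n m k l : ℕ} {W : Type*} [NormedAddCommGroup W] [NormedSpace ℝ W]
  {U : Set (𝔼 (Fin n))} {f g : JetCoord n m → W}

theorem IsSmoothOfOrder.congr (hf : IsSmoothOfOrder U k f) (h : ∀ z, z.1 ∈ U → g z = f z) :
    IsSmoothOfOrder U k g := by
  obtain ⟨F, hF, hfF⟩ := hf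
  exact ⟨F, hF, fun z hz => (h z hz).trans (hfF z hz)⟩

theorem IsSmoothOfOrder.mono_set {U' : Set (𝔼 (Fin n))} (hf : IsSmoothOfOrder U k f) (h : U' ⊆ U) :
    IsSmoothOfOrder U' k f := by
  obtain ⟨F, hF, hfF⟩ := hf
  exact ⟨F, hF.mono (prod_mono_left h), fun z hz => hfF z (h hz)⟩

theorem isSmoothOfOrder_zero : IsSmoothOfOrder U k (fun _ : JetCoord n m => (0 : W)) :=
  ⟨fun _ => 0, contDiffOn_const, fun _ _ => rfl⟩

theorem IsSmoothOfOrder.add (hf : IsSmoothOfOrder U k f) (hg : IsSmoothOfOrder U k g) :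
    IsSmoothOfOrder U k fun z => f z + g z := by
  obtain ⟨F, hF, hfF⟩ := hf
  obtain ⟨G, hG, hgG⟩ := hg
  exact ⟨fun y => F y + G y, hF.add hG, fun z hz => congrArg₂ _ (hfF z hz) (hgG z hz)⟩

theorem IsSmoothOfOrder.smul {c : JetCoord n m → ℝ} (hc : IsSmoothOfOrder U k c)
    (hf : IsSmoothOfOrder U k f) : IsSmoothOfOrder U k fun z => c z • f z := by
  obtain ⟨F, hF, hfF⟩ := hf
  obtain ⟨C, hC, hcC⟩ := hc
  exact ⟨fun y => C y • F y, hC.smul hF, fun z hz => congrArg₂ _ (hcC z hz) (hfF z hz)⟩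

theorem IsSmoothOfOrder.const_smul (hf : IsSmoothOfOrder U k f) (c : ℝ) :
    IsSmoothOfOrder U k fun z => c • f z := by
  obtain ⟨F, hF, hfF⟩ := hf
  exact ⟨fun y => c • F y, hF.const_smul c, fun z hz => congrArg _ (hfF z hz)⟩

theorem IsSmoothOfOrder.sum {ι : Type*} (s : Finset ι) {f : ι → JetCoord n m → W}
    (h : ∀ i ∈ s, IsSmoothOfOrder U k (f i)) : IsSmoothOfOrder U k fun z => ∑ i ∈ s, f i z := by
  classical
  induction s using Finset.induction_on with
  | empty => simpa using isSmoothOfOrder_zero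
  | insert a s ha ih =>
    simp only [Finset.sum_insert ha]
    exact (h a (Finset.mem_insert_self _ _)).add (ih fun i hi => h i (Finset.mem_insert_of_mem hi))

theorem isSmoothOfOrder_fst {G : 𝔼 (Fin n) → W} (hG : ContDiffOn ℝ ∞ G U) :
    IsSmoothOfOrder U k fun z : JetCoord n m => G z.1 :=
  ⟨fun y => G y.1, hG.comp contDiff_fst.contDiffOn fun _ hy => hy.1, fun _ _ => rfl⟩

theorem exists_order_iterOp {ι : Type*} {U : ι → Set (𝔼 (Fin n))} (hU : ∀ i, IsOpen (U i))
    {f : ι → JetCoord n m → W} (hf : ∀ i, IsSmoothOfOrder (U i) k (f i)) (I : Fin n → ℕ) :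
    ∃ l, ∀ i, IsSmoothOfOrder (U i) l (iterOp totalD I (f i)) := by
  have key := iterOp_rel (D := fun i (F : ι → JetCoord n m → W) j => totalD i (F j))
    (D' := fun i (F : ι → JetCoord n m → W) j => totalD i (F j))
    (fun F _ => ∃ l, ∀ i, IsSmoothOfOrder (U i) l (F i))
    (fun i F _ ⟨l, h⟩ => ⟨l + 1, fun j => (h j).totalD (hU j) i⟩) I (a := f) (b := f) ⟨k, hf⟩
  have h2 : ∀ j, iterOp (fun i (F : ι → JetCoord n m → W) j => totalD i (F j)) I f j
      = iterOp totalD I (f j) := fun j =>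
    iterOp_rel (D := fun i (F : ι → JetCoord n m → W) j => totalD i (F j)) (D' := totalD)
      (fun v w => v j = w) (fun i v w h => congrArg (totalD i) h) I rfl
  simpa only [h2] using key

theorem exists_order_eulerOp {ι : Type*} {U : ι → Set (𝔼 (Fin n))} (hU : ∀ i, IsOpen (U i))
    {f : ι → JetCoord n m → W} (hf : ∀ i, IsSmoothOfOrder (U i) k (f i)) :
    ∃ l, ∀ i a, IsSmoothOfOrder (U i) l (eulerOp a (f i)) := by
  have h := fun (I : Fin n → ℕ) => exists_order_iterOp (ι := ι × Fin m) (U := fun i => U i.1)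
    (fun i => hU i.1) (f := fun i => jetD I i.2 (f i.1)) (fun i => (hf i.1).jetD (hU i.1) I i.2) I
  choose l hl using h
  refine ⟨∑ I ∈ idxLE n k, l I, fun i a => ?_⟩
  refine (IsSmoothOfOrder.sum (idxLE n k) fun I hI => ((hl I (i, a)).mono
    (Finset.single_le_sum (f := l) (fun _ _ => Nat.zero_le _) hI)).const_smul
      ((-1 : ℝ) ^ (∑ i, I i))).congr fun z hz => ?_
  exact eulerOp_eq_sum (hU i) (hf i) a hz

end Order

section Variation
set_option linter.unusedSectionVars false
variable {n m : ℕ} {M : Type*} [TopologicalSpace M] [ChartedSpace (EuclideanSpace ℝ (Fin n)) M]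
  [IsManifold (𝓡 n) ∞ M]
  {E : M → Type*} [∀ p, AddCommGroup (E p)] [∀ p, Module ℝ (E p)] [∀ p, TopologicalSpace (E p)]
  [TopologicalSpace (TotalSpace (Fin m → ℝ) E)] [FiberBundle (Fin m → ℝ) E]
  [VectorBundle ℝ (Fin m → ℝ) E] [ContMDiffVectorBundle ∞ (Fin m → ℝ) E (𝓡 n)]

local notation "ch" => chartAt (EuclideanSpace ℝ (Fin n))
local notation "tr" => trivializationAt (Fin m → ℝ) E

variable [T2Space M]

theorem smoothSecAt_of_localExpr {s : ∀ q, E q} {p r : M} (hr : r ∈ coordDom n m E p)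
    (h : ContDiffAt ℝ ∞ (localExpr n m p s) (ch p r)) : SmoothSecAt n m s r := by
  refine ((tr p).contMDiffAt_section_iff (IB := 𝓡 n) hr.2).2 ?_
  have h3 : ContMDiffAt (𝓡 n) 𝓘(ℝ, Fin m → ℝ) ∞ (fun r => localExpr n m p s (ch p r)) r :=
    h.contMDiffAt.comp r (contMDiffAt_chart hr.1)
  refine h3.congr_of_eventuallyEq ?_
  filter_upwards [(ch p).open_source.mem_nhds hr.1] with q hq
  exact congrArg (fun r' => (tr p ⟨r', s r'⟩).2) ((ch p).left_inv hq).symm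

theorem linearMapAt_triv {p r : M} (hr : r ∈ (tr p).baseSet) (v : E r) :
    (tr p).linearMapAt ℝ r v = (tr p ⟨r, v⟩).2 :=
  congrFun ((tr p).coe_linearMapAt_of_mem hr) v

theorem triv_add_smul {p r : M} (hr : r ∈ (tr p).baseSet) (v w : E r) (c : ℝ) :
    (tr p ⟨r, v + c • w⟩).2 = (tr p ⟨r, v⟩).2 + c • (tr p ⟨r, w⟩).2 := by
  rw [← linearMapAt_triv hr, ← linearMapAt_triv hr, ← linearMapAt_triv hr, map_add, map_smul]

theorem localExpr_add_smul {s h : ∀ q, E q} {p : M} {y : 𝔼 (Fin n)} (hy : y ∈ chartDom n m E p)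
    (c : ℝ) : localExpr n m p (fun q => s q + c • h q) y
      = localExpr n m p s y + c • localExpr n m p h y :=
  triv_add_smul hy.2 _ _ c

/-- A smooth family of sections, constant off `K`, with velocity `V` at `0`. -/
structure IsVariation (n m : ℕ) {M : Type*} [TopologicalSpace M]
    [ChartedSpace (EuclideanSpace ℝ (Fin n)) M] {E : M → Type*} [∀ p, AddCommGroup (E p)]
    [∀ p, TopologicalSpace (E p)] [TopologicalSpace (TotalSpace (Fin m → ℝ) E)]
    [FiberBundle (Fin m → ℝ) E] (K : Set M) (S : ℝ → ∀ q, E q) (V : ∀ q, E q) : Prop where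
  contDiffOn : ∀ p, ContDiffOn ℝ ∞ (fun w : ℝ × 𝔼 (Fin n) => localExpr n m p (S w.1) w.2)
    (univ ×ˢ chartDom n m E p)
  smooth : ∀ ε r, SmoothSecAt n m (S ε) r
  hasDerivAt : ∀ p r, r ∈ (trivializationAt (Fin m → ℝ) E p).baseSet →
    HasDerivAt (fun ε => (trivializationAt (Fin m → ℝ) E p ⟨r, S ε r⟩).2)
      (trivializationAt (Fin m → ℝ) E p ⟨r, V r⟩).2 0
  eq : ∀ r ∉ K, ∀ ε, S ε r = S 0 r

theorem IsVariation.hasDerivAt_localExpr {K : Set M} {S : ℝ → ∀ q, E q} {V : ∀ q, E q}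
    (h : IsVariation n m K S V) (p : M) : ∀ y ∈ chartDom n m E p,
      HasDerivAt (fun ε => localExpr n m p (S ε) y) (localExpr n m p V y) 0 :=
  fun _ hy => h.hasDerivAt p _ hy.2

theorem IsVariation.contDiffOn_velocity {K : Set M} {S : ℝ → ∀ q, E q} {V : ∀ q, E q}
    (h : IsVariation n m K S V) (p : M) :
    ContDiffOn ℝ ∞ (localExpr n m p V) (chartDom n m E p) := by
  have hΩ : IsOpen ((univ : Set ℝ) ×ˢ chartDom n m E p) := isOpen_univ.prod (isOpen_chartDom p)
  have h1 := contDiffOn_fderiv_apply hΩ (h.contDiffOn p) (1, 0)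
  have h2 : ContDiffOn ℝ ∞ (fun y : 𝔼 (Fin n) => ((0 : ℝ), y)) (chartDom n m E p) :=
    contDiffOn_const.prodMk contDiffOn_id
  refine (h1.comp h2 fun y hy => ⟨mem_univ _, hy⟩).congr fun y hy => ?_
  have h3 : HasDerivAt (fun ε : ℝ => (ε, y)) (1, 0) 0 := (hasDerivAt_id 0).prodMk (hasDerivAt_const 0 y)
  have h4 := (((h.contDiffOn p).differentiableAt_of_isOpen hΩ (x := ((0 : ℝ), y))
    ⟨mem_univ _, hy⟩).hasFDerivAt).comp_hasDerivAt (0 : ℝ) h3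
  exact (h.hasDerivAt_localExpr p y hy).unique h4

theorem IsVariation.secIn {K : Set M} {S : ℝ → ∀ q, E q} {V : ∀ q, E q}
    (h : IsVariation n m K S V) : SecIn n m K V := by
  refine ⟨fun r => ?_, fun q hq => ?_⟩
  · have hr := mem_coordDom_self (n := n) (m := m) (E := E) r
    exact smoothSecAt_of_localExpr hr ((h.contDiffOn_velocity r).contDiffAt
      ((isOpen_chartDom r).mem_nhds (chart_mem_chartDom hr.1 hr.2)))
  have hq' := (mem_coordDom_self (n := n) (m := m) (E := E) q).2
  have h1 := h.hasDerivAt q q hq'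
  have h2 : HasDerivAt (fun ε => (tr q ⟨q, S ε q⟩).2) 0 0 := by
    simp only [h.eq q hq]
    exact hasDerivAt_const _ _
  have h3 : (tr q).linearMapAt ℝ q (V q) = 0 := by
    rw [linearMapAt_triv hq']
    exact h1.unique h2
  rw [← (tr q).symmₗ_linearMapAt (R := ℝ) hq' (V q), h3, map_zero]

theorem isVariation_add_smul {K : Set M} {s h : ∀ q, E q} (hs : ∀ r, SmoothSecAt n m s r)
    (hh : SecIn n m K h) : IsVariation n m K (fun ε q => s q + ε • h q) h where
  contDiffOn p := by
    have h1 : ContDiffOn ℝ ∞ (fun w : ℝ × 𝔼 (Fin n) => localExpr n m p s w.2 + w.1 • localExpr n m p h w.2)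
        (univ ×ˢ chartDom n m E p) :=
      ((contDiffOn_localExpr_univ p hs).comp contDiff_snd.contDiffOn fun w hw => hw.2).add
        (contDiff_fst.contDiffOn.smul ((contDiffOn_localExpr_univ p hh.smooth).comp
          contDiff_snd.contDiffOn fun w hw => hw.2))
    exact h1.congr fun w hw => localExpr_add_smul hw.2 w.1
  smooth ε r := (hs r).add ((hh.smooth r).const_smul ε)
  hasDerivAt p r hr := by
    simp only [triv_add_smul hr]
    have h1 : HasDerivAt (fun ε : ℝ => (tr p ⟨r, s r⟩).2 + ε • (tr p ⟨r, h r⟩).2)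
        ((1 : ℝ) • (tr p ⟨r, h r⟩).2) 0 := ((hasDerivAt_id (0 : ℝ)).smul_const _).const_add _
    rwa [one_smul] at h1
  eq r hr ε := by rw [hh.eq_zero r hr, smul_zero, smul_zero]

/-- The vertical derivative of the fibre-preserving map `a` at `v`. -/
noncomputable def vertDeriv (m : ℕ) {M : Type*} [TopologicalSpace M] {E : M → Type*}
    [∀ p, AddCommGroup (E p)] [∀ p, Module ℝ (E p)] [∀ p, TopologicalSpace (E p)]
    [TopologicalSpace (TotalSpace (Fin m → ℝ) E)] [FiberBundle (Fin m → ℝ) E]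
    [VectorBundle ℝ (Fin m → ℝ) E] (a : ∀ q, E q → E q) (r : M) (v : E r) : E r →ₗ[ℝ] E r :=
  (trivializationAt (Fin m → ℝ) E r).symmₗ ℝ r ∘ₗ
    (fderiv ℝ (fun w : Fin m → ℝ => (trivializationAt (Fin m → ℝ) E r
      ⟨r, a r ((trivializationAt (Fin m → ℝ) E r).symm r w)⟩).2)
      (trivializationAt (Fin m → ℝ) E r ⟨r, v⟩).2).toLinearMap ∘ₗ
    (trivializationAt (Fin m → ℝ) E r).linearMapAt ℝ r

theorem hasDerivAt_vertDeriv {a : ∀ q, E q → E q} (ha : SmoothFibreMap n m a) {p r : M}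
    (hr : r ∈ (tr p).baseSet) (v w : E r) :
    HasDerivAt (fun ε : ℝ => (tr p ⟨r, a r (v + ε • w)⟩).2) (tr p ⟨r, vertDeriv m a r v w⟩).2 0 := by
  have hrr := (mem_coordDom_self (n := n) (m := m) (E := E) r).2
  set T : (Fin m → ℝ) →L[ℝ] (Fin m → ℝ) :=
    LinearMap.toContinuousLinearMap ((tr p).linearMapAt ℝ r ∘ₗ (tr r).symmₗ ℝ r) with hTdef
  have hT : ∀ x : E r, (tr p ⟨r, x⟩).2 = T (tr r ⟨r, x⟩).2 := fun x => by
    simp only [hTdef, LinearMap.coe_toContinuousLinearMap', LinearMap.comp_apply]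
    rw [← linearMapAt_triv hr, ← linearMapAt_triv hrr, (tr r).symmₗ_linearMapAt hrr]
  set g : (Fin m → ℝ) → Fin m → ℝ := fun w => (tr r ⟨r, a r ((tr r).symm r w)⟩).2
  have hg : DifferentiableAt ℝ g (tr r ⟨r, v⟩).2 := by
    have h1 := contDiffAt_fibreExpr ha (p := r) (q := r) (w := (ch r r, (tr r ⟨r, v⟩).2))
      (chart_mem_chartDom (mem_chart_source _ r) hrr) (by rwa [(ch r).left_inv (mem_chart_source _ r)])
    have h2 : ContDiffAt ℝ ∞ (fun w : Fin m → ℝ => fibreExpr n m r r a (ch r r, w)) (tr r ⟨r, v⟩).2 :=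
      h1.comp (tr r ⟨r, v⟩).2 (f := fun w : Fin m → ℝ => (ch r r, w)) (contDiffAt_const.prodMk contDiffAt_id)
    have h3 : (fun w : Fin m → ℝ => fibreExpr n m r r a (ch r r, w)) = g := by
      funext w
      exact congrArg (fun r' => (tr r ⟨r', a r' ((tr r).symm r' w)⟩).2)
        ((ch r).left_inv (mem_chart_source _ r))
    rw [h3] at h2
    exact h2.differentiableAt (by simp)
  have h0 : HasDerivAt (fun ε : ℝ => (tr r ⟨r, v⟩).2 + ε • (tr r ⟨r, w⟩).2) (tr r ⟨r, w⟩).2 0 := by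
    have h1 : HasDerivAt (fun ε : ℝ => (tr r ⟨r, v⟩).2 + ε • (tr r ⟨r, w⟩).2)
        ((1 : ℝ) • (tr r ⟨r, w⟩).2) 0 := ((hasDerivAt_id (0 : ℝ)).smul_const _).const_add _
    rwa [one_smul] at h1
  have h1 := (hg.hasFDerivAt.comp_hasDerivAt_of_eq (0 : ℝ) h0 (by simp))
  have h2 := T.hasFDerivAt.comp_hasDerivAt (0 : ℝ) h1
  have e1 : T (fderiv ℝ g (tr r ⟨r, v⟩).2 (tr r ⟨r, w⟩).2) = (tr p ⟨r, vertDeriv m a r v w⟩).2 := by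
    rw [hT]
    refine congrArg T ?_
    rw [← linearMapAt_triv hrr (vertDeriv m a r v w)]
    refine Eq.trans ?_ ((tr r).linearMapAt_symmₗ (R := ℝ) hrr _).symm
    exact congrArg (fderiv ℝ g (tr r ⟨r, v⟩).2) (linearMapAt_triv hrr w).symm
  rw [← e1]
  refine h2.congr_of_eventuallyEq (.of_forall fun ε => ?_)
  simp only [Function.comp_apply, g]
  rw [hT, ← triv_add_smul hrr, (tr r).symm_apply_apply_mk hrr]

theorem isVariation_fibreMap {a : ∀ q, E q → E q} (ha : SmoothFibreMap n m a) {K : Set M}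
    {s h : ∀ q, E q} (hs : ∀ r, SmoothSecAt n m s r) (hh : SecIn n m K h) :
    IsVariation n m K (fun ε q => a q (s q + ε • h q)) fun q => vertDeriv m a q (s q) (h q) where
  contDiffOn p := by
    have h0 := (isVariation_add_smul hs hh).contDiffOn p
    have h1 : ContDiffOn ℝ ∞ (fun w : ℝ × 𝔼 (Fin n) => fibreExpr n m p p a
        (w.2, localExpr n m p (fun q => s q + w.1 • h q) w.2)) (univ ×ˢ chartDom n m E p) := by
      intro w hw
      have h2 := contDiffAt_fibreExpr ha (p := p) (q := p)
        (w := (w.2, localExpr n m p (fun q => s q + w.1 • h q) w.2)) hw.2 hw.2.2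
      have h3 : ContDiffWithinAt ℝ ∞
          (fun w : ℝ × 𝔼 (Fin n) => (w.2, localExpr n m p (fun q => s q + w.1 • h q) w.2))
          (univ ×ˢ chartDom n m E p) w := contDiff_snd.contDiffOn.prodMk h0 w hw
      exact ContDiffAt.comp_contDiffWithinAt (g := fibreExpr n m p p a) w h2 h3
    refine h1.congr fun w hw => ?_
    have := localExpr_fibreMap (s := fun q => s q + w.1 • h q) a p p (y := w.2)
      ((ch p).map_target hw.2.1) hw.2.2
    rw [this, Function.comp_apply, (ch p).right_inv hw.2.1]
  smooth ε r := smoothSecAt_fibreMap ha ((hs r).add ((hh.smooth r).const_smul ε))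
  hasDerivAt p r hr := hasDerivAt_vertDeriv ha hr _ _
  eq r hr ε := by rw [hh.eq_zero r hr, smul_zero, smul_zero]

end Variation

section VariationalFormula
set_option linter.unusedSectionVars false
variable {n m : ℕ} {M : Type*} [TopologicalSpace M] [ChartedSpace (EuclideanSpace ℝ (Fin n)) M]
  [IsManifold (𝓡 n) ∞ M]
  {E : M → Type*} [∀ p, AddCommGroup (E p)] [∀ p, Module ℝ (E p)] [∀ p, TopologicalSpace (E p)]
  [TopologicalSpace (TotalSpace (Fin m → ℝ) E)] [FiberBundle (Fin m → ℝ) E]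
  [VectorBundle ℝ (Fin m → ℝ) E] [ContMDiffVectorBundle ∞ (Fin m → ℝ) E (𝓡 n)]

local notation "ch" => chartAt (EuclideanSpace ℝ (Fin n))
local notation "tr" => trivializationAt (Fin m → ℝ) E

variable [T2Space M] {N : ℕ}

theorem contDiff_indicator {V W : Type*} [NormedAddCommGroup V] [NormedSpace ℝ V]
    [NormedAddCommGroup W] [NormedSpace ℝ W] {U K : Set V} (hU : IsOpen U) (hK : IsCompact K)
    (hKU : K ⊆ U) {f : V → W} (hf : ContDiffOn ℝ ∞ f U) (h0 : ∀ y ∈ U, y ∉ K → f y = 0) :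
    ContDiff ℝ ∞ (U.indicator f) ∧ tsupport (U.indicator f) ⊆ K := by
  have h1 : ∀ y ∉ K, U.indicator f y = 0 := fun y hy => by
    by_cases hyU : y ∈ U
    · rw [indicator_of_mem hyU, h0 y hyU hy]
    · exact indicator_of_notMem hyU _
  refine ⟨contDiff_iff_contDiffAt.2 fun y => ?_, closure_minimal (fun y hy => ?_) hK.isClosed⟩
  · by_cases hy : y ∈ U
    · refine (hf.contDiffAt (hU.mem_nhds hy)).congr_of_eventuallyEq ?_
      filter_upwards [hU.mem_nhds hy] with y' hy'
      exact indicator_of_mem hy' _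
    · refine (contDiffAt_const (c := (0 : W))).congr_of_eventuallyEq ?_
      filter_upwards [hK.isClosed.isOpen_compl.mem_nhds fun h => hy (hKU h)] with y' hy'
      exact h1 y' hy'
  · by_contra hc
    exact hy (h1 y hc)

theorem jetOf_eq_zero_of_notMem_tsupport {H : 𝔼 (Fin n) → Fin m → ℝ} {y : 𝔼 (Fin n)} (hy : y ∉ tsupport H) :
    (jetOf H y).2 = 0 :=
  funext fun I => image_eq_zero_of_notMem_tsupport (f := iterOp partialD I H)
    fun h => hy (tsupport_iterOp_partialD_subset H I h)

/-- The component of an `n`-form in the coordinates at `p`. -/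
noncomputable def lagrangian (p : M) (α : RawForm n m E n) (z : JetCoord n m) : ℝ :=
  inCoord p α z basisVec

theorem HasOrder.lagrangian {α : RawForm n m E n} (hα : HasOrder N α) (p : M) :
    IsSmoothOfOrder (chartDom n m E p) N (lagrangian p α) :=
  (hα p).clm (ContinuousAlternatingMap.apply ℝ (𝔼 (Fin n)) ℝ (basisVec : Fin n → 𝔼 (Fin n)))

theorem eulerOp_lagrangian {α : RawForm n m E n} (hα : HasOrder N α) (p : M) (a : Fin m)
    {z : JetCoord n m} (hz : z.1 ∈ chartDom n m E p) :
    eulerOp a (HorizontalForms.lagrangian p α) z = eulerOp a (inCoord p α) z basisVec :=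
  eulerOp_clm (isOpen_chartDom p) (hα p)
    (ContinuousAlternatingMap.apply ℝ (𝔼 (Fin n)) ℝ (basisVec : Fin n → 𝔼 (Fin n))) a hz

/-- The integrand `P(j^∞s)` of the functional of `Pν`. -/
noncomputable def VolumeForm.dens (ν : VolumeForm n M) (α : RawForm n m E n) (s : ∀ q, E q) (r : M) : ℝ :=
  ν.quot r (α (jet n m s r))

theorem functional_eq (ν : VolumeForm n M) [MeasurableSpace M] (μ : Measure M) (α : RawForm n m E n)
    (s : ∀ q, E q) : functional ν μ α s = ∫ r, ν.dens α s r ∂μ := rfl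

theorem VolumeForm.dens_eq (ν : VolumeForm n M) {α : RawForm n m E n} (hα : HasOrder N α) {p r : M}
    (hp : r ∈ coordDom n m E p) {s : ∀ q, E q} (hs : ∀ r, SmoothSecAt n m s r) :
    ν.dens α s r
      = HorizontalForms.lagrangian p α (jetOf (localExpr n m p s) (ch p r)) / ν.comp p (ch p r) := by
  refine (ν.quot_eq_formInChart hp.1 (α (jet n m s r))).trans ?_
  exact congrArg (fun A : 𝔼 (Fin n) [⋀^Fin n]→L[ℝ] ℝ => A basisVec / ν.comp p (ch p r))
    (formInChart_jet hα.dependsTo hp isOpen_univ (mem_univ r) fun r _ => hs r)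

/-- The Euler-Lagrange form, computed in the coordinates at `p`, on the vertical vector `v`. -/
noncomputable def VolumeForm.pairing (ν : VolumeForm n M) (p : M) (α : RawForm n m E n) (s : ∀ q, E q)
    (r : M) (v : E r) : ℝ :=
  (∑ a, fibreCoord m p a r v
    * eulerOp a (HorizontalForms.lagrangian p α) (jetOf (localExpr n m p s) (ch p r))) / ν.comp p (ch p r)

theorem VolumeForm.quot_euler (ν : VolumeForm n M) {α : RawForm n m E n} (hα : HasOrder N α)
    (s : ∀ q, E q) (r : M) (v : E r) :
    ν.quot r (euler α (jet n m s r) v) = ν.pairing r α s r v := by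
  have hr := mem_coordDom_self (n := n) (m := m) (E := E) r
  refine (ν.quot_eq_formInChart hr.1 (euler α (jet n m s r) v)).trans ?_
  unfold VolumeForm.pairing
  refine congrArg (· / ν.comp r (ch r r)) ?_
  refine (congrArg (fun A : 𝔼 (Fin n) [⋀^Fin n]→L[ℝ] ℝ => A basisVec) (formInChart_self r _)).trans ?_
  unfold euler
  have h2 : ∀ a, eulerOp a (HorizontalForms.lagrangian r α) (jetOf (localExpr n m r s) (ch r r))
      = eulerOp a (inCoord r α) (jet n m s r).coord basisVec := fun a =>
    eulerOp_lagrangian hα r a (chart_mem_chartDom hr.1 hr.2)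
  simp only [h2]
  refine (congrArg (fun A : 𝔼 (Fin n) [⋀^Fin n]→L[ℝ] ℝ => A basisVec) (LinearMap.sum_apply _ _ _)).trans ?_
  refine (map_sum (ContinuousAlternatingMap.apply ℝ (𝔼 (Fin n)) ℝ (basisVec : Fin n → 𝔼 (Fin n))) _ _).trans ?_
  rfl

theorem IsVariation.hasDerivAt_dens {K : Set M} {S : ℝ → ∀ q, E q} {V : ∀ q, E q}
    (h : IsVariation n m K S V) (ν : VolumeForm n M) {α : RawForm n m E n} (hα : HasOrder N α) {p r : M}
    (hp : r ∈ coordDom n m E p) :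
    HasDerivAt (fun ε => ν.dens α (S ε) r)
      (firstVar N (HorizontalForms.lagrangian p α) (jetOf (localExpr n m p (S 0)) (ch p r))
        (jetOf (localExpr n m p V) (ch p r)).2 / ν.comp p (ch p r)) 0 := by
  have h1 := (hasDerivAt_comp_jetOf (isOpen_chartDom p) (hα.lagrangian p) (h.contDiffOn p)
    (h.hasDerivAt_localExpr p) (ch p r) (chart_mem_chartDom hp.1 hp.2)).div_const (ν.comp p (ch p r))
  refine h1.congr_of_eventuallyEq (.of_forall fun ε => ?_)
  exact ν.dens_eq hα hp (h.smooth ε)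

theorem IsVariation.dens_eq {K : Set M} {S : ℝ → ∀ q, E q} {V : ∀ q, E q}
    (h : IsVariation n m K S V) (ν : VolumeForm n M) (α : RawForm n m E n) {r : M} (hK : IsClosed K)
    (hr : r ∉ K) (ε : ℝ) : ν.dens α (S ε) r = ν.dens α (S 0) r := by
  have h1 : jet n m (S ε) r = jet n m (S 0) r := by
    refine jet_congr_nhds ?_
    filter_upwards [hK.isOpen_compl.mem_nhds hr] with q hq
    exact h.eq q hq ε
  exact congrArg (fun c => ν.quot r (formAt α r c)) (congrArg JetInf.coeff h1)

theorem IsVariation.deriv_dens_eq_zero {K : Set M} {S : ℝ → ∀ q, E q} {V : ∀ q, E q}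
    (h : IsVariation n m K S V) (ν : VolumeForm n M) (α : RawForm n m E n) {r : M} (hK : IsClosed K)
    (hr : r ∉ K) : deriv (fun ε => ν.dens α (S ε) r) 0 = 0 := by
  simp only [h.dens_eq ν α hK hr]
  exact deriv_const 0 _

theorem isCompact_chart_image {p : M} {K : Set M} (hK : IsCompact K) (hKp : K ⊆ coordDom n m E p) :
    IsCompact (ch p '' K) ∧ ch p '' K ⊆ chartDom n m E p :=
  ⟨hK.image_of_continuousOn ((ch p).continuousOn_toFun.mono fun _ h => (hKp h).1),
    image_subset_iff.2 fun _ h => chart_mem_chartDom (hKp h).1 (hKp h).2⟩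

theorem symm_notMem_of_notMem_image {p : M} {K : Set M} {y : 𝔼 (Fin n)} (hy : y ∈ (ch p).target)
    (h : y ∉ ch p '' K) : (ch p).symm y ∉ K := fun hc =>
  h ⟨_, hc, (ch p).right_inv hy⟩

theorem contDiffOn_firstVar {U : Set (𝔼 (Fin n))} (hU : IsOpen U) {f : JetCoord n m → ℝ}
    (hf : IsSmoothOfOrder U N f) {u h : 𝔼 (Fin n) → Fin m → ℝ} (hu : ContDiffOn ℝ ∞ u U)
    (hh : ContDiffOn ℝ ∞ h U) :
    ContDiffOn ℝ ∞ (fun y => firstVar N f (jetOf u y) (jetOf h y).2) U := by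
  unfold firstVar
  refine ContDiffOn.sum fun I _ => ContDiffOn.sum fun a _ => ?_
  have h1 : ContDiffOn ℝ ∞ (fun y => iterOp partialD I h y a) U :=
    contDiffOn_pi.1 (contDiffOn_iterOp_partialD hU hh I) a
  exact h1.smul (contDiffOn_comp_jetOf hU (hf.jetD hU I a) hu)

theorem contDiffOn_eulerOp_jetOf {U : Set (𝔼 (Fin n))} (hU : IsOpen U) {f : JetCoord n m → ℝ}
    (hf : IsSmoothOfOrder U N f) (a : Fin m) {u : 𝔼 (Fin n) → Fin m → ℝ} (hu : ContDiffOn ℝ ∞ u U) :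
    ContDiffOn ℝ ∞ (fun y => eulerOp a f (jetOf u y)) U := by
  obtain ⟨l, hl⟩ := exists_order_eulerOp (ι := Unit) (fun _ => hU) (fun _ => hf)
  exact contDiffOn_comp_jetOf hU (hl () a) hu

variable [MeasurableSpace M] [BorelSpace M] {ν : VolumeForm n M} {μ : Measure M}

theorem VolumeForm.IsMeasure.integral_eq_of_compact (hμ : ν.IsMeasure μ) {p : M} {K : Set M}
    (hK : IsCompact K) (hKp : K ⊆ coordDom n m E p) {F : M → ℝ} (hF0 : ∀ q ∉ K, F q = 0)
    {f : 𝔼 (Fin n) → ℝ} (hf : ContDiffOn ℝ ∞ f (chartDom n m E p))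
    (hFf : ∀ r ∈ coordDom n m E p, F r = f (ch p r) / ν.comp p (ch p r)) :
    ∫ q, F q ∂μ = ∫ y, (SignType.sign (ν.comp p y) : ℝ) * (chartDom n m E p).indicator f y := by
  obtain ⟨hK', hK'U⟩ := isCompact_chart_image hK hKp
  have hFf' : ∀ y ∈ chartDom n m E p, F ((ch p).symm y) = f y / ν.comp p y := fun y hy => by
    rw [hFf _ (symm_mem_coordDom hy), (ch p).right_inv hy.1]
  refine hμ.integral_chart p (fun q hq => hF0 q fun h => hq (hKp h).1) (fun y hy => ?_) (fun y hy => ?_)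
    fun y hy => ?_
  · by_cases hyU : y ∈ chartDom n m E p
    · have h1 : ContDiffOn ℝ ∞ (fun y => f y / ν.comp p y) (chartDom n m E p) :=
        hf.div ((ν.contDiffOn_comp p).mono inter_subset_left) fun y hy => ν.comp_ne_zero hy.1
      refine ((h1.contDiffAt ((isOpen_chartDom p).mem_nhds hyU)).continuousAt.congr ?_).continuousWithinAt
      filter_upwards [(isOpen_chartDom p).mem_nhds hyU] with y' hy'
      exact (hFf' y' hy').symm
    · refine ((continuousAt_const (y := (0 : ℝ))).congr ?_).continuousWithinAt
      filter_upwards [(ch p).open_target.mem_nhds hy,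
        hK'.isClosed.isOpen_compl.mem_nhds fun h => hyU (hK'U h)] with y' hy' hyK'
      exact (hF0 _ (symm_notMem_of_notMem_image hy' hyK')).symm
  · rw [indicator_of_notMem fun h => hy h.1, mul_zero]
  · by_cases hyU : y ∈ chartDom n m E p
    · rw [indicator_of_mem hyU, hFf' y hyU]
      have h0 := ν.comp_ne_zero hy
      have h1 : |ν.comp p y| = SignType.sign (ν.comp p y) * ν.comp p y := (sign_mul_self _).symm
      rw [h1]
      field_simp
    · rw [indicator_of_notMem hyU, hF0 _ (symm_notMem_of_notMem_image hy fun h => hyU (hK'U h))]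
      simp

theorem VolumeForm.isLocConstOn_sign (ν : VolumeForm n M) (p : M) :
    IsLocConstOn (ch p).target fun y => (SignType.sign (ν.comp p y) : ℝ) := by
  intro y hy
  have hc : ContinuousAt (ν.comp p) y :=
    (ν.contDiffOn_comp p).continuousOn.continuousAt ((ch p).open_target.mem_nhds hy)
  rcases lt_or_gt_of_ne (ν.comp_ne_zero hy) with h | h
  · filter_upwards [hc.eventually (gt_mem_nhds h)] with y' hy'
    simp [sign_neg h, sign_neg hy']
  · filter_upwards [hc.eventually (lt_mem_nhds h)] with y' hy'
    simp [sign_pos h, sign_pos hy']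

theorem IsVariation.integral_eq_pairing {K : Set M} {S : ℝ → ∀ q, E q} {V : ∀ q, E q}
    (h : IsVariation n m K S V) (hμ : ν.IsMeasure μ) {α : RawForm n m E n} (hα : HasOrder N α) {p : M}
    (hK : IsCompact K) (hKp : K ⊆ coordDom n m E p) :
    ∫ r, deriv (fun ε => ν.dens α (S ε) r) 0 ∂μ = ∫ r, ν.pairing p α (S 0) r (V r) ∂μ := by
  have hU := isOpen_chartDom (n := n) (m := m) (E := E) p
  obtain ⟨hK', hK'U⟩ := isCompact_chart_image hK hKp
  have hV0 : ∀ y ∈ chartDom n m E p, y ∉ ch p '' K → localExpr n m p V y = 0 := fun y hy hyK => by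
    have h1 := h.secIn.eq_zero _ (symm_notMem_of_notMem_image hy.1 hyK)
    unfold localExpr
    rw [h1, ← linearMapAt_triv hy.2, map_zero]
  obtain ⟨hH, hHK⟩ := contDiff_indicator hU hK' hK'U (h.contDiffOn_velocity p) hV0
  set H := (chartDom n m E p).indicator (localExpr n m p V) with hHdef
  have hjet : ∀ y ∈ chartDom n m E p, jetOf H y = jetOf (localExpr n m p V) y := fun y hy => by
    refine jetOf_congr_nhds ?_
    filter_upwards [hU.mem_nhds hy] with y' hy'
    exact indicator_of_mem hy' _
  have hu := contDiffOn_localExpr_univ p (h.smooth 0)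
  have hL := hα.lagrangian p
  have hint := integral_firstVar hU hL hu hH (hK'.of_isClosed_subset (isClosed_tsupport _) hHK)
    (hHK.trans hK'U) (c := fun y => (SignType.sign (ν.comp p y) : ℝ))
    fun y hy => ν.isLocConstOn_sign p y hy.1
  rw [hμ.integral_eq_of_compact hK hKp (fun q hq => h.deriv_dens_eq_zero ν α hK.isClosed hq)
      (contDiffOn_firstVar hU hL hu (h.contDiffOn_velocity p))
      fun r hr => (h.hasDerivAt_dens ν hα hr).deriv,
    hμ.integral_eq_of_compact hK hKp (F := fun r => ν.pairing p α (S 0) r (V r))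
      (f := fun y => ∑ a, localExpr n m p V y a
        * eulerOp a (HorizontalForms.lagrangian p α) (jetOf (localExpr n m p (S 0)) y))]
  · refine Eq.trans (integral_congr_ae (.of_forall fun y => ?_))
      (hint.trans (integral_congr_ae (.of_forall fun y => ?_)))
    · simp only
      by_cases hy : y ∈ chartDom n m E p
      · rw [indicator_of_mem hy, hjet y hy]
      · rw [indicator_of_notMem hy, jetOf_eq_zero_of_notMem_tsupport fun h => hy (hK'U (hHK h))]
        simp [firstVar]
    · simp only
      by_cases hy : y ∈ chartDom n m E p
      · rw [indicator_of_mem hy, hHdef, indicator_of_mem hy]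
      · rw [indicator_of_notMem hy, hHdef, indicator_of_notMem hy]
        simp
  · intro r hr
    show ν.pairing p α (S 0) r (V r) = 0
    unfold VolumeForm.pairing
    simp only [h.secIn.eq_zero r hr, map_zero, zero_mul, Finset.sum_const_zero, zero_div]
  · exact ContDiffOn.sum fun a _ => (contDiffOn_pi.1 (h.contDiffOn_velocity p) a).mul
      (contDiffOn_eulerOp_jetOf hU hL a hu)
  · intro r hr
    have h1 : ∀ a, fibreCoord m p a r (V r) = localExpr n m p V (ch p r) a := fun a =>
      (congrFun (linearMapAt_triv hr.2 (V r)) a).trans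
        (congrArg (fun r' => (tr p ⟨r', V r'⟩).2 a) ((ch p).left_inv hr.1).symm)
    unfold VolumeForm.pairing
    simp only [h1]

end VariationalFormula

section Divergence

variable {n m k : ℕ} {U : Set (𝔼 (Fin n))}

theorem eqOn_zero_of_integral_mul {c : 𝔼 (Fin n) → ℝ} (hU : IsOpen U) (hc : ContinuousOn c U)
    (h : ∀ g : 𝔼 (Fin n) → ℝ, ContDiff ℝ ∞ g → HasCompactSupport g → tsupport g ⊆ U →
      ∫ y, g y * c y = 0) : EqOn c 0 U := by
  have h1 := hU.ae_eq_zero_of_integral_contDiff_smul_eq_zero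
    (hc.locallyIntegrableOn hU.measurableSet) h
  refine Measure.eqOn_open_of_ae_eq (μ := volume) ?_ hU hc continuousOn_const
  exact (ae_restrict_iff' hU.measurableSet).2 h1

theorem contDiffOn_comp_jetOf_slice {W : Type*} [NormedAddCommGroup W] [NormedSpace ℝ W] (hU : IsOpen U)
    {f : JetCoord n m → W} (hf : IsSmoothOfOrder U k f) {P : Type*} [NormedAddCommGroup P] [NormedSpace ℝ P]
    {u : P → 𝔼 (Fin n) → Fin m → ℝ}
    (hu : ContDiffOn ℝ ∞ (fun q : P × 𝔼 (Fin n) => u q.1 q.2) (univ ×ˢ U)) :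
    ContDiffOn ℝ ∞ (fun q : P × 𝔼 (Fin n) => f (jetOf (u q.1) q.2)) (univ ×ˢ U) := by
  obtain ⟨G, hG, hfG⟩ := hf
  have h : ContDiffOn ℝ ∞ (fun q : P × 𝔼 (Fin n) =>
      (q.2, fun K : idxLE n k => iterOp partialD (K : Fin n → ℕ) (u q.1) q.2)) (univ ×ˢ U) :=
    contDiff_snd.contDiffOn.prodMk (contDiffOn_pi.2 fun K => contDiffOn_iterOp_slice hU hu _)
  exact (hG.comp h fun q hq => ⟨hq.2, mem_univ _⟩).congr fun q hq => hfG _ hq.2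

theorem contDiffOn_line {W : Type*} [NormedAddCommGroup W] [NormedSpace ℝ W] {u h : 𝔼 (Fin n) → W}
    (hu : ContDiffOn ℝ ∞ u U) (hh : ContDiffOn ℝ ∞ h U) :
    ContDiffOn ℝ ∞ (fun q : ℝ × 𝔼 (Fin n) => u q.2 + q.1 • h q.2) (univ ×ˢ U) :=
  (hu.comp contDiff_snd.contDiffOn fun _ hq => hq.2).add
    (contDiff_fst.contDiffOn.smul (hh.comp contDiff_snd.contDiffOn fun _ hq => hq.2))

theorem hasDerivAt_line {W : Type*} [NormedAddCommGroup W] [NormedSpace ℝ W] (a b : W) (ε : ℝ) :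
    HasDerivAt (fun ε : ℝ => a + ε • b) b ε := by
  have h1 : HasDerivAt (fun ε : ℝ => a + ε • b) ((1 : ℝ) • b) ε :=
    ((hasDerivAt_id ε).smul_const b).const_add a
  rwa [one_smul] at h1

theorem contDiffOn_line_right {W : Type*} [NormedAddCommGroup W] [NormedSpace ℝ W] {u h : 𝔼 (Fin n) → W}
    (hu : ContDiffOn ℝ ∞ u U) (hh : ContDiffOn ℝ ∞ h U) (ε : ℝ) :
    ContDiffOn ℝ ∞ (fun y => u y + ε • h y) U :=
  hu.add (hh.const_smul ε)

theorem firstVar_totalD (hU : IsOpen U) {f : JetCoord n m → ℝ} (hf : IsSmoothOfOrder U k f)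
    {u h : 𝔼 (Fin n) → Fin m → ℝ} (hu : ContDiffOn ℝ ∞ u U) (hh : ContDiffOn ℝ ∞ h U) (i : Fin n) :
    EqOn (fun y => firstVar (k + 1) (totalD i f) (jetOf u y) (jetOf h y).2)
      (partialD i fun y => firstVar k f (jetOf u y) (jetOf h y).2) U := by
  intro y hy
  have hline := contDiffOn_line hu hh
  have e0 : (fun y => u y + (0 : ℝ) • h y) = u := by simp
  have h1 := hasDerivAt_comp_jetOf hU (hf.totalD hU i) (u := fun ε y => u y + ε • h y) (ε := 0) hline
    (fun y _ => hasDerivAt_line _ _ _) y hy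
  have h2 := hasDerivAt_partialD hU (u := fun ε y => f (jetOf (fun y => u y + ε • h y) y))
    (contDiffOn_comp_jetOf_slice hU hf (u := fun ε y => u y + ε • h y) hline)
    (hasDerivAt_comp_jetOf hU hf (u := fun ε y => u y + ε • h y) (ε := 0) hline
      (fun y _ => hasDerivAt_line _ _ _)) i y hy
  simp only [e0] at h1 h2
  refine h1.unique (h2.congr_of_eventuallyEq (.of_forall fun ε => ?_))
  exact totalD_jetOf hU hf (contDiffOn_line_right hu hh ε) i hy

/-- The Euler-Lagrange operator annihilates total divergences. -/
theorem eulerOp_totalD (hU : IsOpen U) {f : JetCoord n m → ℝ} (hf : IsSmoothOfOrder U k f)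
    (i : Fin n) (a : Fin m) {z : JetCoord n m} (hz : z.1 ∈ U) : eulerOp a (totalD i f) z = 0 := by
  obtain ⟨l, hl⟩ := exists_order_eulerOp (ι := Unit) (fun _ => hU) (fun _ => hf.totalD hU i)
  have hl := hl () a
  set u := taylorPoly z l
  have hu : ContDiffOn ℝ ∞ u U := (contDiff_taylorPoly z l).contDiffOn
  have key : EqOn (fun y => eulerOp a (totalD i f) (jetOf u y)) 0 U := by
    refine eqOn_zero_of_integral_mul hU (contDiffOn_comp_jetOf hU hl hu).continuousOn
      fun g hg hgc hgU => ?_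
    set h : 𝔼 (Fin n) → Fin m → ℝ := fun y => Pi.single a (g y)
    have hh : ContDiff ℝ ∞ h :=
      (ContinuousLinearMap.single ℝ (fun _ : Fin m => ℝ) a).contDiff.comp hg
    have hs : tsupport h ⊆ tsupport g := closure_mono fun y hy h0 => hy (by simp [h, h0])
    have hc : HasCompactSupport h := hgc.of_isClosed_subset (isClosed_tsupport _) hs
    have h1 := integral_firstVar hU (hf.totalD hU i) hu hh hc (hs.trans hgU) (c := fun _ => 1)
      fun y _ => .of_forall fun _ => rfl
    have h2 : ∀ y, ∑ b, h y b * eulerOp b (totalD i f) (jetOf u y)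
        = g y * eulerOp a (totalD i f) (jetOf u y) := fun y => by
      rw [Finset.sum_eq_single a (fun b _ hb => by simp [h, hb]) (by simp)]
      simp [h]
    simp only [h2, one_mul] at h1
    rw [← h1]
    set w : 𝔼 (Fin n) → ℝ := fun y => firstVar k f (jetOf u y) (jetOf h y).2
    have hw0 : ∀ y ∉ tsupport h, w y = 0 := fun y hy => by
      simp [w, jetOf_eq_zero_of_notMem_tsupport hy, firstVar]
    obtain ⟨hw, hws⟩ := contDiff_indicator hU hc (hs.trans hgU) (contDiffOn_firstVar hU hf hu hh.contDiffOn)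
      fun y _ hy => hw0 y hy
    have hwi : U.indicator w = w := by
      funext y
      by_cases hy : y ∈ U
      · exact indicator_of_mem hy _
      · rw [indicator_of_notMem hy, hw0 y fun hc => hy ((hs.trans hgU) hc)]
    change ContDiff ℝ ∞ (U.indicator w) at hw
    change tsupport (U.indicator w) ⊆ _ at hws
    rw [hwi] at hw hws
    rw [← integral_partialD_eq_zero hw (hc.of_isClosed_subset (isClosed_tsupport _) hws) i]
    refine integral_congr_ae (.of_forall fun y => ?_)
    by_cases hy : y ∈ U
    · exact firstVar_totalD hU hf hu hh.contDiffOn i hy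
    · have hy' : y ∉ tsupport h := fun hc => hy ((hs.trans hgU) hc)
      have h3 : partialD i w y = 0 := image_eq_zero_of_notMem_tsupport fun hc =>
        hy' (hws (tsupport_partialD_subset w i hc))
      simp [h3, jetOf_eq_zero_of_notMem_tsupport hy', firstVar]
  have h1 : eulerOp a (totalD i f) (jetOf u z.1) = eulerOp a (totalD i f) z :=
    hl.congr_jets hz fun I hI => iterOp_partialD_taylorPoly z l I hI
  rw [← h1]
  exact key hz

end Divergence

section EulerGlobal
set_option linter.unusedSectionVars false
variable {n m : ℕ} {M : Type*} [TopologicalSpace M] [ChartedSpace (EuclideanSpace ℝ (Fin n)) M]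
  [IsManifold (𝓡 n) ∞ M]
  {E : M → Type*} [∀ p, AddCommGroup (E p)] [∀ p, Module ℝ (E p)] [∀ p, TopologicalSpace (E p)]
  [TopologicalSpace (TotalSpace (Fin m → ℝ) E)] [FiberBundle (Fin m → ℝ) E]
  [VectorBundle ℝ (Fin m → ℝ) E] [ContMDiffVectorBundle ∞ (Fin m → ℝ) E (𝓡 n)]

local notation "ch" => chartAt (EuclideanSpace ℝ (Fin n))
local notation "tr" => trivializationAt (Fin m → ℝ) E

variable [T2Space M] {N : ℕ}

/-- `VolumeForm.pairing` as a linear form. -/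
noncomputable def VolumeForm.pairingₗ (ν : VolumeForm n M) (p : M) (α : RawForm n m E n) (s : ∀ q, E q)
    (r : M) : E r →ₗ[ℝ] ℝ :=
  ∑ a, (eulerOp a (HorizontalForms.lagrangian p α) (jetOf (localExpr n m p s) (ch p r))
    / ν.comp p (ch p r)) • fibreCoord m p a r

theorem VolumeForm.pairingₗ_apply (ν : VolumeForm n M) (p : M) (α : RawForm n m E n) (s : ∀ q, E q)
    (r : M) (v : E r) : ν.pairingₗ p α s r v = ν.pairing p α s r v := by
  unfold VolumeForm.pairingₗ VolumeForm.pairing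
  rw [LinearMap.sum_apply, Finset.sum_div]
  refine Finset.sum_congr rfl fun a _ => ?_
  rw [LinearMap.smul_apply, smul_eq_mul]
  ring

theorem continuousOn_pairing (ν : VolumeForm n M) (p : M) {α : RawForm n m E n} (hα : HasOrder N α)
    {s h : ∀ q, E q} (hs : ∀ r, SmoothSecAt n m s r) (hh : ∀ r, SmoothSecAt n m h r) :
    ContinuousOn (fun r => ν.pairing p α s r (h r)) (coordDom n m E p) := by
  have hc : ContinuousOn (ch p) (coordDom n m E p) := (ch p).continuousOn_toFun.mono inter_subset_left
  have hmaps : MapsTo (ch p) (coordDom n m E p) (chartDom n m E p) := fun r hr =>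
    chart_mem_chartDom hr.1 hr.2
  have h1 : ContinuousOn (fun y => (∑ a, localExpr n m p h y a
      * eulerOp a (HorizontalForms.lagrangian p α) (jetOf (localExpr n m p s) y)) / ν.comp p y)
      (chartDom n m E p) := by
    refine ContinuousOn.div (continuousOn_finsetSum _ fun a _ => ?_)
      ((ν.contDiffOn_comp p).continuousOn.mono inter_subset_left) fun y hy => ν.comp_ne_zero hy.1
    exact ((contDiffOn_pi.1 (contDiffOn_localExpr_univ p hh) a).mul
      (contDiffOn_eulerOp_jetOf (isOpen_chartDom p) (hα.lagrangian p) a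
        (contDiffOn_localExpr_univ p hs))).continuousOn
  refine (h1.comp hc hmaps).congr fun r hr => ?_
  have h1 : ∀ a, fibreCoord m p a r (h r) = localExpr n m p h (ch p r) a := fun a =>
    (congrFun (linearMapAt_triv hr.2 (h r)) a).trans
      (congrArg (fun r' => (tr p ⟨r', h r'⟩).2 a) ((ch p).left_inv hr.1).symm)
  unfold VolumeForm.pairing
  simp only [h1]
  rfl

variable [SecondCountableTopology M] [MeasurableSpace M] [BorelSpace M] {ν : VolumeForm n M} {μ : Measure M}

theorem VolumeForm.IsMeasure.eqOn_zero (hμ : ν.IsMeasure μ) {O : Set M} (hO : IsOpen O) {c : M → ℝ}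
    (hc : ContinuousOn c O)
    (h : ∀ f : M → ℝ, ContMDiff (𝓡 n) 𝓘(ℝ) ∞ f → HasCompactSupport f → tsupport f ⊆ O →
      ∫ r, f r * c r ∂μ = 0) : EqOn c 0 O := by
  have := hμ.isLocallyFinite
  have := hμ.isOpenPos
  have : LocallyCompactSpace M := Manifold.locallyCompact_of_finiteDimensional (𝓡 n)
  have h1 := hO.ae_eq_zero_of_integral_contMDiff_smul_eq_zero (𝓡 n)
    (hc.locallyIntegrableOn hO.measurableSet) h
  refine Measure.eqOn_open_of_ae_eq (μ := μ) ?_ hO hc continuousOn_const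
  exact (ae_restrict_iff' hO.measurableSet).2 h1

theorem continuous_of_notMem {O K : Set M} (hO : IsOpen O) (hK : IsClosed K) (hKO : K ⊆ O)
    {F : M → ℝ} (hF : ContinuousOn F O) (h0 : ∀ r ∉ K, F r = 0) : Continuous F := by
  rw [continuous_iff_continuousAt]
  intro r
  by_cases hr : r ∈ O
  · exact hF.continuousAt (hO.mem_nhds hr)
  · refine (continuousAt_const (y := (0 : ℝ))).congr ?_
    filter_upwards [hK.isOpen_compl.mem_nhds fun h => hr (hKO h)] with r' hr'
    exact (h0 r' hr').symm

theorem VolumeForm.IsMeasure.integrable (hμ : ν.IsMeasure μ) {O K : Set M} (hO : IsOpen O) (hK : IsCompact K)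
    (hKO : K ⊆ O) {F : M → ℝ} (hF : ContinuousOn F O) (h0 : ∀ r ∉ K, F r = 0) : Integrable F μ := by
  have := hμ.isLocallyFinite
  exact (continuous_of_notMem hO hK.isClosed hKO hF h0).integrable_of_hasCompactSupport
    (HasCompactSupport.intro hK h0)

theorem VolumeForm.IsMeasure.linear_ext (hμ : ν.IsMeasure μ) {O : Set M} (hO : IsOpen O)
    {P Q : ∀ r, E r →ₗ[ℝ] ℝ}
    (hP : ∀ h : ∀ q, E q, (∀ r, SmoothSecAt n m h r) → ContinuousOn (fun r => P r (h r)) O)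
    (hQ : ∀ h : ∀ q, E q, (∀ r, SmoothSecAt n m h r) → ContinuousOn (fun r => Q r (h r)) O)
    (hPQ : ∀ (K : Set M) (h : ∀ q, E q), IsCompact K → K ⊆ O → SecIn n m K h →
      ∫ r, P r (h r) ∂μ = ∫ r, Q r (h r) ∂μ) {r : M} (hr : r ∈ O) : P r = Q r := by
  refine LinearMap.ext fun v => ?_
  obtain ⟨K, h, hK, hKO, hh, hv⟩ := exists_secIn_value (n := n) (m := m) hO hr v
  have key : EqOn (fun r => P r (h r) - Q r (h r)) 0 O := by
    refine hμ.eqOn_zero hO ((hP h hh.smooth).sub (hQ h hh.smooth)) fun f hf hfc hfO => ?_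
    have h1 := hh.smul hf
    have hK' : IsCompact (K ∩ tsupport f) := hK.inter_right (isClosed_tsupport f)
    have h2 := hPQ _ _ hK' (inter_subset_left.trans hKO) h1
    simp only [map_smul, smul_eq_mul] at h2
    have hi : ∀ R : ∀ r, E r →ₗ[ℝ] ℝ, ContinuousOn (fun r => R r (h r)) O →
        Integrable (fun r => f r * R r (h r)) μ := fun R hR =>
      hμ.integrable hO hK hKO (hf.continuous.continuousOn.mul hR) fun r hr => by
        rw [hh.eq_zero r hr, map_zero, mul_zero]
    simp only [mul_sub]
    rw [integral_sub (hi P (hP h hh.smooth)) (hi Q (hQ h hh.smooth)), h2, sub_self]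
  have := key hr
  simp only [hv, Pi.zero_apply] at this
  exact sub_eq_zero.1 this

/-- The Euler-Lagrange form may be computed in any coordinates. -/
theorem VolumeForm.IsMeasure.quot_euler_eq_pairing (hμ : ν.IsMeasure μ) {α : RawForm n m E n}
    (hα : HasOrder N α) {s : ∀ q, E q} (hs : ∀ r, SmoothSecAt n m s r) {p r : M}
    (hr : r ∈ coordDom n m E p) (v : E r) :
    ν.quot r (euler α (jet n m s r) v) = ν.pairing p α s r v := by
  have hrr := mem_coordDom_self (n := n) (m := m) (E := E) r
  rw [ν.quot_euler hα, ← ν.pairingₗ_apply, ← ν.pairingₗ_apply]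
  refine congrFun (congrArg DFunLike.coe (hμ.linear_ext (m := m) (E := E) (P := ν.pairingₗ r α s) (Q := ν.pairingₗ p α s)
    ((isOpen_coordDom p).inter (isOpen_coordDom r)) (fun h hh => ?_) (fun h hh => ?_)
    (fun K h hK hKO hh => ?_) ⟨hr, hrr⟩)) v
  · simp only [ν.pairingₗ_apply]
    exact (continuousOn_pairing ν r hα hs hh).mono inter_subset_right
  · simp only [ν.pairingₗ_apply]
    exact (continuousOn_pairing ν p hα hs hh).mono inter_subset_left
  · simp only [ν.pairingₗ_apply]
    have hv := isVariation_add_smul hs hh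
    have h1 := hv.integral_eq_pairing hμ hα hK (hKO.trans inter_subset_left)
    have h2 := hv.integral_eq_pairing hμ hα hK (hKO.trans inter_subset_right)
    have e0 : (fun q => s q + (0 : ℝ) • h q) = s := by simp
    rw [e0] at h1 h2
    exact h2.symm.trans h1

theorem VolumeForm.IsMeasure.continuous_quot_euler (hμ : ν.IsMeasure μ) {α : RawForm n m E n}
    (hα : HasOrder N α) {s h : ∀ q, E q} (hs : ∀ r, SmoothSecAt n m s r)
    (hh : ∀ r, SmoothSecAt n m h r) : Continuous fun r => ν.quot r (euler α (jet n m s r) (h r)) := by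
  rw [continuous_iff_continuousAt]
  intro p
  have h1 := (continuousOn_pairing ν p hα hs hh).continuousAt
    ((isOpen_coordDom p).mem_nhds (mem_coordDom_self (n := n) (m := m) (E := E) p))
  refine h1.congr ?_
  filter_upwards [(isOpen_coordDom (n := n) (m := m) (E := E) p).mem_nhds (mem_coordDom_self p)] with r hr
  exact (hμ.quot_euler_eq_pairing hα hs hr _).symm

/-- `v ↦ E(α)(v) / ν` along `s`. -/
noncomputable def VolumeForm.eulerQuot (ν : VolumeForm n M) (α : RawForm n m E n) (s : ∀ q, E q) (r : M) :
    E r →ₗ[ℝ] ℝ :=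
  ν.quotₗ r ∘ₗ (euler α (jet n m s r) : E r →ₗ[ℝ] TangentSpace (𝓡 n) r [⋀^Fin n]→L[ℝ] ℝ)

theorem IsVariation.integral_deriv {K : Set M} {S : ℝ → ∀ q, E q} {V : ∀ q, E q}
    (h : IsVariation n m K S V) (hμ : ν.IsMeasure μ) {α : RawForm n m E n} (hα : HasOrder N α) {p : M}
    (hK : IsCompact K) (hKp : K ⊆ coordDom n m E p) :
    ∫ r, deriv (fun ε => ν.dens α (S ε) r) 0 ∂μ
      = ∫ r, ν.eulerQuot α (S 0) r (V r) ∂μ := by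
  rw [h.integral_eq_pairing hμ hα hK hKp]
  refine integral_congr_ae (.of_forall fun r => ?_)
  by_cases hr : r ∈ K
  · exact (hμ.quot_euler_eq_pairing hα (h.smooth 0) (hKp hr) _).symm
  · unfold VolumeForm.pairing
    simp only [h.secIn.eq_zero r hr, map_zero, zero_mul, Finset.sum_const_zero, zero_div]

theorem VolumeForm.euler_eq_zero_iff (ν : VolumeForm n M) (α : RawForm n m E n) (s : ∀ q, E q) (r : M) :
    euler α (jet n m s r) = 0 ↔ ν.eulerQuot α s r = 0 := by
  refine ⟨fun h => LinearMap.ext fun v => ?_, fun h => LinearMap.ext fun v => ?_⟩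
  · exact (congrArg (fun A : E r →ₗ[ℝ] TangentSpace (𝓡 n) r [⋀^Fin n]→L[ℝ] ℝ => ν.quotₗ r (A v)) h).trans
      (map_zero (ν.quotₗ r))
  · exact ν.quot_eq_zero (congrArg (fun A : E r →ₗ[ℝ] ℝ => A v) h)

/-- The Euler-Lagrange form at `r` is determined by the first variations supported near `r`. -/
theorem VolumeForm.IsMeasure.euler_eq_zero (hμ : ν.IsMeasure μ) {α : RawForm n m E n}
    (hα : HasOrder N α) {s : ∀ q, E q} (hs : ∀ r, SmoothSecAt n m s r) {O : Set M} (hO : IsOpen O) {r : M}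
    (hr : r ∈ O) (h0 : ∀ (K : Set M) (h : ∀ q, E q), IsCompact K → K ⊆ O → SecIn n m K h →
      ∫ r, deriv (fun ε : ℝ => ν.dens α (fun q => s q + ε • h q) r) 0 ∂μ = 0) :
    euler α (jet n m s r) = 0 := by
  rw [ν.euler_eq_zero_iff]
  refine hμ.linear_ext (m := m) (E := E) (P := ν.eulerQuot α s) (Q := fun _ => 0)
    (hO.inter (isOpen_coordDom (n := n) (m := m) (E := E) r))
    (fun h hh => ?_) (fun h hh => ?_) (fun K h hK hKO hh => ?_) ⟨hr, mem_coordDom_self r⟩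
  · exact (hμ.continuous_quot_euler hα hs hh).continuousOn
  · exact continuousOn_const
  · have h1 := (isVariation_add_smul hs hh).integral_deriv hμ hα hK (hKO.trans inter_subset_right)
    have e0 : (fun q => s q + (0 : ℝ) • h q) = s := by simp
    rw [e0, h0 K h hK (hKO.trans inter_subset_left) hh] at h1
    simpa using h1.symm

/-- The Euler-Lagrange form of the pull-back of a lagrangian by a fibre-preserving map. -/
theorem VolumeForm.IsMeasure.euler_fibreMap (hμ : ν.IsMeasure μ) {α β : RawForm n m E n}
    (hα : HasOrder N α) (hβ : HasOrder N β) {a : ∀ q, E q → E q} (ha : SmoothFibreMap n m a)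
    (hab : ∀ s : ∀ q, E q, (∀ r, SmoothSecAt n m s r) → ∀ r,
      ν.dens β s r = ν.dens α (fun q => a q (s q)) r) {s : ∀ q, E q} (hs : ∀ r, SmoothSecAt n m s r) (r : M) :
    ν.eulerQuot β s r = ν.eulerQuot α (fun q => a q (s q)) r ∘ₗ vertDeriv m a r (s r) := by
  have hs' : ∀ r, SmoothSecAt n m (fun q => a q (s q)) r := fun r => smoothSecAt_fibreMap ha (hs r)
  have e0 : ∀ h : ∀ q, E q, (fun q => s q + (0 : ℝ) • h q) = s := fun h => by simp
  refine hμ.linear_ext (m := m) (E := E) (P := ν.eulerQuot β s)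
    (Q := fun r => ν.eulerQuot α (fun q => a q (s q)) r ∘ₗ vertDeriv m a r (s r))
    (isOpen_coordDom (n := n) (m := m) (E := E) r)
    (fun h hh => ?_) (fun h hh => ?_) (fun K h hK hKO hh => ?_) (mem_coordDom_self r)
  · exact (hμ.continuous_quot_euler hβ hs hh).continuousOn
  · have hu : SecIn n m univ h := ⟨hh, fun q hq => (hq (mem_univ q)).elim⟩
    exact (hμ.continuous_quot_euler hα hs' (isVariation_fibreMap ha hs hu).secIn.smooth).continuousOn
  · have hv := isVariation_add_smul hs hh
    have hva := isVariation_fibreMap ha hs hh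
    have h1 := hv.integral_deriv hμ hβ hK hKO
    have h2 := hva.integral_deriv hμ hα hK hKO
    simp only [e0] at h1
    have e1 : (fun q => a q (s q + (0 : ℝ) • h q)) = fun q => a q (s q) := by simp
    rw [e1] at h2
    refine h1.symm.trans (Eq.trans (integral_congr_ae (.of_forall fun r => ?_)) h2)
    refine congrArg (fun F : ℝ → ℝ => deriv F 0) ?_
    funext ε
    exact hab _ (hv.smooth ε) r

end EulerGlobal

section EulerD

theorem eulerOp_sum {n m k : ℕ} {U : Set (𝔼 (Fin n))} (hU : IsOpen U) {ι : Type*} (t : Finset ι) (c : ι → ℝ)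
    {g : ι → JetCoord n m → ℝ} (hg : ∀ i, IsSmoothOfOrder U k (g i)) (a : Fin m) {z : JetCoord n m}
    (hz : z.1 ∈ U) :
    eulerOp a (fun z => ∑ i ∈ t, c i • g i z) z = ∑ i ∈ t, c i • eulerOp a (g i) z := by
  classical
  induction t using Finset.induction_on with
  | empty =>
    have h0 : IsSmoothOfOrder U 0 (0 : JetCoord n m → ℝ) := isSmoothOfOrder_zero
    have h := eulerOp_lin hU h0 h0 (-1) a hz
    rw [show (-1 : ℝ) • (0 : JetCoord n m → ℝ) + 0 = fun _ => 0 by funext; simp] at h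
    simpa using h.trans (by simp)
  | insert i t hi ih =>
    have h := eulerOp_lin hU (hg i)
      (IsSmoothOfOrder.sum t (f := fun i z => c i • g i z) fun j _ => (hg j).const_smul (c j)) (c i) a hz
    simp only [Finset.sum_insert hi]
    rw [← ih, ← h]
    rfl

set_option linter.unusedSectionVars false
variable {n m : ℕ} {M : Type*} [TopologicalSpace M] [ChartedSpace (EuclideanSpace ℝ (Fin n)) M]
  [IsManifold (𝓡 n) ∞ M]
  {E : M → Type*} [∀ p, AddCommGroup (E p)] [∀ p, Module ℝ (E p)] [∀ p, TopologicalSpace (E p)]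
  [TopologicalSpace (TotalSpace (Fin m → ℝ) E)] [FiberBundle (Fin m → ℝ) E]
  [VectorBundle ℝ (Fin m → ℝ) E] [ContMDiffVectorBundle ∞ (Fin m → ℝ) E (𝓡 n)]

local notation "ch" => chartAt (EuclideanSpace ℝ (Fin n))
local notation "tr" => trivializationAt (Fin m → ℝ) E

variable [T2Space M]

theorem dCoord_basisVec {k : ℕ} {U : Set (𝔼 (Fin (k + 1)))} (hU : IsOpen U) {N : ℕ}
    {f : JetCoord (k + 1) m → 𝔼 (Fin (k + 1)) [⋀^Fin k]→L[ℝ] ℝ} (hf : IsSmoothOfOrder U N f)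
    {z : JetCoord (k + 1) m} (hz : z.1 ∈ U) :
    dCoord f z basisVec = ∑ i : Fin (k + 1), (-1 : ℝ) ^ (i : ℕ) • totalD i (fun z => f z (i.removeNth basisVec)) z := by
  unfold dCoord
  rw [ContinuousAlternatingMap.alternatizeUncurryFin_apply]
  refine Finset.sum_congr rfl fun i _ => ?_
  rw [← Int.cast_smul_eq_zsmul ℝ]
  rw [Int.cast_pow, Int.cast_neg, Int.cast_one]
  congr 1
  have h1 : totalD i (fun z => f z (i.removeNth basisVec)) z = totalD i f z (i.removeNth basisVec) :=
    hf.lineDeriv_clm hU (ContinuousAlternatingMap.apply ℝ (𝔼 (Fin (k + 1))) ℝ (i.removeNth basisVec)) hz _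
  have h2 : ∀ j, ((EuclideanSpace.proj j : 𝔼 (Fin (k + 1)) →L[ℝ] ℝ).smulRight (totalD j f z)) (basisVec i)
      = (if j = i then (1 : ℝ) else 0) • totalD j f z := fun j => by
    simp [basisVec]
  have h3 : (∑ j, (EuclideanSpace.proj j : 𝔼 (Fin (k + 1)) →L[ℝ] ℝ).smulRight (totalD j f z)) (basisVec i)
      = totalD i f z := by
    rw [_root_.sum_apply]
    simp only [h2]
    simp
  rw [h1]
  exact congrArg (fun A : 𝔼 (Fin (k + 1)) [⋀^Fin k]→L[ℝ] ℝ => A (i.removeNth basisVec)) h3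

theorem euler_dH {k N : ℕ} (hk : k + 1 = n) {α : RawForm n m E k} (hα : HasOrder N α) (j : JetInf n m E) :
    euler (dH α) j = 0 := by
  subst hk
  have h1 : ∀ a, eulerOp a (inCoord j.pt (dH α)) j.coord = 0 := fun a => by
    refine topForm_ext ?_
    rw [← eulerOp_lagrangian hα.dH j.pt a j.coord_mem]
    have hg : ∀ i : Fin (k + 1), IsSmoothOfOrder (chartDom (k + 1) m E j.pt) N
        fun z => inCoord j.pt α z (i.removeNth basisVec) := fun i =>
      (hα j.pt).clm (ContinuousAlternatingMap.apply ℝ (𝔼 (Fin (k + 1))) ℝ (i.removeNth basisVec))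
    rw [eulerOp_congr (isOpen_chartDom j.pt) (g := fun z => ∑ i : Fin (k + 1), (-1 : ℝ) ^ (i : ℕ)
      • totalD i (fun z => inCoord j.pt α z (i.removeNth basisVec)) z) (fun z hz => ?_) a j.coord_mem,
      eulerOp_sum (isOpen_chartDom j.pt) _ _ (fun i => (hg i).totalD (isOpen_chartDom j.pt) i) a j.coord_mem]
    · simp only [eulerOp_totalD (isOpen_chartDom j.pt) (hg _) _ a j.coord_mem, smul_zero,
        Finset.sum_const_zero]
      rfl
    · unfold lagrangian
      rw [inCoord_dH hα j.pt hz, dCoord_basisVec (isOpen_chartDom j.pt) (hα j.pt) hz]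
  unfold euler
  refine Finset.sum_eq_zero fun a _ => ?_
  refine LinearMap.ext fun v => ?_
  exact (congrArg (fun A : 𝔼 (Fin (k + 1)) [⋀^Fin (k + 1)]→L[ℝ] ℝ => fibreCoord m j.pt a j.pt v • A) (h1 a)).trans
    (smul_zero _)

theorem dH_jet_eq_zero {k N : ℕ} {α : RawForm n m E k} (hα : HasOrder N α) {s : ∀ q, E q}
    (hs : ∀ r, SmoothSecAt n m s r) {r : M} (h0 : ∀ᶠ q in 𝓝 r, α (jet n m s q) = 0) :
    dH α (jet n m s r) = 0 := by
  have hself := mem_coordDom_self (n := n) (m := m) (E := E) r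
  have h1 := formInChart_dH_jet hα hself isOpen_univ (mem_univ r) fun r _ => hs r
  refine formInChart_injective (n := n) (p := r) (q := r) hself.1 (h1.trans ?_)
  have hev : (fun y => inCoord r α (jetOf (localExpr n m r s) y)) =ᶠ[𝓝 (ch r r)] fun _ => 0 := by
    have hy0 : (ch r).symm (ch r r) = r := (ch r).left_inv hself.1
    have hc := (ch r).continuousAt_symm (mem_chart_target _ r)
    rw [ContinuousAt, hy0] at hc
    filter_upwards [hc.eventually h0, (isOpen_chartDom r).mem_nhds (chart_mem_chartDom hself.1 hself.2)]
      with y hy hyU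
    have h2 := formInChart_jet hα.dependsTo (symm_mem_coordDom hyU) isOpen_univ (mem_univ _) fun r _ => hs r
    rw [(ch r).right_inv hyU.1] at h2
    rw [← h2]
    exact (congrArg (formInChart r ((ch r).symm y)) hy).trans (formInChart_zero _ _)
  unfold extDeriv
  rw [hev.fderiv_eq]
  exact (congrArg ContinuousAlternatingMap.alternatizeUncurryFin (fderiv_const_apply _)).trans
    (map_zero (ContinuousAlternatingMap.alternatizeUncurryFinCLM ℝ (𝔼 (Fin n)) ℝ))

theorem dH_mem_omegaC {k : ℕ} {α : RawForm n m E k} (hα : α ∈ omegaC n m E k) :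
    dH α ∈ omegaC n m E (k + 1) := by
  obtain ⟨⟨N, hN⟩, hα'⟩ := hα
  have hN : HasOrder N α := hN
  refine ⟨⟨N + 1, hN.dH⟩, fun s hs => ⟨?_, fun hk => ⟨∅, isCompact_empty, fun p _ => euler_dH hk hN _⟩⟩⟩
  obtain ⟨K, hK, h0⟩ := (hα' s hs).1
  refine ⟨K, hK, fun r hr => dH_jet_eq_zero hN hs.1 ?_⟩
  filter_upwards [hK.isClosed.isOpen_compl.mem_nhds hr] with q hq
  exact h0 q hq

end EulerD

section Bracket
set_option linter.unusedSectionVars false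
variable {n m : ℕ} {M : Type*} [TopologicalSpace M] [ChartedSpace (EuclideanSpace ℝ (Fin n)) M]
  [IsManifold (𝓡 n) ∞ M]
  {E : M → Type*} [∀ p, AddCommGroup (E p)] [∀ p, Module ℝ (E p)] [∀ p, TopologicalSpace (E p)]
  [TopologicalSpace (TotalSpace (Fin m → ℝ) E)] [FiberBundle (Fin m → ℝ) E]
  [VectorBundle ℝ (Fin m → ℝ) E] [ContMDiffVectorBundle ∞ (Fin m → ℝ) E (𝓡 n)]

local notation "ch" => chartAt (EuclideanSpace ℝ (Fin n))
local notation "tr" => trivializationAt (Fin m → ℝ) E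

variable [T2Space M] {N : ℕ}

theorem ofCoord_jetOf {p r : M} (hr : r ∈ coordDom n m E p) {s : ∀ q, E q} (hs : ∀ r, SmoothSecAt n m s r) :
    ofCoord E p (jetOf (localExpr n m p s) (ch p r)) = jet n m s r := by
  have e : (ch p).symm (ch p r) = r := (ch p).left_inv hr.1
  have h : ofCoord E p (jetOf (localExpr n m p s) (ch p r))
      = jet n m s ((ch p).symm (ch p r)) :=
    JetInf.ext rfl (funext fun I => ofCoord_coeff (z := jetOf (localExpr n m p s) (ch p r))
      (chart_mem_chartDom hr.1 hr.2) isOpen_univ (mem_univ _) (fun r _ => hs r)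
      (hasCoords_jetOf p s (∑ i, I i) _) I le_rfl)
  rw [h, e]

theorem exists_euler_dependsTo {α : RawForm n m E n} (hα : HasOrder N α) :
    ∃ l, ∀ (r : M) (c c' : (Fin n → ℕ) → Fin m → ℝ), (∀ I, ∑ i, I i ≤ l → c I = c' I) →
      (euler α ⟨r, c⟩ : E r →ₗ[ℝ] TangentSpace (𝓡 n) r [⋀^Fin n]→L[ℝ] ℝ) = euler α ⟨r, c'⟩ := by
  obtain ⟨l, hl⟩ := exists_order_eulerOp (fun p => isOpen_chartDom (n := n) (m := m) (E := E) p) hα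
  refine ⟨l, fun r c c' h => ?_⟩
  refine Finset.sum_congr rfl fun a _ => ?_
  have h1 := (hl r a).congr_jets (JetInf.coord_mem (⟨r, c⟩ : JetInf n m E)) h
  exact congrArg (fun A : TangentSpace (𝓡 n) r [⋀^Fin n]→L[ℝ] ℝ => (fibreCoord m r a r).smulRight A) h1

/-- The components of the Euler-Lagrange form with respect to `θ^a ∧ ν`, in the coordinates at `p`. -/
noncomputable def VolumeForm.eulerComp (ν : VolumeForm n M) (p : M) (α : RawForm n m E n) (a : Fin m)
    (z : JetCoord n m) : ℝ :=
  (ν.comp p z.1)⁻¹ • eulerOp a (lagrangian p α) z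

theorem VolumeForm.exists_order_eulerComp (m : ℕ) (E : M → Type*) [∀ p, AddCommGroup (E p)]
    [∀ p, Module ℝ (E p)] [∀ p, TopologicalSpace (E p)] [TopologicalSpace (TotalSpace (Fin m → ℝ) E)]
    [FiberBundle (Fin m → ℝ) E] [VectorBundle ℝ (Fin m → ℝ) E] [ContMDiffVectorBundle ∞ (Fin m → ℝ) E (𝓡 n)]
    (ν : VolumeForm n M) (N : ℕ) : ∃ l, ∀ α : RawForm n m E n, HasOrder N α →
      ∀ p a, IsSmoothOfOrder (chartDom n m E p) l (ν.eulerComp p α a) := by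
  obtain ⟨l, hl⟩ := exists_order_eulerOp (ι := {α : RawForm n m E n // HasOrder N α} × M)
    (fun i => isOpen_chartDom (n := n) (m := m) (E := E) i.2) fun i => i.1.2.lagrangian i.2
  exact ⟨l, fun α hα p a => (isSmoothOfOrder_fst (((ν.contDiffOn_comp p).mono inter_subset_left).inv
    fun y hy => ν.comp_ne_zero hy.1)).smul (hl (⟨α, hα⟩, p) a)⟩

variable [SecondCountableTopology M] [MeasurableSpace M] [BorelSpace M] {ν : VolumeForm n M} {μ : Measure M}

theorem VolumeForm.IsMeasure.quot_euler_ofCoord (hμ : ν.IsMeasure μ) {α : RawForm n m E n} (hα : HasOrder N α)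
    {p : M} {z : JetCoord n m} (hz : z.1 ∈ chartDom n m E p) (v : E ((ch p).symm z.1)) :
    ν.quot ((ch p).symm z.1) (euler α (ofCoord E p z) v)
      = ∑ a, fibreCoord m p a ((ch p).symm z.1) v * ν.eulerComp p α a z := by
  obtain ⟨l, hl⟩ := exists_euler_dependsTo hα
  obtain ⟨l', hl'⟩ := ν.exists_order_eulerComp m E N
  obtain ⟨s, hs, hsz⟩ := exists_section_hasCoords (E := E) hz (l + l')
  have hr := symm_mem_coordDom hz
  have h1 := hl ((ch p).symm z.1) (ofCoord E p z).coeff (jet n m s ((ch p).symm z.1)).coeff fun I hI =>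
    ofCoord_coeff hz isOpen_univ (mem_univ _) (fun r _ => hs.1 r) hsz I (hI.trans (Nat.le_add_right l l'))
  refine (congrArg (fun A : E ((ch p).symm z.1) →ₗ[ℝ] TangentSpace (𝓡 n) ((ch p).symm z.1) [⋀^Fin n]→L[ℝ] ℝ =>
    ν.quot ((ch p).symm z.1) (A v)) h1).trans ((hμ.quot_euler_eq_pairing hα hs.1 hr v).trans ?_)
  have e : ch p ((ch p).symm z.1) = z.1 := (ch p).right_inv hz.1
  unfold VolumeForm.pairing
  rw [Finset.sum_div, e]
  refine Finset.sum_congr rfl fun a _ => ?_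
  rw [← (hl' α hα p a).congr_jets (y := z.1) (c := (jetOf (localExpr n m p s) z.1).2) hz fun I hI =>
    hsz I (hI.trans (Nat.le_add_left l' l))]
  unfold VolumeForm.eulerComp
  rw [smul_eq_mul, mul_div_assoc, div_eq_inv_mul]
  rfl

theorem VolumeForm.IsMeasure.euler_ofCoord (hμ : ν.IsMeasure μ) {α : RawForm n m E n} (hα : HasOrder N α)
    {p : M} {z : JetCoord n m} (hz : z.1 ∈ chartDom n m E p) :
    euler α (ofCoord E p z) = ∑ a, ν.eulerComp p α a z •
      (fibreCoord m p a (ofCoord E p z).pt).smulRight (ν.val (ofCoord E p z).pt) := by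
  refine LinearMap.ext fun v => ?_
  refine (ν.quot_smul_val ((ch p).symm z.1) (euler α (ofCoord E p z) v)).symm.trans ?_
  rw [LinearMap.sum_apply]
  refine (congrArg (· • ν.val ((ch p).symm z.1)) (hμ.quot_euler_ofCoord hα hz v)).trans ?_
  refine (Finset.sum_smul (R := ℝ) (M := TangentSpace (𝓡 n) ((ch p).symm z.1) [⋀^Fin n]→L[ℝ] ℝ)).trans ?_
  refine Finset.sum_congr rfl fun a _ => ?_
  rw [mul_comm]
  exact mul_smul _ _ _

/-- A vertical vector with a single component. -/
noncomputable def frameVec (m : ℕ) {M : Type*} [TopologicalSpace M] {E : M → Type*}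
    [∀ p, AddCommGroup (E p)] [∀ p, Module ℝ (E p)] [∀ p, TopologicalSpace (E p)]
    [TopologicalSpace (TotalSpace (Fin m → ℝ) E)] [FiberBundle (Fin m → ℝ) E]
    [VectorBundle ℝ (Fin m → ℝ) E] (p : M) (a : Fin m) (r : M) : E r :=
  (trivializationAt (Fin m → ℝ) E p).symmₗ ℝ r (Pi.single a 1)

theorem fibreCoord_frameVec {p r : M} (hr : r ∈ (tr p).baseSet) (a b : Fin m) :
    fibreCoord m p b r (frameVec m (E := E) p a r) = if b = a then 1 else 0 := by
  unfold fibreCoord frameVec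
  rw [LinearMap.comp_apply, (tr p).linearMapAt_symmₗ hr]
  simp [Pi.single_apply]

theorem VolumeForm.IsMeasure.eulerComp_eq (hμ : ν.IsMeasure μ) {α : RawForm n m E n} (hα : HasOrder N α)
    {p : M} {z : JetCoord n m} (hz : z.1 ∈ chartDom n m E p) (a : Fin m) :
    ν.eulerComp p α a z
      = ν.quot ((ch p).symm z.1) (euler α (ofCoord E p z) (frameVec m p a ((ch p).symm z.1))) := by
  rw [hμ.quot_euler_ofCoord hα hz]
  simp [fibreCoord_frameVec hz.2]

theorem VolumeForm.IsMeasure.eulerComp_eq_zero (hμ : ν.IsMeasure μ) {α : RawForm n m E n} (hα : HasOrder N α)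
    {p : M} {z : JetCoord n m} (hz : z.1 ∈ chartDom n m E p) (h0 : euler α (ofCoord E p z) = 0) (a : Fin m) :
    ν.eulerComp p α a z = 0 := by
  rw [hμ.eulerComp_eq hα hz]
  exact (congrArg (fun A : E ((ch p).symm z.1) →ₗ[ℝ] TangentSpace (𝓡 n) ((ch p).symm z.1) [⋀^Fin n]→L[ℝ] ℝ =>
    ν.quotₗ ((ch p).symm z.1) (A _)) h0).trans (map_zero (ν.quotₗ ((ch p).symm z.1)))

/-- The components of `w` in the coordinates at `p`. -/
noncomputable def SkewTensor.comp (w : SkewTensor m E ν) (p : M) (a b : Fin m) (z : JetCoord n m) : ℝ :=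
  w.val (ofCoord E p z)
    ((fibreCoord m p a (ofCoord E p z).pt).smulRight (ν.val (ofCoord E p z).pt))
    ((fibreCoord m p b (ofCoord E p z).pt).smulRight (ν.val (ofCoord E p z).pt))

/-- The component of `l̃_2(α, β)` with respect to `ν`, in the coordinates at `p`. -/
noncomputable def SkewTensor.l2Comp (w : SkewTensor m E ν) (p : M) (α β : RawForm n m E n) (z : JetCoord n m) : ℝ :=
  ∑ a, ∑ b, ν.eulerComp p α a z • ν.eulerComp p β b z • w.comp p a b z

theorem SkewTensor.l2_ofCoord (w : SkewTensor m E ν) (hμ : ν.IsMeasure μ) {α β : RawForm n m E n}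
    (hα : HasOrder N α) (hβ : HasOrder N β) {p : M} {z : JetCoord n m} (hz : z.1 ∈ chartDom n m E p) :
    w.l2 α β (ofCoord E p z) = w.l2Comp p α β z • ν.val (ofCoord E p z).pt := by
  unfold SkewTensor.l2 SkewTensor.l2Comp
  congr 1
  rw [hμ.euler_ofCoord hα hz, hμ.euler_ofCoord hβ hz]
  simp only [map_sum, map_smul, LinearMap.sum_apply, LinearMap.smul_apply, Finset.smul_sum]
  rw [Finset.sum_comm]
  exact Finset.sum_congr rfl fun a _ => Finset.sum_congr rfl fun b _ => smul_comm _ _ _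

theorem SkewTensor.exists_order_l2 (w : SkewTensor m E ν) (hμ : ν.IsMeasure μ) (N : ℕ) :
    ∃ l, ∀ α β : RawForm n m E n, HasOrder N α → HasOrder N β → HasOrder l (w.l2 α β) := by
  obtain ⟨l1, h1⟩ := ν.exists_order_eulerComp m E N
  obtain ⟨l3, h3⟩ := w.smooth
  refine ⟨l1 + l3, fun α β hα hβ p => ?_⟩
  have hl : IsSmoothOfOrder (chartDom n m E p) (l1 + l3) (w.l2Comp p α β) :=
    IsSmoothOfOrder.sum _ fun a _ => IsSmoothOfOrder.sum _ fun b _ =>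
      ((h1 α hα p a).mono (by omega)).smul (((h1 β hβ p b).mono (by omega)).smul ((h3 p a b).mono (by omega)))
  refine (hl.smul (isSmoothOfOrder_fst ((ν.smooth p).mono inter_subset_left))).congr fun z hz => ?_
  exact congrArg (formInChart p ((ch p).symm z.1)) (w.l2_ofCoord hμ hα hβ hz)

theorem SkewTensor.exists_hasOrder_l2 (w : SkewTensor m E ν) (hμ : ν.IsMeasure μ) {α β : RawForm n m E n}
    (hα : HasOrder N α) (hβ : HasOrder N β) : ∃ l, HasOrder l (w.l2 α β) :=
  (w.exists_order_l2 hμ N).imp fun _ h => h α β hα hβ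

theorem SkewTensor.dens_l2 (w : SkewTensor m E ν) (hμ : ν.IsMeasure μ) {α β : RawForm n m E n}
    (hα : HasOrder N α) (hβ : HasOrder N β) {p r : M} (hr : r ∈ coordDom n m E p) {s : ∀ q, E q}
    (hs : ∀ r, SmoothSecAt n m s r) :
    ν.dens (w.l2 α β) s r = w.l2Comp p α β (jetOf (localExpr n m p s) (ch p r)) := by
  have h1 := w.l2_ofCoord hμ hα hβ (z := jetOf (localExpr n m p s) (ch p r)) (chart_mem_chartDom hr.1 hr.2)
  have h2 : ν.dens (w.l2 α β) s r = w.val (jet n m s r) (euler α (jet n m s r)) (euler β (jet n m s r)) :=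
    ν.quot_self_smul r _
  rw [h2, ← ofCoord_jetOf hr hs]
  have h3 := congrArg (ν.quot ((ch p).symm (ch p r))) h1
  exact (ν.quot_self_smul ((ch p).symm (ch p r)) _).symm.trans (h3.trans (ν.quot_self_smul _ _))

theorem hasDerivAt_mul_mul_zero {f g k : ℝ → ℝ} {f' g' k' : ℝ} (hf : HasDerivAt f f' 0)
    (hg : HasDerivAt g g' 0) (hk : HasDerivAt k k' 0) (hf0 : f 0 = 0) (hg0 : g 0 = 0) :
    HasDerivAt (fun ε => f ε • g ε • k ε) 0 0 := by
  have := hf.fun_mul (hg.fun_mul hk)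
  simpa [hf0, hg0] using this

theorem SkewTensor.euler_l2_eq_zero (w : SkewTensor m E ν) (hμ : ν.IsMeasure μ) {α β : RawForm n m E n}
    (hα : HasOrder N α) (hβ : HasOrder N β) {s : ∀ q, E q} (hs : ∀ r, SmoothSecAt n m s r)
    {O : Set M} (hO : IsOpen O) (hαO : ∀ r ∈ O, euler α (jet n m s r) = 0)
    (hβO : ∀ r ∈ O, euler β (jet n m s r) = 0) {r : M} (hr : r ∈ O) :
    euler (w.l2 α β) (jet n m s r) = 0 := by
  obtain ⟨l, hl⟩ := w.exists_hasOrder_l2 hμ hα hβ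
  refine hμ.euler_eq_zero hl hs hO hr fun K h hK hKO hh => ?_
  have hv := isVariation_add_smul hs hh
  refine integral_eq_zero_of_ae (.of_forall fun r => ?_)
  by_cases hrO : r ∈ O
  swap
  · exact hv.deriv_dens_eq_zero ν _ hK.isClosed fun h => hrO (hKO h)
  have hrr := mem_coordDom_self (n := n) (m := m) (E := E) r
  have hc := chart_mem_chartDom hrr.1 hrr.2
  have e0 : (fun q => s q + (0 : ℝ) • h q) = s := by simp
  obtain ⟨l1, h1⟩ := ν.exists_order_eulerComp m E N
  obtain ⟨l2, h2⟩ := ν.exists_order_eulerComp m E N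
  obtain ⟨l3, h3⟩ := w.smooth
  replace h3 : ∀ p a b, IsSmoothOfOrder (chartDom n m E p) l3 (w.comp p a b) := h3
  have hj : ofCoord E r (jetOf (localExpr n m r s) (ch r r)) = jet n m s r := ofCoord_jetOf hrr hs
  have key : HasDerivAt (fun ε : ℝ => w.l2Comp r α β (jetOf (localExpr n m r fun q => s q + ε • h q) (ch r r)))
      0 0 := by
    unfold SkewTensor.l2Comp
    refine HasDerivAt.congr_deriv (f' := ∑ _a : Fin m, ∑ _b : Fin m, (0 : ℝ)) ?_ (by simp)
    refine HasDerivAt.fun_sum fun a _ => HasDerivAt.fun_sum fun b _ => ?_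
    have k1 := hasDerivAt_comp_jetOf (isOpen_chartDom r) (h1 α hα r a) (hv.contDiffOn r)
      (hv.hasDerivAt_localExpr r) (ch r r) hc
    have k2 := hasDerivAt_comp_jetOf (isOpen_chartDom r) (h2 β hβ r b) (hv.contDiffOn r)
      (hv.hasDerivAt_localExpr r) (ch r r) hc
    have k3 := hasDerivAt_comp_jetOf (isOpen_chartDom r) (h3 r a b) (hv.contDiffOn r)
      (hv.hasDerivAt_localExpr r) (ch r r) hc
    exact hasDerivAt_mul_mul_zero k1 k2 k3
      (by simp only [e0]; exact hμ.eulerComp_eq_zero hα hc (by rw [hj]; exact hαO r hrO) a)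
      (by simp only [e0]; exact hμ.eulerComp_eq_zero hβ hc (by rw [hj]; exact hβO r hrO) b)
  refine (key.congr_of_eventuallyEq (.of_forall fun ε => ?_)).deriv
  exact w.dens_l2 hμ hα hβ hrr (hv.smooth ε)

theorem SkewTensor.l2_mem_omegaC (w : SkewTensor m E ν) (hμ : ν.IsMeasure μ) {α β : RawForm n m E n}
    (hα : α ∈ omegaC n m E n) (hβ : β ∈ omegaC n m E n) : w.l2 α β ∈ omegaC n m E n := by
  obtain ⟨⟨N, hN⟩, hα'⟩ := hα
  obtain ⟨⟨N', hN'⟩, hβ'⟩ := hβ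
  have hN1 : HasOrder (max N N') α := HasOrder.mono hN (le_max_left _ _)
  have hN2 : HasOrder (max N N') β := HasOrder.mono hN' (le_max_right _ _)
  refine ⟨w.exists_hasOrder_l2 hμ hN1 hN2, fun s hs => ?_⟩
  obtain ⟨K, hK, h0⟩ := (hα' s hs).2 rfl
  obtain ⟨K', hK', h0'⟩ := (hβ' s hs).2 rfl
  refine ⟨⟨K, hK, fun r hr => ?_⟩, fun _ => ⟨K ∪ K', hK.union hK', fun r hr => ?_⟩⟩
  · have h1 : w.val (jet n m s r) (euler α (jet n m s r)) (euler β (jet n m s r)) = 0 := by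
      rw [h0 r hr]
      simp
    exact (congrArg (· • ν.val r) h1).trans (zero_smul ℝ _)
  · exact w.euler_l2_eq_zero hμ hN1 hN2 hs.1 (hK.union hK').isClosed.isOpen_compl
      (fun r hr => h0 r fun h => hr (Or.inl h)) (fun r hr => h0' r fun h => hr (Or.inr h)) hr

end Bracket

section FunctionalZero
set_option linter.unusedSectionVars false
variable {n m : ℕ} {M : Type*} [TopologicalSpace M] [ChartedSpace (EuclideanSpace ℝ (Fin n)) M]
  [IsManifold (𝓡 n) ∞ M]
  {E : M → Type*} [∀ p, AddCommGroup (E p)] [∀ p, Module ℝ (E p)] [∀ p, TopologicalSpace (E p)]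
  [TopologicalSpace (TotalSpace (Fin m → ℝ) E)] [FiberBundle (Fin m → ℝ) E]
  [VectorBundle ℝ (Fin m → ℝ) E] [ContMDiffVectorBundle ∞ (Fin m → ℝ) E (𝓡 n)]

local notation "ch" => chartAt (EuclideanSpace ℝ (Fin n))
local notation "tr" => trivializationAt (Fin m → ℝ) E

variable [T2Space M] {N k : ℕ}

theorem euler_congr_of_isOpen {O : Set M} (hO : IsOpen O) {α β : RawForm n m E k}
    (h : ∀ j : JetInf n m E, j.pt ∈ O → α j = β j) {j : JetInf n m E} (hj : j.pt ∈ O) :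
    euler α j = euler β j := by
  unfold euler
  refine Finset.sum_congr rfl fun a _ => ?_
  have h1 : eulerOp a (inCoord j.pt α) j.coord = eulerOp a (inCoord j.pt β) j.coord :=
    eulerOp_congr (isOpen_domOn (n := n) (m := m) (E := E) j.pt hO)
      (fun z hz => congrArg (formInChart j.pt ((ch j.pt).symm z.1)) (h (ofCoord E j.pt z) hz.2.2)) a
      ⟨j.coord_mem, j.coord_mem.1, by
        show (ch j.pt).symm j.coord.1 ∈ O
        rwa [j.symm_coord]⟩
  exact congrArg (fun A : TangentSpace (𝓡 n) j.pt [⋀^Fin k]→L[ℝ] ℝ => (fibreCoord m j.pt a j.pt).smulRight A) h1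

theorem VolumeForm.continuous_dens (ν : VolumeForm n M) {α : RawForm n m E n} (hα : HasOrder N α)
    {s : ∀ q, E q} (hs : ∀ r, SmoothSecAt n m s r) : Continuous (ν.dens α s) := by
  rw [continuous_iff_continuousAt]
  intro p
  have hO := (isOpen_coordDom (n := n) (m := m) (E := E) p).mem_nhds (mem_coordDom_self p)
  have h1 : ContinuousOn (fun y => HorizontalForms.lagrangian p α (jetOf (localExpr n m p s) y) / ν.comp p y)
      (chartDom n m E p) :=
    (contDiffOn_comp_jetOf (isOpen_chartDom p) (hα.lagrangian p)
      (contDiffOn_localExpr_univ p hs)).continuousOn.div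
      ((ν.contDiffOn_comp p).continuousOn.mono inter_subset_left) fun y hy => ν.comp_ne_zero hy.1
  have h2 : ContinuousOn (ν.dens α s) (coordDom n m E p) :=
    (h1.comp ((ch p).continuousOn_toFun.mono inter_subset_left)
      fun r hr => chart_mem_chartDom hr.1 hr.2).congr fun r hr => ν.dens_eq hα hr hs
  exact h2.continuousAt hO

variable [SecondCountableTopology M] [MeasurableSpace M] [BorelSpace M] {ν : VolumeForm n M} {μ : Measure M}

theorem VolumeForm.IsMeasure.integrable_dens (hμ : ν.IsMeasure μ) {α : RawForm n m E n}
    (hα : HasOrder N α) {s : ∀ q, E q} (hs : ∀ r, SmoothSecAt n m s r) {K : Set M} (hK : IsCompact K)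
    (h0 : ∀ r ∉ K, α (jet n m s r) = 0) : Integrable (ν.dens α s) μ :=
  hμ.integrable isOpen_univ hK (subset_univ K) (ν.continuous_dens hα hs).continuousOn
    fun r hr => (congrArg (ν.quotₗ r) (h0 r hr)).trans (map_zero (ν.quotₗ r))

theorem isCompactSection_add_smul {s h : ∀ q, E q} (hs : IsCompactSection n m s) {K : Set M}
    (hK : IsCompact K) (hh : SecIn n m K h) (ε : ℝ) : IsCompactSection n m fun q => s q + ε • h q :=
  hs.add_secIn (hh.const_smul ε) hK

theorem VolumeForm.IsMeasure.integral_deriv_dens_eq_zero (hμ : ν.IsMeasure μ) {α : RawForm n m E n}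
    (hα : α ∈ omegaC n m E n) (h0 : ∀ s, IsCompactSection n m s → functional ν μ α s = 0)
    {s h : ∀ q, E q} (hs : IsCompactSection n m s) {K : Set M} {p : M} (hK : IsCompact K)
    (hKp : K ⊆ coordDom n m E p) (hh : SecIn n m K h) :
    ∫ r, deriv (fun ε : ℝ => ν.dens α (fun q => s q + ε • h q) r) 0 ∂μ = 0 := by
  obtain ⟨⟨N, hN⟩, hα'⟩ := hα
  have hN : HasOrder N α := hN
  have hv := isVariation_add_smul hs.1 hh
  have hU := isOpen_chartDom (n := n) (m := m) (E := E) p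
  have := hμ.isLocallyFinite
  set Φ : ℝ × 𝔼 (Fin n) → ℝ := fun w =>
    HorizontalForms.lagrangian p α (jetOf (localExpr n m p fun q => s q + w.1 • h q) w.2) / ν.comp p w.2
  have hΦ : ContDiffOn ℝ ∞ Φ (univ ×ˢ chartDom n m E p) := by
    have h1 := contDiffOn_comp_jetOf_slice hU (hN.lagrangian p)
      (u := fun ε => localExpr n m p fun q => s q + ε • h q) (hv.contDiffOn p)
    have h2 : ContDiffOn ℝ ∞ (fun w : ℝ × 𝔼 (Fin n) => ν.comp p w.2) (univ ×ˢ chartDom n m E p) :=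
      ((ν.contDiffOn_comp p).mono inter_subset_left).comp contDiff_snd.contDiffOn fun w hw => hw.2
    exact h1.div h2 fun w hw => ν.comp_ne_zero hw.2.1
  have hΩ : IsOpen ((univ : Set ℝ) ×ˢ chartDom n m E p) := isOpen_univ.prod hU
  have hdΦ := (contDiffOn_fderiv_apply hΩ hΦ ((1 : ℝ), (0 : 𝔼 (Fin n)))).continuousOn
  obtain ⟨hK', hK'U⟩ := isCompact_chart_image hK hKp
  obtain ⟨C, hC⟩ := ((isCompact_Icc (a := (-1 : ℝ)) (b := 1)).prod hK').exists_bound_of_continuousOn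
    (hdΦ.mono (prod_mono (subset_univ _) hK'U))
  have hder : ∀ r, ∀ ε : ℝ, HasDerivAt (fun ε : ℝ => ν.dens α (fun q => s q + ε • h q) r)
      (K.indicator (fun r => fderiv ℝ Φ (ε, ch p r) (1, 0)) r) ε := fun r ε => by
    by_cases hr : r ∈ K
    · have hrp := hKp hr
      rw [indicator_of_mem hr]
      have h1 := (hΦ.differentiableAt_of_isOpen hΩ
        (x := (ε, ch p r)) ⟨mem_univ _, chart_mem_chartDom hrp.1 hrp.2⟩).hasFDerivAt
      have h2 : HasDerivAt (fun ε : ℝ => (ε, ch p r)) (1, 0) ε :=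
        (hasDerivAt_id ε).prodMk (hasDerivAt_const ε _)
      refine (h1.comp_hasDerivAt ε h2).congr_of_eventuallyEq (.of_forall fun ε' => ?_)
      exact ν.dens_eq hN hrp (hv.smooth ε')
    · rw [indicator_of_notMem hr]
      refine (hasDerivAt_const ε (ν.dens α (fun q => s q + (0 : ℝ) • h q) r)).congr_of_eventuallyEq
        (.of_forall fun ε' => ?_)
      exact hv.dens_eq ν α hK.isClosed hr ε'
  have hint : ∀ ε : ℝ, Integrable (ν.dens α fun q => s q + ε • h q) μ := fun ε => by
    have hc := isCompactSection_add_smul hs hK hh ε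
    obtain ⟨K1, hK1, hz⟩ := (hα' _ hc).1
    exact hμ.integrable_dens hN hc.1 hK1 hz
  have hmeas : AEStronglyMeasurable (K.indicator fun r => fderiv ℝ Φ ((0 : ℝ), ch p r) (1, 0)) μ := by
    refine (aestronglyMeasurable_indicator_iff hK.measurableSet).2
      (ContinuousOn.aestronglyMeasurable (s := K) ?_ hK.measurableSet)
    exact (hdΦ.comp (continuousOn_const.prodMk ((ch p).continuousOn_toFun.mono fun r hr => (hKp hr).1))
      fun r hr => ⟨mem_univ _, chart_mem_chartDom (hKp hr).1 (hKp hr).2⟩)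
  have key := hasDerivAt_integral_of_dominated_loc_of_deriv_le (μ := μ) (x₀ := (0 : ℝ))
    (F := fun ε r => ν.dens α (fun q => s q + ε • h q) r)
    (F' := fun ε r => K.indicator (fun r => fderiv ℝ Φ (ε, ch p r) (1, 0)) r)
    (bound := K.indicator fun _ => C) (s := Icc (-1) 1) (Icc_mem_nhds (by norm_num) (by norm_num))
    (.of_forall fun ε => (hint ε).aestronglyMeasurable) (hint 0) hmeas
    (.of_forall fun r ε hε => ?_) ?_ (.of_forall fun r ε hε => hder r ε)
  · have e : (fun ε : ℝ => ∫ r, ν.dens α (fun q => s q + ε • h q) r ∂μ) = fun _ => 0 := funext fun ε =>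
      h0 _ (isCompactSection_add_smul hs hK hh ε)
    rw [e] at key
    have h2 := key.2.unique (hasDerivAt_const (0 : ℝ) (0 : ℝ))
    exact (integral_congr_ae (.of_forall fun r => (hder r 0).deriv)).trans h2
  · by_cases hr : r ∈ K
    · rw [indicator_of_mem hr, indicator_of_mem hr]
      exact hC (ε, ch p r) ⟨hε, mem_image_of_mem _ hr⟩
    · rw [indicator_of_notMem hr, indicator_of_notMem hr, norm_zero]
  · exact (integrable_indicator_iff hK.measurableSet).2 (integrableOn_const hK.measure_lt_top.ne)

/-- A form whose functional vanishes has vanishing Euler-Lagrange form. -/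
theorem VolumeForm.IsMeasure.euler_eq_zero_of_functional (hμ : ν.IsMeasure μ) {α : RawForm n m E n}
    (hα : α ∈ omegaC n m E n) (h0 : ∀ s, IsCompactSection n m s → functional ν μ α s = 0)
    (j : JetInf n m E) : euler α j = 0 := by
  obtain ⟨N, hN⟩ := hα.1
  obtain ⟨l, hl⟩ := exists_euler_dependsTo (hN : HasOrder N α)
  obtain ⟨s, hs, hj⟩ := exists_section_jet j l
  refine (hl j.pt j.coeff (jet n m s j.pt).coeff fun I hI => (hj I hI).symm).trans ?_
  exact hμ.euler_eq_zero hN hs.1 (isOpen_coordDom (n := n) (m := m) (E := E) j.pt) (mem_coordDom_self _)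
    fun K h hK hKp hh => hμ.integral_deriv_dens_eq_zero hα h0 hs hK hKp hh

end FunctionalZero

section Jacobiator
set_option linter.unusedSectionVars false
variable {n m : ℕ} {M : Type*} [TopologicalSpace M] [ChartedSpace (EuclideanSpace ℝ (Fin n)) M]
  [IsManifold (𝓡 n) ∞ M]
  {E : M → Type*} [∀ p, AddCommGroup (E p)] [∀ p, Module ℝ (E p)] [∀ p, TopologicalSpace (E p)]
  [TopologicalSpace (TotalSpace (Fin m → ℝ) E)] [FiberBundle (Fin m → ℝ) E]
  [VectorBundle ℝ (Fin m → ℝ) E] [ContMDiffVectorBundle ∞ (Fin m → ℝ) E (𝓡 n)]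

local notation "ch" => chartAt (EuclideanSpace ℝ (Fin n))
local notation "tr" => trivializationAt (Fin m → ℝ) E

variable [T2Space M] {N k : ℕ}

/-- The product of a form with a function on `M`. -/
noncomputable def mulFun (f : M → ℝ) (α : RawForm n m E k) : RawForm n m E k := fun j => f j.pt • α j

theorem HasOrder.mulFun {f : M → ℝ} (hf : ContMDiff (𝓡 n) 𝓘(ℝ) ∞ f) {α : RawForm n m E k}
    (hα : HasOrder N α) : HasOrder N (mulFun f α) := by
  intro p
  have h1 : ContDiffOn ℝ ∞ (fun y => f ((ch p).symm y)) (chartDom n m E p) := fun y hy =>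
    (contMDiffAt_iff_contDiffAt.1 ((hf _).comp y (contMDiffAt_chart_symm hy.1))).contDiffWithinAt
  exact ((isSmoothOfOrder_fst h1).smul (hα p)).mono (by simp)

theorem mulFun_eq_zero {f : M → ℝ} {α : RawForm n m E k} {j : JetInf n m E} (h : f j.pt = 0) :
    mulFun f α j = 0 := by
  unfold mulFun
  rw [h, zero_smul]

theorem euler_mulFun_eq_zero {f : M → ℝ} {α : RawForm n m E k} {j : JetInf n m E} (h : j.pt ∉ tsupport f) :
    euler (mulFun f α) j = 0 := by
  refine (euler_congr_of_isOpen (isClosed_tsupport f).isOpen_compl (β := 0) (fun j hj => ?_) h).trans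
    (euler_zero j)
  exact mulFun_eq_zero (image_eq_zero_of_notMem_tsupport hj)

theorem mulFun_mem_omegaC {f : M → ℝ} (hf : ContMDiff (𝓡 n) 𝓘(ℝ) ∞ f) (hc : HasCompactSupport f)
    {α : RawForm n m E k} (hα : IsHorizontal α) : mulFun f α ∈ omegaC n m E k := by
  obtain ⟨N, hN⟩ := hα
  refine ⟨⟨N, HasOrder.mulFun hf hN⟩, fun s _ => ⟨⟨tsupport f, hc, fun p hp => ?_⟩,
    fun _ => ⟨tsupport f, hc, fun p hp => euler_mulFun_eq_zero hp⟩⟩⟩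
  exact mulFun_eq_zero (image_eq_zero_of_notMem_tsupport hp)

theorem RawForm.neg_one_smul (α : RawForm n m E k) : (-1 : ℝ) • α = -α :=
  funext fun j => ContinuousAlternatingMap.ext fun v => neg_one_mul (α j v)

variable {ν : VolumeForm n M}

theorem SkewTensor.l2_skew (w : SkewTensor m E ν) (α β : RawForm n m E n) : w.l2 α β = -w.l2 β α := by
  funext j
  show w.val j (euler α j) (euler β j) • ν.val j.pt = -(w.val j (euler β j) (euler α j) • ν.val j.pt)
  rw [w.skew j]
  exact ContinuousAlternatingMap.ext fun v => neg_mul _ _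

theorem SkewTensor.l2_lin_left (w : SkewTensor m E ν) {α α' : RawForm n m E n} (hα : IsHorizontal α)
    (hα' : IsHorizontal α') (c : ℝ) (β : RawForm n m E n) :
    w.l2 (c • α + α') β = c • w.l2 α β + w.l2 α' β := by
  funext j
  show w.val j (euler (c • α + α') j) (euler β j) • ν.val j.pt
    = c • (w.val j (euler α j) (euler β j) • ν.val j.pt) + w.val j (euler α' j) (euler β j) • ν.val j.pt
  rw [euler_lin hα hα', map_add, map_smul, LinearMap.add_apply, LinearMap.smul_apply, add_smul, smul_eq_mul,
    mul_smul]

theorem SkewTensor.l2_lin_right (w : SkewTensor m E ν) {α α' : RawForm n m E n} (hα : IsHorizontal α)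
    (hα' : IsHorizontal α') (c : ℝ) (β : RawForm n m E n) :
    w.l2 β (c • α + α') = c • w.l2 β α + w.l2 β α' := by
  rw [w.l2_skew β, w.l2_lin_left hα hα', w.l2_skew β α, w.l2_skew β α', smul_neg, neg_add]

theorem SkewTensor.l2_apply_eq_zero_left (w : SkewTensor m E ν) {α : RawForm n m E n} {j : JetInf n m E}
    (hα : euler α j = 0) (β : RawForm n m E n) : w.l2 α β j = 0 := by
  show w.val j (euler α j) (euler β j) • ν.val j.pt = 0
  rw [hα, map_zero, LinearMap.zero_apply, zero_smul]

theorem SkewTensor.l2_apply_eq_zero_right (w : SkewTensor m E ν) (α : RawForm n m E n) {β : RawForm n m E n}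
    {j : JetInf n m E} (hβ : euler β j = 0) : w.l2 α β j = 0 := by
  show w.val j (euler α j) (euler β j) • ν.val j.pt = 0
  rw [hβ, map_zero, zero_smul]

theorem SkewTensor.l2_eq_zero_left (w : SkewTensor m E ν) {α : RawForm n m E n} (hα : ∀ j, euler α j = 0)
    (β : RawForm n m E n) : w.l2 α β = 0 := funext fun j => w.l2_apply_eq_zero_left (hα j) β

theorem SkewTensor.l2_eq_zero_right (w : SkewTensor m E ν) (α : RawForm n m E n) {β : RawForm n m E n}
    (hβ : ∀ j, euler β j = 0) : w.l2 α β = 0 := funext fun j => w.l2_apply_eq_zero_right α (hβ j)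

/-- The Jacobiator of `l̃_2`. -/
noncomputable def SkewTensor.jac (w : SkewTensor m E ν) (α β γ : RawForm n m E n) : RawForm n m E n :=
  w.l2 (w.l2 α β) γ + w.l2 (w.l2 β γ) α + w.l2 (w.l2 γ α) β

variable [SecondCountableTopology M] [MeasurableSpace M] [BorelSpace M] {μ : Measure M}

theorem VolumeForm.IsMeasure.functional_add (hμ : ν.IsMeasure μ) {α β : RawForm n m E n}
    (hα : α ∈ omegaC n m E n) (hβ : β ∈ omegaC n m E n) {s : ∀ q, E q} (hs : IsCompactSection n m s) :
    functional ν μ (α + β) s = functional ν μ α s + functional ν μ β s := by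
  obtain ⟨⟨N, hN⟩, hα'⟩ := hα
  obtain ⟨⟨N', hN'⟩, hβ'⟩ := hβ
  obtain ⟨⟨K, hK, h0⟩, -⟩ := hα' s hs
  obtain ⟨⟨K', hK', h0'⟩, -⟩ := hβ' s hs
  rw [functional_eq, functional_eq, functional_eq,
    ← integral_add (hμ.integrable_dens hN hs.1 hK h0) (hμ.integrable_dens hN' hs.1 hK' h0')]
  refine integral_congr_ae (.of_forall fun r => ?_)
  exact map_add (ν.quotₗ r) (α (jet n m s r)) (β (jet n m s r))

theorem SkewTensor.jac_mem (w : SkewTensor m E ν) (hμ : ν.IsMeasure μ) {α β γ : RawForm n m E n}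
    (hα : α ∈ omegaC n m E n) (hβ : β ∈ omegaC n m E n) (hγ : γ ∈ omegaC n m E n) :
    w.jac α β γ ∈ omegaC n m E n :=
  add_mem (add_mem (w.l2_mem_omegaC hμ (w.l2_mem_omegaC hμ hα hβ) hγ)
    (w.l2_mem_omegaC hμ (w.l2_mem_omegaC hμ hβ hγ) hα)) (w.l2_mem_omegaC hμ (w.l2_mem_omegaC hμ hγ hα) hβ)

theorem SkewTensor.functional_jac (w : SkewTensor m E ν) (hμ : ν.IsMeasure μ) (hJ : w.Jacobi μ)
    {α β γ : RawForm n m E n} (hα : α ∈ omegaC n m E n) (hβ : β ∈ omegaC n m E n) (hγ : γ ∈ omegaC n m E n)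
    {s : ∀ q, E q} (hs : IsCompactSection n m s) : functional ν μ (w.jac α β γ) s = 0 := by
  have h1 := w.l2_mem_omegaC hμ (w.l2_mem_omegaC hμ hα hβ) hγ
  have h2 := w.l2_mem_omegaC hμ (w.l2_mem_omegaC hμ hβ hγ) hα
  have h3 := w.l2_mem_omegaC hμ (w.l2_mem_omegaC hμ hγ hα) hβ
  unfold SkewTensor.jac
  rw [hμ.functional_add (add_mem h1 h2) h3 hs, hμ.functional_add h1 h2 hs]
  exact hJ α hα β hβ γ hγ s hs

theorem SkewTensor.euler_jac (w : SkewTensor m E ν) (hμ : ν.IsMeasure μ) (hJ : w.Jacobi μ)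
    {α β γ : RawForm n m E n} (hα : α ∈ omegaC n m E n) (hβ : β ∈ omegaC n m E n) (hγ : γ ∈ omegaC n m E n)
    (j : JetInf n m E) : euler (w.jac α β γ) j = 0 :=
  hμ.euler_eq_zero_of_functional (w.jac_mem hμ hα hβ hγ) (fun _ hs => w.functional_jac hμ hJ hα hβ hγ hs) j

theorem SkewTensor.jac_lin (w : SkewTensor m E ν) (hμ : ν.IsMeasure μ) {α α' β γ : RawForm n m E n}
    (hα : α ∈ omegaC n m E n) (hα' : α' ∈ omegaC n m E n) (hβ : β ∈ omegaC n m E n) (hγ : γ ∈ omegaC n m E n)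
    (c : ℝ) : w.jac (c • α + α') β γ = c • w.jac α β γ + w.jac α' β γ := by
  unfold SkewTensor.jac
  rw [w.l2_lin_left hα.1 hα'.1, w.l2_lin_right hα.1 hα'.1, w.l2_lin_right hα.1 hα'.1,
    w.l2_lin_left (w.l2_mem_omegaC hμ hα hβ).1 (w.l2_mem_omegaC hμ hα' hβ).1,
    w.l2_lin_left (w.l2_mem_omegaC hμ hγ hα).1 (w.l2_mem_omegaC hμ hγ hα').1]
  module

theorem SkewTensor.jac_rotate (w : SkewTensor m E ν) (α β γ : RawForm n m E n) :
    w.jac β γ α = w.jac α β γ := by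
  unfold SkewTensor.jac
  abel

theorem SkewTensor.jac_swap (w : SkewTensor m E ν) (hμ : ν.IsMeasure μ) {α β γ : RawForm n m E n}
    (hα : α ∈ omegaC n m E n) (hβ : β ∈ omegaC n m E n) (hγ : γ ∈ omegaC n m E n) :
    w.jac β α γ = -w.jac α β γ := by
  have hneg : ∀ {α β γ : RawForm n m E n}, α ∈ omegaC n m E n → β ∈ omegaC n m E n →
      w.l2 (w.l2 β α) γ = -w.l2 (w.l2 α β) γ := fun {α β γ} hα hβ => by
    have h := w.l2_lin_left (w.l2_mem_omegaC hμ hα hβ).1 isHorizontal_zero (-1) γ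
    rw [add_zero, w.l2_eq_zero_left euler_zero, add_zero] at h
    rw [w.l2_skew β α, ← RawForm.neg_one_smul, h, RawForm.neg_one_smul]
  unfold SkewTensor.jac
  rw [hneg hα hβ, hneg hγ hα, hneg hβ hγ]
  abel

/-- Locality of the bracket. -/
theorem SkewTensor.l2_congr_of_isOpen (w : SkewTensor m E ν) {O : Set M} (hO : IsOpen O)
    {α α' β β' : RawForm n m E n} (hα : ∀ j : JetInf n m E, j.pt ∈ O → α j = α' j)
    (hβ : ∀ j : JetInf n m E, j.pt ∈ O → β j = β' j) {j : JetInf n m E} (hj : j.pt ∈ O) :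
    w.l2 α β j = w.l2 α' β' j := by
  unfold SkewTensor.l2
  rw [euler_congr_of_isOpen hO hα hj, euler_congr_of_isOpen hO hβ hj]

theorem SkewTensor.jac_congr_of_isOpen (w : SkewTensor m E ν) {O : Set M} (hO : IsOpen O)
    {α α' β γ : RawForm n m E n} (hα : ∀ j : JetInf n m E, j.pt ∈ O → α j = α' j)
    {j : JetInf n m E} (hj : j.pt ∈ O) : w.jac α β γ j = w.jac α' β γ j := by
  have h1 := w.l2_congr_of_isOpen hO (fun j hj => w.l2_congr_of_isOpen hO hα (β := β) (fun _ _ => rfl) hj)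
    (β := γ) (fun _ _ => rfl) hj
  have h2 := w.l2_congr_of_isOpen hO (α := w.l2 β γ) (fun _ _ => rfl) hα hj
  have h3 := w.l2_congr_of_isOpen hO (fun j hj => w.l2_congr_of_isOpen hO (α := γ) (fun _ _ => rfl) hα hj)
    (β := β) (fun _ _ => rfl) hj
  show w.l2 (w.l2 α β) γ j + w.l2 (w.l2 β γ) α j + w.l2 (w.l2 γ α) β j = _
  rw [h1, h2, h3]
  rfl

theorem SkewTensor.jac_zero_left (w : SkewTensor m E ν) (β γ : RawForm n m E n) : w.jac 0 β γ = 0 := by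
  unfold SkewTensor.jac
  rw [w.l2_eq_zero_left euler_zero β, w.l2_eq_zero_right γ euler_zero, w.l2_eq_zero_right _ euler_zero,
    w.l2_eq_zero_left euler_zero, w.l2_eq_zero_left euler_zero]
  simp

end Jacobiator

section OrderZero
set_option linter.unusedSectionVars false
variable {n m : ℕ} {M : Type*} [TopologicalSpace M] [ChartedSpace (EuclideanSpace ℝ (Fin n)) M]
  [IsManifold (𝓡 n) ∞ M]
  {E : M → Type*} [∀ p, AddCommGroup (E p)] [∀ p, Module ℝ (E p)] [∀ p, TopologicalSpace (E p)]
  [TopologicalSpace (TotalSpace (Fin m → ℝ) E)] [FiberBundle (Fin m → ℝ) E]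
  [VectorBundle ℝ (Fin m → ℝ) E] [ContMDiffVectorBundle ∞ (Fin m → ℝ) E (𝓡 n)]

local notation "ch" => chartAt (EuclideanSpace ℝ (Fin n))
local notation "tr" => trivializationAt (Fin m → ℝ) E

variable [T2Space M] {N k : ℕ}

theorem eulerOp_of_order_zero {W : Type*} [NormedAddCommGroup W] [NormedSpace ℝ W] {U : Set (𝔼 (Fin n))}
    (hU : IsOpen U) {f : JetCoord n m → W} (hf : IsSmoothOfOrder U 0 f) (a : Fin m) {z : JetCoord n m}
    (hz : z.1 ∈ U) : eulerOp a f z = jetD 0 a f z := by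
  unfold eulerOp
  rw [finsum_eq_single _ (0 : Fin n → ℕ)]
  · simp [iterOp_zero]
  · intro I hI
    have h0 : I ∉ idxLE n 0 := fun h => hI (by
      rw [mem_idxLE, Nat.le_zero, Finset.sum_eq_zero_iff] at h
      exact funext fun i => h i (Finset.mem_univ i))
    rw [iterOp_totalD_zero hU I (fun z hz => jetD_eq_zero hU hf h0 a hz) z hz, smul_zero]

theorem jetD_smul_fst {W : Type*} [NormedAddCommGroup W] [NormedSpace ℝ W] (I : Fin n → ℕ) (a : Fin m)
    (φ : 𝔼 (Fin n) → ℝ) (f : JetCoord n m → W) (z : JetCoord n m) :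
    jetD I a (fun z => φ z.1 • f z) z = φ z.1 • jetD I a f z := by
  unfold jetD lineDeriv
  simp only [Prod.fst_add, Prod.smul_fst, smul_zero, add_zero]
  exact deriv_fun_const_smul_field _ _

theorem euler_mulFun_of_order_zero {f : M → ℝ} (hf : ContMDiff (𝓡 n) 𝓘(ℝ) ∞ f) {α : RawForm n m E k}
    (hα : HasOrder 0 α) (j : JetInf n m E) : euler (mulFun f α) j = f j.pt • euler α j := by
  unfold euler
  rw [Finset.smul_sum]
  refine Finset.sum_congr rfl fun a _ => ?_
  have h1 : eulerOp a (inCoord j.pt (mulFun f α)) j.coord = f j.pt • eulerOp a (inCoord j.pt α) j.coord := by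
    rw [eulerOp_of_order_zero (isOpen_chartDom j.pt) (HasOrder.mulFun hf hα j.pt) a j.coord_mem,
      eulerOp_of_order_zero (isOpen_chartDom j.pt) (hα j.pt) a j.coord_mem]
    refine (jetD_smul_fst (W := 𝔼 (Fin n) [⋀^Fin k]→L[ℝ] ℝ) 0 a (fun y => f ((ch j.pt).symm y))
      (inCoord j.pt α) j.coord).trans ?_
    rw [j.symm_coord]
  have h2 := smulRight_lin (V := E j.pt) (fibreCoord m j.pt a j.pt)
    (Y := eulerOp a (inCoord j.pt α) j.coord) (Z := 0) (f j.pt) (h1.trans (add_zero _).symm)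
  refine Eq.trans h2 ?_
  have h3 : (fibreCoord m j.pt a j.pt : E j.pt →ₗ[ℝ] ℝ).smulRight
      (0 : TangentSpace (𝓡 n) j.pt [⋀^Fin k]→L[ℝ] ℝ) = 0 := LinearMap.ext fun v => smul_zero _
  refine (congrArg _ h3).trans ?_
  exact add_zero _

/-- The value of a section with a given jet. -/
noncomputable def JetInf.value {n m : ℕ} {M : Type*} [TopologicalSpace M]
    {E : M → Type*} [∀ p, AddCommGroup (E p)]
    [∀ p, TopologicalSpace (E p)] [TopologicalSpace (TotalSpace (Fin m → ℝ) E)]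
    [FiberBundle (Fin m → ℝ) E] (j : JetInf n m E) : E j.pt :=
  (trivializationAt (Fin m → ℝ) E j.pt).symm j.pt (j.coeff 0)

theorem value_eq {r : M} {c : (Fin n → ℕ) → Fin m → ℝ} {s : ∀ q, E q} (h : c 0 = (jet n m s r).coeff 0) :
    (⟨r, c⟩ : JetInf n m E).value = s r := by
  have h1 : (jet n m s r).coeff 0 = (tr r ⟨r, s r⟩).2 := by
    rw [jet_coeff, iterOp_zero]
    exact congrArg (fun q => (tr r ⟨q, s q⟩).2) ((ch r).left_inv (mem_chart_source _ r))
  unfold JetInf.value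
  simp only
  rw [h, h1, (tr r).symm_apply_apply_mk (mem_coordDom_self (n := n) (m := m) (E := E) r).2]

theorem polySection_zero_apply (p : M) (z : JetCoord n m) (q : M) (hq : ch p q = z.1) :
    polySection E p z 0 q = (tr p).symm q (z.2 0) := by
  unfold polySection
  have h := iterOp_partialD_taylorPoly z 0 0 (by simp)
  rw [iterOp_zero] at h
  rw [hq, h]

theorem value_ofCoord {p : M} {z : JetCoord n m} (hz : z.1 ∈ chartDom n m E p) :
    (ofCoord E p z).value = (tr p).symm ((ch p).symm z.1) (z.2 0) := by
  refine (value_eq (c := (ofCoord E p z).coeff) (s := polySection E p z 0) ?_).trans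
    (polySection_zero_apply p z _ ((ch p).right_inv hz.1))
  show (jet n m (polySection E p z (∑ i, (0 : Fin n → ℕ) i)) ((ch p).symm z.1)).coeff 0 = _
  simp

theorem FibreAction.value_prolong {G : Type*} [Group G] (A : FibreAction n m G E) (g : G) (j : JetInf n m E) :
    (A.prolong g j).value = A.act g j.pt j.value := by
  refine (value_eq (c := (A.prolong g j).coeff)
    (s := fun q => A.act g q (polySection E j.pt j.coord 0 q)) ?_).trans
    (congrArg (A.act g j.pt) (polySection_zero_apply j.pt j.coord _ rfl))
  show (jet n m (fun q => A.act g q (polySection E j.pt j.coord (∑ i, (0 : Fin n → ℕ) i) q)) j.pt).coeff 0 = _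
  simp

/-- The form of order zero with density `F`. -/
noncomputable def ordZero (ν : VolumeForm n M) (F : ∀ q, E q → ℝ) : RawForm n m E n := fun j =>
  F j.pt j.value • ν.val j.pt

/-- `F` is a smooth function on the total space. -/
abbrev SmoothOnTotal (n m : ℕ) {M : Type*} [TopologicalSpace M]
    [ChartedSpace (EuclideanSpace ℝ (Fin n)) M] {E : M → Type*}
    [∀ p, TopologicalSpace (E p)] [TopologicalSpace (TotalSpace (Fin m → ℝ) E)]
    [FiberBundle (Fin m → ℝ) E] (F : ∀ q, E q → ℝ) : Prop :=
  ContMDiff ((𝓡 n).prod 𝓘(ℝ, Fin m → ℝ)) 𝓘(ℝ) ∞ (fun v : TotalSpace (Fin m → ℝ) E => F v.1 v.2)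

variable {ν : VolumeForm n M}

theorem hasOrder_ordZero {F : ∀ q, E q → ℝ} (hF : SmoothOnTotal n m F) :
    HasOrder 0 (ordZero ν F : RawForm n m E n) := by
  intro p
  have h0 : (0 : Fin n → ℕ) ∈ idxLE n 0 := mem_idxLE.2 (by simp)
  have h1 : IsSmoothOfOrder (chartDom n m E p) 0 fun z : JetCoord n m =>
      F ((ch p).symm z.1) ((tr p).symm ((ch p).symm z.1) (z.2 0)) := by
    refine ⟨fun w => F ((ch p).symm w.1) ((tr p).symm ((ch p).symm w.1) (w.2 ⟨0, h0⟩)), fun w hw => ?_,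
      fun _ _ => rfl⟩
    have hb : ContMDiffAt 𝓘(ℝ, 𝔼 (Fin n) × (idxLE n 0 → Fin m → ℝ)) (𝓡 n) ∞
        (fun w : 𝔼 (Fin n) × (idxLE n 0 → Fin m → ℝ) => (ch p).symm w.1) w :=
      (contMDiffAt_chart_symm hw.1.1).comp w contDiffAt_fst.contMDiffAt
    have h := contMDiffAt_fibrePoint (p := p) smoothFibreMap_id hb
      (v := fun w => w.2 ⟨0, h0⟩) (by fun_prop) hw.1.2
    exact (contMDiffAt_iff_contDiffAt.1 ((hF _).comp w h)).contDiffWithinAt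
  refine ((h1.smul (isSmoothOfOrder_fst ((ν.smooth p).mono inter_subset_left))).mono (l := 0)
    (by simp)).congr fun z hz => ?_
  refine congrArg (fun v : E ((ch p).symm z.1) => F ((ch p).symm z.1) v • formInChart p ((ch p).symm z.1)
    (ν.val ((ch p).symm z.1))) (value_ofCoord hz)

theorem FibreAction.pullback_ordZero {G : Type*} [Group G] (A : FibreAction n m G E) (g : G)
    (F : ∀ q, E q → ℝ) : A.pullback g (ordZero ν F : RawForm n m E n) = ordZero ν fun q v => F q (A.act g q v) :=
  funext fun j => congrArg (fun v : E j.pt => F j.pt v • ν.val j.pt) (A.value_prolong g j)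

theorem ordZero_mem_omegaC {F : ∀ q, E q → ℝ} (hF : SmoothOnTotal n m F) {K : Set M} (hK : IsCompact K)
    (h0 : ∀ q ∉ K, ∀ v, F q v = 0) : (ordZero ν F : RawForm n m E n) ∈ omegaC n m E n := by
  have h1 : ∀ j : JetInf n m E, j.pt ∈ Kᶜ → ordZero ν F j = (0 : RawForm n m E n) j := fun j hj =>
    (congrArg (· • ν.val j.pt) (h0 _ hj _)).trans (zero_smul ℝ _)
  exact ⟨⟨0, hasOrder_ordZero hF⟩, fun s _ => ⟨⟨K, hK, fun p hp => h1 (jet n m s p) hp⟩,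
    fun _ => ⟨K, hK, fun p hp =>
      (euler_congr_of_isOpen hK.isClosed.isOpen_compl h1 (j := jet n m s p) hp).trans (euler_zero _)⟩⟩⟩

theorem smoothOnTotal_comp {F : ∀ q, E q → ℝ} (hF : SmoothOnTotal n m F) {a : ∀ q, E q → E q}
    (ha : SmoothFibreMap n m a) : SmoothOnTotal n m fun q v => F q (a q v) :=
  ContMDiff.comp (g := fun v : TotalSpace (Fin m → ℝ) E => F v.1 v.2) hF ha

/-- A linear function on the fibres near `r`, cut off. -/
theorem exists_smoothOnTotal (r : M) (ℓ : (Fin m → ℝ) →L[ℝ] ℝ) :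
    ∃ (K : Set M) (F : ∀ q, E q → ℝ), IsCompact K ∧ SmoothOnTotal n m F ∧ (∀ q ∉ K, ∀ v, F q v = 0) ∧
      ∀ v, F r v = ℓ (tr r ⟨r, v⟩).2 := by
  obtain ⟨f, hf, hfc, hfO, hf1⟩ := exists_bump (n := n) (isOpen_coordDom (n := n) (m := m) (E := E) r)
    (mem_coordDom_self r)
  refine ⟨tsupport f, fun q v => f q * ℓ (tr r ⟨q, v⟩).2, hfc, fun v => ?_, fun q hq v => ?_, fun v => ?_⟩
  · have hpr : ContMDiff ((𝓡 n).prod 𝓘(ℝ, Fin m → ℝ)) (𝓡 n) ∞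
        (fun v : TotalSpace (Fin m → ℝ) E => v.1) := Bundle.contMDiff_proj E
    by_cases hv : v.1 ∈ coordDom n m E r
    · have h1 : ContMDiffAt ((𝓡 n).prod 𝓘(ℝ, Fin m → ℝ)) ((𝓡 n).prod 𝓘(ℝ, Fin m → ℝ)) ∞ (tr r) v :=
        ((tr r).contMDiffOn (IB := 𝓡 n) (n := ∞)).contMDiffAt
          ((tr r).open_source.mem_nhds ((tr r).mem_source.2 hv.2))
      have h2 : ContMDiffAt ((𝓡 n).prod 𝓘(ℝ, Fin m → ℝ)) 𝓘(ℝ) ∞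
          (fun v : TotalSpace (Fin m → ℝ) E => ℓ (tr r v).2) v :=
        (ℓ.contMDiff (x := (tr r v).2)).comp v (contMDiffAt_snd.comp v h1)
      exact ((hf _).comp v (hpr v)).mul h2
    · refine (contMDiffAt_const (c := (0 : ℝ))).congr_of_eventuallyEq ?_
      have : ∀ᶠ v' : TotalSpace (Fin m → ℝ) E in 𝓝 v, v'.1 ∈ (tsupport f)ᶜ :=
        hpr.continuous.continuousAt.eventually_mem
          ((isClosed_tsupport f).isOpen_compl.mem_nhds fun h => hv (hfO h))
      filter_upwards [this] with v' hv'
      rw [image_eq_zero_of_notMem_tsupport hv', zero_mul]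
  · show f q * _ = 0
    rw [image_eq_zero_of_notMem_tsupport hq, zero_mul]
  · show f r * _ = _
    rw [hf1.self_of_nhds, one_mul]

theorem euler_ordZero_linear {r : M} {F : ∀ q, E q → ℝ} (hF : SmoothOnTotal n m F) {ℓ : (Fin m → ℝ) →L[ℝ] ℝ}
    (hℓ : ∀ v, F r v = ℓ (tr r ⟨r, v⟩).2) (c : (Fin n → ℕ) → Fin m → ℝ) (v : E r) :
    (euler (ordZero ν F : RawForm n m E n) ⟨r, c⟩ : E r →ₗ[ℝ] TangentSpace (𝓡 n) r [⋀^Fin n]→L[ℝ] ℝ) v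
      = ℓ (tr r ⟨r, v⟩).2 • ν.val r := by
  set j : JetInf n m E := ⟨r, c⟩
  have hr := (mem_coordDom_self (n := n) (m := m) (E := E) r)
  have h1 : ∀ a, eulerOp a (inCoord r (ordZero ν F : RawForm n m E n)) j.coord
      = ℓ (Pi.single a 1) • formInChart r r (ν.val r) := fun a => by
    rw [eulerOp_of_order_zero (isOpen_chartDom r) (hasOrder_ordZero hF r) a j.coord_mem]
    unfold jetD
    refine HasLineDerivAt.lineDeriv ?_
    unfold HasLineDerivAt
    have h2 : HasDerivAt (fun t : ℝ => (ℓ (c 0) + t • ℓ (Pi.single a 1)) • formInChart r r (ν.val r))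
        (ℓ (Pi.single a 1) • formInChart r r (ν.val r)) 0 := 
      (hasDerivAt_line _ _ _).smul_const (F := 𝔼 (Fin n) [⋀^Fin n]→L[ℝ] ℝ) _
    refine h2.congr_of_eventuallyEq (.of_forall fun t => ?_)
    set z : JetCoord n m := j.coord + t • ((0 : 𝔼 (Fin n)), Pi.single (0 : Fin n → ℕ) (Pi.single a (1 : ℝ)))
    have hz1 : z.1 = ch r r := by simp [z, j, JetInf.coord]
    have hz : z.1 ∈ chartDom n m E r := hz1 ▸ chart_mem_chartDom hr.1 hr.2
    have hz2 : z.2 0 = c 0 + t • Pi.single a (1 : ℝ) := by simp [z, j, JetInf.coord]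
    have hx : (ch r).symm z.1 = r := by rw [hz1, (ch r).left_inv hr.1]
    have h3 : inCoord r (ordZero ν F : RawForm n m E n) z
        = F ((ch r).symm z.1) ((tr r).symm ((ch r).symm z.1) (z.2 0))
          • formInChart r ((ch r).symm z.1) (ν.val ((ch r).symm z.1)) :=
      congrArg (fun v : E ((ch r).symm z.1) => F ((ch r).symm z.1) v • formInChart r ((ch r).symm z.1)
        (ν.val ((ch r).symm z.1))) (value_ofCoord hz)
    refine h3.trans ?_
    rw [hx, hℓ, (tr r).apply_mk_symm hr.2, hz2, map_add, map_smul]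
  show (∑ a, (fibreCoord m r a r).smulRight _ : E r →ₗ[ℝ] TangentSpace (𝓡 n) r [⋀^Fin n]→L[ℝ] ℝ) v = _
  rw [LinearMap.sum_apply]
  have h2 : ∀ a, (fibreCoord m r a r : E r →ₗ[ℝ] ℝ) v = (tr r ⟨r, v⟩).2 a := fun a => by
    rw [← linearMapAt_triv hr.2]
    rfl
  have h3 : ℓ (tr r ⟨r, v⟩).2 = ∑ a, (tr r ⟨r, v⟩).2 a * ℓ (Pi.single a 1) := by
    conv_lhs => rw [pi_eq_sum_univ' (tr r ⟨r, v⟩).2]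
    rw [map_sum]
    refine Finset.sum_congr rfl fun a _ => ?_
    rw [map_smul, smul_eq_mul]
  rw [h3]
  refine Eq.trans ?_ (Finset.sum_smul (R := ℝ) (M := TangentSpace (𝓡 n) r [⋀^Fin n]→L[ℝ] ℝ)).symm
  refine Finset.sum_congr rfl fun a _ => ?_
  have h4 := (h1 a).trans (congrArg (fun A : 𝔼 (Fin n) [⋀^Fin n]→L[ℝ] ℝ => ℓ (Pi.single a 1) • A) (formInChart_self r (ν.val r)))
  refine (congrArg (fun A : TangentSpace (𝓡 n) r [⋀^Fin n]→L[ℝ] ℝ => (fibreCoord m r a r : E r →ₗ[ℝ] ℝ) v • A) h4).trans ?_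
  rw [h2]
  exact (mul_smul _ _ _).symm

end OrderZero

section Action
set_option linter.unusedSectionVars false
variable {n m : ℕ} {M : Type*} [TopologicalSpace M] [ChartedSpace (EuclideanSpace ℝ (Fin n)) M]
  [IsManifold (𝓡 n) ∞ M]
  {E : M → Type*} [∀ p, AddCommGroup (E p)] [∀ p, Module ℝ (E p)] [∀ p, TopologicalSpace (E p)]
  [TopologicalSpace (TotalSpace (Fin m → ℝ) E)] [FiberBundle (Fin m → ℝ) E]
  [VectorBundle ℝ (Fin m → ℝ) E] [ContMDiffVectorBundle ∞ (Fin m → ℝ) E (𝓡 n)]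

local notation "ch" => chartAt (EuclideanSpace ℝ (Fin n))
local notation "tr" => trivializationAt (Fin m → ℝ) E

variable [T2Space M] {N k : ℕ} {G : Type*} [Group G]

theorem dH_mem_omegaG (A : FibreAction n m G E) {α : RawForm n m E k} (hα : α ∈ omegaG A k) :
    dH α ∈ omegaG A (k + 1) := by
  obtain ⟨N, hN⟩ := hα.1.1
  have hN : HasOrder N α := hN
  exact ⟨dH_mem_omegaC hα.1, fun g => by
    rw [A.pullback_dH g hN (by rw [hα.2 g]; exact hN), hα.2 g]⟩

theorem FibreAction.prolong_congr (A : FibreAction n m G E) (g : G) (r : M)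
    {c c' : (Fin n → ℕ) → Fin m → ℝ} (h : ∀ I, ∑ i, I i ≤ N → c I = c' I) (I : Fin n → ℕ)
    (hI : ∑ i, I i ≤ N) : (A.prolong g ⟨r, c⟩).coeff I = (A.prolong g ⟨r, c'⟩).coeff I := by
  have e : taylorPoly (JetInf.coord (⟨r, c⟩ : JetInf n m E)) (∑ i, I i)
      = taylorPoly (JetInf.coord (⟨r, c'⟩ : JetInf n m E)) (∑ i, I i) := by
    funext y
    unfold taylorPoly
    refine Finset.sum_congr rfl fun K hK => ?_
    show _ • c K = _ • c' K
    rw [h K ((mem_idxLE.1 hK).trans hI)]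
    rfl
  have e2 : polySection E r (JetInf.coord (⟨r, c⟩ : JetInf n m E)) (∑ i, I i)
      = polySection E r (JetInf.coord (⟨r, c'⟩ : JetInf n m E)) (∑ i, I i) := by
    unfold polySection
    rw [e]
  show (jet n m (fun q => A.act g q (polySection E r (JetInf.coord (⟨r, c⟩ : JetInf n m E)) (∑ i, I i) q)) r).coeff I
    = (jet n m (fun q => A.act g q (polySection E r (JetInf.coord (⟨r, c'⟩ : JetInf n m E)) (∑ i, I i) q)) r).coeff I
  rw [e2]

theorem FibreAction.dependsTo_pullback (A : FibreAction n m G E) (g : G) {α : RawForm n m E k}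
    (hα : FormDependsTo N α) : FormDependsTo N (A.pullback g α) := fun p c c' h =>
  hα p (A.prolong g ⟨p, c⟩).coeff (A.prolong g ⟨p, c'⟩).coeff fun I hI => A.prolong_congr g p h I hI

variable {ν : VolumeForm n M}

theorem SkewTensor.dens_l2_eq (w : SkewTensor m E ν) (α β : RawForm n m E n) (s : ∀ q, E q) (r : M) :
    ν.dens (w.l2 α β) s r = w.val (jet n m s r) (euler α (jet n m s r)) (euler β (jet n m s r)) :=
  ν.quot_self_smul r _

theorem SkewTensor.dens_l2_mulFun (w : SkewTensor m E ν) {f : M → ℝ} (hf : ContMDiff (𝓡 n) 𝓘(ℝ) ∞ f)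
    {α : RawForm n m E n} (hα : HasOrder 0 α) (β : RawForm n m E n) (s : ∀ q, E q) (r : M) :
    ν.dens (w.l2 (mulFun f α) β) s r = f r * ν.dens (w.l2 α β) s r := by
  rw [w.dens_l2_eq, w.dens_l2_eq, euler_mulFun_of_order_zero hf hα, map_smul, LinearMap.smul_apply, smul_eq_mul]
  rfl

variable [SecondCountableTopology M] [MeasurableSpace M] [BorelSpace M] {μ : Measure M}

theorem FibreAction.IsCanonical.dens_l2 {A : FibreAction n m G E} {w : SkewTensor m E ν}
    (hA : A.IsCanonical w μ) (hμ : ν.IsMeasure μ) (g : G) {α β : RawForm n m E n} (hα : HasOrder 0 α)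
    (hβ : HasOrder 0 β) (hα' : HasOrder 0 (A.pullback g α)) (hβ' : HasOrder 0 (A.pullback g β))
    (hβc : β ∈ omegaC n m E n) (hβc' : A.pullback g β ∈ omegaC n m E n)
    {s : ∀ q, E q} (hs : IsCompactSection n m s) (r : M) :
    ν.dens (w.l2 (A.pullback g α) (A.pullback g β)) s r = ν.dens (w.l2 α β) (fun q => A.act g q (s q)) r := by
  have hgs : ∀ r, SmoothSecAt n m (fun q => A.act g q (s q)) r := fun r => smoothSecAt_fibreMap (A.smooth g) (hs.1 r)
  obtain ⟨l, hl⟩ := w.exists_hasOrder_l2 hμ hα hβ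
  obtain ⟨l', hl'⟩ := w.exists_hasOrder_l2 hμ hα' hβ'
  have h1 := ν.continuous_dens hl hgs
  have h2 := ν.continuous_dens hl' hs.1
  have := hμ.isLocallyFinite
  refine sub_eq_zero.1 (hμ.eqOn_zero isOpen_univ (h2.sub h1).continuousOn (fun f hf hfc _ => ?_) (mem_univ r))
  have hint : ∀ {c : M → ℝ}, Continuous c → Integrable (fun r => f r * c r) μ := fun hc =>
    (hf.continuous.mul hc).integrable_of_hasCompactSupport hfc.mul_right
  have h3 := hA g (mulFun f α) (mulFun_mem_omegaC hf hfc ⟨0, hα⟩) β hβc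
    (mulFun_mem_omegaC hf hfc ⟨0, hα'⟩) hβc' s hs
  have e1 : functional ν μ (w.l2 (A.pullback g (mulFun f α)) (A.pullback g β)) s
      = ∫ r, f r * ν.dens (w.l2 (A.pullback g α) (A.pullback g β)) s r ∂μ :=
    integral_congr_ae (.of_forall fun r => w.dens_l2_mulFun hf hα' _ s r)
  have e2 : functional ν μ (w.l2 (mulFun f α) β) (fun q => A.act g q (s q))
      = ∫ r, f r * ν.dens (w.l2 α β) (fun q => A.act g q (s q)) r ∂μ :=
    integral_congr_ae (.of_forall fun r => w.dens_l2_mulFun hf hα _ _ r)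
  rw [e1, e2] at h3
  simp only [Pi.sub_apply, mul_sub]
  rw [integral_sub (hint h2) (hint h1), h3, sub_self]

theorem FibreAction.euler_pullback (A : FibreAction n m G E) (hμ : ν.IsMeasure μ) (g : G)
    {α : RawForm n m E n} (hα : HasOrder N α) (hα' : HasOrder N (A.pullback g α)) {s : ∀ q, E q}
    (hs : ∀ r, SmoothSecAt n m s r) (r : M) :
    (euler (A.pullback g α) (jet n m s r) : E r →ₗ[ℝ] TangentSpace (𝓡 n) r [⋀^Fin n]→L[ℝ] ℝ)
      = (euler α (jet n m (fun q => A.act g q (s q)) r) : E r →ₗ[ℝ] TangentSpace (𝓡 n) r [⋀^Fin n]→L[ℝ] ℝ)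
        ∘ₗ vertDeriv m (A.act g) r (s r) := by
  have h := hμ.euler_fibreMap hα hα' (A.smooth g) (fun s hs r => congrArg (ν.quot r)
    (A.pullback_jet g α isOpen_univ (fun r _ => hs r) (mem_univ r))) hs r
  refine LinearMap.ext fun v => ?_
  have h1 := LinearMap.congr_fun h v
  refine (ν.quot_smul_val r _).symm.trans (Eq.trans ?_ (ν.quot_smul_val r _))
  exact congrArg (· • ν.val r) h1

/-- Every functional-valued vertical form at a point is the Euler-Lagrange form of a form of order zero. -/
theorem exists_ordZero_euler (ν : VolumeForm n M) (r : M) (θ : E r →ₗ[ℝ] TangentSpace (𝓡 n) r [⋀^Fin n]→L[ℝ] ℝ) :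
    ∃ (K : Set M) (F : ∀ q, E q → ℝ), IsCompact K ∧ SmoothOnTotal n m F ∧ (∀ q ∉ K, ∀ v, F q v = 0) ∧
      ∀ c, (euler (ordZero ν F : RawForm n m E n) ⟨r, c⟩ : E r →ₗ[ℝ] TangentSpace (𝓡 n) r [⋀^Fin n]→L[ℝ] ℝ) = θ := by
  have hr := (mem_coordDom_self (n := n) (m := m) (E := E) r).2
  obtain ⟨K, F, hK, hF, h0, hℓ⟩ := exists_smoothOnTotal (n := n) (m := m) (E := E) r
    (LinearMap.toContinuousLinearMap (ν.quotₗ r ∘ₗ θ ∘ₗ (tr r).symmₗ ℝ r))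
  refine ⟨K, F, hK, hF, h0, fun c => LinearMap.ext fun v => ?_⟩
  refine (euler_ordZero_linear hF hℓ c v).trans (Eq.trans ?_ (ν.quot_smul_val r (θ v)))
  have h2 : (tr r).symmₗ ℝ r (tr r ⟨r, v⟩).2 = v := by
    rw [← linearMapAt_triv hr, (tr r).symmₗ_linearMapAt hr]
  exact congrArg (fun v => ν.quot r (θ v) • ν.val r) h2

theorem FibreAction.IsCanonical.val_eq {A : FibreAction n m G E} {w : SkewTensor m E ν}
    (hA : A.IsCanonical w μ) (hμ : ν.IsMeasure μ) (g : G) {s : ∀ q, E q} (hs : IsCompactSection n m s) (r : M)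
    (θ θ' : E r →ₗ[ℝ] TangentSpace (𝓡 n) r [⋀^Fin n]→L[ℝ] ℝ) :
    w.val (jet n m (fun q => A.act g q (s q)) r) θ θ'
      = w.val (jet n m s r) (θ ∘ₗ vertDeriv m (A.act g) r (s r)) (θ' ∘ₗ vertDeriv m (A.act g) r (s r)) := by
  obtain ⟨K, F, hK, hF, h0, hθ⟩ := exists_ordZero_euler (n := n) (m := m) (E := E) ν r θ
  obtain ⟨K', F', hK', hF', h0', hθ'⟩ := exists_ordZero_euler (n := n) (m := m) (E := E) ν r θ'
  have hg := fun {F : ∀ q, E q → ℝ} (hF : SmoothOnTotal n m F) => smoothOnTotal_comp hF (A.smooth g)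
  have ho : ∀ {F : ∀ q, E q → ℝ}, SmoothOnTotal n m F → HasOrder 0 (A.pullback g (ordZero ν F : RawForm n m E n)) :=
    fun hF => by rw [A.pullback_ordZero]; exact hasOrder_ordZero (hg hF)
  have hoc : A.pullback g (ordZero ν F' : RawForm n m E n) ∈ omegaC n m E n := by
    rw [A.pullback_ordZero]
    exact ordZero_mem_omegaC (hg hF') hK' fun q hq v => h0' q hq _
  have h1 := hA.dens_l2 hμ g (hasOrder_ordZero hF) (hasOrder_ordZero hF') (ho hF) (ho hF')
    (ordZero_mem_omegaC hF' hK' h0') hoc hs r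
  rw [w.dens_l2_eq, w.dens_l2_eq] at h1
  have e1 := A.euler_pullback hμ g (hasOrder_ordZero hF) (ho hF) hs.1 r
  have e2 := A.euler_pullback hμ g (hasOrder_ordZero hF') (ho hF') hs.1 r
  have e3 := hθ (jet n m (fun q => A.act g q (s q)) r).coeff
  have e4 := hθ' (jet n m (fun q => A.act g q (s q)) r).coeff
  replace e1 := e1.trans (congrArg (· ∘ₗ vertDeriv m (A.act g) r (s r)) e3)
  replace e2 := e2.trans (congrArg (· ∘ₗ vertDeriv m (A.act g) r (s r)) e4)
  have h2 := h1.symm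
  have e5 : w.val (jet n m (fun q => A.act g q (s q)) r)
      (euler (ordZero ν F) (jet n m (fun q => A.act g q (s q)) r))
      (euler (ordZero ν F') (jet n m (fun q => A.act g q (s q)) r))
      = w.val (jet n m (fun q => A.act g q (s q)) r) θ θ' :=
    congrArg₂ (fun a b : E r →ₗ[ℝ] TangentSpace (𝓡 n) r [⋀^Fin n]→L[ℝ] ℝ =>
      w.val (jet n m (fun q => A.act g q (s q)) r) a b) e3 e4
  refine e5.symm.trans (h2.trans ?_)
  exact congrArg₂ (fun a b : E r →ₗ[ℝ] TangentSpace (𝓡 n) r [⋀^Fin n]→L[ℝ] ℝ => w.val (jet n m s r) a b) e1 e2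

/-- `l̃_2` preserves invariant forms. -/
theorem FibreAction.IsCanonical.l2_mem_omegaG {A : FibreAction n m G E} {w : SkewTensor m E ν}
    (hA : A.IsCanonical w μ) (hμ : ν.IsMeasure μ) {α β : RawForm n m E n} (hα : α ∈ omegaG A n)
    (hβ : β ∈ omegaG A n) : w.l2 α β ∈ omegaG A n := by
  obtain ⟨N, hN⟩ := hα.1.1
  obtain ⟨N', hN'⟩ := hβ.1.1
  have hN1 : HasOrder (max N N') α := HasOrder.mono hN (le_max_left _ _)
  have hN2 : HasOrder (max N N') β := HasOrder.mono hN' (le_max_right _ _)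
  refine ⟨w.l2_mem_omegaC hμ hα.1 hβ.1, fun g => ?_⟩
  obtain ⟨l, hl⟩ := w.exists_hasOrder_l2 hμ hN1 hN2
  refine form_ext (A.dependsTo_pullback g hl.dependsTo) hl.dependsTo fun s hs r => ?_
  refine (A.pullback_jet g _ isOpen_univ (fun r _ => hs.1 r) (mem_univ r)).trans ?_
  have e1 := A.euler_pullback hμ g hN1 (by rw [hα.2 g]; exact hN1) hs.1 r
  have e2 := A.euler_pullback hμ g hN2 (by rw [hβ.2 g]; exact hN2) hs.1 r
  rw [hα.2 g] at e1
  rw [hβ.2 g] at e2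
  refine congrArg (· • ν.val r) ((hA.val_eq hμ g hs r _ _).trans ?_)
  exact congrArg₂ (fun a b : E r →ₗ[ℝ] TangentSpace (𝓡 n) r [⋀^Fin n]→L[ℝ] ℝ => w.val (jet n m s r) a b)
    e1.symm e2.symm

end Action

section ParametricIntegral

/-- The derivative in the first variables. -/
noncomputable def fderivFst {V W : Type} [NormedAddCommGroup V] [NormedSpace ℝ V] [NormedAddCommGroup W]
    [NormedSpace ℝ W] (F : V × ℝ → W) (w : V × ℝ) : V →L[ℝ] W :=
  (fderiv ℝ F w).comp (ContinuousLinearMap.inl ℝ V ℝ)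

variable {V W : Type} [NormedAddCommGroup V] [NormedSpace ℝ V] [FiniteDimensional ℝ V] [NormedAddCommGroup W]
  [NormedSpace ℝ W] {O : Set V} {F : V × ℝ → W}

theorem contDiffOn_fderivFst (hO : IsOpen O) (hF : ContDiffOn ℝ ∞ F (O ×ˢ univ)) :
    ContDiffOn ℝ ∞ (fderivFst F) (O ×ˢ univ) :=
  (hF.fderiv_of_isOpen (hO.prod isOpen_univ) (m := ∞) (by simp)).clm_comp contDiffOn_const

theorem continuous_slice_of_contDiffOn (hF : ContinuousOn F (O ×ˢ univ)) {x : V} (hx : x ∈ O) :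
    Continuous fun t : ℝ => F (x, t) :=
  continuousOn_univ.1 (hF.comp (s := univ) (by fun_prop) fun _ _ => ⟨hx, mem_univ _⟩)

theorem hasFDerivAt_parametric (hO : IsOpen O) (hF : ContDiffOn ℝ ∞ F (O ×ˢ univ)) {x : V} (hx : x ∈ O) :
    HasFDerivAt (fun x => ∫ t in (0 : ℝ)..1, F (x, t)) (∫ t in (0 : ℝ)..1, fderivFst F (x, t)) x := by
  have : ProperSpace V := FiniteDimensional.proper ℝ V
  obtain ⟨ε, hε, hεO⟩ := Metric.nhds_basis_closedBall.mem_iff.1 (hO.mem_nhds hx)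
  have hF' := (contDiffOn_fderivFst hO hF).continuousOn
  obtain ⟨C, hC⟩ := ((isCompact_closedBall x ε).prod (isCompact_Icc (a := (0 : ℝ)) (b := 1))).exists_bound_of_continuousOn
    (hF'.mono (prod_mono hεO (subset_univ _)))
  refine (intervalIntegral.hasFDerivAt_integral_of_dominated_of_fderiv_le (μ := volume) (𝕜 := ℝ) (a := 0) (b := 1)
    (F := fun x t => F (x, t)) (F' := fun x t => fderivFst F (x, t)) (bound := fun _ => C)
    (s := Metric.closedBall x ε) (Metric.closedBall_mem_nhds x hε) ?_ ?_ ?_ ?_ (by simp) ?_)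
  · filter_upwards [hO.mem_nhds hx] with x' hx'
    exact (continuous_slice_of_contDiffOn hF.continuousOn hx').aestronglyMeasurable
  · exact (continuous_slice_of_contDiffOn hF.continuousOn hx).intervalIntegrable _ _
  · exact (continuous_slice_of_contDiffOn hF' hx).aestronglyMeasurable
  · refine .of_forall fun t ht x' hx' => hC (x', t) ⟨hx', ?_⟩
    rw [uIoc_of_le zero_le_one] at ht
    exact ⟨ht.1.le, ht.2⟩
  · refine .of_forall fun t _ x' hx' => ?_
    have h1 := (hF.differentiableAt_of_isOpen (hO.prod isOpen_univ) (x := (x', t))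
      ⟨hεO hx', mem_univ _⟩).hasFDerivAt
    have h2 : HasFDerivAt (fun x : V => (x, t)) (ContinuousLinearMap.inl ℝ V ℝ) x' :=
      (hasFDerivAt_id x').prodMk (hasFDerivAt_const t x')
    exact h1.comp x' h2

theorem contDiffOn_parametric (hO : IsOpen O) (hF : ContDiffOn ℝ ∞ F (O ×ˢ univ)) :
    ContDiffOn ℝ ∞ (fun x => ∫ t in (0 : ℝ)..1, F (x, t)) O := by
  rw [contDiffOn_infty]
  intro k
  induction k generalizing W with
  | zero =>
    exact contDiffOn_zero.2 fun x hx => (hasFDerivAt_parametric hO hF hx).continuousAt.continuousWithinAt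
  | succ k ih =>
    push_cast
    rw [contDiffOn_succ_iff_fderiv_of_isOpen hO]
    refine ⟨fun x hx => (hasFDerivAt_parametric hO hF hx).differentiableAt.differentiableWithinAt, by simp, ?_⟩
    exact (ih (contDiffOn_fderivFst hO hF)).congr fun x hx => (hasFDerivAt_parametric hO hF hx).fderiv

end ParametricIntegral

section Homotopy

variable {n m : ℕ} {U : Set (𝔼 (Fin n))} {k l : ℕ} {f g : JetCoord n m → ℝ}

/-- The average of `f` along the segment from the zero jet. -/
noncomputable def avg (f : JetCoord n m → ℝ) (z : JetCoord n m) : ℝ :=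
  ∫ t in (0 : ℝ)..1, f (z.1, t • z.2)

theorem contDiffOn_scale (hU : IsOpen U) {G : 𝔼 (Fin n) × (idxLE n k → Fin m → ℝ) → ℝ}
    (hG : ContDiffOn ℝ ∞ G (U ×ˢ univ)) :
    ContDiffOn ℝ ∞ (fun w : (𝔼 (Fin n) × (idxLE n k → Fin m → ℝ)) × ℝ => G (w.1.1, w.2 • w.1.2))
      ((U ×ˢ univ) ×ˢ univ) := by
  refine hG.comp (s := (U ×ˢ univ) ×ˢ univ) (ContDiff.contDiffOn (by fun_prop)) ?_
  rintro w ⟨⟨hw, -⟩, -⟩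
  exact ⟨hw, mem_univ _⟩

theorem IsSmoothOfOrder.avg (hU : IsOpen U) (hf : IsSmoothOfOrder U k f) :
    IsSmoothOfOrder U k (avg f) := by
  obtain ⟨G, hG, hfG⟩ := hf
  refine ⟨_, contDiffOn_parametric (hU.prod isOpen_univ) (contDiffOn_scale hU hG), fun z hz => ?_⟩
  exact intervalIntegral.integral_congr fun t _ => hfG (z.1, t • z.2) hz

theorem continuous_scale (hf : IsSmoothOfOrder U k f) {z : JetCoord n m} (hz : z.1 ∈ U) :
    Continuous fun t : ℝ => f (z.1, t • z.2) := by
  obtain ⟨G, hG, hfG⟩ := hf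
  have h : Continuous fun t : ℝ => G (z.1, t • fun K : idxLE n k => z.2 K) :=
    continuousOn_univ.1 (hG.continuousOn.comp (s := univ) (by fun_prop) fun _ _ => ⟨hz, mem_univ _⟩)
  exact h.congr fun t => (hfG (z.1, t • z.2) hz).symm

theorem lineDeriv_avg (hU : IsOpen U) (hf : IsSmoothOfOrder U k f) {z : JetCoord n m} (hz : z.1 ∈ U)
    (v : JetCoord n m) :
    lineDeriv ℝ (avg f) z v = ∫ t in (0 : ℝ)..1, lineDeriv ℝ f (z.1, t • z.2) (v.1, t • v.2) := by
  obtain ⟨G, hG, hfG⟩ := hf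
  have hO : IsOpen (U ×ˢ (univ : Set (idxLE n k → Fin m → ℝ))) := hU.prod isOpen_univ
  have hF := contDiffOn_scale hU hG
  set F : (𝔼 (Fin n) × (idxLE n k → Fin m → ℝ)) × ℝ → ℝ := fun w => G (w.1.1, w.2 • w.1.2)
  set x : 𝔼 (Fin n) × (idxLE n k → Fin m → ℝ) := (z.1, fun K => z.2 K)
  have hx : x ∈ U ×ˢ (univ : Set (idxLE n k → Fin m → ℝ)) := ⟨hz, mem_univ _⟩
  have h1 : HasLineDerivAt ℝ (avg f) _ z v := IsSmoothOfOrder.hasLineDerivAt hU (contDiffOn_parametric hO hF)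
    (fun z hz => (intervalIntegral.integral_congr fun t _ => hfG (z.1, t • z.2) hz :
      avg f z = ∫ t in (0 : ℝ)..1, F ((z.1, fun K => z.2 K), t))) hz v
  rw [h1.lineDeriv, (hasFDerivAt_parametric hO hF hx).fderiv]
  rw [ContinuousLinearMap.intervalIntegral_apply
    ((continuous_slice_of_contDiffOn (contDiffOn_fderivFst hO hF).continuousOn hx).intervalIntegrable _ _)]
  refine intervalIntegral.integral_congr fun t _ => ?_
  have h2 := IsSmoothOfOrder.hasLineDerivAt hU hG hfG (z := (z.1, t • z.2)) hz (v.1, t • v.2)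
  show _ = lineDeriv ℝ f (z.1, t • z.2) (v.1, t • v.2)
  rw [h2.lineDeriv]
  have h3 : HasFDerivAt (fun x : 𝔼 (Fin n) × (idxLE n k → Fin m → ℝ) => F (x, t)) (fderivFst F (x, t)) x := by
    have h1 := (hF.differentiableAt_of_isOpen (hO.prod isOpen_univ) (x := (x, t)) ⟨hx, mem_univ _⟩).hasFDerivAt
    have h2 : HasFDerivAt (fun x : 𝔼 (Fin n) × (idxLE n k → Fin m → ℝ) => (x, t)) (ContinuousLinearMap.inl ℝ _ ℝ) x :=
      (hasFDerivAt_id x).prodMk (hasFDerivAt_const t x)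
    exact h1.comp x h2
  have h4 : HasFDerivAt (fun x : 𝔼 (Fin n) × (idxLE n k → Fin m → ℝ) => F (x, t))
      ((fderiv ℝ G (x.1, t • x.2)).comp ((ContinuousLinearMap.fst ℝ _ _).prod
        (t • ContinuousLinearMap.snd ℝ _ _))) x := by
    have h1 := (hG.differentiableAt_of_isOpen hO (x := (x.1, t • x.2)) ⟨hz, mem_univ _⟩).hasFDerivAt
    have h2 : HasFDerivAt (fun x : 𝔼 (Fin n) × (idxLE n k → Fin m → ℝ) => (x.1, t • x.2))
        ((ContinuousLinearMap.fst ℝ _ _).prod (t • ContinuousLinearMap.snd ℝ _ _)) x :=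
      hasFDerivAt_fst.prodMk (hasFDerivAt_snd.const_smul t)
    exact h1.comp x h2
  rw [h3.unique h4]
  rfl

theorem totalD_avg (hU : IsOpen U) (hf : IsSmoothOfOrder U k f) (i : Fin n) {z : JetCoord n m}
    (hz : z.1 ∈ U) : totalD i (avg f) z = avg (totalD i f) z :=
  lineDeriv_avg hU hf hz _

theorem iterOp_totalD_avg (hU : IsOpen U) (hf : IsSmoothOfOrder U k f) (I : Fin n → ℕ) {z : JetCoord n m}
    (hz : z.1 ∈ U) : iterOp totalD I (avg f) z = avg (iterOp totalD I f) z := by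
  refine (iterOp_rel (fun (a b : JetCoord n m → ℝ) =>
      (∃ k, IsSmoothOfOrder U k b) ∧ ∀ z, z.1 ∈ U → a z = avg b z)
    (fun i a b h => ⟨h.1.imp' (· + 1) fun k hk => hk.totalD hU i, fun z hz => ?_⟩) I
    ⟨⟨k, hf⟩, fun _ _ => rfl⟩).2 z hz
  obtain ⟨⟨k, hk⟩, h2⟩ := h
  rw [totalD_congr hU h2 i hz, totalD_avg hU hk i hz]

theorem exists_order_iterOp_totalD (hU : IsOpen U) (hf : IsSmoothOfOrder U k f) (I : Fin n → ℕ) :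
    ∃ l, IsSmoothOfOrder U l (iterOp totalD I f) :=
  iterOp_induction (fun f => ∃ l, IsSmoothOfOrder U l f) (fun i _ h => h.imp' (· + 1) fun _ hl => hl.totalD hU i) I
    ⟨k, hf⟩

theorem sum_avg_jetD (hU : IsOpen U) (hf : IsSmoothOfOrder U k f) {z : JetCoord n m} (hz : z.1 ∈ U) :
    ∑ a, ∑ I ∈ idxLE n k, avg (jetD I a f) z * z.2 I a = f z - f (z.1, 0) := by
  set u := taylorPoly z k
  have hu : ContDiff ℝ ∞ u := contDiff_taylorPoly z k
  have hcoord : ∀ I, ∑ i, I i ≤ k → iterOp partialD I u z.1 = z.2 I := fun I hI =>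
    iterOp_partialD_taylorPoly z k I hI
  have hscale : ∀ t : ℝ, ∀ I, ∑ i, I i ≤ k → iterOp partialD I (fun y => t • u y) z.1 = (t • z.2) I :=
    fun t I hI => by
      rw [iterOp_partialD_smul isOpen_univ hu.contDiffOn t I (mem_univ _)]
      simp only [hcoord I hI, Pi.smul_apply]
  have hder : ∀ t : ℝ, HasDerivAt (fun t : ℝ => f (z.1, t • z.2))
      (∑ a, ∑ I ∈ idxLE n k, jetD I a f (z.1, t • z.2) * z.2 I a) t := fun t => by
    have h1 := hasDerivAt_comp_jetOf hU hf (u := fun t y => t • u y) (h := u) (ε := t)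
      (ContDiff.contDiffOn (by fun_prop)) (fun y _ => by simpa using (hasDerivAt_id t).smul_const (u y)) z.1 hz
    refine (h1.congr_of_eventuallyEq (.of_forall fun t' => ?_)).congr_deriv ?_
    · exact (hf.congr_jets (y := z.1) hz (c := fun I => iterOp partialD I (fun y => t' • u y) z.1) (hscale t')).symm
    · unfold firstVar
      rw [Finset.sum_comm]
      refine Finset.sum_congr rfl fun a _ => Finset.sum_congr rfl fun I hI => ?_
      rw [smul_eq_mul, mul_comm]
      congr 1
      · exact (hf.jetD hU I a).congr_jets (y := z.1) hz (c := fun I => iterOp partialD I (fun y => t • u y) z.1) (hscale t)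
      · exact congrFun (hcoord I (mem_idxLE.1 hI)) a
  have hc : ∀ a, ∀ I ∈ idxLE n k, Continuous fun t : ℝ => jetD I a f (z.1, t • z.2) * z.2 I a :=
    fun a I _ => (continuous_scale (hf.jetD hU I a) hz).mul continuous_const
  have h2 := intervalIntegral.integral_eq_sub_of_hasDerivAt (a := (0 : ℝ)) (b := 1) (fun t _ => hder t)
    ((continuous_finsetSum _ fun a _ => continuous_finsetSum _ fun I hI => hc a I hI).intervalIntegrable _ _)
  rw [one_smul, zero_smul] at h2
  rw [← h2, intervalIntegral.integral_finsetSum fun a _ =>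
    (continuous_finsetSum _ fun I hI => hc a I hI).intervalIntegrable _ _]
  refine Finset.sum_congr rfl fun a _ => ?_
  rw [intervalIntegral.integral_finsetSum fun I hI => (hc a I hI).intervalIntegrable _ _]
  refine Finset.sum_congr rfl fun I hI => ?_
  rw [intervalIntegral.integral_mul_const]
  rfl

theorem totalD_mul (hU : IsOpen U) (hf : IsSmoothOfOrder U k f) (hg : IsSmoothOfOrder U l g) (i : Fin n)
    {z : JetCoord n m} (hz : z.1 ∈ U) :
    totalD i (fun z => f z * g z) z = totalD i f z * g z + f z * totalD i g z := by
  obtain ⟨F, hF, hfF⟩ := hf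
  obtain ⟨G, hG, hgG⟩ := hg
  set v : JetCoord n m := (basisVec i, fun J => z.2 (J + Pi.single i 1))
  have h1 := IsSmoothOfOrder.hasLineDerivAt hU hF hfF hz v
  have h2 := IsSmoothOfOrder.hasLineDerivAt hU hG hgG hz v
  show lineDeriv ℝ (fun z => f z * g z) z v = lineDeriv ℝ f z v * g z + f z * lineDeriv ℝ g z v
  rw [h1.lineDeriv, h2.lineDeriv]
  unfold HasLineDerivAt at h1 h2
  have h3 := (h1.fun_mul h2).deriv
  simp only [zero_smul, add_zero] at h3
  exact h3

theorem isSmoothOfOrder_coord (I : Fin n → ℕ) (a : Fin m) (hI : ∑ i, I i ≤ k) :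
    IsSmoothOfOrder U k fun z : JetCoord n m => z.2 I a :=
  ⟨fun w => w.2 ⟨I, mem_idxLE.2 hI⟩ a, ContDiff.contDiffOn (by fun_prop), fun _ _ => rfl⟩

theorem totalD_coord (I : Fin n → ℕ) (a : Fin m) (i : Fin n) (z : JetCoord n m) :
    totalD i (fun z : JetCoord n m => z.2 I a) z = z.2 (I + Pi.single i 1) a := by
  refine HasLineDerivAt.lineDeriv ?_
  unfold HasLineDerivAt
  exact hasDerivAt_line (z.2 I a) (z.2 (I + Pi.single i 1) a) 0

theorem totalD_add (hU : IsOpen U) (hf : IsSmoothOfOrder U k f) (hg : IsSmoothOfOrder U l g) (i : Fin n)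
    {z : JetCoord n m} (hz : z.1 ∈ U) :
    totalD i (fun z => f z + g z) z = totalD i f z + totalD i g z := by
  have h := hf.lineDeriv_lin hU hg 1 hz (basisVec i, fun J => z.2 (J + Pi.single i 1))
  rw [one_smul, one_smul] at h
  exact h

theorem totalD_sum (hU : IsOpen U) {ι : Type*} (s : Finset ι) {F : ι → JetCoord n m → ℝ}
    (hF : ∀ j ∈ s, IsSmoothOfOrder U k (F j)) (i : Fin n) {z : JetCoord n m} (hz : z.1 ∈ U) :
    totalD i (fun z => ∑ j ∈ s, F j z) z = ∑ j ∈ s, totalD i (F j) z := by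
  classical
  induction s using Finset.induction_on with
  | empty =>
    simp only [Finset.sum_empty]
    exact (hasDerivAt_const (0 : ℝ) (0 : ℝ)).deriv
  | insert j s hj ih =>
    simp only [Finset.sum_insert hj]
    rw [totalD_add hU (hF j (Finset.mem_insert_self _ _))
      (IsSmoothOfOrder.sum s fun j hj => hF j (Finset.mem_insert_of_mem hj)) i hz,
      ih fun j hj => hF j (Finset.mem_insert_of_mem hj)]

theorem totalD_neg (hU : IsOpen U) (hf : IsSmoothOfOrder U k f) (i : Fin n) {z : JetCoord n m} (hz : z.1 ∈ U) :
    totalD i (fun z => -f z) z = -totalD i f z := by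
  have h := hf.lineDeriv_clm hU (-ContinuousLinearMap.id ℝ ℝ) hz (basisVec i, fun J => z.2 (J + Pi.single i 1))
  exact h

theorem iterOp_totalD_add_single (hU : IsOpen U) (hf : IsSmoothOfOrder U k f) (I : Fin n → ℕ) (i : Fin n)
    {z : JetCoord n m} (hz : z.1 ∈ U) :
    iterOp totalD (I + Pi.single i 1) f z = iterOp totalD I (totalD i f) z := by
  obtain ⟨l, hl⟩ := exists_order_iterOp_totalD hU hf (I + Pi.single i 1)
  obtain ⟨l', hl'⟩ := exists_order_iterOp_totalD hU (hf.totalD hU i) I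
  set u := taylorPoly z (max l l')
  have hu : ContDiffOn ℝ ∞ u U := (contDiff_taylorPoly z (max l l')).contDiffOn
  have hc : ∀ I, ∑ i, I i ≤ max l l' → iterOp partialD I u z.1 = z.2 I := fun I hI =>
    iterOp_partialD_taylorPoly z _ I hI
  have h1 := hl.congr_jets (y := z.1) hz (c := (jetOf u z.1).2) fun I hI => hc I (hI.trans (le_max_left _ _))
  have h2 := hl'.congr_jets (y := z.1) hz (c := (jetOf u z.1).2) fun I hI => hc I (hI.trans (le_max_right _ _))
  refine h1.symm.trans (Eq.trans ?_ h2)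
  refine (iterOp_totalD_jetOf hU hf hu _ hz).trans (Eq.trans ?_ (iterOp_totalD_jetOf hU (hf.totalD hU i) hu I hz).symm)
  have hsm := contDiffOn_comp_jetOf hU hf hu
  rw [iterOp_partialD_add_single hU hsm I i hz, ← iterOp_partialD_partialD hU hsm I i hz]
  exact (iterOp_partialD_congr hU (totalD_jetOf hU hf hu i) I hz).symm

/-- Formal integration by parts. -/
theorem exists_byParts (hU : IsOpen U) (I : Fin n → ℕ) (a : Fin m) :
    ∀ {k : ℕ} {g : JetCoord n m → ℝ}, IsSmoothOfOrder U k g → ∃ Q : Fin n → JetCoord n m → ℝ,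
      (∀ i, IsSmoothOfOrder U (k + ∑ i, I i) (Q i)) ∧
      (∀ z, z.1 ∈ U → g z * z.2 I a
        = (-1) ^ (∑ i, I i) * iterOp totalD I g z * z.2 0 a + ∑ i, totalD i (Q i) z) ∧
      (∀ i z, z.2 = 0 → Q i z = 0) ∧
      ∀ V : Set (𝔼 (Fin n)), IsOpen V → (∀ z : JetCoord n m, z.1 ∈ V → g z = 0) →
        ∀ i z, z.1 ∈ V → Q i z = 0 := by
  induction I using multiIndex_induction with
  | h0 =>
    intro k g hg
    refine ⟨fun _ _ => 0, fun i => isSmoothOfOrder_zero, fun z hz => ?_, fun _ _ _ => rfl, fun _ _ _ _ _ _ => rfl⟩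
    have h0 : ∀ i : Fin n, totalD i (fun _ : JetCoord n m => (0 : ℝ)) z = 0 := fun i =>
      (hasDerivAt_const (0 : ℝ) (0 : ℝ)).deriv
    simp [iterOp_zero, h0]
  | h1 I i ih =>
    intro k g hg
    obtain ⟨Q, hQ, hQe, hQ0, hQV⟩ := ih (hg.totalD hU i)
    have hP : IsSmoothOfOrder U (k + ∑ j, (I + Pi.single i 1 : Fin n → ℕ) j) fun z : JetCoord n m => g z * z.2 I a := by
      rw [sum_add_single]
      exact (hg.mono (by omega)).smul (isSmoothOfOrder_coord I a (by omega))
    have hQ' : ∀ j, IsSmoothOfOrder U (k + ∑ j, (I + Pi.single i 1 : Fin n → ℕ) j) (Q j) := fun j => by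
      rw [sum_add_single]
      exact (hQ j).mono (by omega)
    have hN : ∀ j, IsSmoothOfOrder U (k + ∑ j, (I + Pi.single i 1 : Fin n → ℕ) j) fun z => -Q j z := fun j =>
      (hQ' j).clm (-ContinuousLinearMap.id ℝ ℝ)
    refine ⟨fun j z => (if j = i then g z * z.2 I a else 0) + -Q j z, fun j => ?_, fun z hz => ?_, fun j z hz => ?_,
      fun V hV hg0 j z hz => ?_⟩
    · refine IsSmoothOfOrder.add ?_ (hN j)
      split_ifs
      · exact hP
      · exact isSmoothOfOrder_zero
    · have h1 : ∀ j, totalD j (fun z : JetCoord n m => (if j = i then g z * z.2 I a else 0) + -Q j z) z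
          = (if j = i then totalD i g z * z.2 I a + g z * z.2 (I + Pi.single i 1) a else 0) - totalD j (Q j) z := by
        intro j
        split_ifs with h
        · subst h
          rw [totalD_add hU hP (hN j) j hz, totalD_neg hU (hQ j) j hz,
            totalD_mul hU hg (isSmoothOfOrder_coord (k := ∑ i, I i) I a le_rfl) j hz, totalD_coord]
          ring
        · simp only [zero_add]
          rw [totalD_neg hU (hQ j) j hz, zero_sub]
      simp only [h1]
      rw [Finset.sum_sub_distrib, Finset.sum_ite_eq' Finset.univ i, if_pos (Finset.mem_univ i), hQe z hz,
        sum_add_single, iterOp_totalD_add_single hU hg I i hz]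
      ring
    · simp [hz, hQ0 j z hz]
    · show (if j = i then g z * z.2 I a else 0) + -Q j z = 0
      have h2 : ∀ z : JetCoord n m, z.1 ∈ V → totalD i g z = 0 := fun z hz => by
        rw [totalD_congr (g := fun _ => 0) hV hg0 i hz]
        exact (hasDerivAt_const (0 : ℝ) (0 : ℝ)).deriv
      rw [hQV V hV h2 j z hz, hg0 z hz]
      simp

/-- A Lagrangian with vanishing Euler-Lagrange expressions is a total divergence up to its value on the zero
jets. -/
theorem exists_currents (hU : IsOpen U) (hf : IsSmoothOfOrder U k f)
    (hE : ∀ a z, z.1 ∈ U → eulerOp a f z = 0) :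
    ∃ B : Fin n → JetCoord n m → ℝ, (∀ i, IsSmoothOfOrder U (2 * k) (B i)) ∧
      (∀ z, z.1 ∈ U → ∑ i, totalD i (B i) z = f z - f (z.1, 0)) ∧
      (∀ i z, z.2 = 0 → B i z = 0) ∧
      ∀ V : Set (𝔼 (Fin n)), IsOpen V → (∀ z : JetCoord n m, z.1 ∈ V → f z = 0) →
        ∀ i z, z.1 ∈ V → B i z = 0 := by
  have h : ∀ (a : Fin m) (I : Fin n → ℕ), _ := fun a I => exists_byParts (n := n) hU I a ((hf.jetD hU I a).avg hU)
  choose Q hQ hQe hQ0 hQV using h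
  have hQs : ∀ i a, ∀ I ∈ idxLE n k, IsSmoothOfOrder U (2 * k) (Q a I i) := fun i a I hI =>
    (hQ a I i).mono (by have := mem_idxLE.1 hI; omega)
  have hQs' : ∀ i a, IsSmoothOfOrder U (2 * k) fun z => ∑ I ∈ idxLE n k, Q a I i z := fun i a =>
    IsSmoothOfOrder.sum _ fun I hI => hQs i a I hI
  refine ⟨fun i z => ∑ a, ∑ I ∈ idxLE n k, Q a I i z, fun i => IsSmoothOfOrder.sum _ fun a _ => hQs' i a,
    fun z hz => ?_, fun i z hz => ?_, fun V hV h0 i z hz => ?_⟩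
  · rw [← sum_avg_jetD hU hf hz]
    have h1 : ∀ i, totalD i (fun z => ∑ a, ∑ I ∈ idxLE n k, Q a I i z) z
        = ∑ a, ∑ I ∈ idxLE n k, totalD i (Q a I i) z := fun i => by
      rw [totalD_sum hU _ (fun a _ => hQs' i a) i hz]
      exact Finset.sum_congr rfl fun a _ => totalD_sum hU _ (fun I hI => hQs i a I hI) i hz
    simp only [h1]
    rw [Finset.sum_comm]
    refine Finset.sum_congr rfl fun a _ => ?_
    rw [Finset.sum_comm, Finset.sum_congr rfl fun I _ => hQe a I z hz, Finset.sum_add_distrib,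
      ← Finset.sum_mul]
    have h2 : ∑ I ∈ idxLE n k, (-1 : ℝ) ^ (∑ i, I i) * iterOp totalD I (avg (jetD I a f)) z = 0 := by
      have h3 : ∀ I ∈ idxLE n k, (-1 : ℝ) ^ (∑ i, I i) * iterOp totalD I (avg (jetD I a f)) z
          = ∫ t in (0 : ℝ)..1, (-1 : ℝ) ^ (∑ i, I i) * iterOp totalD I (jetD I a f) (z.1, t • z.2) := fun I _ => by
        rw [iterOp_totalD_avg hU (hf.jetD hU I a) I hz, intervalIntegral.integral_const_mul]
        rfl
      rw [Finset.sum_congr rfl h3, ← intervalIntegral.integral_finsetSum fun I _ => ?_]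
      · refine (intervalIntegral.integral_congr (g := fun _ => 0) fun t _ => ?_).trans (by simp)
        exact (eulerOp_eq_sum hU hf a (z := (z.1, t • z.2)) hz).symm.trans (hE a _ hz)
      · obtain ⟨l, hl⟩ := exists_order_iterOp_totalD hU (hf.jetD hU I a) I
        exact (continuous_const.mul (continuous_scale hl hz)).intervalIntegrable _ _
    rw [h2, zero_mul, zero_add]
  · exact Finset.sum_eq_zero fun a _ => Finset.sum_eq_zero fun I _ => hQ0 a I i z hz
  · refine Finset.sum_eq_zero fun a _ => Finset.sum_eq_zero fun I _ => hQV a I V hV (fun z hz => ?_) i z hz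
    refine (intervalIntegral.integral_congr (g := fun _ => 0) fun t _ => ?_).trans (by simp)
    have h4 : jetD I a f (z.1, t • z.2) = jetD I a (fun _ : JetCoord n m => (0 : ℝ)) (z.1, t • z.2) :=
      jetD_congr hV h0 I a hz
    exact h4.trans (hasDerivAt_const (0 : ℝ) (0 : ℝ)).deriv

end Homotopy

section Poincare

variable {n : ℕ}

/-- The closed cube with centre `a` and side length `2ρ`. -/
def cube (a : 𝔼 (Fin n)) (ρ : ℝ) : Set (𝔼 (Fin n)) := {x | ∀ i, x i ∈ Icc (a i - ρ) (a i + ρ)}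

theorem cube_eq (a : 𝔼 (Fin n)) (ρ : ℝ) :
    cube a ρ = EuclideanSpace.equiv (Fin n) ℝ ⁻¹' univ.pi fun i => Icc (a i - ρ) (a i + ρ) := by
  ext x
  simp only [cube, mem_ofPred_eq, mem_preimage, mem_univ_pi]
  rfl

theorem isCompact_cube (a : 𝔼 (Fin n)) (ρ : ℝ) : IsCompact (cube a ρ) := by
  rw [cube_eq]
  exact (EuclideanSpace.equiv (Fin n) ℝ).toHomeomorph.isClosedEmbedding.isCompact_preimage
    (isCompact_univ_pi fun i => isCompact_Icc)

theorem convex_cube (a : 𝔼 (Fin n)) (ρ : ℝ) : Convex ℝ (cube a ρ) := by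
  rw [cube_eq]
  exact (convex_pi fun i _ => convex_Icc _ _).linear_preimage (EuclideanSpace.equiv (Fin n) ℝ).toLinearMap

theorem mem_cube_self (a : 𝔼 (Fin n)) {ρ : ℝ} (hρ : 0 < ρ) : a ∈ cube a ρ := fun i =>
  ⟨by linarith, by linarith⟩

/-- The point `x` with its `i`-th coordinate replaced by `s`. -/
noncomputable def updCoord (i : Fin n) (x : 𝔼 (Fin n)) (s : ℝ) : 𝔼 (Fin n) := x + (s - x i) • basisVec i

theorem updCoord_apply (i j : Fin n) (x : 𝔼 (Fin n)) (s : ℝ) :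
    updCoord i x s j = if j = i then s else x j := by
  simp only [updCoord, basisVec, PiLp.add_apply, PiLp.smul_apply, PiLp.single_apply, smul_eq_mul]
  split_ifs with h
  · subst h; ring
  · ring

theorem updCoord_self (i : Fin n) (x : 𝔼 (Fin n)) : updCoord i x (x i) = x := by
  simp [updCoord]

theorem updCoord_updCoord (i : Fin n) (x : 𝔼 (Fin n)) (s t : ℝ) : updCoord i (updCoord i x t) s = updCoord i x s := by
  ext j
  simp only [updCoord_apply]
  split_ifs <;> rfl

theorem updCoord_comm {i j : Fin n} (h : i ≠ j) (x : 𝔼 (Fin n)) (s t : ℝ) :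
    updCoord i (updCoord j x t) s = updCoord j (updCoord i x s) t := by
  ext l
  simp only [updCoord_apply]
  split_ifs with h1 h2
  · exact (h (h1.symm.trans h2)).elim
  all_goals rfl

theorem updCoord_line (i : Fin n) (x : 𝔼 (Fin n)) (s t : ℝ) :
    updCoord i (x + t • basisVec i) s = updCoord i x s := by
  ext j
  simp only [updCoord_apply, PiLp.add_apply, PiLp.smul_apply, basisVec, PiLp.single_apply]
  split_ifs <;> simp

theorem contDiff_coord (i : Fin n) : ContDiff ℝ ∞ fun x : 𝔼 (Fin n) => x i :=
  (EuclideanSpace.proj i : 𝔼 (Fin n) →L[ℝ] ℝ).contDiff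

theorem contDiff_integral_updCoord (i : Fin n) {f : 𝔼 (Fin n) → ℝ} (hf : ContDiff ℝ ∞ f) (c : ℝ)
    {b : 𝔼 (Fin n) → ℝ} (hb : ContDiff ℝ ∞ b) :
    ContDiff ℝ ∞ fun x => ∫ s in c..b x, f (updCoord i x s) := by
  have h : ∀ x, (∫ s in c..b x, f (updCoord i x s))
      = (b x - c) * ∫ t in (0 : ℝ)..1, f (updCoord i x ((b x - c) * t + c)) := fun x => by
    have := intervalIntegral.smul_integral_comp_mul_add (a := 0) (b := 1) (fun s => f (updCoord i x s)) (b x - c) c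
    rw [smul_eq_mul] at this
    rw [this]
    congr 1 <;> ring
  simp only [h]
  refine (hb.sub contDiff_const).mul (contDiffOn_univ.1 (contDiffOn_parametric isOpen_univ
    (F := fun w : 𝔼 (Fin n) × ℝ => f (updCoord i w.1 ((b w.1 - c) * w.2 + c))) (ContDiff.contDiffOn ?_)))
  refine hf.comp ?_
  have hb' : ContDiff ℝ ∞ fun w : 𝔼 (Fin n) × ℝ => b w.1 := hb.comp contDiff_fst
  have hx : ContDiff ℝ ∞ fun w : 𝔼 (Fin n) × ℝ => w.1 i := (contDiff_coord i).comp contDiff_fst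
  exact contDiff_fst.add (((((hb'.sub contDiff_const).mul contDiff_snd).add contDiff_const).sub hx).smul contDiff_const)

/-- The normalized bump function on the interval with centre `c` and radius `ρ`. -/
noncomputable def lineBump {ρ : ℝ} (hρ : 0 < ρ) (c : ℝ) : ℝ → ℝ :=
  (⟨ρ / 2, ρ, by positivity, by linarith⟩ : ContDiffBump c).normed volume

variable {ρ : ℝ} (hρ : 0 < ρ)

theorem contDiff_lineBump (c : ℝ) : ContDiff ℝ ∞ (lineBump hρ c) := ContDiffBump.contDiff_normed _

theorem support_lineBump (c : ℝ) : Function.support (lineBump hρ c) = Ioo (c - ρ) (c + ρ) :=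
  (ContDiffBump.support_normed_eq _).trans (Real.ball_eq_Ioo _ _)

theorem integral_lineBump (c : ℝ) : ∫ t in (c - ρ)..(c + ρ), lineBump hρ c t = 1 := by
  rw [intervalIntegral.integral_eq_integral_of_support_subset]
  · exact ContDiffBump.integral_normed _
  · rw [support_lineBump]
    exact Ioo_subset_Ioc_self

/-- One coordinate is integrated out at the cost of a partial derivative. -/
theorem exists_partialD_primitive (a : 𝔼 (Fin n)) (i : Fin n) {f : 𝔼 (Fin n) → ℝ} (hf : ContDiff ℝ ∞ f)
    (h0 : ∀ x ∉ cube a ρ, f x = 0) :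
    ∃ g A : 𝔼 (Fin n) → ℝ, ContDiff ℝ ∞ g ∧ (∀ x ∉ cube a ρ, g x = 0) ∧ ContDiff ℝ ∞ A ∧
      (∀ x ∉ cube a ρ, A x = 0) ∧ (∀ x, f x = A x + partialD i g x) ∧
      ∀ x, A x = lineBump hρ (a i) (x i) * ∫ s in (a i - ρ)..(a i + ρ), f (updCoord i x s) := by
  set J : 𝔼 (Fin n) → ℝ := fun x => ∫ s in (a i - ρ)..(a i + ρ), f (updCoord i x s)
  have hJ : ContDiff ℝ ∞ J := contDiff_integral_updCoord i hf _ contDiff_const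
  set A : 𝔼 (Fin n) → ℝ := fun x => lineBump hρ (a i) (x i) * J x
  have hA : ContDiff ℝ ∞ A := ((contDiff_lineBump hρ _).comp (contDiff_coord i)).mul hJ
  have hJ0 : ∀ x, ∀ j ≠ i, x j ∉ Icc (a j - ρ) (a j + ρ) → ∀ s, updCoord i x s ∉ cube a ρ := fun x j hj hx s hs => by
    have := hs j
    rw [updCoord_apply, if_neg hj] at this
    exact hx this
  have hA0 : ∀ x ∉ cube a ρ, A x = 0 := fun x hx => by
    obtain ⟨j, hj⟩ := not_forall.1 hx
    by_cases hji : j = i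
    · subst hji
      have : lineBump hρ (a j) (x j) = 0 := by
        by_contra h
        have h1 : x j ∈ Function.support (lineBump hρ (a j)) := h
        rw [support_lineBump] at h1
        exact hj ⟨h1.1.le, h1.2.le⟩
      simp [A, this]
    · have : J x = 0 := by
        simp only [J]
        rw [intervalIntegral.integral_congr (g := fun _ => 0) fun s _ => h0 _ (hJ0 x j hji hj s)]
        simp
      simp [A, this]
  set k : 𝔼 (Fin n) → ℝ := fun x => f x - A x
  have hk : ContDiff ℝ ∞ k := hf.sub hA
  have hk0 : ∀ x ∉ cube a ρ, k x = 0 := fun x hx => by simp [k, h0 x hx, hA0 x hx]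
  have hcont : ∀ {q : 𝔼 (Fin n) → ℝ} (_ : ContDiff ℝ ∞ q) (x : 𝔼 (Fin n)), Continuous fun s => q (updCoord i x s) := fun hq x =>
    hq.continuous.comp (by unfold updCoord; fun_prop)
  have hkint : ∀ x, ∫ s in (a i - ρ)..(a i + ρ), k (updCoord i x s) = 0 := fun x => by
    have h1 : ∀ s, A (updCoord i x s) = lineBump hρ (a i) s * J x := fun s => by
      simp only [A, J, updCoord_apply, if_true, updCoord_updCoord]
    simp only [k]
    rw [intervalIntegral.integral_sub ((hcont hf x).intervalIntegrable _ _) ((hcont hA x).intervalIntegrable _ _)]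
    simp only [h1]
    rw [intervalIntegral.integral_mul_const, integral_lineBump, one_mul, sub_self]
  refine ⟨fun x => ∫ s in (a i - ρ)..(x i), k (updCoord i x s), A,
    contDiff_integral_updCoord i hk _ (contDiff_coord i), fun x hx => ?_, hA, hA0, fun x => ?_, fun x => rfl⟩
  · show ∫ s in (a i - ρ)..(x i), k (updCoord i x s) = 0
    obtain ⟨j, hj⟩ := not_forall.1 hx
    by_cases hji : j = i
    · subst hji
      have hz : ∀ s, s ∉ Icc (a j - ρ) (a j + ρ) → k (updCoord j x s) = 0 := fun s hs => hk0 _ fun h => hs (by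
        have := h j
        rwa [updCoord_apply, if_pos rfl] at this)
      rcases lt_or_ge (x j) (a j - ρ) with hlt | hge
      · rw [intervalIntegral.integral_symm, intervalIntegral.integral_of_le hlt.le, integral_Ioc_eq_integral_Ioo,
          setIntegral_congr_fun (g := fun _ => 0) measurableSet_Ioo fun s hs => hz s fun h => by linarith [h.1, hs.2]]
        simp
      · have hgt : a j + ρ < x j := by
          by_contra h
          exact hj ⟨hge, not_lt.1 h⟩
        rw [← intervalIntegral.integral_add_adjacent_intervals (b := a j + ρ)
          ((hcont hk x).intervalIntegrable _ _) ((hcont hk x).intervalIntegrable _ _), hkint, zero_add,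
          intervalIntegral.integral_of_le hgt.le,
          setIntegral_congr_fun (g := fun _ => 0) measurableSet_Ioc fun s hs => hz s fun h => by linarith [h.2, hs.1]]
        simp
    · rw [intervalIntegral.integral_congr (g := fun _ => 0) fun s _ => hk0 _ (hJ0 x j hji hj s)]
      simp
  · have h1 : HasDerivAt (fun t => ∫ s in (a i - ρ)..t, k (updCoord i x s)) (k (updCoord i x (x i))) (x i) :=
      intervalIntegral.integral_hasDerivAt_right ((hcont hk x).intervalIntegrable _ _)
        ((hcont hk x).stronglyMeasurableAtFilter _ _) (hcont hk x).continuousAt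
    have h2 : HasDerivAt (fun t : ℝ => x i + t) 1 0 := (hasDerivAt_id (0 : ℝ)).const_add _
    have h3 : partialD i (fun x => ∫ s in (a i - ρ)..(x i), k (updCoord i x s)) x = k x := by
      unfold partialD lineDeriv
      have h4 : HasDerivAt (fun t => ∫ s in (a i - ρ)..t, k (updCoord i x s)) (k (updCoord i x (x i)))
          (x i + (0 : ℝ)) := by rwa [add_zero]
      refine ((h4.comp (0 : ℝ) h2).congr_of_eventuallyEq (.of_forall fun t => ?_)).deriv.trans ?_
      · have h5 : (x + t • basisVec i : 𝔼 (Fin n)) i = x i + t := by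
          simp [basisVec]
        simp only [Function.comp, updCoord_line, h5]
      · rw [mul_one, updCoord_self]
    rw [h3]
    simp [k]

theorem exists_divergence_aux (a : 𝔼 (Fin n)) {f : 𝔼 (Fin n) → ℝ} (hf : ContDiff ℝ ∞ f)
    (h0 : ∀ x ∉ cube a ρ, f x = 0) (S : Finset (Fin n)) :
    ∃ (g : Fin n → 𝔼 (Fin n) → ℝ) (A c : 𝔼 (Fin n) → ℝ), (∀ i, ContDiff ℝ ∞ (g i)) ∧
      (∀ i, ∀ x ∉ cube a ρ, g i x = 0) ∧ ContDiff ℝ ∞ A ∧ (∀ x ∉ cube a ρ, A x = 0) ∧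
      (∀ x, f x = A x + ∑ i, partialD i (g i) x) ∧
      (∀ x, A x = (∏ i ∈ S, lineBump hρ (a i) (x i)) * c x) ∧ ∀ i ∈ S, ∀ x s, c (updCoord i x s) = c x := by
  induction S using Finset.induction_on with
  | empty =>
    refine ⟨fun _ _ => 0, f, f, fun _ => contDiff_const, fun _ _ _ => rfl, hf, h0, fun x => ?_, fun x => by simp,
      fun i hi => (Finset.notMem_empty i hi).elim⟩
    simp [partialD, lineDeriv]
  | insert i S hi ih =>
    obtain ⟨g, A, c, hg, hg0, hA, hA0, hfA, hAc, hc⟩ := ih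
    obtain ⟨g', A', hg', hg0', hA', hA0', hAA', hA'c⟩ := exists_partialD_primitive hρ a i hA hA0
    refine ⟨fun j => g j + if j = i then g' else 0, A', fun x => ∫ s in (a i - ρ)..(a i + ρ), c (updCoord i x s),
      fun j => ?_, fun j x hx => ?_, hA', hA0', fun x => ?_, fun x => ?_, fun j hj x s => ?_⟩
    · show ContDiff ℝ ∞ (g j + if j = i then g' else 0)
      split_ifs
      · exact (hg j).add hg'
      · simpa using hg j
    · show (g j + if j = i then g' else 0) x = 0
      split_ifs
      · simp [hg0 j x hx, hg0' x hx]
      · simp [hg0 j x hx]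
    · have h1 : ∀ j, partialD j (g j + if j = i then g' else 0) x
          = partialD j (g j) x + if j = i then partialD i g' x else 0 := fun j => by
        split_ifs with h
        · subst h
          unfold partialD
          rw [((hg j).differentiable (by simp) x).lineDeriv_eq_fderiv,
            (hg'.differentiable (by simp) x).lineDeriv_eq_fderiv,
            (DifferentiableAt.lineDeriv_eq_fderiv (f := g j + g') (((hg j).add hg').differentiable (by simp) x)),
            fderiv_add ((hg j).differentiable (by simp) x) (hg'.differentiable (by simp) x)]
          rfl
        · simp
      simp only [h1]
      rw [Finset.sum_add_distrib, Finset.sum_ite_eq' Finset.univ i, if_pos (Finset.mem_univ i), hfA x, hAA' x]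
      ring
    · rw [hA'c, Finset.prod_insert hi, mul_assoc]
      congr 1
      rw [← intervalIntegral.integral_const_mul]
      refine intervalIntegral.integral_congr fun s _ => ?_
      show A (updCoord i x s) = _
      rw [hAc]
      congr 1
      refine Finset.prod_congr rfl fun j hj => ?_
      rw [updCoord_apply, if_neg (ne_of_mem_of_not_mem hj hi)]
    · refine intervalIntegral.integral_congr fun t _ => ?_
      show c _ = c _
      rcases Finset.mem_insert.1 hj with h | h
      · subst h
        rw [updCoord_updCoord]
      · rw [updCoord_comm (ne_of_mem_of_not_mem h hi).symm]
        exact hc j h _ _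

theorem exists_divergence (hρ : 0 < ρ) (a : 𝔼 (Fin n)) {f : 𝔼 (Fin n) → ℝ} (hf : ContDiff ℝ ∞ f)
    (h0 : ∀ x ∉ cube a ρ, f x = 0) (hint : ∫ x, f x = 0) :
    ∃ g : Fin n → 𝔼 (Fin n) → ℝ, (∀ i, ContDiff ℝ ∞ (g i)) ∧ (∀ i, ∀ x ∉ cube a ρ, g i x = 0) ∧
      ∀ x, f x = ∑ i, partialD i (g i) x := by
  obtain ⟨g, A, c, hg, hg0, hA, hA0, hfA, hAc, hc⟩ := exists_divergence_aux hρ a hf h0 Finset.univ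
  refine ⟨g, hg, hg0, fun x => ?_⟩
  have hcs : ∀ {q : 𝔼 (Fin n) → ℝ}, (∀ x ∉ cube a ρ, q x = 0) → HasCompactSupport q := fun hq =>
    HasCompactSupport.intro (isCompact_cube a ρ) hq
  have hconst : ∀ (S : Finset (Fin n)) x y, (∀ i ∉ S, x i = y i) → c x = c y := fun S => by
    induction S using Finset.induction_on with
    | empty => exact fun x y h => congrArg c (by ext i; exact h i (Finset.notMem_empty i))
    | insert i S hi ih =>
      intro x y h
      rw [← hc i (Finset.mem_univ i) x (y i)]
      refine ih _ _ fun j hj => ?_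
      rw [updCoord_apply]
      split_ifs with hji
      · rw [hji]
      · exact h j fun h' => (Finset.mem_insert.1 h').elim hji hj
  have hAc' : ∀ x, A x = c a * ∏ i, lineBump hρ (a i) (x i) := fun x => by
    rw [hAc, mul_comm, hconst Finset.univ x a fun i hi => (hi (Finset.mem_univ i)).elim]
  set Φ : 𝔼 (Fin n) → ℝ := fun x => ∏ i, lineBump hρ (a i) (x i)
  have hΦ : Continuous Φ := continuous_finsetProd _ fun i _ =>
    (contDiff_lineBump hρ (a i)).continuous.comp (contDiff_coord i).continuous
  have hmem : ∀ i t, lineBump hρ (a i) t ≠ 0 ↔ t ∈ Ioo (a i - ρ) (a i + ρ) := fun i t => by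
    rw [← support_lineBump hρ, Function.mem_support]
  have hΦ0 : ∀ x ∉ cube a ρ, Φ x = 0 := fun x hx => by
    obtain ⟨i, hi⟩ := not_forall.1 hx
    refine Finset.prod_eq_zero (Finset.mem_univ i) ?_
    by_contra h
    exact hi (Ioo_subset_Icc_self ((hmem i _).1 h))
  have hpos : 0 < ∫ x, Φ x := hΦ.integral_pos_of_hasCompactSupport_nonneg_nonzero (hcs hΦ0)
    (fun x => Finset.prod_nonneg fun i _ => ContDiffBump.nonneg_normed _ _) (x := a)
    (Finset.prod_ne_zero_iff.2 fun i _ => (hmem i _).2 ⟨by linarith, by linarith⟩)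
  have hint0 : ∀ {q : 𝔼 (Fin n) → ℝ}, ContDiff ℝ ∞ q → (∀ x ∉ cube a ρ, q x = 0) → Integrable q := fun hq hq0 =>
    hq.continuous.integrable_of_hasCompactSupport (hcs hq0)
  have hgi : ∀ i, Integrable (partialD i (g i)) := fun i => by
    have h1 : HasCompactSupport (partialD i (g i)) := (hcs (hg0 i)).mono'
      ((subset_tsupport _).trans (tsupport_partialD_subset (g i) i))
    refine Continuous.integrable_of_hasCompactSupport ?_ h1
    exact (contDiffOn_univ.1 (contDiffOn_partialD isOpen_univ (hg i).contDiffOn i)).continuous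
  have h1 : c a * ∫ x, Φ x = 0 := by
    have h2 : ∀ x, c a * Φ x = A x := fun x => (hAc' x).symm
    rw [← integral_const_mul, ← hint]
    simp only [hfA, h2]
    rw [integral_add (hint0 hA hA0) (integrable_finsetSum _ fun i _ => hgi i), integral_finsetSum _ fun i _ => hgi i,
      Finset.sum_eq_zero fun i _ => integral_partialD_eq_zero (hg i) (hcs (hg0 i)) i, add_zero]
  rw [hfA, hAc', (mul_eq_zero.1 h1).resolve_right hpos.ne', zero_mul, zero_add]

end Poincare

section CubeCurrents

variable {n m : ℕ} {U : Set (𝔼 (Fin n))} {k : ℕ} {f : JetCoord n m → ℝ}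

/-- A Lagrangian over a cube whose Euler-Lagrange expressions and whose integral on the zero section vanish is
a total divergence of currents over the same cube. -/
theorem exists_currents_cube (hU : IsOpen U) (hf : IsSmoothOfOrder U k f)
    (hE : ∀ a z, z.1 ∈ U → eulerOp a f z = 0) {a : 𝔼 (Fin n)} {ρ : ℝ} (hρ : 0 < ρ) (hC : cube a ρ ⊆ U)
    (h0 : ∀ z : JetCoord n m, z.1 ∈ U → z.1 ∉ cube a ρ → f z = 0)
    (hint : ∫ y, U.indicator (fun y => f (y, 0)) y = 0) :
    ∃ B : Fin n → JetCoord n m → ℝ, (∀ i, IsSmoothOfOrder U (2 * k) (B i)) ∧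
      (∀ z, z.1 ∈ U → ∑ i, totalD i (B i) z = f z) ∧
      (∀ i z, z.1 ∈ U → z.1 ∉ cube a ρ → B i z = 0) ∧
      ((∀ y ∈ U, f (y, 0) = 0) → (∀ i z, z.2 = 0 → B i z = 0) ∧
        ∀ V : Set (𝔼 (Fin n)), IsOpen V → (∀ z : JetCoord n m, z.1 ∈ V → f z = 0) →
          ∀ i z, z.1 ∈ V → B i z = 0) := by
  obtain ⟨B, hB, hBe, hB0, hBV⟩ := exists_currents hU hf hE
  have hO : IsOpen (U \ cube a ρ) := hU.sdiff (isCompact_cube a ρ).isClosed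
  have hBc := hBV _ hO fun z hz => h0 z hz.1 hz.2
  by_cases hz0 : ∀ y ∈ U, f (y, 0) = 0
  · exact ⟨B, hB, fun z hz => by rw [hBe z hz, hz0 z.1 hz, sub_zero], fun i z hz hz' => hBc i z ⟨hz, hz'⟩,
      fun _ => ⟨hB0, hBV⟩⟩
  have hf0 : ContDiffOn ℝ ∞ (fun y => f (y, 0)) U := by
    obtain ⟨G, hG, hfG⟩ := hf
    refine (hG.comp (s := U) (f := fun y => (y, 0)) (ContDiff.contDiffOn (by fun_prop))
      fun y hy => ⟨hy, mem_univ _⟩).congr fun y hy => hfG (y, 0) hy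
  have hind := (contDiff_indicator hU (isCompact_cube a ρ) hC hf0 fun y hy hy' => h0 (y, 0) hy hy').1
  obtain ⟨g, hg, hg0, hge⟩ := exists_divergence hρ a hind (fun x hx => by
    by_cases hxU : x ∈ U
    · rw [indicator_of_mem hxU]
      exact h0 (x, 0) hxU hx
    · exact indicator_of_notMem hxU _) hint
  have hgs : ∀ i, IsSmoothOfOrder U (2 * k) fun z : JetCoord n m => g i z.1 := fun i =>
    isSmoothOfOrder_fst (hg i).contDiffOn
  refine ⟨fun i z => B i z + g i z.1, fun i => (hB i).add (hgs i), fun z hz => ?_, fun i z hz hz' => ?_,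
    fun h => (hz0 h).elim⟩
  · rw [Finset.sum_congr rfl fun i _ => totalD_add hU (hB i) (hgs i) i hz, Finset.sum_add_distrib, hBe z hz]
    have h1 : ∑ i, totalD i (fun z : JetCoord n m => g i z.1) z = ∑ i, partialD i (g i) z.1 := rfl
    rw [h1, ← hge, indicator_of_mem hz]
    ring
  · show B i z + g i z.1 = 0
    rw [hBc i z ⟨hz, hz'⟩, hg0 i _ hz', add_zero]

end CubeCurrents

section MinorForms

/-- The coordinate forms of degree `k` on `ℝ^{k+1}`, dual to the tuples of basis vectors with one left out. -/
theorem exists_minorForm (k : ℕ) : ∃ ω₀ : Fin (k + 1) → 𝔼 (Fin (k + 1)) [⋀^Fin k]→L[ℝ] ℝ,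
    ∀ i j : Fin (k + 1), ω₀ i (j.removeNth basisVec) = if i = j then 1 else 0 := by
  set D : 𝔼 (Fin k) [⋀^Fin k]→ₗ[ℝ] ℝ := (EuclideanSpace.basisFun (Fin k) ℝ).toBasis.det
  have hD : Continuous D := by
    have h1 : ∀ v, D v = Matrix.det (Matrix.of fun i j => v j i) := fun v => by
      rw [Module.Basis.det_apply]
      rfl
    refine Continuous.congr ?_ fun v => (h1 v).symm
    exact Continuous.matrix_det (by fun_prop)
  let V : 𝔼 (Fin k) [⋀^Fin k]→L[ℝ] ℝ := { D with cont := hD }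
  have hV : V basisVec = 1 := by
    have : (basisVec : Fin k → 𝔼 (Fin k)) = (EuclideanSpace.basisFun (Fin k) ℝ).toBasis := by
      ext i
      simp [basisVec]
    show D basisVec = 1
    rw [this]
    exact Module.Basis.det_self _
  refine ⟨fun i => V.compContinuousLinearMap
    ((EuclideanSpace.equiv (Fin k) ℝ).symm.toContinuousLinearMap ∘L
      (ContinuousLinearMap.pi fun l => ContinuousLinearMap.proj (i.succAbove l)) ∘L
        (EuclideanSpace.equiv (Fin (k + 1)) ℝ).toContinuousLinearMap), fun i j => ?_⟩
  split_ifs with h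
  · subst h
    rw [← hV]
    show V _ = V _
    congr 1
    funext l
    ext l'
    show (basisVec (i.succAbove l) : 𝔼 (Fin (k + 1))) (i.succAbove l') = (basisVec l : 𝔼 (Fin k)) l'
    simp [basisVec, Pi.single_apply]
  · obtain ⟨l, hl⟩ := Fin.exists_succAbove_eq h
    refine V.map_coord_zero l ?_
    ext l'
    show (basisVec (j.succAbove l) : 𝔼 (Fin (k + 1))) (i.succAbove l') = 0
    rw [hl]
    simp [basisVec, Fin.succAbove_ne]

end MinorForms

section FormExpansion

variable {n k : ℕ}

theorem sum_coord_smul_basisVec (v : 𝔼 (Fin n)) : v = ∑ j, v j • basisVec j := by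
  ext i
  simp [basisVec, Finset.sum_apply, Pi.single_apply]

theorem form_apply_eq_sum (A : 𝔼 (Fin n) [⋀^Fin k]→L[ℝ] ℝ) (v : Fin k → 𝔼 (Fin n)) :
    A v = ∑ σ : Fin k → Fin n, (∏ i, v i (σ i)) * A fun i => basisVec (σ i) := by
  have h : v = fun i => ∑ j, v i j • basisVec j := funext fun i => sum_coord_smul_basisVec (v i)
  conv_lhs => rw [h]
  refine (A.toMultilinearMap.map_sum (fun i j => v i j • basisVec j)).trans ?_
  refine Finset.sum_congr rfl fun σ _ => ?_
  exact A.toMultilinearMap.map_smul_univ (fun i => v i (σ i)) fun i => basisVec (σ i)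

theorem exists_form_expansion (n k : ℕ) : ∃ η : (Fin k → Fin n) → 𝔼 (Fin n) [⋀^Fin k]→L[ℝ] ℝ,
    ∀ A : 𝔼 (Fin n) [⋀^Fin k]→L[ℝ] ℝ, A = ∑ σ : Fin k → Fin n, (A fun i => basisVec (σ i)) • η σ := by
  set P : (Fin k → Fin n) → ContinuousMultilinearMap ℝ (fun _ : Fin k => 𝔼 (Fin n)) ℝ := fun σ =>
    (ContinuousMultilinearMap.mkPiAlgebra ℝ (Fin k) ℝ).compContinuousLinearMap fun i => EuclideanSpace.proj (σ i)
  refine ⟨fun σ => ((k.factorial : ℝ)⁻¹) • ContinuousMultilinearMap.alternatization (P σ), fun A => ?_⟩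
  refine ContinuousAlternatingMap.ext fun v => ?_
  have hk : (k.factorial : ℝ) ≠ 0 := Nat.cast_ne_zero.2 k.factorial_ne_zero
  have h1 : (k.factorial : ℝ) * A v = ∑ τ : Equiv.Perm (Fin k), (Equiv.Perm.sign τ : ℤ) • A fun i => v (τ i) := by
    have h2 : ∀ τ : Equiv.Perm (Fin k), (Equiv.Perm.sign τ : ℤ) • (A fun i => v (τ i)) = A v := fun τ => by
      have h3 : (A fun i => v (τ i)) = Equiv.Perm.sign τ • A v := A.toAlternatingMap.map_perm v τ
      rw [h3, Units.smul_def, smul_smul, Int.units_coe_mul_self, one_smul]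
    simp only [h2]
    simp [Fintype.card_perm]
  have h4 : ∀ (σ : Fin k → Fin n) (τ : Equiv.Perm (Fin k)), P σ (fun i => v (τ i)) = ∏ i, v (τ i) (σ i) := fun σ τ => by
    simp [P]
  have h5 : (∑ σ : Fin k → Fin n, (A fun i => basisVec (σ i)) • (k.factorial : ℝ)⁻¹ •
        ContinuousMultilinearMap.alternatization (P σ)) v
      = ∑ σ : Fin k → Fin n, (A fun i => basisVec (σ i)) * ((k.factorial : ℝ)⁻¹ *
        ∑ τ : Equiv.Perm (Fin k), (Equiv.Perm.sign τ : ℤ) • ∏ i, v (τ i) (σ i)) := by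
    simp [ContinuousAlternatingMap.sum_apply, ContinuousMultilinearMap.alternatization_apply_apply, h4, Units.smul_def,
      Function.comp_def]
  rw [h5]
  refine mul_left_cancel₀ hk ?_
  rw [h1, Finset.mul_sum]
  have h6 : ∀ σ : Fin k → Fin n, (k.factorial : ℝ) * ((A fun i => basisVec (σ i)) * ((k.factorial : ℝ)⁻¹ *
        ∑ τ : Equiv.Perm (Fin k), (Equiv.Perm.sign τ : ℤ) • ∏ i, v (τ i) (σ i)))
      = ∑ τ : Equiv.Perm (Fin k), (Equiv.Perm.sign τ : ℤ) • ((∏ i, v (τ i) (σ i)) * A fun i => basisVec (σ i)) := fun σ => by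
    rw [mul_left_comm, mul_inv_cancel_left₀ hk, Finset.mul_sum]
    refine Finset.sum_congr rfl fun τ _ => ?_
    rw [mul_smul_comm, mul_comm]
  simp only [h6]
  rw [Finset.sum_comm]
  refine Finset.sum_congr rfl fun τ _ => ?_
  rw [form_apply_eq_sum A fun i => v (τ i), Finset.smul_sum]

theorem contDiffOn_compContinuousLinearMap {V : Type*} [NormedAddCommGroup V] [NormedSpace ℝ V] {S : Set V}
    {A : V → 𝔼 (Fin n) [⋀^Fin k]→L[ℝ] ℝ} {T : V → 𝔼 (Fin n) →L[ℝ] 𝔼 (Fin n)} (hA : ContDiffOn ℝ ∞ A S)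
    (hT : ContDiffOn ℝ ∞ T S) : ContDiffOn ℝ ∞ (fun x => (A x).compContinuousLinearMap (T x)) S := by
  obtain ⟨η, hη⟩ := exists_form_expansion n k
  have h1 : ∀ x, (A x).compContinuousLinearMap (T x) = ∑ σ : Fin k → Fin n,
      (∑ τ : Fin k → Fin n, (∏ i, T x (basisVec (σ i)) (τ i)) * A x fun i => basisVec (τ i)) • η σ := fun x => by
    refine (hη _).trans (Finset.sum_congr rfl fun σ _ => ?_)
    congr 1
    exact form_apply_eq_sum (A x) _
  simp only [h1]
  have h2 : ∀ σ : Fin k → Fin n, ContDiffOn ℝ ∞ (fun x =>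
      ∑ τ : Fin k → Fin n, (∏ i, T x (basisVec (σ i)) (τ i)) * A x fun i => basisVec (τ i)) S := fun σ => by
    refine ContDiffOn.sum fun τ _ => ContDiffOn.mul ?_ ?_
    rotate_left
    · exact (ContinuousAlternatingMap.apply ℝ (𝔼 (Fin n)) ℝ fun i => basisVec (τ i)).contDiff.comp_contDiffOn hA
    refine contDiffOn_prod fun i _ => ?_
    exact (EuclideanSpace.proj (τ i) : 𝔼 (Fin n) →L[ℝ] ℝ).contDiff.comp_contDiffOn (hT.clm_apply contDiffOn_const)
  exact ContDiffOn.sum fun σ _ => (h2 σ).smul contDiffOn_const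

end FormExpansion

section LocalOrder

variable {n m N : ℕ} {W : Type*} [NormedAddCommGroup W] [NormedSpace ℝ W] {U : Set (𝔼 (Fin n))}

/-- The jet coordinates with given coordinates of order at most `N`, and zero ones above. -/
def extendJet (w : 𝔼 (Fin n) × (idxLE n N → Fin m → ℝ)) : JetCoord n m :=
  (w.1, fun I => if h : I ∈ idxLE n N then w.2 ⟨I, h⟩ else 0)

theorem extendJet_snd (z : JetCoord n m) (I : Fin n → ℕ) (hI : ∑ i, I i ≤ N) :
    (extendJet (N := N) (z.1, fun K => z.2 K)).2 I = z.2 I := dif_pos (mem_idxLE.2 hI)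

theorem isSmoothOfOrder_of_local {f : JetCoord n m → W}
    (h : ∀ y ∈ U, ∃ V, IsOpen V ∧ y ∈ V ∧ IsSmoothOfOrder V N f) : IsSmoothOfOrder U N f := by
  refine ⟨fun w => f (extendJet w), fun w hw => ?_, fun z hz => ?_⟩
  · obtain ⟨V, hV, hwV, G, hG, hfG⟩ := h w.1 hw.1
    refine ContDiffAt.contDiffWithinAt ?_
    have hO : V ×ˢ (univ : Set (idxLE n N → Fin m → ℝ)) ∈ 𝓝 w := (hV.prod isOpen_univ).mem_nhds ⟨hwV, mem_univ _⟩
    refine (hG.contDiffAt hO).congr_of_eventuallyEq ?_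
    filter_upwards [hO] with w' hw'
    rw [hfG (extendJet w') hw'.1]
    refine congrArg G (Prod.ext rfl (funext fun K => ?_))
    exact dif_pos K.2
  · obtain ⟨V, hV, hwV, hf⟩ := h z.1 hz
    exact hf.congr_jets hwV fun I hI => (extendJet_snd z I hI).symm

end LocalOrder

section Transfer
set_option linter.unusedSectionVars false
variable {n m : ℕ} {M : Type*} [TopologicalSpace M] [ChartedSpace (EuclideanSpace ℝ (Fin n)) M]
  [IsManifold (𝓡 n) ∞ M]
  {E : M → Type*} [∀ p, AddCommGroup (E p)] [∀ p, Module ℝ (E p)] [∀ p, TopologicalSpace (E p)]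
  [TopologicalSpace (TotalSpace (Fin m → ℝ) E)] [FiberBundle (Fin m → ℝ) E]
  [VectorBundle ℝ (Fin m → ℝ) E] [ContMDiffVectorBundle ∞ (Fin m → ℝ) E (𝓡 n)]

local notation "ch" => chartAt (EuclideanSpace ℝ (Fin n))
local notation "tr" => trivializationAt (Fin m → ℝ) E

variable {N k : ℕ}

/-- The coordinates `(x, u)` at `p` of a jet. -/
noncomputable def toCoord (p : M) (j : JetInf n m E) : JetCoord n m :=
  (chartAt (𝔼 (Fin n)) p j.pt, fun I =>
    iterOp partialD I (localExpr n m p (polySection E j.pt j.coord (∑ i, I i))) (chartAt (𝔼 (Fin n)) p j.pt))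

theorem toCoord_coeff {p : M} {j : JetInf n m E} (hp : j.pt ∈ coordDom n m E p) {s : ∀ q, E q} {O : Set M}
    (hO : IsOpen O) (hr : j.pt ∈ O) (hs : ∀ r ∈ O, SmoothSecAt n m s r) {N : ℕ}
    (h : HasCoords j.pt s N j.coord) (I : Fin n → ℕ) (hI : ∑ i, I i ≤ N) :
    (toCoord p j).2 I = iterOp partialD I (localExpr n m p s) (ch p j.pt) := by
  have h1 := HasCoords.polySection_transform (E := E) smoothFibreMap_id (p := j.pt) (q := p) (z := j.coord) j.coord_mem
    (by rwa [j.symm_coord]) hO (by rwa [j.symm_coord]) hs h I hI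
  rwa [j.symm_coord] at h1

theorem toCoord_jet {p r : M} (hp : r ∈ coordDom n m E p) {s : ∀ q, E q} {O : Set M}
    (hO : IsOpen O) (hr : r ∈ O) (hs : ∀ r ∈ O, SmoothSecAt n m s r) :
    toCoord p (jet n m s r) = jetOf (localExpr n m p s) (ch p r) :=
  Prod.ext rfl (funext fun I => toCoord_coeff (j := jet n m s r) hp hO hr hs (fun _ _ => rfl) I le_rfl)

open Classical in
/-- The form on the coordinate domain at `p` with coordinate expression `b`, continued by zero. -/
noncomputable def pullForm (p : M) (b : JetCoord n m → 𝔼 (Fin n) [⋀^Fin k]→L[ℝ] ℝ) : RawForm n m E k := fun j =>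
  if j.pt ∈ coordDom n m E p then
    (ContinuousAlternatingMap.compContinuousLinearMap (M := 𝔼 (Fin n)) (b (toCoord p j))
      (tangentCoordChange (𝓡 n) j.pt p j.pt) : 𝔼 (Fin n) [⋀^Fin k]→L[ℝ] ℝ)
  else (0 : 𝔼 (Fin n) [⋀^Fin k]→L[ℝ] ℝ)

theorem pullForm_of_mem {p : M} (b : JetCoord n m → 𝔼 (Fin n) [⋀^Fin k]→L[ℝ] ℝ) {j : JetInf n m E}
    (h : j.pt ∈ coordDom n m E p) :
    formInChart p j.pt (pullForm p b j) = b (toCoord p j) := by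
  refine (congrArg (formInChart p j.pt) (if_pos h : pullForm p b j = _)).trans ?_
  refine ContinuousAlternatingMap.ext fun v => congrArg (b (toCoord p j)) (funext fun i => ?_)
  refine (tangentCoordChange_comp ?_).trans (tangentCoordChange_self ?_)
  · simp only [extChartAt_source]
    exact ⟨⟨h.1, mem_chart_source _ _⟩, h.1⟩
  · simp only [extChartAt_source]
    exact h.1

theorem pullForm_of_notMem {p : M} (b : JetCoord n m → 𝔼 (Fin n) [⋀^Fin k]→L[ℝ] ℝ) {j : JetInf n m E}
    (h : j.pt ∉ coordDom n m E p) : pullForm p b j = 0 := if_neg h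

theorem pullForm_eq_zero {p : M} {b : JetCoord n m → 𝔼 (Fin n) [⋀^Fin k]→L[ℝ] ℝ} {j : JetInf n m E}
    (h : j.pt ∈ coordDom n m E p → b (toCoord p j) = 0) : pullForm p b j = 0 := by
  by_cases hj : j.pt ∈ coordDom n m E p
  · exact formInChart_injective hj.1 ((pullForm_of_mem b hj).trans (h hj))
  · exact pullForm_of_notMem b hj

theorem pullForm_dependsTo {p : M} {b : JetCoord n m → 𝔼 (Fin n) [⋀^Fin k]→L[ℝ] ℝ}
    (hb : IsSmoothOfOrder (chartDom n m E p) N b) : FormDependsTo N (pullForm p b : RawForm n m E k) := by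
  intro r c c' h
  by_cases hr : r ∈ coordDom n m E p
  · have h1 : b (toCoord p (⟨r, c⟩ : JetInf n m E)) = b (toCoord p (⟨r, c'⟩ : JetInf n m E)) := by
      refine hb.congr_jets (y := ch p r) (chart_mem_chartDom hr.1 hr.2) fun I hI => ?_
      have h2 : polySection E r ((⟨r, c⟩ : JetInf n m E).coord) (∑ i, I i)
          = polySection E r ((⟨r, c'⟩ : JetInf n m E).coord) (∑ i, I i) := by
        funext q
        refine congrArg ((tr r).symm q) (Finset.sum_congr rfl fun K hK => ?_)
        exact congrArg _ (h K ((mem_idxLE.1 hK).trans hI))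
      exact congrArg (fun s => iterOp partialD I (localExpr n m p s) (ch p r)) h2
    exact formInChart_injective hr.1 ((pullForm_of_mem b (j := ⟨r, c⟩) hr).trans
      (h1.trans (pullForm_of_mem b (j := ⟨r, c'⟩) hr).symm))
  · exact (pullForm_of_notMem b (j := ⟨r, c⟩) hr).trans (pullForm_of_notMem b (j := ⟨r, c'⟩) hr).symm

theorem pullForm_jet {p r : M} (b : JetCoord n m → 𝔼 (Fin n) [⋀^Fin k]→L[ℝ] ℝ) (hr : r ∈ coordDom n m E p)
    {s : ∀ q, E q} {O : Set M} (hO : IsOpen O) (hrO : r ∈ O) (hs : ∀ r ∈ O, SmoothSecAt n m s r) :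
    formInChart p r (pullForm p b (jet n m s r)) = b (jetOf (localExpr n m p s) (ch p r)) :=
  (pullForm_of_mem b (j := jet n m s r) hr).trans (congrArg b (toCoord_jet hr hO hrO hs))

theorem inCoord_pullForm {p : M} {b : JetCoord n m → 𝔼 (Fin n) [⋀^Fin k]→L[ℝ] ℝ}
    (hb : IsSmoothOfOrder (chartDom n m E p) N b) (q : M) {z : JetCoord n m} (hz : z.1 ∈ chartDom n m E q)
    (hp : (ch q).symm z.1 ∈ coordDom n m E p) :
    inCoord q (pullForm p b : RawForm n m E k) z
      = (b (jetOf (localExpr n m p (polySection E q z N)) ((ch p ∘ (ch q).symm) z.1))).compContinuousLinearMap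
          (fderiv ℝ (ch p ∘ (ch q).symm) z.1) := by
  have hs : ∀ r ∈ coordDom n m E q, SmoothSecAt n m (polySection E q z N) r := fun r hr =>
    smoothSecAt_polySection q z N hr.1 hr.2
  have hq := symm_mem_coordDom hz
  refine (inCoord_eq (pullForm_dependsTo hb) hz (isOpen_coordDom q) hq hs (hasCoords_polySection hz N)).trans
    ((formInChart_trans hq.1 hp.1 _).trans ?_)
  have h1 := pullForm_jet b hp (isOpen_coordDom q) hq hs
  have h2 : tangentCoordChange (𝓡 n) q p ((ch q).symm z.1) = fderiv ℝ (ch p ∘ (ch q).symm) z.1 := by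
    rw [tangentCoordChange_eq_fderiv, (ch q).right_inv hz.1]
  exact congrArg₂ (fun (B : 𝔼 (Fin n) [⋀^Fin k]→L[ℝ] ℝ) (T : 𝔼 (Fin n) →L[ℝ] 𝔼 (Fin n)) =>
    B.compContinuousLinearMap T) h1 h2

theorem polySection_extendJet (q : M) (z : JetCoord n m) (N : ℕ) :
    polySection E q (extendJet (N := N) (z.1, fun K => z.2 K)) N = polySection E q z N := by
  funext r
  refine congrArg ((tr q).symm r) (Finset.sum_congr rfl fun K hK => ?_)
  rw [extendJet_snd z K (mem_idxLE.1 hK)]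
  rfl

theorem contDiff_taylorPoly_extendJet {n m N : ℕ} :
    ContDiff ℝ ∞ fun a : (𝔼 (Fin n) × (idxLE n N → Fin m → ℝ)) × 𝔼 (Fin n) => taylorPoly (extendJet a.1) N a.2 := by
  unfold taylorPoly
  refine ContDiff.sum fun K hK => ?_
  have h1 : ContDiff ℝ ∞ fun a : (𝔼 (Fin n) × (idxLE n N → Fin m → ℝ)) × 𝔼 (Fin n) =>
      ∏ i, (a.2 i - a.1.1 i) ^ K i / ((K i).factorial : ℝ) := by fun_prop
  have h2 : ContDiff ℝ ∞ fun a : (𝔼 (Fin n) × (idxLE n N → Fin m → ℝ)) × 𝔼 (Fin n) => (extendJet a.1).2 K := by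
    simp only [extendJet, dif_pos hK]
    fun_prop
  exact h1.smul h2

theorem contDiffAt_comp_snd {P V W : Type*} [NormedAddCommGroup P] [NormedSpace ℝ P] [NormedAddCommGroup V]
    [NormedSpace ℝ V] [NormedAddCommGroup W] [NormedSpace ℝ W] {Φ : P × V → W} (hΦ : ContDiff ℝ ∞ Φ) {τ : V → V}
    {a : P × V} (hτ : ContDiffAt ℝ ∞ τ a.2) : ContDiffAt ℝ ∞ (fun a : P × V => Φ (a.1, τ a.2)) a :=
  hΦ.contDiffAt.comp a (contDiffAt_fst.prodMk (hτ.comp a contDiffAt_snd))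

theorem isSmoothOfOrder_pullForm {p : M} {b : JetCoord n m → 𝔼 (Fin n) [⋀^Fin k]→L[ℝ] ℝ}
    (hb : IsSmoothOfOrder (chartDom n m E p) N b) (q : M) :
    IsSmoothOfOrder (domOn n m E q (coordDom n m E p)) N (inCoord q (pullForm p b : RawForm n m E k)) := by
  set V := domOn n m E q (coordDom n m E p)
  set D := domOn n m E p (coordDom n m E q)
  have hV : IsOpen V := isOpen_domOn q (isOpen_coordDom p)
  have hD : IsOpen D := isOpen_domOn p (isOpen_coordDom q)
  have hu : ContDiffOn ℝ ∞ (fun a : (𝔼 (Fin n) × (idxLE n N → Fin m → ℝ)) × 𝔼 (Fin n) =>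
      localExpr n m p (polySection E q (extendJet a.1) N) a.2) (univ ×ˢ D) := by
    have h1 : ContDiffOn ℝ ∞ (fun a : (𝔼 (Fin n) × (idxLE n N → Fin m → ℝ)) × 𝔼 (Fin n) =>
        fibreExpr n m q p (fun _ v => v : ∀ r, E r → E r)
          (a.2, taylorPoly (extendJet a.1) N ((ch q ∘ (ch p).symm) a.2))) (univ ×ˢ D) := by
      intro a ha
      refine ContDiffAt.contDiffWithinAt ?_
      have h0 : ContDiffAt ℝ ∞ (fibreExpr n m q p (fun _ v => v : ∀ r, E r → E r))
          (a.2, taylorPoly (extendJet a.1) N ((ch q ∘ (ch p).symm) a.2)) :=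
        contDiffAt_fibreExpr smoothFibreMap_id ha.2.1 ha.2.2.2.2
      refine h0.comp a (f := fun a => (a.2, taylorPoly (extendJet a.1) N ((ch q ∘ (ch p).symm) a.2))) ?_
      refine contDiffAt_snd.prodMk ?_
      exact contDiffAt_comp_snd contDiff_taylorPoly_extendJet (contDiffAt_transition (p := q) (q := p) ha.2.1.1 ha.2.2.2.1)
    refine h1.congr fun a ha => ?_
    rw [← localExpr_polySection (E := E) q (extendJet a.1) N]
    · exact localExpr_fibreMap (s := polySection E q (extendJet a.1) N) (fun _ v => v) q p ha.2.2.2.1 ha.2.2.2.2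
    · exact chart_mem_chartDom ha.2.2.2.1 ha.2.2.2.2
  have hτ : ContDiffOn ℝ ∞ (ch p ∘ (ch q).symm) V := fun y hy =>
    (contDiffAt_transition (p := p) (q := q) hy.1.1 hy.2.2.1).contDiffWithinAt
  have hτD : ∀ y ∈ V, (ch p ∘ (ch q).symm) y ∈ D := fun y hy =>
    mem_domOn hy.2.2 (symm_mem_coordDom hy.1)
  have h1 := contDiffOn_comp_jetOf_slice hD (hb.mono_set inter_subset_left)
    (u := fun w => localExpr n m p (polySection E q (extendJet w) N)) hu
  have h2 : ContDiffOn ℝ ∞ (fun w : 𝔼 (Fin n) × (idxLE n N → Fin m → ℝ) =>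
      b (jetOf (localExpr n m p (polySection E q (extendJet w) N)) ((ch p ∘ (ch q).symm) w.1))) (V ×ˢ univ) :=
    h1.comp (s := V ×ˢ univ) (f := fun w => (w, (ch p ∘ (ch q).symm) w.1))
      (contDiffOn_id.prodMk (hτ.comp contDiffOn_fst fun w hw => hw.1)) fun w hw => ⟨mem_univ _, hτD _ hw.1⟩
  refine ⟨_, contDiffOn_compContinuousLinearMap h2
    ((hτ.fderiv_of_isOpen hV (m := ∞) (by simp)).comp contDiffOn_fst fun w hw => hw.1), fun z hz => ?_⟩
  rw [inCoord_pullForm hb q hz.1 hz.2.2]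
  show _ = (b (jetOf (localExpr n m p (polySection E q (extendJet (N := N) (z.1, fun K => z.2 K)) N)) _)).compContinuousLinearMap _
  rw [polySection_extendJet]
  rfl

theorem hasOrder_pullForm [T2Space M] {p : M} {b : JetCoord n m → 𝔼 (Fin n) [⋀^Fin k]→L[ℝ] ℝ}
    (hb : IsSmoothOfOrder (chartDom n m E p) N b) {K : Set M} (hK : IsCompact K) (hKp : K ⊆ coordDom n m E p)
    (h0 : ∀ z : JetCoord n m, z.1 ∈ chartDom n m E p → (ch p).symm z.1 ∉ K → b z = 0) :
    HasOrder N (pullForm p b : RawForm n m E k) := by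
  intro q
  refine isSmoothOfOrder_of_local fun y hy => ?_
  by_cases hyp : (ch q).symm y ∈ coordDom n m E p
  · exact ⟨_, isOpen_domOn q (isOpen_coordDom p), ⟨hy, hy.1, hyp⟩, isSmoothOfOrder_pullForm hb q⟩
  · refine ⟨_, isOpen_domOn q hK.isClosed.isOpen_compl, ⟨hy, hy.1, fun h => hyp (hKp h)⟩,
      isSmoothOfOrder_zero.congr fun z hz => ?_⟩
    have h1 : pullForm p b (ofCoord E q z) = 0 := pullForm_eq_zero fun hp => h0 _ (chart_mem_chartDom hp.1 hp.2) (by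
      have e : (ch p).symm (toCoord p (ofCoord E q z)).1 = (ofCoord E q z).pt := (ch p).left_inv hp.1
      rw [e]
      exact hz.2.2)
    exact (congrArg (formInChart q ((ch q).symm z.1)) h1).trans (formInChart_zero _ _)

theorem inCoord_pullForm_self {p : M} {b : JetCoord n m → 𝔼 (Fin n) [⋀^Fin k]→L[ℝ] ℝ}
    (hb : IsSmoothOfOrder (chartDom n m E p) N b) {z : JetCoord n m} (hz : z.1 ∈ chartDom n m E p) :
    inCoord p (pullForm p b : RawForm n m E k) z = b z := by
  have hs : ∀ r ∈ coordDom n m E p, SmoothSecAt n m (polySection E p z N) r := fun r hr =>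
    smoothSecAt_polySection p z N hr.1 hr.2
  have hp := symm_mem_coordDom hz
  rw [inCoord_eq (pullForm_dependsTo hb) hz (isOpen_coordDom p) hp hs (hasCoords_polySection hz N)]
  refine (pullForm_jet b hp (isOpen_coordDom p) hp hs).trans ?_
  rw [(ch p).right_inv hz.1]
  exact hb.congr_jets hz (hasCoords_polySection hz N)

theorem dCoord_congr {U : Set (𝔼 (Fin n))} (hU : IsOpen U) {f g : JetCoord n m → 𝔼 (Fin n) [⋀^Fin k]→L[ℝ] ℝ}
    (h : ∀ z, z.1 ∈ U → f z = g z) {z : JetCoord n m} (hz : z.1 ∈ U) : dCoord f z = dCoord g z := by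
  unfold dCoord
  simp only [totalD_congr hU h _ hz]

theorem dH_congr_of_isOpen {O : Set M} (hO : IsOpen O) {α β : RawForm n m E k}
    (h : ∀ j : JetInf n m E, j.pt ∈ O → α j = β j) {j : JetInf n m E} (hj : j.pt ∈ O) : dH α j = dH β j := by
  have h1 : dCoord (inCoord j.pt α) j.coord = dCoord (inCoord j.pt β) j.coord :=
    dCoord_congr (isOpen_domOn (n := n) (m := m) (E := E) j.pt hO)
      (fun z hz => congrArg (formInChart j.pt ((ch j.pt).symm z.1)) (h (ofCoord E j.pt z) hz.2.2))
      ⟨j.coord_mem, j.coord_mem.1, by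
        show (ch j.pt).symm j.coord.1 ∈ O
        rwa [j.symm_coord]⟩
  exact h1

theorem dH_zero : dH (0 : RawForm n m E k) = 0 := by
  funext j
  have h1 : ∀ i, totalD i (inCoord j.pt (0 : RawForm n m E k)) j.coord = 0 := fun i =>
    (hasDerivAt_const (0 : ℝ) (0 : 𝔼 (Fin n) [⋀^Fin k]→L[ℝ] ℝ)).deriv
  have h2 : dCoord (inCoord j.pt (0 : RawForm n m E k)) j.coord = 0 := by
    unfold dCoord
    simp only [h1]
    refine ContinuousAlternatingMap.ext fun v => ?_
    simp [ContinuousAlternatingMap.alternatizeUncurryFin_apply]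
  exact h2

end Transfer

section EulerVanishing
set_option linter.unusedSectionVars false
variable {n m : ℕ} {M : Type*} [TopologicalSpace M] [ChartedSpace (EuclideanSpace ℝ (Fin n)) M]
  [IsManifold (𝓡 n) ∞ M]
  {E : M → Type*} [∀ p, AddCommGroup (E p)] [∀ p, Module ℝ (E p)] [∀ p, TopologicalSpace (E p)]
  [TopologicalSpace (TotalSpace (Fin m → ℝ) E)] [FiberBundle (Fin m → ℝ) E]
  [VectorBundle ℝ (Fin m → ℝ) E] [ContMDiffVectorBundle ∞ (Fin m → ℝ) E (𝓡 n)]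

local notation "ch" => chartAt (EuclideanSpace ℝ (Fin n))
local notation "tr" => trivializationAt (Fin m → ℝ) E

variable [T2Space M] [SecondCountableTopology M] [MeasurableSpace M] [BorelSpace M] {ν : VolumeForm n M}
  {μ : Measure M} {N : ℕ}

theorem VolumeForm.IsMeasure.eulerOp_lagrangian_eq_zero (hμ : ν.IsMeasure μ) {α : RawForm n m E n} (hα : HasOrder N α)
    (hE : ∀ j, euler α j = 0) (p : M) (a : Fin m) {z : JetCoord n m} (hz : z.1 ∈ chartDom n m E p) :
    eulerOp a (lagrangian p α) z = 0 := by
  have h := hμ.eulerComp_eq_zero hα hz (hE _) a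
  exact (smul_eq_zero.1 h).resolve_left (inv_ne_zero (ν.comp_ne_zero hz.1))

theorem jetOf_localExpr_zero {p : M} {y : 𝔼 (Fin n)} (hy : y ∈ chartDom n m E p) :
    jetOf (localExpr n m p fun q => (0 : E q)) y = (y, 0) := by
  have h1 : ∀ y ∈ chartDom n m E p, localExpr n m p (fun q => (0 : E q)) y = (fun _ => 0) y := fun y hy => by
    show (tr p ⟨_, 0⟩).2 = 0
    rw [← linearMapAt_triv hy.2, map_zero]
  refine Prod.ext rfl (funext fun I => ?_)
  show iterOp partialD I (localExpr n m p fun q => (0 : E q)) y = 0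
  rw [iterOp_partialD_congr (isOpen_chartDom p) h1 I hy]
  have h2 := iterOp_partialD_smul isOpen_univ (contDiffOn_const (c := (0 : Fin m → ℝ))) 0 I (mem_univ y)
  simpa using h2

/-- The integral of a form supported in a cube over the zero section. -/
theorem VolumeForm.IsMeasure.integral_lagrangian_zero (hμ : ν.IsMeasure μ) {α : RawForm n m E n} (hα : HasOrder N α)
    {p : M} {a : 𝔼 (Fin n)} {ρ : ℝ} (hρ : 0 < ρ) (hC : cube a ρ ⊆ chartDom n m E p)
    (h0 : ∀ j : JetInf n m E, j.pt ∉ (ch p).symm '' cube a ρ → α j = 0)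
    (hf : functional ν μ α (fun q => (0 : E q)) = 0) :
    ∫ y, (chartDom n m E p).indicator (fun y => lagrangian p α (y, 0)) y = 0 := by
  have hs : ∀ r, SmoothSecAt n m (fun q => (0 : E q)) r := smoothSecAt_zero
  have hK : IsCompact ((ch p).symm '' cube a ρ) := (isCompact_cube a ρ).image_of_continuousOn
    ((ch p).continuousOn_symm.mono fun y hy => (hC hy).1)
  have hKp : (ch p).symm '' cube a ρ ⊆ coordDom n m E p := by
    rintro _ ⟨y, hy, rfl⟩
    exact symm_mem_coordDom (hC hy)
  have hcd : ContDiffOn ℝ ∞ (fun y => lagrangian p α (y, (0 : (Fin n → ℕ) → Fin m → ℝ))) (chartDom n m E p) :=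
    (contDiffOn_comp_jetOf (isOpen_chartDom p) (hα.lagrangian p) (contDiffOn_localExpr_univ p hs)).congr
      fun y hy => by rw [jetOf_localExpr_zero hy]
  have h1 := hμ.integral_eq_of_compact hK hKp (F := ν.dens α fun q => (0 : E q))
    (fun q hq => by
      have := h0 (jet n m (fun q => (0 : E q)) q) hq
      exact (congrArg (ν.quot q) this).trans (zero_div _)) hcd
    fun r hr => by rw [ν.dens_eq hα hr hs, jetOf_localExpr_zero (chart_mem_chartDom hr.1 hr.2)]
  have hsub : cube a ρ ⊆ (ch p).target := fun y hy => (hC hy).1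
  have hconst : ∀ y ∈ cube a ρ, (SignType.sign (ν.comp p y) : ℝ) = SignType.sign (ν.comp p a) := fun y hy => by
    refine (convex_cube a ρ).isPreconnected.constant_of_mapsTo (T := {-1, 0, 1})
      (f := fun y => (SignType.sign (ν.comp p y) : ℝ)) (toFinite _).isDiscrete (fun y hy => ?_) (fun y _ => ?_) hy (mem_cube_self a hρ)
    · exact (continuousAt_const.congr ((ν.isLocConstOn_sign p y (hsub hy)).mono fun _ h => h.symm)).continuousWithinAt
    · rcases SignType.trichotomy (SignType.sign (ν.comp p y)) with h | h | h <;> simp [h]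
  have h2 : ∀ y, (SignType.sign (ν.comp p y) : ℝ) * (chartDom n m E p).indicator (fun y => lagrangian p α (y, 0)) y
      = (SignType.sign (ν.comp p a) : ℝ) * (chartDom n m E p).indicator (fun y => lagrangian p α (y, 0)) y := fun y => by
    by_cases hy : y ∈ cube a ρ
    · rw [hconst y hy]
    · have : (chartDom n m E p).indicator (fun y => lagrangian p α (y, 0)) y = 0 := by
        by_cases hyU : y ∈ chartDom n m E p
        · rw [indicator_of_mem hyU]
          have h3 : α (ofCoord E p (y, 0)) = 0 := h0 _ (by
            rintro ⟨y', hy', he⟩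
            exact hy ((ch p).symm.injOn (hC hy').1 hyU.1 he ▸ hy'))
          exact congrArg (fun A => formInChart p ((ch p).symm y) A basisVec) h3
        · exact indicator_of_notMem hyU _
      rw [this, mul_zero, mul_zero]
  rw [functional_eq] at hf
  simp only [h2] at h1
  rw [hf, integral_const_mul] at h1
  refine (mul_eq_zero.1 h1.symm).resolve_left ?_
  have h3 := ν.comp_ne_zero (hsub (mem_cube_self a hρ))
  rcases lt_or_gt_of_ne h3 with h | h
  · simp [sign_neg h]
  · simp [sign_pos h]

end EulerVanishing

section ChartPrimitive
set_option linter.unusedSectionVars false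
variable {k m : ℕ} {M : Type*} [TopologicalSpace M] [ChartedSpace (EuclideanSpace ℝ (Fin (k + 1))) M]
  [IsManifold (𝓡 (k + 1)) ∞ M]
  {E : M → Type*} [∀ p, AddCommGroup (E p)] [∀ p, Module ℝ (E p)] [∀ p, TopologicalSpace (E p)]
  [TopologicalSpace (TotalSpace (Fin m → ℝ) E)] [FiberBundle (Fin m → ℝ) E]
  [VectorBundle ℝ (Fin m → ℝ) E] [ContMDiffVectorBundle ∞ (Fin m → ℝ) E (𝓡 (k + 1))]

local notation "ch" => chartAt (EuclideanSpace ℝ (Fin (k + 1)))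
local notation "tr" => trivializationAt (Fin m → ℝ) E

variable [T2Space M] [SecondCountableTopology M] [MeasurableSpace M] [BorelSpace M] {ν : VolumeForm (k + 1) M}
  {μ : Measure M} {N : ℕ}

theorem jet_zero_eq_of_coord {p : M} {y : 𝔼 (Fin (k + 1))} (hy : y ∈ chartDom (k + 1) m E p)
    {α : RawForm (k + 1) m E (k + 1)} (hα : HasOrder N α)
    (h : α (jet (k + 1) m (fun q => (0 : E q)) ((ch p).symm y)) = 0) : inCoord p α (y, 0) = 0 := by
  have h1 := formInChart_jet hα.dependsTo (symm_mem_coordDom hy) isOpen_univ (mem_univ _)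
    fun r _ => smoothSecAt_zero (n := k + 1) (m := m) (E := E) r
  rw [(ch p).right_inv hy.1, jetOf_localExpr_zero hy] at h1
  exact h1.symm.trans ((congrArg (formInChart p ((ch p).symm y)) h).trans (formInChart_zero _ _))

/-- A top degree form supported in a cube, with vanishing Euler-Lagrange form and functional, is exact. -/
theorem VolumeForm.IsMeasure.exists_primitive_cube (hμ : ν.IsMeasure μ) {α : RawForm (k + 1) m E (k + 1)}
    (hα : HasOrder N α) (hE : ∀ j, euler α j = 0) {p : M} {a : 𝔼 (Fin (k + 1))} {ρ : ℝ} (hρ : 0 < ρ)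
    (hC : cube a ρ ⊆ chartDom (k + 1) m E p)
    (h0 : ∀ j : JetInf (k + 1) m E, j.pt ∉ (ch p).symm '' cube a ρ → α j = 0)
    (hf : functional ν μ α (fun q => (0 : E q)) = 0) :
    ∃ β : RawForm (k + 1) m E k, HasOrder (2 * N) β ∧ dH β = α ∧
      (∀ j : JetInf (k + 1) m E, j.pt ∉ (ch p).symm '' cube a ρ → β j = 0) ∧
      ((∀ r, α (jet (k + 1) m (fun q => (0 : E q)) r) = 0) →
        (∀ r, β (jet (k + 1) m (fun q => (0 : E q)) r) = 0) ∧
        ∀ O : Set M, IsOpen O → (∀ j : JetInf (k + 1) m E, j.pt ∈ O → α j = 0) →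
          ∀ j : JetInf (k + 1) m E, j.pt ∈ O → β j = 0) := by
  set U := chartDom (k + 1) m E p
  have hU : IsOpen U := isOpen_chartDom p
  have hcube : ∀ y ∈ U, (ch p).symm y ∈ (ch p).symm '' cube a ρ → y ∈ cube a ρ := by
    rintro y hy ⟨y', hy', he⟩
    exact (ch p).symm.injOn (hC hy').1 hy.1 he ▸ hy'
  have hin : ∀ z : JetCoord (k + 1) m, α (ofCoord E p z) = 0 → inCoord p α z = 0 := fun z h =>
    (congrArg (formInChart p ((ch p).symm z.1)) h).trans (formInChart_zero _ _)
  obtain ⟨B, hB, hBe, hBc, hB0⟩ := exists_currents_cube hU (hα.lagrangian p)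
    (fun b z hz => hμ.eulerOp_lagrangian_eq_zero hα hE p b hz) hρ hC
    (fun z hz hz' => congrArg (fun A => A basisVec) (hin z (h0 _ fun h => hz' (hcube _ hz h))))
    (hμ.integral_lagrangian_zero hα hρ hC h0 hf)
  obtain ⟨η, hη⟩ := exists_minorForm k
  set b : JetCoord (k + 1) m → 𝔼 (Fin (k + 1)) [⋀^Fin k]→L[ℝ] ℝ := fun z =>
    ∑ i : Fin (k + 1), ((-1 : ℝ) ^ (i : ℕ) • B i z) • η i
  have hb : IsSmoothOfOrder U (2 * N) b := IsSmoothOfOrder.sum _ fun i _ =>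
    ((hB i).const_smul _).smul (isSmoothOfOrder_fst (G := fun _ => η i) contDiffOn_const)
  have hb0 : ∀ z, (∀ i, B i z = 0) → b z = 0 := fun z h => by
    simp [b, h]
  have hbz : ∀ z : JetCoord (k + 1) m, z.1 ∈ U → (ch p).symm z.1 ∉ (ch p).symm '' cube a ρ → b z = 0 := fun z hz hz' =>
    hb0 z fun i => hBc i z hz fun h => hz' ⟨z.1, h, rfl⟩
  have hK : IsCompact ((ch p).symm '' cube a ρ) := (isCompact_cube a ρ).image_of_continuousOn
    ((ch p).continuousOn_symm.mono fun y hy => (hC hy).1)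
  have hKp : (ch p).symm '' cube a ρ ⊆ coordDom (k + 1) m E p := by
    rintro _ ⟨y, hy, rfl⟩
    exact symm_mem_coordDom (hC hy)
  have hord : HasOrder (2 * N) (pullForm p b : RawForm (k + 1) m E k) := hasOrder_pullForm hb hK hKp hbz
  have hoff : ∀ j : JetInf (k + 1) m E, j.pt ∉ (ch p).symm '' cube a ρ → pullForm p b j = 0 := fun j hj =>
    pullForm_eq_zero fun hp => hbz _ (chart_mem_chartDom hp.1 hp.2) (by
      have e : (ch p).symm (toCoord p j).1 = j.pt := (ch p).left_inv hp.1
      rwa [e])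
  have hd : ∀ z, z.1 ∈ U → inCoord p (dH (pullForm p b : RawForm (k + 1) m E k)) z = inCoord p α z := fun z hz => by
    refine topForm_ext ?_
    rw [inCoord_dH hord p hz, dCoord_congr hU (fun z hz => inCoord_pullForm_self hb hz) hz, dCoord_basisVec hU hb hz]
    refine Eq.trans ?_ (hBe z hz)
    refine Finset.sum_congr rfl fun i _ => ?_
    have h1 : ∀ z, b z (i.removeNth basisVec) = (-1 : ℝ) ^ (i : ℕ) • B i z := fun z => by
      simp [b, ContinuousAlternatingMap.sum_apply, hη]
    simp only [h1]
    have h2 : totalD i (fun z => (-1 : ℝ) ^ (i : ℕ) • B i z) z = (-1 : ℝ) ^ (i : ℕ) • totalD i (B i) z :=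
      (hB i).lineDeriv_clm hU ((-1 : ℝ) ^ (i : ℕ) • ContinuousLinearMap.id ℝ ℝ) hz _
    rw [h2, smul_smul, ← pow_add, ← two_mul, Even.neg_one_pow ⟨i, two_mul _⟩, one_smul]
  refine ⟨pullForm p b, hord, ?_, hoff, fun hz => ⟨fun r => ?_, fun O hO hO0 j hj => ?_⟩⟩
  · refine form_ext hord.dH.dependsTo (hα.mono (show N ≤ 2 * N + 1 by omega)).dependsTo fun s hs r => ?_
    by_cases hr : r ∈ (ch p).symm '' cube a ρ
    · have hr := hKp hr
      refine formInChart_injective hr.1 ?_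
      rw [formInChart_jet hord.dH.dependsTo hr isOpen_univ (mem_univ r) fun r _ => hs.1 r,
        formInChart_jet hα.dependsTo hr isOpen_univ (mem_univ r) fun r _ => hs.1 r]
      exact hd _ (chart_mem_chartDom hr.1 hr.2)
    · rw [h0 _ hr]
      have h1 := dH_congr_of_isOpen hK.isClosed.isOpen_compl (α := pullForm p b) (β := 0) (fun j hj => hoff j hj)
        (j := jet (k + 1) m s r) hr
      rw [h1, dH_zero]
      rfl
  · refine pullForm_eq_zero fun hr => hb0 _ fun i => (hB0 fun y hy => ?_).1 i _ ?_
    · exact congrArg (fun A => A basisVec) (jet_zero_eq_of_coord hy hα (hz _))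
    · have h1 := toCoord_jet (r := r) hr isOpen_univ (mem_univ _) fun r _ => smoothSecAt_zero (n := k + 1) (m := m) (E := E) r
      rw [h1, jetOf_localExpr_zero (y := ch p r) (chart_mem_chartDom hr.1 hr.2)]
  · refine pullForm_eq_zero fun hr => hb0 _ fun i => (hB0 fun y hy => ?_).2 (domOn (k + 1) m E p O) (isOpen_domOn p hO)
      (fun z hz => ?_) i _ (mem_domOn hr hj)
    · exact congrArg (fun A => A basisVec) (jet_zero_eq_of_coord hy hα (hz _))
    · exact congrArg (fun A => A basisVec) (hin z (hO0 _ hz.2.2))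

end ChartPrimitive

section LocalSums
set_option linter.unusedSectionVars false
variable {n m : ℕ} {M : Type*} [TopologicalSpace M] [ChartedSpace (EuclideanSpace ℝ (Fin n)) M]
  [IsManifold (𝓡 n) ∞ M]
  {E : M → Type*} [∀ p, AddCommGroup (E p)] [∀ p, Module ℝ (E p)] [∀ p, TopologicalSpace (E p)]
  [TopologicalSpace (TotalSpace (Fin m → ℝ) E)] [FiberBundle (Fin m → ℝ) E]
  [VectorBundle ℝ (Fin m → ℝ) E] [ContMDiffVectorBundle ∞ (Fin m → ℝ) E (𝓡 n)]

local notation "ch" => chartAt (EuclideanSpace ℝ (Fin n))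
local notation "tr" => trivializationAt (Fin m → ℝ) E

variable [T2Space M] {N k : ℕ}

theorem hasOrder_of_local {α : RawForm n m E k}
    (h : ∀ r : M, ∃ O, IsOpen O ∧ r ∈ O ∧ ∃ α' : RawForm n m E k, HasOrder N α' ∧
      ∀ j : JetInf n m E, j.pt ∈ O → α j = α' j) : HasOrder N α := fun p =>
  isSmoothOfOrder_of_local fun y hy => by
    obtain ⟨O, hO, hr, α', hα', he⟩ := h ((ch p).symm y)
    refine ⟨domOn n m E p O, isOpen_domOn p hO, ⟨hy, hy.1, hr⟩,
      (hα'.isSmoothOfOrder_domOn p O).congr fun z hz => ?_⟩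
    exact congrArg (formInChart p ((ch p).symm z.1)) (he (ofCoord E p z) hz.2.2)

theorem HasOrder.lin {α β : RawForm n m E k} (hα : HasOrder N α) (hβ : HasOrder N β) (c : ℝ) :
    HasOrder N (c • α + β) := fun p => by
  have h := (hα p).lin (hβ p) c
  rwa [max_self] at h

theorem hasOrder_zero : HasOrder N (0 : RawForm n m E k) := fun _ => ⟨0, contDiffOn_const, fun _ _ => rfl⟩

theorem dH_lin {α β : RawForm n m E k} (hα : HasOrder N α) (hβ : HasOrder N β) (c : ℝ) :
    dH (c • α + β) = c • dH α + dH β := by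
  funext j
  have h1 : ∀ i, totalD i (inCoord j.pt (c • α + β)) j.coord
      = c • totalD i (inCoord j.pt α) j.coord + totalD i (inCoord j.pt β) j.coord := fun i =>
    (hα j.pt).lineDeriv_lin (isOpen_chartDom j.pt) (hβ j.pt) c j.coord_mem _
  have h2 : dCoord (inCoord j.pt (c • α + β)) j.coord
      = c • dCoord (inCoord j.pt α) j.coord + dCoord (inCoord j.pt β) j.coord := by
    unfold dCoord
    rw [← ContinuousAlternatingMap.alternatizeUncurryFin_smul, ← ContinuousAlternatingMap.alternatizeUncurryFin_add]
    congr 1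
    simp only [h1, Finset.smul_sum, ← Finset.sum_add_distrib]
    refine Finset.sum_congr rfl fun i _ => ContinuousLinearMap.ext fun v => ?_
    simp only [ContinuousLinearMap.smulRight_apply, ContinuousLinearMap.add_apply, ContinuousLinearMap.smul_apply,
      smul_add, smul_comm c]
  exact h2

theorem hasOrder_sum {ι : Type*} (s : Finset ι) {f : ι → RawForm n m E k} (h : ∀ i ∈ s, HasOrder N (f i)) :
    HasOrder N (∑ i ∈ s, f i) ∧ dH (∑ i ∈ s, f i) = ∑ i ∈ s, dH (f i) := by
  classical
  induction s using Finset.induction_on with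
  | empty => exact ⟨hasOrder_zero, dH_zero⟩
  | insert i s hi ih =>
    have h1 := h i (Finset.mem_insert_self i s)
    have h2 := ih fun i hi => h i (Finset.mem_insert_of_mem hi)
    have e := one_smul ℝ (f i)
    rw [Finset.sum_insert hi, Finset.sum_insert hi, ← h2.2, ← e]
    refine ⟨h1.lin h2.1 1, ?_⟩
    rw [dH_lin h1 h2.1, e, one_smul]

theorem exists_cube_subset {a : 𝔼 (Fin n)} {U : Set (𝔼 (Fin n))} (hU : U ∈ 𝓝 a) :
    ∃ ρ, 0 < ρ ∧ cube a ρ ⊆ U := by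
  have h1 : (EuclideanSpace.equiv (Fin n) ℝ).symm ⁻¹' U ∈ 𝓝 (EuclideanSpace.equiv (Fin n) ℝ a) :=
    (EuclideanSpace.equiv (Fin n) ℝ).symm.continuous.continuousAt.preimage_mem_nhds (by simpa using hU)
  obtain ⟨ρ, hρ, h2⟩ := Metric.nhds_basis_closedBall.mem_iff.1 h1
  refine ⟨ρ, hρ, fun x hx => ?_⟩
  have h3 : EuclideanSpace.equiv (Fin n) ℝ x ∈ Metric.closedBall (EuclideanSpace.equiv (Fin n) ℝ a) ρ := by
    rw [closedBall_pi _ hρ.le, mem_univ_pi]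
    intro i
    rw [Real.closedBall_eq_Icc]
    exact hx i
  simpa using h2 h3

theorem cube_mem_nhds (a : 𝔼 (Fin n)) {ρ : ℝ} (hρ : 0 < ρ) : cube a ρ ∈ 𝓝 a := by
  rw [cube_eq]
  refine (EuclideanSpace.equiv (Fin n) ℝ).continuous.continuousAt.preimage_mem_nhds
    (set_pi_mem_nhds finite_univ fun i _ => Icc_mem_nhds ?_ ?_)
  · show a i - ρ < a i
    linarith
  · show a i < a i + ρ
    linarith

variable (n m E) in
/-- A smooth partition of unity subordinate to coordinate cubes. -/
theorem exists_cube_partition [SecondCountableTopology M] : ∃ (ρ : M → ℝ) (f : M → M → ℝ),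
    (∀ p, 0 < ρ p ∧ cube (ch p p) (ρ p) ⊆ chartDom n m E p) ∧ (∀ p, ContMDiff (𝓡 n) 𝓘(ℝ) ∞ (f p)) ∧
    (∀ p, tsupport (f p) ⊆ (ch p).symm '' cube (ch p p) (ρ p)) ∧ (LocallyFinite fun p => tsupport (f p)) ∧
    ∀ (r : M) (F : Finset M), (∀ p, r ∈ tsupport (f p) → p ∈ F) → ∑ p ∈ F, f p r = 1 := by
  have h1 : ∀ p : M, ∃ ρ, 0 < ρ ∧ cube (ch p p) ρ ⊆ chartDom n m E p := fun p =>
    exists_cube_subset ((isOpen_chartDom p).mem_nhds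
      (chart_mem_chartDom (mem_chart_source _ p) (FiberBundle.mem_baseSet_trivializationAt' p)))
  choose ρ hρ using h1
  have : LocallyCompactSpace M := ChartedSpace.locallyCompactSpace (𝔼 (Fin n)) M
  obtain ⟨f, hf⟩ := SmoothPartitionOfUnity.exists_isSubordinate (𝓡 n) isClosed_univ
    (fun p : M => (ch p).source ∩ ch p ⁻¹' interior (cube (ch p p) (ρ p)))
    (fun p => (ch p).isOpen_inter_preimage isOpen_interior)
    (fun p _ => mem_iUnion.2 ⟨p, mem_chart_source _ p, mem_interior_iff_mem_nhds.2 (cube_mem_nhds _ (hρ p).1)⟩)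
  refine ⟨ρ, fun p => f p, hρ, fun p => (f p).contMDiff, fun p r hr => ?_, f.locallyFinite.closure, fun r F hF => ?_⟩
  · have h2 := hf p hr
    exact ⟨ch p r, interior_subset h2.2, (ch p).left_inv h2.1⟩
  · rw [← f.sum_eq_one (mem_univ r)]
    exact (finsum_eq_sum_of_support_subset _ fun p hp => hF p (subset_tsupport _ hp)).symm

theorem isCompact_chart_cube {p : M} {a : 𝔼 (Fin n)} {ρ : ℝ} (hC : cube a ρ ⊆ chartDom n m E p) :
    IsCompact ((ch p).symm '' cube a ρ) := (isCompact_cube a ρ).image_of_continuousOn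
  ((ch p).continuousOn_symm.mono fun _ hy => (hC hy).1)

end LocalSums

section Jacobiator
set_option linter.unusedSectionVars false
variable {n m : ℕ} {M : Type*} [TopologicalSpace M] [ChartedSpace (EuclideanSpace ℝ (Fin n)) M]
  [IsManifold (𝓡 n) ∞ M]
  {E : M → Type*} [∀ p, AddCommGroup (E p)] [∀ p, Module ℝ (E p)] [∀ p, TopologicalSpace (E p)]
  [TopologicalSpace (TotalSpace (Fin m → ℝ) E)] [FiberBundle (Fin m → ℝ) E]
  [VectorBundle ℝ (Fin m → ℝ) E] [ContMDiffVectorBundle ∞ (Fin m → ℝ) E (𝓡 n)]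

local notation "ch" => chartAt (EuclideanSpace ℝ (Fin n))
local notation "tr" => trivializationAt (Fin m → ℝ) E

variable [T2Space M] [SecondCountableTopology M] [MeasurableSpace M] [BorelSpace M] {ν : VolumeForm n M}
  {μ : Measure M} {N : ℕ}

theorem isCompactSection_zero : IsCompactSection n m fun q => (0 : E q) :=
  ⟨smoothSecAt_zero, ∅, isCompact_empty, fun _ _ => rfl⟩

theorem SkewTensor.exists_order_jac (w : SkewTensor m E ν) (hμ : ν.IsMeasure μ) (N : ℕ) :
    ∃ l, ∀ α β γ : RawForm n m E n, HasOrder N α → HasOrder N β → HasOrder N γ → HasOrder l (w.jac α β γ) := by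
  obtain ⟨l, hl⟩ := w.exists_order_l2 hμ N
  obtain ⟨l', hl'⟩ := w.exists_order_l2 hμ (max N l)
  have key : ∀ α β γ : RawForm n m E n, HasOrder N α → HasOrder N β → HasOrder N γ →
      HasOrder l' (w.l2 (w.l2 α β) γ) := fun α β γ hα hβ hγ =>
    hl' _ _ ((hl α β hα hβ).mono (le_max_right _ _)) (hγ.mono (le_max_left _ _))
  refine ⟨l', fun α β γ hα hβ hγ => ?_⟩
  have h := ((key α β γ hα hβ hγ).lin (key β γ α hβ hγ hα) 1).lin (key γ α β hγ hα hβ) 1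
  rwa [one_smul, one_smul] at h

theorem SkewTensor.jac_sum (w : SkewTensor m E ν) (hμ : ν.IsMeasure μ) {ι : Type*} (s : Finset ι)
    {α : ι → RawForm n m E n} {β γ : RawForm n m E n} (hα : ∀ i, α i ∈ omegaC n m E n)
    (hβ : β ∈ omegaC n m E n) (hγ : γ ∈ omegaC n m E n) :
    w.jac (∑ i ∈ s, α i) β γ = ∑ i ∈ s, w.jac (α i) β γ := by
  classical
  induction s using Finset.induction_on with
  | empty => exact w.jac_zero_left β γ
  | insert i s hi ih =>
    have h := w.jac_lin hμ (hα i) (sum_mem fun i (_ : i ∈ s) => hα i) hβ hγ 1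
    rw [one_smul, one_smul] at h
    rw [Finset.sum_insert hi, Finset.sum_insert hi, h, ih]

theorem SkewTensor.jac_mulFun_eq_zero (w : SkewTensor m E ν) {f : M → ℝ} (α β γ : RawForm n m E n)
    {j : JetInf n m E} (hj : j.pt ∉ tsupport f) : w.jac (mulFun f α) β γ j = 0 := by
  have h := w.jac_congr_of_isOpen (isClosed_tsupport f).isOpen_compl (α := mulFun f α) (α' := 0) (β := β) (γ := γ)
    (fun j hj => mulFun_eq_zero (image_eq_zero_of_notMem_tsupport hj)) hj
  rw [h, w.jac_zero_left]
  rfl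

/-- The Jacobiator is a locally finite sum of Jacobiators whose first argument is supported in a cube. -/
theorem SkewTensor.jac_eq_sum (w : SkewTensor m E ν) (hμ : ν.IsMeasure μ) {α β γ : RawForm n m E n}
    (hα : α ∈ omegaC n m E n) (hβ : β ∈ omegaC n m E n) (hγ : γ ∈ omegaC n m E n) {f : M → M → ℝ}
    (hf : ∀ p, ContMDiff (𝓡 n) 𝓘(ℝ) ∞ (f p)) (hc : ∀ p, HasCompactSupport (f p)) {O : Set M} (hO : IsOpen O)
    {F : Finset M} (h1 : ∀ r ∈ O, ∑ p ∈ F, f p r = 1) {j : JetInf n m E} (hj : j.pt ∈ O) :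
    w.jac α β γ j = (∑ p ∈ F, w.jac (mulFun (f p) α) β γ) j := by
  rw [← w.jac_sum hμ F (fun p => mulFun_mem_omegaC (hf p) (hc p) hα.1) hβ hγ]
  refine w.jac_congr_of_isOpen hO (fun j hj => ?_) hj
  rw [Finset.sum_apply]
  unfold mulFun
  rw [← Finset.sum_smul, h1 _ hj, one_smul]

/-- The first argument only contributes to the Jacobiator along the zero section near a compact set. -/
theorem SkewTensor.exists_compact_jac (w : SkewTensor m E ν) (hμ : ν.IsMeasure μ) {β γ : RawForm n m E n}
    (hβ : β ∈ omegaC n m E n) (hγ : γ ∈ omegaC n m E n) :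
    ∃ K : Set M, IsCompact K ∧ ∀ (α : RawForm n m E n), ∀ r ∉ K, w.jac α β γ (jet n m (fun q => (0 : E q)) r) = 0 := by
  obtain ⟨K1, hK1, h1⟩ := (hβ.2 _ isCompactSection_zero).2 rfl
  obtain ⟨K2, hK2, h2⟩ := (hγ.2 _ isCompactSection_zero).2 rfl
  obtain ⟨K3, hK3, h3⟩ := ((w.l2_mem_omegaC hμ hβ hγ).2 _ isCompactSection_zero).2 rfl
  refine ⟨K1 ∪ K2 ∪ K3, (hK1.union hK2).union hK3, fun α r hr => ?_⟩
  have e1 := w.l2_apply_eq_zero_right (w.l2 α β) (h2 r fun h => hr (Or.inl (Or.inr h)))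
  have e2 := w.l2_apply_eq_zero_left (h3 r fun h => hr (Or.inr h)) α
  have e3 := w.l2_apply_eq_zero_right (w.l2 γ α) (h1 r fun h => hr (Or.inl (Or.inl h)))
  refine (congrArg₂ (· + ·) (congrArg₂ (· + ·) e1 e2) e3).trans ?_
  exact (add_zero _).trans (add_zero _)

end Jacobiator

section JacobiatorExact
set_option linter.unusedSectionVars false
variable {k m : ℕ} {M : Type*} [TopologicalSpace M] [ChartedSpace (EuclideanSpace ℝ (Fin (k + 1))) M]
  [IsManifold (𝓡 (k + 1)) ∞ M]
  {E : M → Type*} [∀ p, AddCommGroup (E p)] [∀ p, Module ℝ (E p)] [∀ p, TopologicalSpace (E p)]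
  [TopologicalSpace (TotalSpace (Fin m → ℝ) E)] [FiberBundle (Fin m → ℝ) E]
  [VectorBundle ℝ (Fin m → ℝ) E] [ContMDiffVectorBundle ∞ (Fin m → ℝ) E (𝓡 (k + 1))]

local notation "ch" => chartAt (EuclideanSpace ℝ (Fin (k + 1)))
local notation "tr" => trivializationAt (Fin m → ℝ) E

variable [T2Space M] [SecondCountableTopology M] [MeasurableSpace M] [BorelSpace M] {ν : VolumeForm (k + 1) M}
  {μ : Measure M} {N : ℕ}

/-- The Jacobiator of forms in `Ω_c` is `d_H` of a form in `Ω_c`. -/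
theorem SkewTensor.exists_primitive_jac (w : SkewTensor m E ν) (hμ : ν.IsMeasure μ) (hJ : w.Jacobi μ)
    {α β γ : RawForm (k + 1) m E (k + 1)} (hα : α ∈ omegaC (k + 1) m E (k + 1))
    (hβ : β ∈ omegaC (k + 1) m E (k + 1)) (hγ : γ ∈ omegaC (k + 1) m E (k + 1)) :
    ∃ δ ∈ omegaC (k + 1) m E k, dH δ = w.jac α β γ := by
  classical
  obtain ⟨ρ, f, hρ, hf, hfC, hlf, hsum⟩ := exists_cube_partition (k + 1) m (M := M) E
  have hC : ∀ p, IsCompact ((ch p).symm '' cube (ch p p) (ρ p)) := fun p => isCompact_chart_cube (hρ p).2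
  have hfc : ∀ p, HasCompactSupport (f p) := fun p => (hC p).of_isClosed_subset (isClosed_tsupport _) (hfC p)
  obtain ⟨K0, hK0, hz⟩ := w.exists_compact_jac hμ hβ hγ
  have hS := hlf.finite_nonempty_inter_compact hK0
  set S : Finset M := hS.toFinset
  obtain ⟨N, hαN, hβN, hγN⟩ : ∃ N, HasOrder N α ∧ HasOrder N β ∧ HasOrder N γ := by
    obtain ⟨⟨N1, h1⟩, -⟩ := hα
    obtain ⟨⟨N2, h2⟩, -⟩ := hβ
    obtain ⟨⟨N3, h3⟩, -⟩ := hγ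
    exact ⟨N1 + N2 + N3, HasOrder.mono h1 (by omega), HasOrder.mono h2 (by omega), HasOrder.mono h3 (by omega)⟩
  obtain ⟨l, hl⟩ := w.exists_order_jac (E := E) hμ N
  have hmem : ∀ p, mulFun (f p) α ∈ omegaC (k + 1) m E (k + 1) := fun p => mulFun_mem_omegaC (hf p) (hfc p) hα.1
  have hlo : ∀ p, HasOrder l (w.jac (mulFun (f p) α) β γ) := fun p => hl _ _ _ (HasOrder.mulFun (hf p) hαN) hβN hγN
  have hprim : ∀ p, ∃ b : RawForm (k + 1) m E k, HasOrder (2 * l) b ∧ dH b = w.jac (mulFun (f p) α) β γ ∧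
      (∀ j : JetInf (k + 1) m E, j.pt ∉ (ch p).symm '' cube (ch p p) (ρ p) → b j = 0) ∧
      (p ∉ S → (∀ r, b (jet (k + 1) m (fun q => (0 : E q)) r) = 0) ∧
        ∀ j : JetInf (k + 1) m E, j.pt ∉ tsupport (f p) → b j = 0) := fun p => by
    obtain ⟨b, hb, hd, hoff, hb0⟩ := hμ.exists_primitive_cube (hlo p)
      (w.euler_jac hμ hJ (hmem p) hβ hγ) (hρ p).1 (hρ p).2
      (fun j hj => w.jac_mulFun_eq_zero α β γ fun h => hj (hfC p h))
      (w.functional_jac hμ hJ (hmem p) hβ hγ isCompactSection_zero)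
    refine ⟨b, hb, hd, hoff, fun hp => ?_⟩
    have h0 : ∀ r, w.jac (mulFun (f p) α) β γ (jet (k + 1) m (fun q => (0 : E q)) r) = 0 := fun r => by
      by_cases hr : r ∈ tsupport (f p)
      · exact hz _ r fun hrK => hp (hS.mem_toFinset.2 ⟨r, hr, hrK⟩)
      · exact w.jac_mulFun_eq_zero (j := jet (k + 1) m (fun q => (0 : E q)) r) α β γ hr
    exact ⟨(hb0 h0).1, fun j hj => (hb0 h0).2 _ (isClosed_tsupport (f p)).isOpen_compl
      (fun j hj => w.jac_mulFun_eq_zero α β γ hj) j hj⟩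
  choose b hb hd hoff hb0 using hprim
  set δ : RawForm (k + 1) m E k := fun j => ∑ᶠ p, b p j with hδ
  have hloc : ∀ r : M, ∃ (O : Set M) (F : Finset M), IsOpen O ∧ r ∈ O ∧
      (∀ j : JetInf (k + 1) m E, j.pt ∈ O → δ j = (∑ p ∈ F, b p) j) ∧
      ∀ j : JetInf (k + 1) m E, j.pt ∈ O → w.jac α β γ j = (∑ p ∈ F, w.jac (mulFun (f p) α) β γ) j := fun r => by
    obtain ⟨O', hO', hfin⟩ := hlf r
    obtain ⟨O, hOO, hO, hr⟩ := mem_nhds_iff.1 hO'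
    have hF : ∀ p, ∀ q ∈ O, q ∈ tsupport (f p) → p ∈ hfin.toFinset ∪ S := fun p q hq hqp =>
      Finset.mem_union_left _ (hfin.mem_toFinset.2 ⟨q, hqp, hOO hq⟩)
    refine ⟨O, hfin.toFinset ∪ S, hO, hr, fun j hj => ?_, fun j hj =>
      w.jac_eq_sum hμ hα hβ hγ hf hfc hO (fun q hq => hsum q _ fun p => hF p q hq) hj⟩
    rw [Finset.sum_apply]
    refine finsum_eq_sum_of_support_subset _ fun p hp => ?_
    by_contra hpF
    exact hp ((hb0 p fun h => hpF (Finset.mem_union_right _ h)).2 j fun h => hpF (hF p _ hj h))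
  have hord : HasOrder (2 * l) δ := hasOrder_of_local fun r => by
    obtain ⟨O, F, hO, hr, h1, -⟩ := hloc r
    exact ⟨O, hO, hr, _, (hasOrder_sum F fun p _ => hb p).1, h1⟩
  refine ⟨δ, ⟨⟨_, hord⟩, fun s hs => ⟨?_, fun h => by omega⟩⟩, funext fun j => ?_⟩
  · obtain ⟨K, hK, hsK⟩ := hs.2
    refine ⟨K ∪ ⋃ p ∈ S, (ch p).symm '' cube (ch p p) (ρ p), hK.union (S.isCompact_biUnion fun p _ => hC p),
      fun r hr => ?_⟩
    have hjet : jet (k + 1) m s r = jet (k + 1) m (fun q => (0 : E q)) r := jet_congr_nhds (by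
      filter_upwards [hK.isClosed.isOpen_compl.mem_nhds fun h => hr (Or.inl h)] with q hq
      exact hsK q hq)
    have h1 : ∀ p, b p (jet (k + 1) m s r) = 0 := fun p => by
      by_cases hp : p ∈ S
      · exact hoff p (jet (k + 1) m s r) fun h => hr (Or.inr (mem_iUnion₂.2 ⟨p, hp, h⟩))
      · have h2 := (hb0 p hp).1 r
        have h3 : ∀ j j' : JetInf (k + 1) m E, j = j' → b p j' = 0 → b p j = 0 := by
          rintro j _ rfl h
          exact h
        exact h3 _ _ hjet h2
    exact (finsum_congr h1).trans finsum_zero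
  · obtain ⟨O, F, hO, hr, h1, h2⟩ := hloc j.pt
    rw [dH_congr_of_isOpen hO h1 hr, (hasOrder_sum F fun p _ => hb p).2, h2 j hr]
    simp only [hd]

end JacobiatorExact

section JacobiatorExactZero
set_option linter.unusedSectionVars false
variable {n m : ℕ} {M : Type*} [TopologicalSpace M] [ChartedSpace (EuclideanSpace ℝ (Fin n)) M]
  [IsManifold (𝓡 n) ∞ M]
  {E : M → Type*} [∀ p, AddCommGroup (E p)] [∀ p, Module ℝ (E p)] [∀ p, TopologicalSpace (E p)]
  [TopologicalSpace (TotalSpace (Fin m → ℝ) E)] [FiberBundle (Fin m → ℝ) E]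
  [VectorBundle ℝ (Fin m → ℝ) E] [ContMDiffVectorBundle ∞ (Fin m → ℝ) E (𝓡 n)]

local notation "ch" => chartAt (EuclideanSpace ℝ (Fin n))
local notation "tr" => trivializationAt (Fin m → ℝ) E

variable [T2Space M] [SecondCountableTopology M] [MeasurableSpace M] [BorelSpace M] {ν : VolumeForm n M}
  {μ : Measure M} {N : ℕ}

theorem VolumeForm.IsMeasure.eq_zero_of_dim_zero [IsEmpty (Fin n)] (hμ : ν.IsMeasure μ) {α : RawForm n m E n}
    (hα : HasOrder N α) (hE : ∀ j, euler α j = 0) {p : M} {a : 𝔼 (Fin n)} {ρ : ℝ} (hρ : 0 < ρ)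
    (hC : cube a ρ ⊆ chartDom n m E p)
    (h0 : ∀ j : JetInf n m E, j.pt ∉ (ch p).symm '' cube a ρ → α j = 0)
    (hf : functional ν μ α (fun q => (0 : E q)) = 0) : α = 0 := by
  have hL : ∀ z : JetCoord n m, z.1 ∈ chartDom n m E p → z.1 ∉ cube a ρ → lagrangian p α z = 0 := fun z _ hz' =>
    (hz' fun i => isEmptyElim i).elim
  obtain ⟨B, -, hB, -⟩ := exists_currents_cube (isOpen_chartDom p) (hα.lagrangian p)
    (fun b z hz => hμ.eulerOp_lagrangian_eq_zero hα hE p b hz) hρ hC hL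
    (hμ.integral_lagrangian_zero hα hρ hC h0 hf)
  refine form_ext hα.dependsTo hasOrder_zero.dependsTo fun s hs r => ?_
  by_cases hr : r ∈ (ch p).symm '' cube a ρ
  · have hr : r ∈ coordDom n m E p := by
      obtain ⟨y, hy, rfl⟩ := hr
      exact symm_mem_coordDom (hC hy)
    refine formInChart_injective hr.1 ?_
    rw [formInChart_jet hα.dependsTo hr isOpen_univ (mem_univ r) fun r _ => hs.1 r]
    refine Eq.trans (topForm_ext ?_) (formInChart_zero _ _).symm
    have h1 := hB (jetOf (localExpr n m p s) (ch p r)) (chart_mem_chartDom hr.1 hr.2)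
    rw [Finset.univ_eq_empty, Finset.sum_empty] at h1
    exact h1.symm
  · exact h0 (jet n m s r) hr

theorem SkewTensor.jac_eq_zero_of_dim_zero [IsEmpty (Fin n)] (w : SkewTensor m E ν) (hμ : ν.IsMeasure μ)
    (hJ : w.Jacobi μ) {α β γ : RawForm n m E n} (hα : α ∈ omegaC n m E n) (hβ : β ∈ omegaC n m E n)
    (hγ : γ ∈ omegaC n m E n) : w.jac α β γ = 0 := by
  obtain ⟨ρ, f, hρ, hf, hfC, hlf, hsum⟩ := exists_cube_partition n m (M := M) E
  have hfc : ∀ p, HasCompactSupport (f p) := fun p =>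
    (isCompact_chart_cube (hρ p).2).of_isClosed_subset (isClosed_tsupport _) (hfC p)
  have hz : ∀ p, w.jac (mulFun (f p) α) β γ = 0 := fun p => by
    have hmem : mulFun (f p) α ∈ omegaC n m E n := mulFun_mem_omegaC (hf p) (hfc p) hα.1
    obtain ⟨⟨N, hN⟩, -⟩ := w.jac_mem hμ hmem hβ hγ
    exact hμ.eq_zero_of_dim_zero hN (w.euler_jac hμ hJ hmem hβ hγ) (hρ p).1 (hρ p).2
      (fun j hj => w.jac_mulFun_eq_zero α β γ fun h => hj (hfC p h))
      (w.functional_jac hμ hJ hmem hβ hγ isCompactSection_zero)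
  funext j
  obtain ⟨O', hO', hfin⟩ := hlf j.pt
  obtain ⟨O, hOO, hO, hr⟩ := mem_nhds_iff.1 hO'
  rw [w.jac_eq_sum hμ hα hβ hγ hf hfc hO (F := hfin.toFinset)
    (fun q hq => hsum q _ fun p hp => hfin.mem_toFinset.2 ⟨q, hp, hOO hq⟩) hr, Finset.sum_eq_zero fun p _ => hz p]

end JacobiatorExactZero

section JacobiatorExactIn
set_option linter.unusedSectionVars false
variable {n m : ℕ} {M : Type*} [TopologicalSpace M] [ChartedSpace (EuclideanSpace ℝ (Fin n)) M]
  [IsManifold (𝓡 n) ∞ M]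
  {E : M → Type*} [∀ p, AddCommGroup (E p)] [∀ p, Module ℝ (E p)] [∀ p, TopologicalSpace (E p)]
  [TopologicalSpace (TotalSpace (Fin m → ℝ) E)] [FiberBundle (Fin m → ℝ) E]
  [VectorBundle ℝ (Fin m → ℝ) E] [ContMDiffVectorBundle ∞ (Fin m → ℝ) E (𝓡 n)]

variable [T2Space M] [SecondCountableTopology M] [MeasurableSpace M] [BorelSpace M] {ν : VolumeForm n M}
  {μ : Measure M}

theorem SkewTensor.isExactIn_jac (w : SkewTensor m E ν) (hμ : ν.IsMeasure μ) (hJ : w.Jacobi μ)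
    {α β γ : RawForm n m E n} (hα : α ∈ omegaC n m E n) (hβ : β ∈ omegaC n m E n) (hγ : γ ∈ omegaC n m E n) :
    IsExactIn (omegaC n m E) (w.jac α β γ) := by
  cases n with
  | zero => exact w.jac_eq_zero_of_dim_zero hμ hJ hα hβ hγ
  | succ k => exact w.exists_primitive_jac hμ hJ hα hβ hγ

end JacobiatorExactIn

section HomotopyLie

variable {V : Type*} [AddCommGroup V] [Module ℝ V]

/-- `V` is the direct sum of the submodules `X i`. -/
def IsGrading (X : ℤ → Submodule ℝ V) : Prop := DirectSum.IsInternal X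

/-- A bilinear map as a multilinear map. -/
def bilinToMultilin (B : V →ₗ[ℝ] V →ₗ[ℝ] V) : MultilinearMap ℝ (fun _ : Fin 2 => V) V :=
  MultilinearMap.mk' (fun x => B (x 0) (x 1))
    (fun x i a b => by fin_cases i <;> simp [Function.update])
    (fun x i c a => by fin_cases i <;> simp [Function.update])

/-- The structure maps `l_1 = D`, `l_2 = B`, `l_3 = T` and `l_k = 0` otherwise. -/
def lMaps (D : V →ₗ[ℝ] V) (B : V →ₗ[ℝ] V →ₗ[ℝ] V) (T : MultilinearMap ℝ (fun _ : Fin 3 => V) V) :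
    ∀ k : ℕ, MultilinearMap ℝ (fun _ : Fin k => V) V
  | 1 => MultilinearMap.ofSubsingleton ℝ V V 0 D
  | 2 => bilinToMultilin B
  | 3 => T
  | _ => 0

theorem koszulSign_eq_one {N : ℕ} {d : Fin N → ℤ} (hd : ∀ r, d r = 0) (σ : Equiv.Perm (Fin N)) :
    koszulSign d σ = 1 :=
  Finset.prod_eq_one fun a _ => Finset.prod_eq_one fun b _ => if_neg fun h => by
    simp [hd] at h

theorem isUnshuffle_three_two (σ : Equiv.Perm (Fin 3)) :
    IsUnshuffle 2 σ ↔ σ ∈ ({1, Equiv.swap 1 2, Equiv.swap 0 1 * Equiv.swap 1 2} : Finset (Equiv.Perm (Fin 3))) := by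
  unfold IsUnshuffle
  revert σ
  decide

theorem isUnshuffle_three_three (σ : Equiv.Perm (Fin 3)) :
    IsUnshuffle 3 σ ↔ σ ∈ ({1} : Finset (Equiv.Perm (Fin 3))) := by
  unfold IsUnshuffle
  revert σ
  decide

set_option maxRecDepth 4000 in
theorem isUnshuffle_four_two (σ : Equiv.Perm (Fin 4)) :
    IsUnshuffle 2 σ ↔ σ ∈ ({1, Equiv.swap 1 2, Equiv.swap 1 2 * Equiv.swap 1 3, Equiv.swap 0 1 * Equiv.swap 1 2,
      Equiv.swap 0 1 * Equiv.swap 1 3 * Equiv.swap 3 2, Equiv.swap 0 2 * Equiv.swap 1 3} :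
        Finset (Equiv.Perm (Fin 4))) := by
  unfold IsUnshuffle
  revert σ
  decide

theorem perm_two (σ : Equiv.Perm (Fin 2)) : σ = 1 ∨ σ = Equiv.swap 0 1 := by
  revert σ
  decide

theorem perm_three (σ : Equiv.Perm (Fin 3)) : σ = 1 ∨ σ = Equiv.swap 0 1 ∨ σ = Equiv.swap 1 2 ∨
    σ = Equiv.swap 0 2 ∨ σ = Equiv.swap 0 1 * Equiv.swap 1 2 ∨ σ = Equiv.swap 1 2 * Equiv.swap 0 1 := by
  revert σ
  decide

open Classical in
theorem sum_ite_unshuffle {N p : ℕ} {S : Finset (Equiv.Perm (Fin N))} (h : ∀ σ, IsUnshuffle p σ ↔ σ ∈ S)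
    (f : Equiv.Perm (Fin N) → V) : ∑ σ, (if IsUnshuffle p σ then f σ else 0) = ∑ σ ∈ S, f σ := by
  rw [← Finset.sum_filter]
  congr 1
  ext σ
  simp [h]

end HomotopyLie

section HomotopyLie

variable {V : Type*} [AddCommGroup V] [Module ℝ V]

/-- The sh-Lie structure whose only non-zero maps are a differential, a bracket and a homotopy for its Jacobi
identity, where bracket and homotopy are non-zero in degree zero only. -/
theorem exists_shLieStructure {X : ℤ → Submodule ℝ V} (hX : IsGrading X) (D : V →ₗ[ℝ] V)
    (B : V →ₗ[ℝ] V →ₗ[ℝ] V) (T : MultilinearMap ℝ (fun _ : Fin 3 => V) V)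
    (hDX : ∀ i, ∀ x ∈ X i, D x ∈ X (i - 1)) (hDD : ∀ x, D (D x) = 0)
    (hBX : ∀ x y, B x y ∈ X 0) (hB0 : ∀ i ≠ 0, ∀ x ∈ X i, ∀ y, B x y = 0) (hBs : ∀ x y, B x y = -B y x)
    (hBD : ∀ x y, B (D x) y = 0) (hDB : ∀ x y, D (B x y) = 0)
    (hTX : ∀ x, T x ∈ X 1) (hT0 : ∀ i ≠ 0, ∀ x r, x r ∈ X i → T x = 0)
    (hTs : ∀ (σ : Equiv.Perm (Fin 3)) x, T (fun r => x (σ r)) = (Equiv.Perm.sign σ : ℤ) • T x)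
    (hTD : ∀ x y z, T ![D x, y, z] = 0)
    (hDT : ∀ x, D (T x) = -(B (B (x 0) (x 1)) (x 2) - B (B (x 0) (x 2)) (x 1) + B (B (x 1) (x 2)) (x 0)))
    (hTB : ∀ a b c d, T ![B a b, c, d] - T ![B a c, b, d] + T ![B a d, b, c] + T ![B b c, a, d]
      - T ![B b d, a, c] + T ![B c d, a, b] = 0) :
    ∃ L : ShLieStructure X, L.l = lMaps D B T ∧ ∀ k, 2 ≤ k → ∀ (d : Fin k → ℤ) (x : Fin k → V),
      (∀ r, x r ∈ X (d r)) → (∃ r, d r ≠ 0) → L.l k x = 0 := by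
  have hB0' : ∀ i ≠ 0, ∀ x ∈ X i, ∀ y, B y x = 0 := fun i hi x hx y => by
    rw [hBs, hB0 i hi x hx, neg_zero]
  have h4 : ∀ k, 4 ≤ k → lMaps D B T k = 0 := fun k hk => by
    obtain ⟨k, rfl⟩ := Nat.exists_eq_add_of_le' hk
    rfl
  have hv : ∀ k, 2 ≤ k → ∀ (d : Fin k → ℤ) (x : Fin k → V), (∀ r, x r ∈ X (d r)) → (∃ r, d r ≠ 0) →
      lMaps D B T k x = 0 := by
    rintro k hk d x hx ⟨r, hr⟩
    rcases Nat.lt_or_ge k 4 with h | h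
    · interval_cases k
      · show B (x 0) (x 1) = 0
        fin_cases r
        · exact hB0 _ hr _ (hx 0) _
        · exact hB0' _ hr _ (hx 1) _
      · exact hT0 _ hr x r (hx r)
    · rw [h4 k h]
      rfl
  have hz : ∀ (k : ℕ) (y : V) (x : Fin k → V), y = 0 → lMaps D B T (k + 1) (Fin.cons y x) = 0 := fun k y x hy =>
    MultilinearMap.map_coord_zero _ 0 hy
  refine ⟨⟨hX, lMaps D B T, rfl, fun k d x hx => ?_, fun k d x hx σ => ?_, fun N d x hx => ?_⟩, rfl, hv⟩
  · by_cases hk : 2 ≤ k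
    · by_cases h0 : ∃ r, d r ≠ 0
      · rw [hv k hk d x hx h0]
        exact zero_mem _
      · push Not at h0
        simp only [h0, Finset.sum_const_zero, zero_add]
        rcases Nat.lt_or_ge k 4 with h | h
        · interval_cases k
          · exact hBX _ _
          · exact hTX x
        · rw [h4 k h]
          exact zero_mem _
    · interval_cases k
      · exact zero_mem _
      · rw [Fin.sum_univ_one]
        have h := hDX _ _ (hx 0)
        have e : d 0 + ((1 : ℕ) : ℤ) - 2 = d 0 - 1 := by push_cast; ring
        rw [e]
        exact h
  · by_cases hk : 2 ≤ k
    · by_cases h0 : ∃ r, d r ≠ 0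
      · rw [hv k hk d x hx h0, hv k hk (fun r => d (σ r)) _ (fun r => hx (σ r)), smul_zero]
        obtain ⟨r, hr⟩ := h0
        exact ⟨σ.symm r, by simpa using hr⟩
      · push Not at h0
        rw [koszulSign_eq_one h0, mul_one]
        rcases Nat.lt_or_ge k 4 with h | h
        · interval_cases k
          · rcases perm_two σ with rfl | rfl
            · simp
            · rw [Equiv.Perm.sign_swap (by decide)]
              show B (x 1) (x 0) = _
              rw [hBs]
              simp [lMaps, bilinToMultilin]
          · exact hTs σ x
        · rw [h4 k h]
          simp
    · have hs : Subsingleton (Fin k) := by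
        refine ⟨fun a b => Fin.ext (by omega)⟩
      obtain rfl : σ = 1 := Subsingleton.elim _ _
      have : koszulSign d 1 = 1 := Finset.prod_eq_one fun a _ => Finset.prod_eq_one fun b _ =>
        if_neg fun h => absurd h.1 (by simp [Subsingleton.elim a b])
      simp [this]
  · rcases Nat.lt_or_ge N 5 with hN | hN
    · interval_cases N
      · rfl
      · refine Finset.sum_eq_zero fun i _ => Finset.sum_eq_zero fun σ _ => ?_
        split_ifs
        · fin_cases i
          refine smul_eq_zero_of_right _ ?_
          exact hDD _
        · rfl
      · refine Finset.sum_eq_zero fun i _ => Finset.sum_eq_zero fun σ _ => ?_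
        split_ifs
        · refine smul_eq_zero_of_right _ ?_
          fin_cases i
          · exact hBD _ _
          · exact hDB _ _
        · rfl
      · have e0 : ∀ σ : Equiv.Perm (Fin 3), T (Fin.cons (D (x (σ 0))) fun r => x (σ ⟨0 + 1 + r, by omega⟩)) = 0 :=
          fun σ => (congrArg T (funext fun i => by fin_cases i <;> rfl)).trans (hTD (x (σ 0)) (x (σ 1)) (x (σ 2)))
        have e1 : ∀ σ : Equiv.Perm (Fin 3), koszulSign d σ • B (B (x (σ 0)) (x (σ 1))) (x (σ 2))
            = B (B (x (σ 0)) (x (σ 1))) (x (σ 2)) := fun σ => by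
          by_cases h0 : ∃ r, d r ≠ 0
          · obtain ⟨r, hr⟩ := h0
            obtain ⟨s, rfl⟩ := σ.surjective r
            suffices h : B (B (x (σ 0)) (x (σ 1))) (x (σ 2)) = 0 by rw [h, smul_zero]
            fin_cases s
            · rw [hB0 _ hr _ (hx (σ 0)), map_zero, LinearMap.zero_apply]
            · rw [hB0' _ hr _ (hx (σ 1)), map_zero, LinearMap.zero_apply]
            · exact hB0' _ hr _ (hx (σ 2)) _
          · push Not at h0
            rw [koszulSign_eq_one h0, one_smul]
        have e2 : koszulSign d 1 • T x = T x := by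
          by_cases h0 : ∃ r, d r ≠ 0
          · obtain ⟨r, hr⟩ := h0
            rw [hT0 _ hr x r (hx r), smul_zero]
          · push Not at h0
            rw [koszulSign_eq_one h0, one_smul]
        have a1 : ∑ σ ∈ ({1, Equiv.swap 1 2, Equiv.swap 0 1 * Equiv.swap 1 2} : Finset (Equiv.Perm (Fin 3))),
            (koszulSign d σ * (Equiv.Perm.sign σ : ℤ) * (-1) ^ (2 * 1)) • B (B (x (σ 0)) (x (σ 1))) (x (σ 2))
            = B (B (x 0) (x 1)) (x 2) - B (B (x 0) (x 2)) (x 1) + B (B (x 1) (x 2)) (x 0) := by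
          simp only [mul_comm (koszulSign d _), mul_right_comm _ (koszulSign d _), mul_smul _ (koszulSign d _), e1]
          rw [Finset.sum_insert (by decide), Finset.sum_insert (by decide), Finset.sum_singleton, map_mul,
            Equiv.Perm.sign_swap (by decide), Equiv.Perm.sign_swap (by decide), map_one]
          have t1 : ∀ r, (Equiv.swap 1 2 : Equiv.Perm (Fin 3)) r = ![0, 2, 1] r := by decide
          have t2 : ∀ r, (Equiv.swap 0 1 * Equiv.swap 1 2 : Equiv.Perm (Fin 3)) r = ![1, 2, 0] r := by decide
          simp [t1, t2, sub_eq_add_neg, add_assoc]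
        have a2 : ∑ σ ∈ ({1} : Finset (Equiv.Perm (Fin 3))),
            (koszulSign d σ * (Equiv.Perm.sign σ : ℤ) * (-1) ^ (3 * 0)) • D (T fun r => x (σ r)) = D (T x) := by
          rw [Finset.sum_singleton, ← map_zsmul D]
          simp [e2]
        refine (Fin.sum_univ_three _).trans ?_
        refine (congrArg₂ (· + ·) (congrArg₂ (· + ·) (Finset.sum_eq_zero fun σ _ => ?_)
          ((sum_ite_unshuffle isUnshuffle_three_two _).trans a1))
          ((sum_ite_unshuffle isUnshuffle_three_three _).trans a2)).trans ?_
        · split_ifs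
          · exact smul_eq_zero_of_right _ (e0 σ)
          · rfl
        · rw [hDT]
          simp
      · have e1 : ∀ σ : Equiv.Perm (Fin 4), koszulSign d σ • T ![B (x (σ 0)) (x (σ 1)), x (σ 2), x (σ 3)]
            = T ![B (x (σ 0)) (x (σ 1)), x (σ 2), x (σ 3)] := fun σ => by
          by_cases h0 : ∃ r, d r ≠ 0
          · obtain ⟨r, hr⟩ := h0
            obtain ⟨s, rfl⟩ := σ.surjective r
            suffices h : T ![B (x (σ 0)) (x (σ 1)), x (σ 2), x (σ 3)] = 0 by rw [h, smul_zero]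
            fin_cases s
            · exact T.map_coord_zero 0 (hB0 _ hr _ (hx (σ 0)) _)
            · exact T.map_coord_zero 0 (hB0' _ hr _ (hx (σ 1)) _)
            · exact hT0 _ hr _ 1 (hx (σ 2))
            · exact hT0 _ hr _ 2 (hx (σ 3))
          · push Not at h0
            rw [koszulSign_eq_one h0, one_smul]
        have e2 : ∀ σ : Equiv.Perm (Fin 4), T (Fin.cons (B (x (σ 0)) (x (σ 1))) fun r => x (σ ⟨1 + 1 + r, by omega⟩))
            = T ![B (x (σ 0)) (x (σ 1)), x (σ 2), x (σ 3)] := fun σ =>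
          congrArg T (funext fun i => by fin_cases i <;> rfl)
        have a1 : ∑ σ ∈ ({1, Equiv.swap 1 2, Equiv.swap 1 2 * Equiv.swap 1 3, Equiv.swap 0 1 * Equiv.swap 1 2,
              Equiv.swap 0 1 * Equiv.swap 1 3 * Equiv.swap 3 2, Equiv.swap 0 2 * Equiv.swap 1 3} :
              Finset (Equiv.Perm (Fin 4))), (koszulSign d σ * (Equiv.Perm.sign σ : ℤ) * (-1) ^ (2 * 2)) •
              T (Fin.cons (B (x (σ 0)) (x (σ 1))) fun r => x (σ ⟨1 + 1 + r, by omega⟩)) = 0 := by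
          simp only [e2]
          simp only [mul_comm (koszulSign d _), mul_right_comm _ (koszulSign d _), mul_smul _ (koszulSign d _), e1]
          rw [Finset.sum_insert (by decide), Finset.sum_insert (by decide), Finset.sum_insert (by decide),
            Finset.sum_insert (by decide), Finset.sum_insert (by decide), Finset.sum_singleton]
          simp only [map_mul, map_one, Equiv.Perm.sign_swap (show (1 : Fin 4) ≠ 2 by decide),
            Equiv.Perm.sign_swap (show (1 : Fin 4) ≠ 3 by decide), Equiv.Perm.sign_swap (show (0 : Fin 4) ≠ 1 by decide),
            Equiv.Perm.sign_swap (show (3 : Fin 4) ≠ 2 by decide), Equiv.Perm.sign_swap (show (0 : Fin 4) ≠ 2 by decide)]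
          have t1 : ∀ r, (Equiv.swap 1 2 : Equiv.Perm (Fin 4)) r = ![0, 2, 1, 3] r := by decide
          have t2 : ∀ r, (Equiv.swap 1 2 * Equiv.swap 1 3 : Equiv.Perm (Fin 4)) r = ![0, 3, 1, 2] r := by decide
          have t3 : ∀ r, (Equiv.swap 0 1 * Equiv.swap 1 2 : Equiv.Perm (Fin 4)) r = ![1, 2, 0, 3] r := by decide
          have t4 : ∀ r, (Equiv.swap 0 1 * Equiv.swap 1 3 * Equiv.swap 3 2 : Equiv.Perm (Fin 4)) r = ![1, 3, 0, 2] r := by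
            decide
          have t5 : ∀ r, (Equiv.swap 0 2 * Equiv.swap 1 3 : Equiv.Perm (Fin 4)) r = ![2, 3, 0, 1] r := by decide
          simp only [t1, t2, t3, t4, t5]
          refine Eq.trans ?_ (hTB (x 0) (x 1) (x 2) (x 3))
          simp [sub_eq_add_neg, add_assoc]
        refine (Fin.sum_univ_four _).trans ?_
        refine (congrArg₂ (· + ·) (congrArg₂ (· + ·) (congrArg₂ (· + ·) (Finset.sum_eq_zero fun σ _ => ?_)
          ((sum_ite_unshuffle isUnshuffle_four_two _).trans a1))
          (Finset.sum_eq_zero fun σ _ => ?_)) (Finset.sum_eq_zero fun σ _ => ?_)).trans ?_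
        · split_ifs
          · exact smul_zero _
          · rfl
        · split_ifs
          · exact smul_eq_zero_of_right _ (hB0 1 one_ne_zero _ (hTX _) _)
          · rfl
        · split_ifs
          · exact smul_eq_zero_of_right _ (map_zero D)
          · rfl
        · simp
    · refine Finset.sum_eq_zero fun i _ => Finset.sum_eq_zero fun σ _ => ?_
      split_ifs
      swap
      · rfl
      refine smul_eq_zero_of_right _ ?_
      rcases Nat.lt_or_ge (i + 1 : ℕ) 4 with hi | hi
      · rcases Nat.lt_or_ge (N - (i + 1) + 1) 4 with hj | hj
        · have hi2 : (i : ℕ) = 2 := by omega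
          obtain rfl : N = 5 := by omega
          obtain rfl : i = 2 := Fin.ext hi2
          exact hT0 1 one_ne_zero _ 0 (hTX _)
        · rw [h4 _ hj]
          rfl
      · refine hz _ _ _ ?_
        rw [h4 _ hi]
        rfl

end HomotopyLie

section LinearAlgebra

variable {V : Type*} [AddCommGroup V] [Module ℝ V]

/-- A cyclically invariant function of three arguments, linear in the first one, as a multilinear map. -/
def trilinOfRotate (F : V → V → V → V) (hl : ∀ (c : ℝ) a b y z, F (c • a + b) y z = c • F a y z + F b y z)
    (hr : ∀ x y z, F y z x = F x y z) : MultilinearMap ℝ (fun _ : Fin 3 => V) V :=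
  have ha : ∀ a b y z, F (a + b) y z = F a y z + F b y z := fun a b y z => by
    simpa using hl 1 a b y z
  have h0 : ∀ y z, F 0 y z = 0 := fun y z => by
    simpa using ha 0 0 y z
  have hs : ∀ (c : ℝ) a y z, F (c • a) y z = c • F a y z := fun c a y z => by
    simpa [h0] using hl c a 0 y z
  have ha1 : ∀ x a b z, F x (a + b) z = F x a z + F x b z := fun x a b z => by
    rw [← hr, ha, hr x a, hr x b]
  have ha2 : ∀ x y a b, F x y (a + b) = F x y a + F x y b := fun x y a b => by
    rw [hr, ha, hr a, hr b]
  have hs1 : ∀ (c : ℝ) x a z, F x (c • a) z = c • F x a z := fun c x a z => by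
    rw [← hr, hs, hr]
  have hs2 : ∀ (c : ℝ) x y a, F x y (c • a) = c • F x y a := fun c x y a => by
    rw [hr, hs, ← hr]
  MultilinearMap.mk' (fun x => F (x 0) (x 1) (x 2))
    (fun x i a b => by fin_cases i <;> simp [Function.update, ha, ha1, ha2])
    (fun x i c a => by
      fin_cases i
      · simp [Function.update, hs]
      · simp [Function.update, hs1]
      · simp [Function.update, hs2])

/-- A linear right inverse on the image of a linear map which respects a subspace. -/
theorem exists_rightInverse_of_le {P Q : Type*} [AddCommGroup P] [Module ℝ P] [AddCommGroup Q] [Module ℝ Q]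
    {W1 W2 : Submodule ℝ P} (hW : W1 ≤ W2) (d : W2 →ₗ[ℝ] Q) :
    ∃ h : Q →ₗ[ℝ] P, (∀ a : W2, ∃ b : W2, h (d a) = b ∧ d b = d a) ∧
      ∀ a : W2, (a : P) ∈ W1 → ∃ b : W2, h (d a) = b ∧ (b : P) ∈ W1 ∧ d b = d a := by
  set d1 : W1 →ₗ[ℝ] Q := d ∘ₗ Submodule.inclusion hW
  obtain ⟨s1, hs1⟩ := d1.rangeRestrict.exists_rightInverse_of_surjective (LinearMap.range_rangeRestrict _)
  obtain ⟨s2, hs2⟩ := d.rangeRestrict.exists_rightInverse_of_surjective (LinearMap.range_rangeRestrict _)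
  obtain ⟨p1, hp1⟩ := (LinearMap.range d1).subtype.exists_leftInverse_of_injective (Submodule.ker_subtype _)
  obtain ⟨p2, hp2⟩ := (LinearMap.range d).subtype.exists_leftInverse_of_injective (Submodule.ker_subtype _)
  have e1 : ∀ q : LinearMap.range d1, d (Submodule.inclusion hW (s1 q)) = q := fun q =>
    congrArg Subtype.val (LinearMap.congr_fun hs1 q)
  have e2 : ∀ q : LinearMap.range d, d (s2 q) = q := fun q => congrArg Subtype.val (LinearMap.congr_fun hs2 q)
  have f1 : ∀ q : LinearMap.range d1, p1 q = q := fun q => LinearMap.congr_fun hp1 q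
  have f2 : ∀ q : LinearMap.range d, p2 q = q := fun q => LinearMap.congr_fun hp2 q
  set g : Q →ₗ[ℝ] W2 := s2 ∘ₗ p2 ∘ₗ (LinearMap.id - (LinearMap.range d1).subtype ∘ₗ p1)
    + Submodule.inclusion hW ∘ₗ s1 ∘ₗ p1
  have hg : ∀ q, g q = s2 (p2 (q - p1 q)) + Submodule.inclusion hW (s1 (p1 q)) := fun q => rfl
  have hgd : ∀ a : W2, d (g (d a)) = d a := fun a => by
    have h1 : d a - p1 (d a) ∈ LinearMap.range d := by
      refine sub_mem ⟨a, rfl⟩ ?_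
      obtain ⟨b, hb⟩ := (p1 (d a)).2
      exact ⟨_, hb⟩
    have h2 := f2 ⟨_, h1⟩
    rw [hg, map_add, e1, e2]
    rw [h2]
    exact sub_add_cancel _ _
  refine ⟨W2.subtype ∘ₗ g, fun a => ⟨g (d a), rfl, hgd a⟩, fun a ha => ⟨g (d a), rfl, ?_, hgd a⟩⟩
  have h1 : d a ∈ LinearMap.range d1 := ⟨⟨a, ha⟩, rfl⟩
  have h2 : (p1 (d a) : Q) = d a := congrArg Subtype.val (f1 ⟨_, h1⟩)
  rw [hg, h2, sub_self, map_zero, map_zero, zero_add]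
  exact (s1 (p1 (d a))).2

theorem isGrading_of_projections {X : ℤ → Submodule ℝ V} (c : ℤ → V →ₗ[ℝ] V) (s : Finset ℤ)
    (hs : ∀ i, ∀ x ∈ X i, c i x = x) (ho : ∀ i j, j ≠ i → ∀ x ∈ X j, c i x = 0) (hX : ∀ i x, c i x ∈ X i)
    (hsum : ∀ x, ∑ i ∈ s, c i x = x) : IsGrading X := by
  have hc : ∀ (x : DirectSum ℤ fun i => X i) (i : ℤ), c i (DirectSum.coeAddMonoidHom X x) = x i := fun x i => by
    induction x using DirectSum.induction_on with
    | zero => simp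
    | of j x =>
      rw [DirectSum.coeAddMonoidHom_of]
      by_cases hj : j = i
      · subst hj
        rw [DirectSum.of_eq_same, hs _ _ x.2]
      · rw [DirectSum.of_eq_of_ne _ _ _ (Ne.symm hj), ho i j hj _ x.2]
        rfl
    | add x y hx hy =>
      rw [map_add, map_add, hx, hy]
      rfl
  refine ⟨(injective_iff_map_eq_zero _).2 fun x hx => DFinsupp.ext fun i => Subtype.ext ?_, fun y =>
    ⟨∑ i ∈ s, DirectSum.of (fun i => X i) i ⟨c i y, hX i y⟩, ?_⟩⟩
  · rw [← hc x i, hx, map_zero]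
    rfl
  · rw [map_sum]
    simp only [DirectSum.coeAddMonoidHom_of]
    exact hsum y

end LinearAlgebra

section TotalSpace
set_option linter.unusedSectionVars false
variable {n m : ℕ} {M : Type*} [TopologicalSpace M] [ChartedSpace (EuclideanSpace ℝ (Fin n)) M]
  [IsManifold (𝓡 n) ∞ M]
  {E : M → Type*} [∀ p, AddCommGroup (E p)] [∀ p, Module ℝ (E p)] [∀ p, TopologicalSpace (E p)]
  [TopologicalSpace (TotalSpace (Fin m → ℝ) E)] [FiberBundle (Fin m → ℝ) E]
  [VectorBundle ℝ (Fin m → ℝ) E] [ContMDiffVectorBundle ∞ (Fin m → ℝ) E (𝓡 n)]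

local notation "ch" => chartAt (EuclideanSpace ℝ (Fin n))
local notation "tr" => trivializationAt (Fin m → ℝ) E

theorem RawForm.eq_zero_of_lt {k : ℕ} (hk : n < k) (α : RawForm n m E k) : α = 0 := by
  have h : ∀ A : 𝔼 (Fin n) [⋀^Fin k]→L[ℝ] ℝ, A = 0 := fun A => ContinuousAlternatingMap.ext fun v =>
    A.toAlternatingMap.map_linearDependent v fun h => by
      have h1 := h.fintype_card_le_finrank
      rw [Fintype.card_fin, finrank_euclideanSpace_fin] at h1
      omega
  exact funext fun j => h (α j)

theorem dTotal_single {k : ℕ} (β : RawForm n m E k) [T2Space M] :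
    dTotal (Pi.single k β : ∀ k, RawForm n m E k) = Pi.single (k + 1) (dH β) := by
  funext j
  rcases j with _ | j
  · rw [Pi.single_eq_of_ne (by omega)]
    rfl
  · show dH ((Pi.single k β : ∀ k, RawForm n m E k) j) = _
    by_cases h : j = k
    · subst h
      rw [Pi.single_eq_same, Pi.single_eq_same]
    · rw [Pi.single_eq_of_ne h, Pi.single_eq_of_ne (by omega), dH_zero]

theorem dTotal_single_top (β : RawForm n m E n) [T2Space M] :
    dTotal (Pi.single n β : ∀ k, RawForm n m E k) = 0 := by
  rw [dTotal_single, RawForm.eq_zero_of_lt (Nat.lt_succ_self n) (dH β), Pi.single_zero]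

variable {Ω : ∀ k, Submodule ℝ (RawForm n m E k)}

theorem single_mem_totalSpace {k : ℕ} {β : RawForm n m E k} (h : β ∈ Ω k) : Pi.single k β ∈ totalSpace Ω :=
  fun j _ => by
    by_cases hj : j = k
    · subst hj
      rwa [Pi.single_eq_same]
    · rw [Pi.single_eq_of_ne hj]
      exact zero_mem _

/-- The component of an element of the total space in the degree `i`. -/
noncomputable def degreeProj (Ω : ∀ k, Submodule ℝ (RawForm n m E k)) (i : ℤ) : totalSpace Ω →ₗ[ℝ] totalSpace Ω where
  toFun x := ⟨fun k => if (k : ℤ) = n - i then x.1 k else 0, fun k _ => by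
    dsimp only
    split_ifs
    · exact x.2 k trivial
    · exact zero_mem _⟩
  map_add' x y := Subtype.ext (funext fun k => by
    show (if (k : ℤ) = n - i then x.1 k + y.1 k else 0) = (if (k : ℤ) = n - i then x.1 k else 0)
      + if (k : ℤ) = n - i then y.1 k else 0
    split_ifs
    · rfl
    · rw [add_zero])
  map_smul' c x := Subtype.ext (funext fun k => by
    show (if (k : ℤ) = n - i then c • x.1 k else 0) = c • if (k : ℤ) = n - i then x.1 k else 0
    split_ifs
    · rfl
    · rw [smul_zero])

theorem isGrading_degreePart : IsGrading (V := totalSpace Ω) (degreePart Ω) := by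
  refine isGrading_of_projections (V := totalSpace Ω) (degreeProj Ω) ((Finset.range (n + 1)).image fun k : ℕ => (n : ℤ) - k)
    (fun i x hx => Subtype.ext (funext fun k => ?_)) (fun i j hj x hx => Subtype.ext (funext fun k => ?_))
    ?_ fun x => Subtype.ext (funext fun k => ?_)
  · show (if (k : ℤ) = n - i then x.1 k else 0) = x.1 k
    split_ifs with h
    · rfl
    · exact (hx k h).symm
  · show (if (k : ℤ) = n - i then x.1 k else 0) = 0
    split_ifs with h
    · exact hx k (by omega)
    · rfl
  · exact fun i x k hk => if_neg hk
  · by_cases hk : k ≤ n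
    · refine (congrFun (map_sum (totalSpace Ω).subtype _ _) k).trans ?_
      rw [Finset.sum_apply]
      refine (Finset.sum_eq_single ((n : ℤ) - k) (fun j _ hj => if_neg ?_) fun h => (h ?_).elim).trans (if_pos ?_)
      · omega
      · exact Finset.mem_image.2 ⟨k, Finset.mem_range.2 (by omega), rfl⟩
      · omega
    · rw [RawForm.eq_zero_of_lt (by omega) (x.1 k)]
      exact RawForm.eq_zero_of_lt (by omega) _

end TotalSpace

section BracketComplex
set_option linter.unusedSectionVars false
variable {n m : ℕ} {M : Type*} [TopologicalSpace M] [ChartedSpace (EuclideanSpace ℝ (Fin n)) M]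
  [IsManifold (𝓡 n) ∞ M]
  {E : M → Type*} [∀ p, AddCommGroup (E p)] [∀ p, Module ℝ (E p)] [∀ p, TopologicalSpace (E p)]
  [TopologicalSpace (TotalSpace (Fin m → ℝ) E)] [FiberBundle (Fin m → ℝ) E]
  [VectorBundle ℝ (Fin m → ℝ) E] [ContMDiffVectorBundle ∞ (Fin m → ℝ) E (𝓡 n)]

variable [T2Space M] {Ω : ∀ k, Submodule ℝ (RawForm n m E k)}

theorem dH_lin_of_mem {k : ℕ} {α β : RawForm n m E k} (hα : α ∈ omegaC n m E k) (hβ : β ∈ omegaC n m E k) (c : ℝ) :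
    dH (c • α + β) = c • dH α + dH β := by
  obtain ⟨⟨N, hN⟩, -⟩ := hα
  obtain ⟨⟨N', hN'⟩, -⟩ := hβ
  exact dH_lin (HasOrder.mono hN (le_max_left N N')) (HasOrder.mono hN' (le_max_right N N')) c

theorem dTotal_lin {x y : ∀ k, RawForm n m E k} (hx : x ∈ totalSpace (omegaC n m E))
    (hy : y ∈ totalSpace (omegaC n m E)) (c : ℝ) : dTotal (c • x + y) = c • dTotal x + dTotal y := by
  funext k
  rcases k with _ | k
  · show (0 : RawForm n m E 0) = c • 0 + 0
    rw [smul_zero, add_zero]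
  · exact dH_lin_of_mem (hx k trivial) (hy k trivial) c

theorem dTotal_dTotal {x : ∀ k, RawForm n m E k} (hx : x ∈ totalSpace (omegaC n m E)) : dTotal (dTotal x) = 0 := by
  funext k
  rcases k with _ | _ | k
  · rfl
  · exact dH_zero
  · obtain ⟨⟨N, hN⟩, -⟩ := hx k trivial
    exact dH_dH hN

theorem exists_linearMap_dTotal (hΩ : ∀ k, Ω k ≤ omegaC n m E k) (hd : ∀ k, ∀ α ∈ Ω k, dH α ∈ Ω (k + 1)) :
    ∃ D : totalSpace Ω →ₗ[ℝ] totalSpace Ω, ∀ x, (D x).1 = dTotal x.1 := by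
  have hle : ∀ x : totalSpace Ω, x.1 ∈ totalSpace (omegaC n m E) := fun x k _ => hΩ k (x.2 k trivial)
  have hm : ∀ x : totalSpace Ω, dTotal x.1 ∈ totalSpace Ω := fun x k _ => by
    rcases k with _ | k
    · exact zero_mem _
    · exact hd k _ (x.2 k trivial)
  have h0 : dTotal (0 : ∀ k, RawForm n m E k) = 0 := by
    funext k
    rcases k with _ | k
    · rfl
    · exact dH_zero
  refine ⟨LinearMap.mk (AddHom.mk (fun x => ⟨dTotal x.1, hm x⟩) fun x y => Subtype.ext ?_)
    fun c x => Subtype.ext ?_, fun x => rfl⟩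
  · have h := dTotal_lin (hle x) (hle y) 1
    rwa [one_smul, one_smul] at h
  · have h := dTotal_lin (hle x) (zero_mem _) c
    rwa [add_zero, h0, add_zero] at h

variable [SecondCountableTopology M] [MeasurableSpace M] [BorelSpace M] {ν : VolumeForm n M} {μ : Measure M}

theorem SkewTensor.exists_bilin_l2 (w : SkewTensor m E ν) {P : Submodule ℝ (RawForm n m E n)}
    (hP : P ≤ omegaC n m E n) (hl : ∀ α ∈ P, ∀ β ∈ P, w.l2 α β ∈ P) :
    ∃ B : P →ₗ[ℝ] P →ₗ[ℝ] P, ∀ α β, (B α β : RawForm n m E n) = w.l2 α β := by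
  have hz1 : ∀ β : RawForm n m E n, w.l2 0 β = 0 := fun β => w.l2_eq_zero_left euler_zero β
  have hz2 : ∀ β : RawForm n m E n, w.l2 β 0 = 0 := fun β => w.l2_eq_zero_right β euler_zero
  refine ⟨LinearMap.mk₂ ℝ (fun α β => ⟨w.l2 α β, hl _ α.2 _ β.2⟩) (fun α α' β => Subtype.ext ?_)
    (fun c α β => Subtype.ext ?_) (fun α β β' => Subtype.ext ?_) (fun c α β => Subtype.ext ?_), fun α β => rfl⟩
  · have h := w.l2_lin_left (hP α.2).1 (hP α'.2).1 1 β
    rwa [one_smul, one_smul] at h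
  · have h := w.l2_lin_left (hP α.2).1 isHorizontal_zero c β
    rwa [add_zero, hz1, add_zero] at h
  · have h := w.l2_lin_right (hP β.2).1 (hP β'.2).1 1 α
    rwa [one_smul, one_smul] at h
  · have h := w.l2_lin_right (hP β.2).1 isHorizontal_zero c α
    rwa [add_zero, hz2, add_zero] at h

/-- The top degree part of the total space. -/
noncomputable def topPart (Ω : ∀ k, Submodule ℝ (RawForm n m E k)) : totalSpace Ω →ₗ[ℝ] Ω n where
  toFun x := ⟨x.1 n, x.2 n trivial⟩
  map_add' _ _ := rfl
  map_smul' _ _ := rfl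

/-- The inclusion of the top degree part in the total space. -/
noncomputable def topSingle (Ω : ∀ k, Submodule ℝ (RawForm n m E k)) : Ω n →ₗ[ℝ] totalSpace Ω :=
  ((LinearMap.single ℝ (fun k => RawForm n m E k) n) ∘ₗ (Ω n).subtype).codRestrict _
    fun α => single_mem_totalSpace α.2

theorem SkewTensor.exists_bracket (w : SkewTensor m E ν) (hΩ : ∀ k, Ω k ≤ omegaC n m E k)
    (hl : ∀ α ∈ Ω n, ∀ β ∈ Ω n, w.l2 α β ∈ Ω n) :
    ∃ B : totalSpace Ω →ₗ[ℝ] totalSpace Ω →ₗ[ℝ] totalSpace Ω,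
      ∀ x y, (B x y).1 = Pi.single n (w.l2 (x.1 n) (y.1 n)) := by
  obtain ⟨B, hB⟩ := w.exists_bilin_l2 (hΩ n) hl
  refine ⟨(B.compl₁₂ (topPart Ω) (topPart Ω)).compr₂ (topSingle Ω), fun x y => ?_⟩
  exact congrArg (Pi.single n) (hB (topPart Ω x) (topPart Ω y))

theorem SkewTensor.exists_homotopy (w : SkewTensor m E ν) (hμ : ν.IsMeasure μ) (hΩ : ∀ k, Ω k ≤ omegaC n m E k)
    (η : RawForm n m E n →ₗ[ℝ] ∀ k, RawForm n m E k)
    (hη : ∀ α ∈ Ω n, ∀ β ∈ Ω n, ∀ γ ∈ Ω n, η (w.jac α β γ) ∈ totalSpace Ω) :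
    ∃ T : MultilinearMap ℝ (fun _ : Fin 3 => totalSpace Ω) (totalSpace Ω),
      ∀ x, (T x).1 = -η (w.jac ((x 0).1 n) ((x 1).1 n) ((x 2).1 n)) := by
  refine ⟨trilinOfRotate (fun x y z : totalSpace Ω => -⟨η (w.jac (x.1 n) (y.1 n) (z.1 n)),
    hη _ (x.2 n trivial) _ (y.2 n trivial) _ (z.2 n trivial)⟩) (fun c a b y z => Subtype.ext ?_)
    (fun x y z => Subtype.ext ?_), fun x => rfl⟩
  · have h := w.jac_lin hμ (hΩ n (a.2 n trivial)) (hΩ n (b.2 n trivial)) (hΩ n (y.2 n trivial))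
      (hΩ n (z.2 n trivial)) c
    show -η (w.jac (c • a.1 n + b.1 n) (y.1 n) (z.1 n)) = c • -η (w.jac (a.1 n) (y.1 n) (z.1 n))
      + -η (w.jac (b.1 n) (y.1 n) (z.1 n))
    rw [h, map_add, map_smul, neg_add, smul_neg]
  · exact congrArg (fun A => -η A) (w.jac_rotate _ _ _)

end BracketComplex

section SymmetricIdentities

variable {V : Type*} [AddCommGroup V] [Module ℝ V]

theorem multilin_perm_three {T : MultilinearMap ℝ (fun _ : Fin 3 => V) V}
    (hs : ∀ x y z, T ![y, x, z] = -T ![x, y, z]) (hr : ∀ x y z, T ![y, z, x] = T ![x, y, z])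
    (σ : Equiv.Perm (Fin 3)) (x : Fin 3 → V) :
    T (fun r => x (σ r)) = (Equiv.Perm.sign σ : ℤ) • T x := by
  have e : ∀ y : Fin 3 → V, T y = T ![y 0, y 1, y 2] := fun y =>
    congrArg T (funext fun i => by fin_cases i <;> rfl)
  rw [e, e x]
  have n1 : (0 : Fin 3) ≠ 1 := by decide
  have n2 : (1 : Fin 3) ≠ 2 := by decide
  have n3 : (0 : Fin 3) ≠ 2 := by decide
  rcases perm_three σ with rfl | rfl | rfl | rfl | rfl | rfl
  · simp
  · rw [Equiv.Perm.sign_swap n1]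
    show T ![x 1, x 0, x 2] = _
    rw [hs]
    simp
  · rw [Equiv.Perm.sign_swap n2]
    show T ![x 0, x 2, x 1] = _
    rw [← hr, hs, hr, hr]
    simp
  · rw [Equiv.Perm.sign_swap n3]
    show T ![x 2, x 1, x 0] = _
    rw [hr, hs, hr, hr]
    simp
  · rw [map_mul, Equiv.Perm.sign_swap n1, Equiv.Perm.sign_swap n2]
    show T ![x 1, x 2, x 0] = _
    rw [hr]
    simp
  · rw [map_mul, Equiv.Perm.sign_swap n1, Equiv.Perm.sign_swap n2]
    show T ![x 2, x 0, x 1] = _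
    rw [← hr]
    simp

/-- The alternating sum of Jacobiators `J([a, b], c, d)`, for a skew bracket whose Jacobiators are central. -/
theorem sum_jacobiator_eq_zero (b : V →ₗ[ℝ] V →ₗ[ℝ] V) (hs : ∀ x y, b x y = -b y x) {J : V → V → V → V}
    (hJ : ∀ x y z, J x y z = b (b x y) z + b (b y z) x + b (b z x) y) (h0 : ∀ x y z u, b (J x y z) u = 0)
    (p q r s : V) : J (b p q) r s - J (b p r) q s + J (b p s) q r + J (b q r) p s - J (b q s) p r
      + J (b r s) p q = 0 := by
  have h1 := h0 p q r s
  have h2 := h0 p q s r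
  have h3 := h0 p r s q
  have h4 := h0 q r s p
  simp only [hJ, map_add, LinearMap.add_apply] at h1 h2 h3 h4 ⊢
  simp only [hs r p, hs s p, hs s q, hs s (b p q), hs s (b p r), hs r (b p s), hs s (b q r), hs r (b q s),
    hs q (b r s), hs (b r s) (b p q), hs (b q s) (b p r), hs (b q r) (b p s), map_neg, LinearMap.neg_apply]
    at h1 h2 h3 h4 ⊢
  have h := congrArg₂ (· - ·) (congrArg₂ (· + ·) (congrArg₂ (· - ·) h1 h2) h3) h4
  simp only [sub_zero, add_zero] at h
  rw [← h]
  abel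

end SymmetricIdentities

section BracketComplex
set_option linter.unusedSectionVars false
variable {n m : ℕ} {M : Type*} [TopologicalSpace M] [ChartedSpace (EuclideanSpace ℝ (Fin n)) M]
  [IsManifold (𝓡 n) ∞ M]
  {E : M → Type*} [∀ p, AddCommGroup (E p)] [∀ p, Module ℝ (E p)] [∀ p, TopologicalSpace (E p)]
  [TopologicalSpace (TotalSpace (Fin m → ℝ) E)] [FiberBundle (Fin m → ℝ) E]
  [VectorBundle ℝ (Fin m → ℝ) E] [ContMDiffVectorBundle ∞ (Fin m → ℝ) E (𝓡 n)]

variable [T2Space M] {ν : VolumeForm n M} {Ω : ∀ k, Submodule ℝ (RawForm n m E k)}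

theorem SkewTensor.jac_eq_zero_left (w : SkewTensor m E ν) {α : RawForm n m E n} (hα : ∀ j, euler α j = 0)
    (β γ : RawForm n m E n) : w.jac α β γ = 0 := by
  unfold SkewTensor.jac
  rw [w.l2_eq_zero_left hα, w.l2_eq_zero_right _ hα, w.l2_eq_zero_right γ hα, w.l2_eq_zero_left euler_zero,
    w.l2_eq_zero_left euler_zero, add_zero, add_zero]

theorem euler_dTotal {x : ∀ k, RawForm n m E k} (hx : x ∈ totalSpace (omegaC n m E)) (j : JetInf n m E) :
    euler (dTotal x n) j = 0 := by
  cases n with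
  | zero => exact euler_zero j
  | succ k =>
    obtain ⟨⟨N, hN⟩, -⟩ := hx k trivial
    exact euler_dH rfl hN j

theorem dH_neg {k : ℕ} {α : RawForm n m E k} (hα : α ∈ omegaC n m E k) : dH (-α) = -dH α := by
  have h := dH_lin_of_mem hα (zero_mem _) (-1)
  rwa [add_zero, dH_zero, add_zero, RawForm.neg_one_smul, RawForm.neg_one_smul] at h

theorem dTotal_neg {x : ∀ k, RawForm n m E k} (hx : x ∈ totalSpace (omegaC n m E)) : dTotal (-x) = -dTotal x := by
  funext k
  rcases k with _ | k
  · exact neg_zero.symm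
  · exact dH_neg (hx k trivial)

/-- A linear right inverse of `d_H` in top degree which respects a subcomplex of `Ω_c`. -/
theorem exists_rightInverse_dH (hΩ : ∀ k, Ω k ≤ omegaC n m E k) :
    ∃ η : RawForm n m E n →ₗ[ℝ] ∀ k, RawForm n m E k,
      (∀ α, IsExactIn (omegaC n m E) α → η α ∈ totalSpace (omegaC n m E) ∧
        (∀ k : ℕ, (k : ℤ) ≠ n - 1 → η α k = 0) ∧ dTotal (η α) = Pi.single n α) ∧
      ∀ α, IsExactIn Ω α → η α ∈ totalSpace Ω := by
  cases n with
  | zero =>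
    refine ⟨0, fun α hα => ⟨zero_mem _, fun _ _ => rfl, ?_⟩, fun _ _ => zero_mem _⟩
    have h0 : α = 0 := hα
    rw [h0, Pi.single_zero]
    funext k
    rcases k with _ | k
    · rfl
    · exact dH_zero
  | succ k =>
    obtain ⟨d, hd⟩ : ∃ d : omegaC (k + 1) m E k →ₗ[ℝ] RawForm (k + 1) m E (k + 1), ∀ α, d α = dH α.1 := by
      refine ⟨LinearMap.mk (AddHom.mk (fun α => dH α.1) fun α β => ?_) fun c α => ?_, fun α => rfl⟩
      · have h := dH_lin_of_mem α.2 β.2 1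
        rwa [one_smul, one_smul] at h
      · have h := dH_lin_of_mem α.2 (zero_mem _) c
        rwa [add_zero, dH_zero, add_zero] at h
    obtain ⟨h, h1, h2⟩ := exists_rightInverse_of_le (hΩ k) d
    refine ⟨LinearMap.single ℝ (fun k' => RawForm (k + 1) m E k') k ∘ₗ h, ?_, ?_⟩
    · rintro _ ⟨β, hβ, rfl⟩
      obtain ⟨b, hb, hdb⟩ := h1 ⟨β, hβ⟩
      rw [hd] at hb hdb
      rw [hd] at hdb
      show Pi.single k (h (dH β)) ∈ _ ∧ (∀ j : ℕ, _ → (Pi.single k (h (dH β)) : ∀ k', RawForm (k + 1) m E k') j = 0) ∧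
        dTotal (Pi.single k (h (dH β))) = _
      rw [hb]
      refine ⟨single_mem_totalSpace b.2, fun j hj => Pi.single_eq_of_ne ?_ _, ?_⟩
      · rintro rfl
        exact hj (by push_cast; ring)
      · rw [dTotal_single, hdb]
    · rintro _ ⟨β, hβ, rfl⟩
      obtain ⟨b, hb, hbΩ, -⟩ := h2 ⟨β, hΩ k hβ⟩ hβ
      rw [hd] at hb
      show Pi.single k (h (dH β)) ∈ _
      rw [hb]
      exact single_mem_totalSpace hbΩ

variable [SecondCountableTopology M] [MeasurableSpace M] [BorelSpace M] {μ : Measure M}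

theorem SkewTensor.jac_eq (w : SkewTensor m E ν) (hμ : ν.IsMeasure μ) {α β γ : RawForm n m E n}
    (hα : α ∈ omegaC n m E n) (hγ : γ ∈ omegaC n m E n) :
    w.jac α β γ = w.l2 (w.l2 α β) γ - w.l2 (w.l2 α γ) β + w.l2 (w.l2 β γ) α := by
  have h1 : w.l2 γ α = (-1 : ℝ) • w.l2 α γ + 0 := by
    rw [add_zero, RawForm.neg_one_smul, w.l2_skew]
  have h2 := w.l2_lin_left (w.l2_mem_omegaC hμ hα hγ).1 isHorizontal_zero (-1) β
  rw [← h1, w.l2_eq_zero_left euler_zero, add_zero, RawForm.neg_one_smul] at h2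
  unfold SkewTensor.jac
  rw [h2]
  abel

theorem SkewTensor.sum_jac_l2_eq_zero (w : SkewTensor m E ν) (hμ : ν.IsMeasure μ) (hJ : w.Jacobi μ)
    {α β γ δ : RawForm n m E n} (hα : α ∈ omegaC n m E n) (hβ : β ∈ omegaC n m E n) (hγ : γ ∈ omegaC n m E n)
    (hδ : δ ∈ omegaC n m E n) : w.jac (w.l2 α β) γ δ - w.jac (w.l2 α γ) β δ + w.jac (w.l2 α δ) β γ
      + w.jac (w.l2 β γ) α δ - w.jac (w.l2 β δ) α γ + w.jac (w.l2 γ δ) α β = 0 := by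
  obtain ⟨B, hB⟩ := w.exists_bilin_l2 (le_refl (omegaC n m E n)) fun α hα β hβ => w.l2_mem_omegaC hμ hα hβ
  have h := sum_jacobiator_eq_zero B (fun x y => Subtype.ext ((hB x y).trans ((w.l2_skew x y).trans
      (congrArg (-·) (hB y x).symm)))) (J := fun x y z => ⟨w.jac x y z, w.jac_mem hμ x.2 y.2 z.2⟩)
    (fun x y z => Subtype.ext ?_) (fun x y z u => Subtype.ext ?_) ⟨α, hα⟩ ⟨β, hβ⟩ ⟨γ, hγ⟩ ⟨δ, hδ⟩
  · have h1 := congrArg Subtype.val h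
    simpa [hB] using h1
  · show w.jac x y z = B (B x y) z + B (B y z) x + B (B z x) y
    simp only [hB]
    rfl
  · rw [hB]
    exact w.l2_eq_zero_left (w.euler_jac hμ hJ x.2 y.2 z.2) _

end BracketComplex

section BracketShLie
set_option linter.unusedSectionVars false
variable {n m : ℕ} {M : Type*} [TopologicalSpace M] [ChartedSpace (EuclideanSpace ℝ (Fin n)) M]
  [IsManifold (𝓡 n) ∞ M]
  {E : M → Type*} [∀ p, AddCommGroup (E p)] [∀ p, Module ℝ (E p)] [∀ p, TopologicalSpace (E p)]
  [TopologicalSpace (TotalSpace (Fin m → ℝ) E)] [FiberBundle (Fin m → ℝ) E]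
  [VectorBundle ℝ (Fin m → ℝ) E] [ContMDiffVectorBundle ∞ (Fin m → ℝ) E (𝓡 n)]

variable [T2Space M] [SecondCountableTopology M] [MeasurableSpace M] [BorelSpace M] {ν : VolumeForm n M}
  {μ : Measure M} {Ω : ∀ k, Submodule ℝ (RawForm n m E k)}

set_option maxHeartbeats 1000000 in
/-- The sh-Lie structure of `l̃_2` on a subcomplex of `Ω_c`, for a homotopy `η` of the Jacobi identity. -/
theorem SkewTensor.exists_shLie (w : SkewTensor m E ν) (hμ : ν.IsMeasure μ) (hJ : w.Jacobi μ)
    (hΩ : ∀ k, Ω k ≤ omegaC n m E k) (hd : ∀ k, ∀ α ∈ Ω k, dH α ∈ Ω (k + 1))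
    (hl : ∀ α ∈ Ω n, ∀ β ∈ Ω n, w.l2 α β ∈ Ω n) (η : RawForm n m E n →ₗ[ℝ] ∀ k, RawForm n m E k)
    (hη : ∀ α, IsExactIn (omegaC n m E) α → η α ∈ totalSpace (omegaC n m E) ∧
      (∀ k : ℕ, (k : ℤ) ≠ n - 1 → η α k = 0) ∧ dTotal (η α) = Pi.single n α)
    (hηΩ : ∀ α ∈ Ω n, ∀ β ∈ Ω n, ∀ γ ∈ Ω n, η (w.jac α β γ) ∈ totalSpace Ω) :
    ∃ L : ShLieStructure (V := totalSpace Ω) (degreePart Ω), Extends w L ∧ (∀ x, (L.l 0 x).1 = 0) ∧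
      (∀ x, (L.l 1 x).1 = dTotal (x 0).1) ∧ (∀ x, (L.l 2 x).1 = Pi.single n (w.l2 ((x 0).1 n) ((x 1).1 n))) ∧
      (∀ x, (L.l 3 x).1 = -η (w.jac ((x 0).1 n) ((x 1).1 n) ((x 2).1 n))) ∧ ∀ k x, (L.l (k + 4) x).1 = 0 := by
  obtain ⟨D, hD⟩ := exists_linearMap_dTotal hΩ hd
  obtain ⟨B, hB⟩ := w.exists_bracket hΩ hl
  obtain ⟨T, hT⟩ := w.exists_homotopy hμ hΩ η hηΩ
  have hle : ∀ x : totalSpace Ω, x.1 ∈ totalSpace (omegaC n m E) := fun x k _ => hΩ k (x.2 k trivial)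
  have hn : ∀ x : totalSpace Ω, x.1 n ∈ omegaC n m E n := fun x => hle x n trivial
  have hBn : ∀ x y, (B x y).1 n = w.l2 (x.1 n) (y.1 n) := fun x y => by
    rw [hB]
    exact Pi.single_eq_same _ _
  have hBB : ∀ x y z, (B (B x y) z).1 = Pi.single n (w.l2 (w.l2 (x.1 n) (y.1 n)) (z.1 n)) := fun x y z => by
    rw [hB, hBn]
  have hex : ∀ x y z : totalSpace Ω, IsExactIn (omegaC n m E) (w.jac (x.1 n) (y.1 n) (z.1 n)) := fun x y z =>
    w.isExactIn_jac hμ hJ (hn x) (hn y) (hn z)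
  have hx0 : ∀ i ≠ 0, ∀ x ∈ degreePart Ω i, x.1 n = 0 := fun i hi x hx => hx n (by omega)
  have hBs : ∀ x y, B x y = -B y x := fun x y => Subtype.ext (by
    show (B x y).1 = -(B y x).1
    rw [hB, hB, w.l2_skew, Pi.single_neg])
  have hjl : ∀ {α β γ : RawForm n m E n}, (∀ j, euler α j = 0) → η (w.jac α β γ) = 0 := fun h => by
    rw [w.jac_eq_zero_left h, map_zero]
  have key : ∃ L : ShLieStructure (V := totalSpace Ω) (degreePart Ω), L.l = lMaps (V := totalSpace Ω) D B T ∧ ∀ k, 2 ≤ k →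
      ∀ (d : Fin k → ℤ) (x : Fin k → totalSpace Ω), (∀ r, x r ∈ degreePart Ω (d r)) → (∃ r, d r ≠ 0) →
        L.l k x = 0 := by
    refine exists_shLieStructure (V := totalSpace Ω) isGrading_degreePart D B T ?_ ?_ ?_ ?_ hBs ?_ ?_
      ?_ ?_ ?_ ?_ ?_ ?_
    · intro i x hx k hk
      rw [hD]
      rcases k with _ | k
      · rfl
      · show dH (x.1 k) = 0
        rw [hx k (by push_cast at hk; omega), dH_zero]
    · exact fun x => Subtype.ext (by
        rw [hD, hD, dTotal_dTotal (hle x)]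
        rfl)
    · intro x y k hk
      rw [hB]
      exact Pi.single_eq_of_ne (by omega) _
    · exact fun i hi x hx y => Subtype.ext (by
        rw [hB, hx0 i hi x hx, w.l2_eq_zero_left euler_zero, Pi.single_zero]
        rfl)
    · exact fun x y => Subtype.ext (by
        rw [hB, hD, w.l2_eq_zero_left (euler_dTotal (hle x)), Pi.single_zero]
        rfl)
    · exact fun x y => Subtype.ext (by
        rw [hD, hB, dTotal_single_top]
        rfl)
    · intro x k hk
      rw [hT]
      show -η _ k = 0
      rw [(hη _ (hex _ _ _)).2.1 k hk, neg_zero]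
    · intro i hi x r hr
      refine Subtype.ext ?_
      have h1 : ∀ j, euler ((x r).1 n) j = 0 := fun j => by
        rw [hx0 i hi _ hr]
        exact euler_zero j
      rw [hT]
      suffices h : η (w.jac ((x 0).1 n) ((x 1).1 n) ((x 2).1 n)) = 0 by
        rw [h, neg_zero]
        rfl
      fin_cases r
      · exact hjl h1
      · rw [← w.jac_rotate]
        exact hjl h1
      · rw [w.jac_rotate]
        exact hjl h1
    · refine multilin_perm_three (V := totalSpace Ω) (T := T) (fun x y z => Subtype.ext ?_) fun x y z => Subtype.ext ?_
      · show (T ![y, x, z]).1 = -(T ![x, y, z]).1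
        rw [hT, hT]
        show -η (w.jac (y.1 n) (x.1 n) (z.1 n)) = - -η (w.jac (x.1 n) (y.1 n) (z.1 n))
        rw [w.jac_swap hμ (hn x) (hn y) (hn z), map_neg]
      · rw [hT, hT]
        exact congrArg (fun A => -η A) (w.jac_rotate _ _ _)
    · exact fun x y z => Subtype.ext (by
        rw [hT]
        show -η (w.jac ((D x).1 n) (y.1 n) (z.1 n)) = 0
        rw [hD, hjl (euler_dTotal (hle x)), neg_zero])
    · intro x
      refine Subtype.ext ?_
      rw [hD, hT, dTotal_neg (hη _ (hex _ _ _)).1, (hη _ (hex _ _ _)).2.2]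
      show _ = -((B (B (x 0) (x 1)) (x 2)).1 - (B (B (x 0) (x 2)) (x 1)).1 + (B (B (x 1) (x 2)) (x 0)).1)
      rw [hBB, hBB, hBB, ← Pi.single_sub, ← Pi.single_add, w.jac_eq hμ (hn _) (hn _)]
    · intro a b c d
      refine Subtype.ext ?_
      show (T ![B a b, c, d]).1 - (T ![B a c, b, d]).1 + (T ![B a d, b, c]).1 + (T ![B b c, a, d]).1
        - (T ![B b d, a, c]).1 + (T ![B c d, a, b]).1 = 0
      have e : ∀ a b c d, (T ![B a b, c, d]).1 = -η (w.jac (w.l2 (a.1 n) (b.1 n)) (c.1 n) (d.1 n)) := fun a b c d => by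
        rw [hT, ← hBn]
        rfl
      have h1 := congrArg (fun A => -η A) (w.sum_jac_l2_eq_zero hμ hJ (hn a) (hn b) (hn c) (hn d))
      simp only [map_add, map_sub, map_zero, neg_zero] at h1
      simp only [e]
      rw [← h1]
      abel
  obtain ⟨L, hL, hv⟩ := key
  refine ⟨L, ⟨fun x => ?_, fun x _ y _ => ?_, hv, fun k hk => ?_⟩, fun x => ?_, fun x => ?_, fun x => ?_, fun x => ?_,
    fun k x => ?_⟩
  · rw [hL]
    exact hD x
  · rw [hL]
    exact hBn x y
  · rw [hL]
    obtain ⟨k, rfl⟩ := Nat.exists_eq_add_of_le' hk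
    rfl
  · rw [hL]
    rfl
  · rw [hL]
    exact hD (x 0)
  · rw [hL]
    exact hB (x 0) (x 1)
  · rw [hL]
    exact hT x
  · rw [hL]
    rfl

end BracketShLie

section InvariantForms
set_option linter.unusedSectionVars false
variable {n m : ℕ} {M : Type*} [TopologicalSpace M] [ChartedSpace (EuclideanSpace ℝ (Fin n)) M]
  [IsManifold (𝓡 n) ∞ M]
  {E : M → Type*} [∀ p, AddCommGroup (E p)] [∀ p, Module ℝ (E p)] [∀ p, TopologicalSpace (E p)]
  [TopologicalSpace (TotalSpace (Fin m → ℝ) E)] [FiberBundle (Fin m → ℝ) E]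
  [VectorBundle ℝ (Fin m → ℝ) E] [ContMDiffVectorBundle ∞ (Fin m → ℝ) E (𝓡 n)]

variable [T2Space M] {Ω : ∀ k, Submodule ℝ (RawForm n m E k)}

theorem isExactIn_zero {k : ℕ} : IsExactIn Ω (0 : RawForm n m E k) := by
  cases k with
  | zero => rfl
  | succ k => exact ⟨0, zero_mem _, dH_zero⟩

theorem euler_eq_zero_of_isExactIn (hΩ : ∀ k, Ω k ≤ omegaC n m E k) {α : RawForm n m E n} (hα : IsExactIn Ω α)
    (j : JetInf n m E) : euler α j = 0 := by
  cases n with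
  | zero =>
    have h0 : α = 0 := hα
    rw [h0]
    exact euler_zero j
  | succ k =>
    obtain ⟨β, hβ, rfl⟩ := hα
    obtain ⟨⟨N, hN⟩, -⟩ := hΩ k hβ
    exact euler_dH rfl hN j

end InvariantForms

end HorizontalForms

open HorizontalForms

theorem mainTheorem6 {n m : ℕ} {M : Type*} [TopologicalSpace M] [T2Space M]
    [SecondCountableTopology M] [ChartedSpace (EuclideanSpace ℝ (Fin n)) M]
    [IsManifold (𝓡 n) ∞ M] [MeasurableSpace M] [BorelSpace M]
    {E : M → Type*} [∀ p, AddCommGroup (E p)] [∀ p, Module ℝ (E p)]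
    [∀ p, TopologicalSpace (E p)] [TopologicalSpace (TotalSpace (Fin m → ℝ) E)]
    [FiberBundle (Fin m → ℝ) E] [VectorBundle ℝ (Fin m → ℝ) E]
    [ContMDiffVectorBundle ∞ (Fin m → ℝ) E (𝓡 n)]
    {G : Type*} [Group G]
    (ν : VolumeForm n M) (μ : MeasureTheory.Measure M) (hμ : ν.IsMeasure μ)
    (w : SkewTensor m E ν) (hJacobi : w.Jacobi μ)
    (A : FibreAction n m G E) (hA : A.IsCanonical w μ)
    (hexact : IsExactComplex (omegaC n m E))
    (hred : ∀ k, ∀ α ∈ omegaG A k, IsExactIn (omegaC n m E) α → IsExactIn (omegaG A) α) :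
    -- the invariant forms are a subcomplex, and it is exact
    (∀ k, ∀ α ∈ omegaG A k, dH α ∈ omegaG A (k + 1)) ∧
    IsExactComplex (omegaG A) ∧
    -- `l̃_2` restricts to invariant forms, where it is bilinear, skew-symmetric and satisfies the
    -- two conditions for the existence of an sh-Lie structure
    (∃ B : omegaG A n →ₗ[ℝ] omegaG A n →ₗ[ℝ] omegaG A n,
      (∀ α β, (B α β : RawForm n m E n) = w.l2 α β) ∧
      (∀ α β, B α β = -B β α) ∧
      (∀ α β : omegaG A n, IsExactIn (omegaG A) (β : RawForm n m E n) →
        IsExactIn (omegaG A) (B α β : RawForm n m E n)) ∧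
      (∀ α β γ : omegaG A n, IsExactIn (omegaG A)
        (B (B α β) γ - B (B α γ) β + B (B β γ) α : RawForm n m E n))) ∧
    -- an sh-Lie structure on all forms restricts to one on the invariant forms
    ∃ (L : ShLieStructure (V := totalSpace (omegaC n m E)) (degreePart (omegaC n m E)))
      (LG : ShLieStructure (V := totalSpace (omegaG A)) (degreePart (omegaG A))),
      Extends w L ∧ Extends w LG ∧
      ∀ (k : ℕ) (x : Fin k → totalSpace (omegaG A)),
        (LG.l k x : ∀ i, RawForm n m E i)
          = L.l k fun r => ⟨(x r).1, totalSpace_omegaG_le A (x r).2⟩ := by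
  have hG : ∀ k, omegaG A k ≤ omegaC n m E k := fun k α hα => hα.1
  have hd : ∀ k, ∀ α ∈ omegaG A k, dH α ∈ omegaG A (k + 1) := fun k α hα => dH_mem_omegaG A hα
  have hl : ∀ α ∈ omegaG A n, ∀ β ∈ omegaG A n, w.l2 α β ∈ omegaG A n := fun α hα β hβ =>
    hA.l2_mem_omegaG hμ hα hβ
  have hj : ∀ α ∈ omegaG A n, ∀ β ∈ omegaG A n, ∀ γ ∈ omegaG A n, IsExactIn (omegaG A) (w.jac α β γ) :=
    fun α hα β hβ γ hγ => hred n _ (add_mem (add_mem (hl _ (hl α hα β hβ) γ hγ) (hl _ (hl β hβ γ hγ) α hα))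
      (hl _ (hl γ hγ α hα) β hβ)) (w.isExactIn_jac hμ hJacobi hα.1 hβ.1 hγ.1)
  refine ⟨hd, fun k hk α hα h => hred k α hα (hexact k hk α hα.1 h), ?_, ?_⟩
  · obtain ⟨B, hB⟩ := w.exists_bilin_l2 (hG n) hl
    refine ⟨B, hB, fun α β => Subtype.ext ?_, fun α β hβ => ?_, fun α β γ => ?_⟩
    · show (B α β : RawForm n m E n) = -(B β α : RawForm n m E n)
      rw [hB, hB, w.l2_skew]
    · rw [hB, w.l2_eq_zero_right _ (euler_eq_zero_of_isExactIn hG hβ)]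
      exact isExactIn_zero
    · rw [hB, hB, hB, hB, hB, hB, ← w.jac_eq hμ (hG n α.2) (hG n γ.2)]
      exact hj _ α.2 _ β.2 _ γ.2
  · obtain ⟨η, hη, hηG⟩ := exists_rightInverse_dH hG
    obtain ⟨L, hLw, hL0, hL1, hL2, hL3, hL4⟩ := w.exists_shLie hμ hJacobi (fun _ => le_rfl)
      (fun k α hα => dH_mem_omegaC hα) (fun α hα β hβ => w.l2_mem_omegaC hμ hα hβ) η hη
      fun α hα β hβ γ hγ => (hη _ (w.isExactIn_jac hμ hJacobi hα hβ hγ)).1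
    obtain ⟨LG, hGw, hG0, hG1, hG2, hG3, hG4⟩ := w.exists_shLie hμ hJacobi hG hd hl η hη
      fun α hα β hβ γ hγ => hηG _ (hj α hα β hβ γ hγ)
    refine ⟨L, LG, hLw, hGw, fun k x => ?_⟩
    match k with
    | 0 => exact (hG0 x).trans (hL0 fun r => ⟨_, totalSpace_omegaG_le A (x r).2⟩).symm
    | 1 => exact (hG1 x).trans (hL1 fun r => ⟨_, totalSpace_omegaG_le A (x r).2⟩).symm
    | 2 => exact (hG2 x).trans (hL2 fun r => ⟨_, totalSpace_omegaG_le A (x r).2⟩).symm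
    | 3 => exact (hG3 x).trans (hL3 fun r => ⟨_, totalSpace_omegaG_le A (x r).2⟩).symm
    | k + 4 => exact (hG4 k x).trans (hL4 k fun r => ⟨_, totalSpace_omegaG_le A (x r).2⟩).symm
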